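/- **Theorem (fault tolerant DFS trees).** *Model.* The computation model is the word RAM: a fixed program, finitely many registers, a random access memory (initially all zero) and read-only input arrays, with unit-cost reads, writes, comparisons and arithmetic on words. A word is an integer in $[0,W)$, and for a suitable constant $c$ the statement holds for every $W\ge (n+2)^c$; so words of $O(\log n)$ bits suffice. *Depth first search.* A DFS forest of a finite undirected simple graph $H$ is a rooted spanning forest that a depth first traversal of $H$ can produce, where the traversal restarts at an arbitrary unvisited vertex whenever no visited vertex has an unvisited neighbour. If $H$ is connected, a DFS forest is exactly a DFS tree of $H$. *Statement.* There are two fixed programs, *preprocess* and *query*, such that for every finite undirected simple graph $G=(V,E)$, $V=\{0,\dots,n-1\}$, $m=|E|$, and every DFS forest $T$ of $G$ the following holds. Given $n$, $m$, the edges of $G$ as a list in any order and $T$ as a parent array, *preprocess* takes $O(m+n)$ time and builds a data structure of $O(m+n)$ words. For every set $F\subseteq V\cup E$ of $k$ failed vertices and edges, given the (unmodified, read-only) data structure and $F$ as a list of its vertices and a list of its edges, *query* computes the parent array of a DFS forest of $G\setminus F$ (a DFS tree, if $G\setminus F$ is connected) in time $$O\bigl(n\,(k'+\log n)\,\log n\bigr).$$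 Here $k'\le k$ is the maximum, over all root-leaf paths $P$ of $T$, of the number of failures on $P$; a failed vertex is on $P$ if it is a vertex of $P$, and a failed edge, tree edge or not, is on $P$ if both of its endpoints are vertices of $P$. The constants in the $O$-bounds are absolute; for $n\le 1$ the bounds are read as constants (that is, $\log n$ is read as $1+\lfloor\log_2 n\rfloor$, and the factors $n$ and $m+n$ as $n+1$ and $m+n+1$). -/

import Mathlib

namespace FaultDFS

/-! ### A word RAM with a step count

Programs are structured programs over finitely many registers, a random access memory whose
cells all contain `0` at the start, and some read-only input arrays. Words are the integers in
`[0, W)`, and every operation on words costs one step. -/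

/-- The operations on words (the result is reduced modulo `W` by `Exp.val`). Subtraction is
truncated; comparisons return `1` or `0`. -/
inductive Op
  | plus | minus | times | quot | rem | less | equal

def Op.apply : Op → ℕ → ℕ → ℕ
  | .plus, a, b => a + b
  | .minus, a, b => a - b
  | .times, a, b => a * b
  | .quot, a, b => a / b
  | .rem, a, b => a % b
  | .less, a, b => if a < b then 1 else 0
  | .equal, a, b => if a = b then 1 else 0

/-- Expressions: constants, registers, memory cells, cells of the `i`-th input array, and
operations. -/
inductive Exp
  | const (c : ℕ)
  | reg (x : ℕ)
  | load (address : Exp)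
  | input (i : ℕ) (address : Exp)
  | op (o : Op) (a b : Exp)

inductive Program
  | skip
  | set (x : ℕ) (e : Exp)
  | store (address e : Exp)
  | seq (p q : Program)
  | ite (b : Exp) (p q : Program)
  | loop (b : Exp) (p : Program)

structure State where
  reg : ℕ → ℕ
  mem : ℕ → ℕ

/-- All registers and all memory cells contain `0`. -/
def State.init : State := ⟨fun _ => 0, fun _ => 0⟩

/-- The value of an expression on a machine with words in `[0, W)` and input arrays `inp`. Reading
an input array beyond its end gives `0`. -/
def Exp.val (W : ℕ) (inp : List (List ℕ)) (s : State) : Exp → ℕ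
  | .const c => c % W
  | .reg x => s.reg x % W
  | .load a => s.mem (a.val W inp s) % W
  | .input i a => (inp.getD i []).getD (a.val W inp s) 0 % W
  | .op o a b => o.apply (a.val W inp s) (b.val W inp s) % W

/-- Evaluating an expression takes one step for each of its nodes. -/
def Exp.cost : Exp → ℕ
  | .const _ => 1
  | .reg _ => 1
  | .load a => a.cost + 1
  | .input _ a => a.cost + 1
  | .op _ a b => a.cost + b.cost + 1

/-- `Exec W inp p s s' t`: started in state `s`, the program `p` halts in state `s'` after exactly
`t` steps. -/
inductive Exec (W : ℕ) (inp : List (List ℕ)) : Program → State → State → ℕ → Prop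
  | skip (s : State) : Exec W inp .skip s s 1
  | set (x : ℕ) (e : Exp) (s : State) :
      Exec W inp (.set x e) s ⟨Function.update s.reg x (e.val W inp s), s.mem⟩ (e.cost + 1)
  | store (a e : Exp) (s : State) :
      Exec W inp (.store a e) s
        ⟨s.reg, Function.update s.mem (a.val W inp s) (e.val W inp s)⟩ (a.cost + e.cost + 1)
  | seq {p q : Program} {s₁ s₂ s₃ : State} {t u : ℕ} :
      Exec W inp p s₁ s₂ t → Exec W inp q s₂ s₃ u → Exec W inp (.seq p q) s₁ s₃ (t + u)
  | ite_true {b : Exp} {p q : Program} {s s' : State} {t : ℕ} :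
      b.val W inp s ≠ 0 → Exec W inp p s s' t → Exec W inp (.ite b p q) s s' (b.cost + 1 + t)
  | ite_false {b : Exp} {p q : Program} {s s' : State} {t : ℕ} :
      b.val W inp s = 0 → Exec W inp q s s' t → Exec W inp (.ite b p q) s s' (b.cost + 1 + t)
  | loop_true {b : Exp} {p : Program} {s₁ s₂ s₃ : State} {t u : ℕ} :
      b.val W inp s₁ ≠ 0 → Exec W inp p s₁ s₂ t → Exec W inp (.loop b p) s₂ s₃ u →
      Exec W inp (.loop b p) s₁ s₃ (b.cost + 1 + t + u)
  | loop_false {b : Exp} {p : Program} {s : State} :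
      b.val W inp s = 0 → Exec W inp (.loop b p) s s (b.cost + 1)

/-! ### DFS forests, failures -/

/-- The parent function `par` (`none` at roots) describes a forest that a depth first traversal of
the graph `H` can produce: there is an order of visits `dfn` such that the parent of each vertex
`v` is a neighbour visited before `v`, and is the most recently visited vertex that has an
unvisited neighbour just before `v` is visited; `v` is a root only if there is no visited vertex
with an unvisited neighbour at that moment. If `H` is connected, this is a DFS tree of `H`. -/
def IsDFSForest {V : Type*} {G : SimpleGraph V} (H : G.Subgraph) (par : V → Option V) : Prop :=
  (∀ v, v ∉ H.verts → par v = none) ∧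
  ∃ dfn : V → ℕ, Set.InjOn dfn H.verts ∧ ∀ v ∈ H.verts,
    (∀ u, par v = some u → H.Adj u v ∧ dfn u < dfn v) ∧
    (∀ w x, H.Adj w x → dfn w < dfn v → dfn v ≤ dfn x → ∃ u, par v = some u ∧ dfn w ≤ dfn u)

/-- `u` is an ancestor of `v` (possibly `v` itself) in the forest given by `par`. -/
def IsAncestor {V : Type*} (par : V → Option V) (u v : V) : Prop :=
  Relation.ReflTransGen (fun a b => par b = some a) u v

def IsLeaf {V : Type*} (par : V → Option V) (v : V) : Prop :=
  ∀ w, par w ≠ some v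

open Classical in
/-- The number of failures on the path from the root to `l`: the failed vertices on this path and
the failed edges that have both endpoints on it. -/
noncomputable def faultsOnPath {V : Type*} (par : V → Option V) (FV : Finset V)
    (FE : Finset (Sym2 V)) (l : V) : ℕ :=
  (FV.filter fun x => IsAncestor par x l).card +
    (FE.filter fun e => ∀ x ∈ e, IsAncestor par x l).card

open Classical in
/-- The maximum number of failures on a root-leaf path (`0` if there is no vertex). -/
noncomputable def maxFaults {V : Type*} [Fintype V] (par : V → Option V) (FV : Finset V)
    (FE : Finset (Sym2 V)) : ℕ :=
  (Finset.univ.filter fun l => IsLeaf par l).sup (faultsOnPath par FV FE)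

/-- The graph `G` without the failed vertices and edges. -/
def surviving {V : Type*} (G : SimpleGraph V) (FV : Finset V) (FE : Finset (Sym2 V)) :
    G.Subgraph :=
  ((⊤ : G.Subgraph).deleteEdges (FE : Set (Sym2 V))).deleteVerts (FV : Set V)

/-! ### Encodings -/

/-- The list `l` contains each member of `S` exactly once and nothing else. -/
def Lists {α : Type*} (l : List α) (S : Set α) : Prop :=
  l.Nodup ∧ ∀ a, a ∈ l ↔ a ∈ S

/-- The pairs in `l` are the edges in `S`, each exactly once and with its endpoints in one of the
two orders. -/
def ListsEdges {V : Type*} (l : List (V × V)) (S : Set (Sym2 V)) : Prop :=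
  Lists (l.map fun p => s(p.1, p.2)) S

def encodePairs {n : ℕ} (l : List (Fin n × Fin n)) : List ℕ :=
  l.flatMap fun p => [p.1.val, p.2.val]

/-- A root is encoded as `0`, a vertex with parent `u` as `u + 1`. -/
def encodeParent {n : ℕ} : Option (Fin n) → ℕ
  | none => 0
  | some u => u.val + 1

/-- The input of the preprocessing: the numbers of vertices and of edges, the parent array of the
forest, and the list of edges. -/
def encodeGraph {n : ℕ} (edges : List (Fin n × Fin n)) (par : Fin n → Option (Fin n)) : List ℕ :=
  [n, edges.length] ++ List.ofFn (fun v => encodeParent (par v)) ++ encodePairs edges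

/-- The failures: the numbers of failed vertices and of failed edges, and the two lists. -/
def encodeFaults {n : ℕ} (vs : List (Fin n)) (es : List (Fin n × Fin n)) : List ℕ :=
  [vs.length, es.length] ++ vs.map (fun v => v.val) ++ encodePairs es

/-- The data structure that a halted preprocessing program leaves: register `0` contains its
number of words, and the words are the first memory cells. -/
def State.data (s : State) : List ℕ :=
  (List.range (s.reg 0)).map s.mem

/-- In its first `n` cells, the memory contains the parent array `par`. -/
def State.Outputs {n : ℕ} (s : State) (par : Fin n → Option (Fin n)) : Prop :=
  ∀ v : Fin n, s.mem v.val = encodeParent (par v)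

end FaultDFS

/-!
# Depth first search in graphs with failed vertices and edges

The nodes of `T` are numbered from `1`, and a virtual root `0` joins the trees of `T`. Labels are
assigned in preorder, the largest subtree first: the subtree of the vertex labelled `x` is the
interval from `x` to `x + sz x`, exclusively, and its heavy child, if any, is `x + 1`. Heavy paths
are therefore intervals, and every vertex has at most logarithmically many light ancestors
(`HTree.light_le_log`). Since `T` is a depth first search forest, each edge joins a label `w` to one
of its ancestors, an *upper neighbour* of `w`.

**Preprocessing** (`prepCmd_spec`). Two counting sorts produce the sorted lists of upper neighbours
(`SortedBy.upLists`). The *rank* of `w` at `x` is the number of upper neighbours of `w` below `x`.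
Each `x` has a *snapshot* of the ranks at `x` for its whole subtree. It is shared with the parent,
unless the total error would reach the size of the subtree (`Snapping.share`,
`Snapping.fresh_snap`); a new snapshot is paid for by the increase of its entries, whence the space
`O(m + n)`. The ranks at `x` of all `w` in the subtree of `x` are found in time proportional to the
size of the subtree by correcting the entries of the snapshot (`rankCmd_spec`, `sum_rank_cost`).

**Queries** (`queryCmd_spec`). The heavy paths are cut into *segments* at the failed vertices and
the failed tree edges. A path to the root meets `O(k' + log n)` segments (`HTree.segs_le`). The
traversal is not the usual one: when a vertex `x` is entered, the unvisited part of its segment is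
an interval, and the traversal walks at once from `x` to the end of this interval that is farther
away, so that the unvisited part is at least halved (`enterCmd_spec`). Then, for every `w` in the
subtree of the uppermost vertex just visited, one edge to the vertices just visited is recorded: the
one to the upper neighbour visited last, on whose list `w` is put. To continue from a vertex `v`,
unvisited upper neighbours of `v` are sought by one binary search for each segment above `v`
(`findUp_spec`), unvisited neighbours below `v` on the list of `v` (`findDown_spec`). If there are
none, the traversal goes back to the parent. This is correct because of the invariant `Visiting`: an
unvisited neighbour below a visited vertex `u` is recorded for a vertex visited no earlier than `u`.
As no vertex visited after the current one has an unvisited neighbour, an empty list of the current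
vertex means that all its neighbours below are visited (`Visiting.exhausted`). The condition on
numbers that defines depth first search forests is part of the invariant `Traversal`.

The time is bounded with the potential `pot`. Each halving of a segment pays for the work on the
subtree of its top, and summed over all segments these subtrees have size `O(n (k' + log n))`, since
a vertex is counted once for each segment above it (`segPot_le`). When the walk goes down, the ranks
at the vertex after its end are needed. The snapshot of that vertex covers only its own subtree, and
the other vertices, which hang off the path walked, need a binary search; there are `O(n log n)` of
them altogether (`HTree.sum_lightSize`). Each vertex pays for two searches for a next vertex, the
one that found it and the one before the traversal goes back from it. The failed edges that the
searches have to skip are counted as well. A failure above a vertex lies on the path to each leaf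
below, so that `k'`, that is `maxFaults`, bounds all numbers of failures involved
(`Labels.faults_above`).

**Verification.** Programs are written in a small language of array programs (`Cmd`), translated to
the RAM by `Cmd.comp`. Their correctness and running time are proved together by weakest
preconditions with time credits (`WP`), which are sound for the RAM by `WP_sound`. The theorem then
follows from `preprocess_run` and `query_run`.

The arrays of the data structure, accessed by queries as `d j`, are:
`0` the number `n` (in cell `0`); `1` the label of a node and `2` the node of a label; `3` the
parent and `4` the size of the subtree, for labels; `5` the starts of the lists of upper neighbours
and `6` the lists; `7` the addresses of the snapshots and `8` the snapshots. The preprocessing also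
uses: `9` numbers of children, `10` sizes, `11` heavy children and `12` their sizes, `13` the queue,
`14` the next free label, `15` and `16` the smaller and larger labels of the edges, `17` the numbers
of edges whose smaller label is below a given one, and `18` to `21` for sorting.

The arrays of queries, `a j`, are: `0` visited or failed vertices; `1` positions of failed edges in
the lists of upper neighbours; `2` lower endpoints of failed tree edges; `3` tops of segments; `4`
and `5` the limits of the unvisited part of a segment, at its top; `6` parents in the new forest;
`7`, `8` and `9` heads, items and links of the lists of recorded edges. The main variables of
queries are: `0` the number `n`; `1` the current vertex, `0` if there is none; `2` the next candidate
for a root; `3` the number of list nodes; `4` the vertex to be entered; `7` and `8` the ends of the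
part of a segment just visited; `9` and `17` the limits of the unvisited part before; `10` a vertex
whose upper neighbours are searched for the label `11`, and `12` the position found.
-/

namespace FaultDFS
open Finset

/-! ### Array programs on the word RAM -/

/-- The state of an array program: scalar variables, (interleaved) arrays and output cells. -/
structure Mach where
  reg : ℕ → ℕ
  arr : ℕ → ℕ → ℕ
  out : ℕ → ℕ

namespace Mach

def setr (σ : Mach) (x v : ℕ) : Mach := ⟨Function.update σ.reg x v, σ.arr, σ.out⟩

def put (σ : Mach) (j i v : ℕ) : Mach :=
  ⟨σ.reg, Function.update σ.arr j (Function.update (σ.arr j) i v), σ.out⟩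

def puto (σ : Mach) (i v : ℕ) : Mach := ⟨σ.reg, σ.arr, Function.update σ.out i v⟩

@[simp] theorem setr_reg (σ : Mach) (x v y : ℕ) :
    (σ.setr x v).reg y = if y = x then v else σ.reg y := by
  simp [setr, Function.update_apply]

@[simp] theorem setr_arr (σ : Mach) (x v : ℕ) : (σ.setr x v).arr = σ.arr := rfl
@[simp] theorem setr_out (σ : Mach) (x v : ℕ) : (σ.setr x v).out = σ.out := rfl
@[simp] theorem put_reg (σ : Mach) (j i v : ℕ) : (σ.put j i v).reg = σ.reg := rfl
@[simp] theorem put_out (σ : Mach) (j i v : ℕ) : (σ.put j i v).out = σ.out := rfl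

@[simp] theorem put_arr (σ : Mach) (j i v l : ℕ) :
    (σ.put j i v).arr l = if l = j then Function.update (σ.arr j) i v else σ.arr l := by
  by_cases h : l = j
  · subst h; simp [put]
  · simp [put, h]

@[simp] theorem puto_reg (σ : Mach) (i v : ℕ) : (σ.puto i v).reg = σ.reg := rfl
@[simp] theorem puto_arr (σ : Mach) (i v : ℕ) : (σ.puto i v).arr = σ.arr := rfl
@[simp] theorem puto_out (σ : Mach) (i v : ℕ) :
    (σ.puto i v).out = Function.update σ.out i v := rfl

end Mach

/-- The parameters of a run: words are below `W`, the values an array program may use are below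
`B`, the arrays start behind `b` output cells, and `inp` are the input arrays. -/
structure Env where
  W : ℕ
  B : ℕ
  b : ℕ
  inp : List (List ℕ)

/-- A cell of an input array. -/
def Env.get (Γ : Env) (i a : ℕ) : ℕ := (Γ.inp.getD i []).getD a 0

/-- The `i`-th cell of the `j`-th array of the 32 arrays interleaved in input `0`. -/
def Env.dat (Γ : Env) (j i : ℕ) : ℕ := Γ.get 0 (i * 32 + j)

/-- Words are large enough for the addresses of all array cells with index below `B`. -/
structure Env.Fits (Γ : Env) : Prop where
  word : 64 * Γ.B + 64 ≤ Γ.W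
  base : Γ.b ≤ Γ.B
  small : 64 ≤ Γ.B
  input : ∀ i a, Γ.get i a < Γ.B

/-- Expressions of array programs: constants, variables, cells of the `j`-th array, cells of the
`j`-th of 32 arrays interleaved in input `0`, cells of an input, and operations. -/
inductive E
  | c (k : ℕ)
  | v (x : ℕ)
  | a (j : ℕ) (e : E)
  | d (j : ℕ) (e : E)
  | i (k : ℕ) (e : E)
  | add (e f : E)
  | sub (e f : E)
  | half (e : E)
  | lt (e f : E)
  | eq (e f : E)
  | and (e f : E)

namespace E

/-- Translation to RAM expressions. Register `0` is reserved for the length of the result,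
register `1` holds the base address; array `j` has its `i`-th cell at `(i + base) * 32 + j`. -/
def comp : E → Exp
  | c k => .const k
  | v x => .reg (x + 2)
  | a j e => .load (.op .plus (.op .times (.op .plus e.comp (.reg 1)) (.const 32)) (.const j))
  | d j e => .input 0 (.op .plus (.op .times e.comp (.const 32)) (.const j))
  | i k e => .input k e.comp
  | add e f => .op .plus e.comp f.comp
  | sub e f => .op .minus e.comp f.comp
  | half e => .op .quot e.comp (.const 2)
  | lt e f => .op .less e.comp f.comp
  | eq e f => .op .equal e.comp f.comp
  | and e f => .op .times (.op .less (.const 0) e.comp) (.op .less (.const 0) f.comp)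

/-- The value of an expression, in natural numbers without bound. -/
def ev (Γ : Env) (σ : Mach) : E → ℕ
  | c k => k
  | v x => σ.reg x
  | a j e => σ.arr j (e.ev Γ σ)
  | d j e => Γ.dat j (e.ev Γ σ)
  | i k e => Γ.get k (e.ev Γ σ)
  | add e f => e.ev Γ σ + f.ev Γ σ
  | sub e f => e.ev Γ σ - f.ev Γ σ
  | half e => e.ev Γ σ / 2
  | lt e f => if e.ev Γ σ < f.ev Γ σ then 1 else 0
  | eq e f => if e.ev Γ σ = f.ev Γ σ then 1 else 0
  | and e f => if e.ev Γ σ ≠ 0 ∧ f.ev Γ σ ≠ 0 then 1 else 0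

/-- The value and all intermediate results are below the bound, provided that the state is. -/
def ok (Γ : Env) (σ : Mach) : E → Prop
  | c k => k < Γ.B
  | v _ => True
  | a j e => j < 32 ∧ e.ok Γ σ
  | d j e => j < 32 ∧ e.ok Γ σ
  | i _ e => e.ok Γ σ
  | add e f => e.ok Γ σ ∧ f.ok Γ σ ∧ e.ev Γ σ + f.ev Γ σ < Γ.B
  | sub e f => e.ok Γ σ ∧ f.ok Γ σ
  | half e => e.ok Γ σ
  | lt e f => e.ok Γ σ ∧ f.ok Γ σ
  | eq e f => e.ok Γ σ ∧ f.ok Γ σ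
  | and e f => e.ok Γ σ ∧ f.ok Γ σ

/-- The number of steps that the evaluation takes. -/
def cost : E → ℕ
  | c _ => 1
  | v _ => 1
  | a _ e => e.cost + 7
  | d _ e => e.cost + 5
  | i _ e => e.cost + 1
  | add e f => e.cost + f.cost + 1
  | sub e f => e.cost + f.cost + 1
  | half e => e.cost + 2
  | lt e f => e.cost + f.cost + 1
  | eq e f => e.cost + f.cost + 1
  | and e f => e.cost + f.cost + 5

theorem cost_comp (e : E) : e.comp.cost = e.cost := by
  induction e <;> (simp [comp, cost, Exp.cost, *]; try omega)

end E

/-- The machine state `s` represents the array program state `σ`. -/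
structure Rep (Γ : Env) (σ : Mach) (s : State) : Prop where
  base : s.reg 1 = Γ.b
  reg : ∀ x, s.reg (x + 2) = σ.reg x
  reg_lt : ∀ x, σ.reg x < Γ.B
  arr : ∀ j < 32, ∀ i < Γ.B, s.mem ((i + Γ.b) * 32 + j) = σ.arr j i
  arr_lt : ∀ j i, σ.arr j i < Γ.B
  out : ∀ i < Γ.b, s.mem i = σ.out i

/-- Words are large enough: nothing wraps around, and the RAM computes the values in `ℕ`. -/
theorem E.val_comp {Γ : Env} (hΓ : Γ.Fits) {σ : Mach} {s : State} (h : Rep Γ σ s) (e : E)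
    (ho : e.ok Γ σ) : e.comp.val Γ.W Γ.inp s = e.ev Γ σ ∧ e.ev Γ σ < Γ.B := by
  have hW := hΓ.word
  have hb := hΓ.base
  have hs := hΓ.small
  have hmod : ∀ k, k < Γ.B → k % Γ.W = k := fun k hk => Nat.mod_eq_of_lt (by omega)
  induction e with
  | c k => exact ⟨hmod k ho, ho⟩
  | v x => exact ⟨by simp only [comp, Exp.val, ev]; rw [h.reg]; exact hmod _ (h.reg_lt x),
      h.reg_lt x⟩
  | a j e ih =>
    obtain ⟨h1, h2⟩ := ih ho.2
    have hj := ho.1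
    refine ⟨?_, h.arr_lt _ _⟩
    simp only [comp, Exp.val, Op.apply, h1, h.base, ev]
    rw [hmod 32 (by omega), hmod j (by omega), Nat.mod_eq_of_lt (a := Γ.b) (by omega),
      Nat.mod_eq_of_lt (a := e.ev Γ σ + Γ.b) (by omega), Nat.mod_eq_of_lt (a := _ * 32) (by omega),
      Nat.mod_eq_of_lt (a := _ * 32 + j) (by omega), h.arr j hj _ h2]
    exact hmod _ (h.arr_lt _ _)
  | d j e ih =>
    obtain ⟨h1, h2⟩ := ih ho.2
    have hj := ho.1
    refine ⟨?_, hΓ.input _ _⟩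
    simp only [comp, Exp.val, Op.apply, h1, ev]
    rw [hmod 32 (by omega), hmod j (by omega), Nat.mod_eq_of_lt (a := _ * 32) (by omega),
      Nat.mod_eq_of_lt (a := _ * 32 + j) (by omega)]
    exact hmod _ (hΓ.input _ _)
  | i k e ih =>
    obtain ⟨h1, h2⟩ := ih ho
    refine ⟨?_, hΓ.input _ _⟩
    simp only [comp, Exp.val, h1, ev]
    exact hmod _ (hΓ.input _ _)
  | add e f ihe ihf =>
    obtain ⟨h1, h2⟩ := ihe ho.1
    obtain ⟨h3, h4⟩ := ihf ho.2.1
    have h5 := ho.2.2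
    refine ⟨?_, h5⟩
    simp only [comp, Exp.val, Op.apply, h1, h3, ev]
    exact hmod _ h5
  | sub e f ihe ihf =>
    obtain ⟨h1, h2⟩ := ihe ho.1
    obtain ⟨h3, h4⟩ := ihf ho.2
    have h5 : e.ev Γ σ - f.ev Γ σ < Γ.B := by omega
    refine ⟨?_, h5⟩
    simp only [comp, Exp.val, Op.apply, h1, h3, ev]
    exact hmod _ h5
  | half e ih =>
    obtain ⟨h1, h2⟩ := ih ho
    have h5 : e.ev Γ σ / 2 < Γ.B := by omega
    refine ⟨?_, h5⟩
    simp only [comp, Exp.val, Op.apply, h1, ev]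
    rw [hmod 2 (by omega)]
    exact hmod _ h5
  | lt e f ihe ihf =>
    obtain ⟨h1, h2⟩ := ihe ho.1
    obtain ⟨h3, h4⟩ := ihf ho.2
    simp only [comp, Exp.val, Op.apply, h1, h3, ev]
    split_ifs <;> exact ⟨hmod _ (by omega), by omega⟩
  | eq e f ihe ihf =>
    obtain ⟨h1, h2⟩ := ihe ho.1
    obtain ⟨h3, h4⟩ := ihf ho.2
    simp only [comp, Exp.val, Op.apply, h1, h3, ev]
    split_ifs <;> exact ⟨hmod _ (by omega), by omega⟩
  | and e f ihe ihf =>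
    obtain ⟨h1, h2⟩ := ihe ho.1
    obtain ⟨h3, h4⟩ := ihf ho.2
    simp only [comp, Exp.val, Op.apply, h1, h3, ev, hmod 0 (by omega), Nat.pos_iff_ne_zero]
    by_cases p : e.ev Γ σ = 0 <;> by_cases q : f.ev Γ σ = 0 <;>
      simp [p, q, hmod 0 (by omega), hmod 1 (by omega)] <;> omega

/-- Array programs. -/
inductive Cmd
  | set (x : ℕ) (e : E)
  | put (j : ℕ) (i e : E)
  | out (i e : E)
  | seq (p q : Cmd)
  | ite (c : E) (p q : Cmd)
  | loop (c : E) (p : Cmd)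
  | skip

namespace Cmd

/-- Translation to RAM programs. -/
def comp : Cmd → Program
  | set x e => .set (x + 2) e.comp
  | put j i e => .store
      (.op .plus (.op .times (.op .plus i.comp (.reg 1)) (.const 32)) (.const j)) e.comp
  | out i e => .store i.comp e.comp
  | seq p q => .seq p.comp q.comp
  | ite c p q => .ite c.comp p.comp q.comp
  | loop c p => .loop c.comp p.comp
  | skip => .skip

/-- The variables that a program may change. -/
def modr : Cmd → ℕ → Bool
  | set x _, y => y == x
  | seq p q, y => p.modr y || q.modr y
  | ite _ p q, y => p.modr y || q.modr y
  | loop _ p, y => p.modr y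
  | _, _ => false

/-- The arrays that a program may change. -/
def moda : Cmd → ℕ → Bool
  | put j _ _, y => y == j
  | seq p q, y => p.moda y || q.moda y
  | ite _ p q, y => p.moda y || q.moda y
  | loop _ p, y => p.moda y
  | _, _ => false

end Cmd

/-- Sequential composition. -/
infixr:60 " ;; " => Cmd.seq

/-- The state `τ` differs from `σ` only in what the program may change. -/
structure Fr (p : Cmd) (σ τ : Mach) : Prop where
  r : ∀ x, p.modr x = false → τ.reg x = σ.reg x
  a : ∀ j, p.moda j = false → τ.arr j = σ.arr j

theorem Fr.refl (p : Cmd) (σ : Mach) : Fr p σ σ := ⟨fun _ _ => rfl, fun _ _ => rfl⟩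

theorem Fr.trans {p : Cmd} {σ τ υ : Mach} (h : Fr p σ τ) (h' : Fr p τ υ) : Fr p σ υ :=
  ⟨fun x hx => (h'.r x hx).trans (h.r x hx), fun x hx => (h'.a x hx).trans (h.a x hx)⟩

/-- Weakest precondition with time credits: with `k` steps available, the program halts in a state
`σ'` and leaves `k'` steps such that `Q σ' k'` holds. Loops come with an invariant; they terminate
because each round consumes credits. -/
def WP (Γ : Env) : Cmd → (Mach → ℕ → Prop) → Mach → ℕ → Prop
  | .set x e, Q, σ, k => e.ok Γ σ ∧ e.cost + 1 ≤ k ∧ Q (σ.setr x (e.ev Γ σ)) (k - (e.cost + 1))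
  | .put j i e, Q, σ, k => (j < 32 ∧ i.ok Γ σ ∧ e.ok Γ σ) ∧ i.cost + e.cost + 7 ≤ k ∧
      Q (σ.put j (i.ev Γ σ) (e.ev Γ σ)) (k - (i.cost + e.cost + 7))
  | .out i e, Q, σ, k => (i.ok Γ σ ∧ e.ok Γ σ ∧ i.ev Γ σ < Γ.b) ∧ i.cost + e.cost + 1 ≤ k ∧
      Q (σ.puto (i.ev Γ σ) (e.ev Γ σ)) (k - (i.cost + e.cost + 1))
  | .seq p q, Q, σ, k => WP Γ p (WP Γ q Q) σ k
  | .ite c p q, Q, σ, k => c.ok Γ σ ∧ c.cost + 1 ≤ k ∧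
      (c.ev Γ σ ≠ 0 → WP Γ p Q σ (k - (c.cost + 1))) ∧
      (c.ev Γ σ = 0 → WP Γ q Q σ (k - (c.cost + 1)))
  | .loop c p, Q, σ, k => ∃ Inv : Mach → ℕ → Prop, Inv σ k ∧ ∀ σ' k', Inv σ' k' →
      c.ok Γ σ' ∧ c.cost + 1 ≤ k' ∧
      (c.ev Γ σ' ≠ 0 → WP Γ p Inv σ' (k' - (c.cost + 1))) ∧
      (c.ev Γ σ' = 0 → Q σ' (k' - (c.cost + 1)))
  | .skip, Q, σ, k => 1 ≤ k ∧ Q σ (k - 1)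

theorem WP_mono {Γ : Env} {p : Cmd} {Q Q' : Mach → ℕ → Prop} {σ : Mach} {k : ℕ}
    (h : WP Γ p Q σ k) (hQ : ∀ σ' k', Q σ' k' → Q' σ' k') : WP Γ p Q' σ k := by
  induction p generalizing Q Q' σ k with
  | set x e => exact ⟨h.1, h.2.1, hQ _ _ h.2.2⟩
  | put j i e => exact ⟨h.1, h.2.1, hQ _ _ h.2.2⟩
  | out i e => exact ⟨h.1, h.2.1, hQ _ _ h.2.2⟩
  | seq p q ihp ihq => exact ihp h fun σ' k' h' => ihq h' hQ
  | ite c p q ihp ihq =>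
    exact ⟨h.1, h.2.1, fun hc => ihp (h.2.2.1 hc) hQ, fun hc => ihq (h.2.2.2 hc) hQ⟩
  | loop c p ih =>
    obtain ⟨Inv, h0, hs⟩ := h
    exact ⟨Inv, h0, fun σ' k' hi => ⟨(hs σ' k' hi).1, (hs σ' k' hi).2.1, (hs σ' k' hi).2.2.1,
      fun hc => hQ _ _ ((hs σ' k' hi).2.2.2 hc)⟩⟩
  | skip => exact ⟨h.1, hQ _ _ h.2⟩

/-- A postcondition may use that only the variables and arrays that `p` mentions have changed. -/
theorem WP_frame {Γ : Env} {p : Cmd} {Q : Mach → ℕ → Prop} {σ : Mach} {k : ℕ}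
    (h : WP Γ p Q σ k) : WP Γ p (fun σ' k' => Fr p σ σ' ∧ Q σ' k') σ k := by
  induction p generalizing Q σ k with
  | set x e =>
    refine ⟨h.1, h.2.1, ⟨fun y hy => ?_, fun _ _ => rfl⟩, h.2.2⟩
    simp only [Cmd.modr, beq_eq_false_iff_ne] at hy
    simp [hy]
  | put j i e =>
    refine ⟨h.1, h.2.1, ⟨fun _ _ => rfl, fun y hy => ?_⟩, h.2.2⟩
    simp only [Cmd.moda, beq_eq_false_iff_ne] at hy
    simp [hy]
  | out i e => exact ⟨h.1, h.2.1, ⟨fun _ _ => rfl, fun _ _ => rfl⟩, h.2.2⟩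
  | seq p q ihp ihq =>
    change WP Γ p (WP Γ q _) σ k
    refine WP_mono (ihp h) fun σ' k' h' => WP_mono (ihq h'.2) fun σ'' k'' h'' => ⟨?_, h''.2⟩
    refine ⟨fun x hx => ?_, fun x hx => ?_⟩
    · simp only [Cmd.modr, Bool.or_eq_false_iff] at hx
      exact (h''.1.r x hx.2).trans (h'.1.r x hx.1)
    · simp only [Cmd.moda, Bool.or_eq_false_iff] at hx
      exact (h''.1.a x hx.2).trans (h'.1.a x hx.1)
  | ite c p q ihp ihq =>
    refine ⟨h.1, h.2.1, fun hc => WP_mono (ihp (h.2.2.1 hc)) fun σ' k' h' => ⟨?_, h'.2⟩,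
      fun hc => WP_mono (ihq (h.2.2.2 hc)) fun σ' k' h' => ⟨?_, h'.2⟩⟩ <;>
    refine ⟨fun x hx => ?_, fun x hx => ?_⟩ <;>
    simp only [Cmd.modr, Cmd.moda, Bool.or_eq_false_iff] at hx
    exacts [h'.1.r x hx.1, h'.1.a x hx.1, h'.1.r x hx.2, h'.1.a x hx.2]
  | loop c p ih =>
    obtain ⟨Inv, h0, hs⟩ := h
    refine ⟨fun σ' k' => Fr p σ σ' ∧ Inv σ' k', ⟨Fr.refl _ _, h0⟩, fun σ' k' hi => ?_⟩
    obtain ⟨h1, h2, h3, h4⟩ := hs σ' k' hi.2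
    exact ⟨h1, h2, fun hc => WP_mono (ih (h3 hc)) fun σ'' k'' h' => ⟨hi.1.trans h'.1, h'.2⟩,
      fun hc => ⟨⟨hi.1.r, hi.1.a⟩, h4 hc⟩⟩
  | skip => exact ⟨h.1, Fr.refl _ _, h.2⟩

theorem WP_conseq {Γ : Env} {p : Cmd} {Q Q' : Mach → ℕ → Prop} {σ : Mach} {k : ℕ}
    (h : WP Γ p Q σ k) (hQ : ∀ σ' k', Fr p σ σ' → Q σ' k' → Q' σ' k') : WP Γ p Q' σ k :=
  WP_mono (WP_frame h) fun σ' k' h' => hQ σ' k' h'.1 h'.2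

/-- An invariant of a loop may use that only what the body mentions has changed. -/
theorem WP_loop {Γ : Env} {c : E} {p : Cmd} {Q : Mach → ℕ → Prop} {σ : Mach} {k : ℕ}
    (Inv : Mach → ℕ → Prop) (h0 : Inv σ k)
    (hs : ∀ σ' k', Fr (.loop c p) σ σ' → Inv σ' k' → c.ok Γ σ' ∧ c.cost + 1 ≤ k' ∧
      (c.ev Γ σ' ≠ 0 → WP Γ p Inv σ' (k' - (c.cost + 1))) ∧
      (c.ev Γ σ' = 0 → Q σ' (k' - (c.cost + 1)))) : WP Γ (.loop c p) Q σ k := by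
  refine ⟨fun σ' k' => Fr p σ σ' ∧ Inv σ' k', ⟨Fr.refl _ _, h0⟩, fun σ' k' hi => ?_⟩
  obtain ⟨h1, h2, h3, h4⟩ := hs σ' k' ⟨hi.1.r, hi.1.a⟩ hi.2
  exact ⟨h1, h2, fun hc => WP_mono (WP_frame (h3 hc)) fun σ'' k'' h' => ⟨hi.1.trans h'.1, h'.2⟩, h4⟩

/-- The RAM program simulates the array program and takes exactly as many steps as credits are
consumed. -/
theorem WP_sound {Γ : Env} (hΓ : Γ.Fits) (p : Cmd) (Q : Mach → ℕ → Prop) (σ : Mach) (k : ℕ)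
    (h : WP Γ p Q σ k) (s : State) (hr : Rep Γ σ s) :
    ∃ s' σ' t, Exec Γ.W Γ.inp p.comp s s' t ∧ Rep Γ σ' s' ∧ t ≤ k ∧ Q σ' (k - t) := by
  have hW := hΓ.word
  have hb := hΓ.base
  have hs := hΓ.small
  induction p generalizing Q σ k s with
  | set x e =>
    obtain ⟨h1, h2, h3⟩ := h
    obtain ⟨v1, v2⟩ := E.val_comp hΓ hr e h1
    refine ⟨_, _, _, Exec.set _ _ _, ?_, ?_, by rw [E.cost_comp]; exact h3⟩
    · refine ⟨?_, fun y => ?_, fun y => ?_, hr.arr, hr.arr_lt, hr.out⟩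
      · simpa [Function.update_apply] using hr.base
      · by_cases hy : y = x <;> simp [hy, v1, hr.reg]
      · by_cases hy : y = x <;> simp [hy, v2, hr.reg_lt]
    · rw [E.cost_comp]; exact h2
  | put j i e =>
    obtain ⟨⟨hj, h1, h1'⟩, h2, h3⟩ := h
    obtain ⟨v1, v2⟩ := E.val_comp hΓ hr e h1'
    obtain ⟨u1, u2⟩ := E.val_comp hΓ hr i h1
    refine ⟨_, σ.put j (i.ev Γ σ) (e.ev Γ σ), _, Exec.store _ _ _, ?_, ?_, ?_⟩
    rotate_left 2
    · have : (Exp.op Op.plus (Exp.op .times (.op .plus i.comp (.reg 1)) (.const 32))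
          (.const j)).cost + e.comp.cost + 1 = i.cost + e.cost + 7 := by
        simp only [Exp.cost, E.cost_comp]; omega
      rw [this]; exact h3
    · have ha : (Exp.op Op.plus (Exp.op .times (.op .plus i.comp (.reg 1)) (.const 32))
          (.const j)).val Γ.W Γ.inp s = (i.ev Γ σ + Γ.b) * 32 + j := by
        simp only [Exp.val, Op.apply, u1, hr.base]
        rw [Nat.mod_eq_of_lt (a := 32) (by omega), Nat.mod_eq_of_lt (a := j) (by omega),
          Nat.mod_eq_of_lt (a := Γ.b) (by omega), Nat.mod_eq_of_lt (a := _ + Γ.b) (by omega),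
          Nat.mod_eq_of_lt (a := _ * 32) (by omega), Nat.mod_eq_of_lt (by omega)]
      rw [ha, v1]
      refine ⟨hr.base, hr.reg, hr.reg_lt, fun j' hj' i' hi' => ?_, fun j' i' => ?_, fun i' hi' => ?_⟩
      · have := hr.arr j' hj' i' hi'
        simp only [Mach.put_arr, Function.update_apply]
        by_cases hjj : j' = j
        · subst hjj
          by_cases hii : i' = i.ev Γ σ
          · simp [hii]
          · rw [if_neg (by omega), if_pos rfl, Function.update_apply, if_neg hii, this]
        · rw [if_neg (by omega), if_neg hjj, this]
      · simp only [Mach.put_arr]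
        split_ifs with hjj
        · simp only [Function.update_apply]
          split_ifs
          · exact v2
          · exact hr.arr_lt _ _
        · exact hr.arr_lt _ _
      · simp only [Function.update_apply]
        rw [if_neg (by omega)]
        exact hr.out i' hi'
    · simp only [Exp.cost, E.cost_comp]; omega
  | out i e =>
    obtain ⟨⟨h1, h1', hib⟩, h2, h3⟩ := h
    obtain ⟨v1, v2⟩ := E.val_comp hΓ hr e h1'
    obtain ⟨u1, u2⟩ := E.val_comp hΓ hr i h1
    refine ⟨_, _, _, Exec.store _ _ _, ?_, ?_, by rw [E.cost_comp, E.cost_comp]; exact h3⟩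
    · rw [u1, v1]
      refine ⟨hr.base, hr.reg, hr.reg_lt, fun j' hj' i' hi' => ?_, hr.arr_lt, fun i' hi' => ?_⟩
      · simp only [Function.update_apply]
        rw [if_neg (by omega)]
        exact hr.arr j' hj' i' hi'
      · simp only [Mach.puto_out, Function.update_apply]
        split_ifs
        · rfl
        · exact hr.out i' hi'
    · rw [E.cost_comp, E.cost_comp]; exact h2
  | seq p q ihp ihq =>
    obtain ⟨s1, σ1, t1, e1, r1, l1, q1⟩ := ihp _ _ _ h s hr
    obtain ⟨s2, σ2, t2, e2, r2, l2, q2⟩ := ihq _ _ _ q1 s1 r1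
    exact ⟨s2, σ2, t1 + t2, Exec.seq e1 e2, r2, by omega, by rwa [← Nat.sub_sub]⟩
  | ite c p q ihp ihq =>
    obtain ⟨h1, h2, h3, h4⟩ := h
    have v1 := (E.val_comp hΓ hr c h1).1
    by_cases hc : c.ev Γ σ = 0
    · obtain ⟨s1, σ1, t1, e1, r1, l1, q1⟩ := ihq _ _ _ (h4 hc) s hr
      refine ⟨s1, σ1, _, Exec.ite_false (by rw [v1, hc]) e1, r1, ?_, ?_⟩ <;> rw [E.cost_comp]
      · omega
      · rwa [← Nat.sub_sub]
    · obtain ⟨s1, σ1, t1, e1, r1, l1, q1⟩ := ihp _ _ _ (h3 hc) s hr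
      refine ⟨s1, σ1, _, Exec.ite_true (by rwa [v1]) e1, r1, ?_, ?_⟩ <;> rw [E.cost_comp]
      · omega
      · rwa [← Nat.sub_sub]
  | loop c p ih =>
    obtain ⟨Inv, h0, hi⟩ := h
    induction k using Nat.strong_induction_on generalizing σ s with
    | _ k ihk =>
      obtain ⟨h1, h2, h3, h4⟩ := hi σ k h0
      have v1 := (E.val_comp hΓ hr c h1).1
      by_cases hc : c.ev Γ σ = 0
      · refine ⟨s, σ, _, Exec.loop_false (by rw [v1, hc]), hr, ?_, ?_⟩ <;> rw [E.cost_comp]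
        · exact h2
        · exact h4 hc
      · obtain ⟨s1, σ1, t1, e1, r1, l1, q1⟩ := ih _ _ _ (h3 hc) s hr
        obtain ⟨s2, σ2, t2, e2, r2, l2, q2⟩ := ihk (k - (c.cost + 1) - t1) (by omega) σ1 s1 r1 q1
        refine ⟨s2, σ2, _, Exec.loop_true (by rwa [v1]) e1 e2, r2, ?_, ?_⟩ <;> rw [E.cost_comp]
        · omega
        · rwa [← Nat.sub_sub, ← Nat.sub_sub]
  | skip => exact ⟨s, σ, 1, Exec.skip s, hr, h.1, h.2⟩

/-- Execute `p` for the values of `x` from the current one up to the value of `e`, exclusively. -/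
def forUp (x : ℕ) (e : E) (p : Cmd) : Cmd :=
  .loop (.lt (.v x) e) (p ;; .set x (.add (.v x) (.c 1)))

/-- A counting loop whose `i`-th round takes at most `T i` steps. -/
theorem WP_for {Γ : Env} {x : ℕ} {e : E} {p : Cmd} {Q : Mach → ℕ → Prop} {σ : Mach} {k : ℕ}
    (lo hi : ℕ) (Inv : ℕ → Mach → Prop) (T : ℕ → ℕ) (k₀ : ℕ)
    (hlo : σ.reg x = lo) (hle : lo ≤ hi) (hB : hi < Γ.B) (h1B : 1 < Γ.B) (h0 : Inv lo σ)
    (hk : ∑ i ∈ Finset.Ico lo hi, (T i + e.cost + 7) + (e.cost + 3) + k₀ ≤ k)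
    (he : ∀ σ', Fr (forUp x e p) σ σ' → e.ok Γ σ' ∧ e.ev Γ σ' = hi)
    (hb : ∀ i σ' k', lo ≤ i → i < hi → Fr (forUp x e p) σ σ' → σ'.reg x = i → Inv i σ' →
      T i ≤ k' → WP Γ p (fun τ l => τ.reg x = i ∧ Inv (i + 1) (τ.setr x (i + 1)) ∧ k' ≤ l + T i) σ' k')
    (hQ : ∀ σ' k', Fr (forUp x e p) σ σ' → σ'.reg x = hi → Inv hi σ' → k₀ ≤ k' → Q σ' k') :
    WP Γ (forUp x e p) Q σ k := by
  refine WP_loop (fun σ' k' => ∃ i, σ'.reg x = i ∧ lo ≤ i ∧ i ≤ hi ∧ Inv i σ' ∧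
    ∑ j ∈ Finset.Ico i hi, (T j + e.cost + 7) + (e.cost + 3) + k₀ ≤ k')
    ⟨lo, hlo, le_rfl, hle, h0, hk⟩ ?_
  rintro σ' k' hF ⟨i, hx, hl, hh, hI, hk'⟩
  obtain ⟨he1, he2⟩ := he σ' hF
  refine ⟨⟨trivial, he1⟩, ?_, ?_, ?_⟩
  · simp only [E.cost]; omega
  · simp only [E.ev, hx, he2, E.cost, show 1 + e.cost + 1 + 1 = e.cost + 3 by omega]
    intro hlt
    have hlt : i < hi := by by_contra hn; simp [hn] at hlt
    rw [Finset.sum_eq_sum_Ico_succ_bot hlt] at hk'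
    change WP Γ p (WP Γ (.set x _) _) σ' _
    refine WP_mono (hb i σ' (k' - (e.cost + 3)) hl hlt hF hx hI (by omega)) ?_
    rintro τ l ⟨h1, h2, h3⟩
    refine ⟨⟨trivial, by simpa [E.ok] using h1B, by simp only [E.ev, h1]; omega⟩, ?_, i + 1, ?_, by omega, by omega, ?_, ?_⟩
    · simp only [E.cost]; omega
    · simp [E.ev, h1]
    · simpa [E.ev, h1] using h2
    · simp only [E.cost]; omega
  · simp only [E.ev, hx, he2, E.cost]
    intro hlt
    have hlt : ¬ i < hi := by by_contra hn; simp [hn] at hlt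
    have : i = hi := by omega
    subst this
    exact hQ _ _ hF hx hI (by simp at hk'; omega)

/-- A counting loop, with time credits as part of the invariant. -/
theorem WP_forK {Γ : Env} {x : ℕ} {e : E} {p : Cmd} {Q : Mach → ℕ → Prop} {σ : Mach} {k : ℕ}
    (lo hi : ℕ) (Inv : ℕ → Mach → ℕ → Prop)
    (hlo : σ.reg x = lo) (hle : lo ≤ hi) (hB : hi < Γ.B) (h1B : 1 < Γ.B) (h0 : Inv lo σ k)
    (he : ∀ σ', Fr (forUp x e p) σ σ' → e.ok Γ σ' ∧ e.ev Γ σ' = hi)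
    (hb : ∀ i σ' k', lo ≤ i → i < hi → Fr (forUp x e p) σ σ' → σ'.reg x = i → Inv i σ' k' →
      e.cost + 3 ≤ k' ∧ WP Γ p (fun τ l => τ.reg x = i ∧ 4 ≤ l ∧
        Inv (i + 1) (τ.setr x (i + 1)) (l - 4)) σ' (k' - (e.cost + 3)))
    (hQ : ∀ σ' k', Fr (forUp x e p) σ σ' → σ'.reg x = hi → Inv hi σ' k' → e.cost + 3 ≤ k' ∧
      Q σ' (k' - (e.cost + 3))) :
    WP Γ (forUp x e p) Q σ k := by
  refine WP_loop (fun σ' k' => ∃ i, σ'.reg x = i ∧ lo ≤ i ∧ i ≤ hi ∧ Inv i σ' k')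
    ⟨lo, hlo, le_rfl, hle, h0⟩ ?_
  rintro σ' k' hF ⟨i, hx, hl, hh, hI⟩
  obtain ⟨he1, he2⟩ := he σ' hF
  have hc : (E.lt (.v x) e).cost + 1 = e.cost + 3 := by simp only [E.cost]; omega
  rw [hc]
  by_cases hlt : i < hi
  · obtain ⟨g1, g2⟩ := hb i σ' k' hl hlt hF hx hI
    refine ⟨⟨trivial, he1⟩, g1, fun _ => ?_, fun h => ?_⟩
    · change WP Γ p (WP Γ (.set x _) _) σ' _
      refine WP_mono g2 ?_
      rintro τ l ⟨h1, h2, h3⟩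
      refine ⟨⟨trivial, by simpa [E.ok] using h1B, by simp only [E.ev, h1]; omega⟩,
        by simp only [E.cost]; omega, i + 1, ?_, by omega, by omega, ?_⟩
      · simp [E.ev, h1]
      · simpa [E.ev, E.cost, h1] using h3
    · simp [E.ev, hx, he2, hlt] at h
  · have : i = hi := by omega
    subst this
    obtain ⟨g1, g2⟩ := hQ σ' k' hF hx hI
    exact ⟨⟨trivial, he1⟩, g1, fun h => by simp [E.ev, hx, he2] at h, fun _ => g2⟩

/-- Increase `x` up to `bound`, as long as `test` is true. -/
def scanUp (x : ℕ) (bound test : E) : Cmd :=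
  .loop (.and (.lt (.v x) bound) test) (.set x (.add (.v x) (.c 1)))

/-- The position where a scan from `a` up to `b` ends: at the first failure of `P`, or at `b`. -/
theorem scan_exists (P : ℕ → Prop) {a b : ℕ} (h : a ≤ b) :
    ∃ t, a ≤ t ∧ t ≤ b ∧ (∀ s, a ≤ s → s < t → P s) ∧ (t < b → ¬ P t) := by
  induction b, h using Nat.le_induction with
  | base => exact ⟨a, le_rfl, le_rfl, fun s h1 h2 => by omega, fun h => by omega⟩
  | succ b hb ih =>
    obtain ⟨t, h1, h2, h3, h4⟩ := ih
    by_cases ht : t < b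
    · exact ⟨t, h1, by omega, h3, fun _ => h4 ht⟩
    · have : t = b := by omega
      subst this
      by_cases hP : P t
      · refine ⟨t + 1, by omega, le_rfl, fun s hs hs' => ?_, fun h => by omega⟩
        rcases Nat.lt_succ_iff_lt_or_eq.1 hs' with h | rfl
        · exact h3 s hs h
        · exact hP
      · exact ⟨t, h1, by omega, h3, fun _ => hP⟩

theorem Mach.setr_setr (σ : Mach) (x u w : ℕ) : (σ.setr x u).setr x w = σ.setr x w := by
  simp [Mach.setr]

theorem Mach.setr_self {σ : Mach} {x u : ℕ} (h : σ.reg x = u) : σ.setr x u = σ := by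
  subst h; simp [Mach.setr]

/-- A scan from `t₀` that ends at `t₁` consumes credits in proportion to `t₁ - t₀ + 1`. -/
theorem WP_scanUp {Γ : Env} {x : ℕ} {bound test : E} {Q : Mach → ℕ → Prop} {σ : Mach} {k : ℕ}
    (P : ℕ → Prop) (t₀ t₁ hi k₀ : ℕ) (h1 : t₀ ≤ t₁) (h2 : t₁ ≤ hi)
    (h3 : ∀ s, t₀ ≤ s → s < t₁ → P s) (h4 : t₁ < hi → ¬ P t₁) (hx : σ.reg x = t₀) (hB : hi < Γ.B)
    (hB1 : 1 < Γ.B)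
    (hE : ∀ s, t₀ ≤ s → s ≤ hi → bound.ok Γ (σ.setr x s) ∧ test.ok Γ (σ.setr x s) ∧
      bound.ev Γ (σ.setr x s) = hi ∧ (s < hi → (test.ev Γ (σ.setr x s) ≠ 0 ↔ P s)))
    (hk : (t₁ - t₀ + 1) * (bound.cost + test.cost + 12) + k₀ ≤ k)
    (hQ : ∀ l, k₀ ≤ l → Q (σ.setr x t₁) l) : WP Γ (scanUp x bound test) Q σ k := by
  refine WP_loop (fun τ l => ∃ s, t₀ ≤ s ∧ s ≤ t₁ ∧ τ = σ.setr x s ∧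
    (t₁ - s + 1) * (bound.cost + test.cost + 12) + k₀ ≤ l)
    ⟨t₀, le_rfl, h1, (Mach.setr_self hx).symm, hk⟩ ?_
  rintro τ l - ⟨s, g1, g2, rfl, g3⟩
  obtain ⟨o1, o2, o3, o4⟩ := hE s g1 (by omega)
  rw [Nat.add_mul] at g3
  simp only [E.ok, E.cost, E.ev, o3, o1, o2, Mach.setr_reg, if_true, true_and, and_true]
  refine ⟨by omega, fun h => ?_, fun h => ?_⟩
  · have hs : s < hi := by
      by_contra hn
      simp [hn] at h
    have ht : test.ev Γ (σ.setr x s) ≠ 0 := by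
      intro h0
      simp [h0] at h
    have hst : s < t₁ := by
      by_contra hn
      have : s = t₁ := by omega
      subst this
      exact h4 hs ((o4 hs).1 ht)
    obtain ⟨d, rfl⟩ : ∃ d, t₁ = s + 1 + d := ⟨t₁ - (s + 1), by omega⟩
    rw [show s + 1 + d - s = d + 1 by omega, Nat.add_mul] at g3
    refine ⟨?_, ?_, s + 1, by omega, by omega, ?_, ?_⟩
    · simp only [E.ok, E.ev, Mach.setr_reg, if_true, true_and]; omega
    · simp only [E.cost]; omega
    · simp [E.ev, Mach.setr_setr]
    · simp only [E.cost]
      rw [show s + 1 + d - (s + 1) = d by omega, Nat.add_mul]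
      omega
  · have hst : s = t₁ := by
      by_contra hn
      have hs : s < hi := by omega
      have := (o4 hs).2 (h3 s g1 (by omega))
      simp [hs, this] at h
    subst hst
    exact hQ _ (by omega)

/-! ### Trees labelled in preorder -/

/-- The labels `0, …, n` form a tree with root `0`, numbered in preorder such that the subtree of
`x` consists of the labels in `[x, x + sz x)`; the first child of a vertex, which has the label
following that of the vertex, is heaviest. -/
structure HTree (n : ℕ) (pa sz : ℕ → ℕ) : Prop where
  sz_zero : sz 0 = n + 1
  pos : ∀ x ≤ n, 1 ≤ sz x
  par : ∀ x, 1 ≤ x → x ≤ n → pa x < x ∧ x + sz x ≤ pa x + sz (pa x)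
  inner : ∀ p x, p ≤ n → p < x → x < p + sz p → p ≤ pa x
  light : ∀ x, 1 ≤ x → x ≤ n → pa x + 1 ≠ x → 2 * sz x ≤ sz (pa x)

namespace HTree
variable {n : ℕ} {pa sz : ℕ → ℕ} (h : HTree n pa sz)
include h

theorem le_end {x : ℕ} (hx : x ≤ n) : x + sz x ≤ n + 1 := by
  induction x using Nat.strong_induction_on with
  | _ x ih =>
    rcases Nat.eq_zero_or_pos x with rfl | h0
    · rw [h.sz_zero]; omega
    · have := h.par x h0 hx
      have := ih (pa x) this.1 (by omega)
      omega

theorem nest {p x : ℕ} (hp : p ≤ n) (h1 : p ≤ x) (h2 : x < p + sz p) :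
    x + sz x ≤ p + sz p := by
  induction x using Nat.strong_induction_on with
  | _ x ih =>
    rcases h1.eq_or_lt with rfl | h1
    · exact le_rfl
    · have := h.le_end hp
      have h3 := h.par x (by omega) (by omega)
      have h4 := h.inner p x hp h1 h2
      have := ih (pa x) h3.1 h4 (by omega)
      omega

end HTree

/-! ### Sizes and heavy children by peeling off leaves -/

/-- The children of `a`, where `par` gives the parents of the nodes `1, …, n`. -/
def kids (n : ℕ) (par : ℕ → ℕ) (a : ℕ) : Finset ℕ := (Icc 1 n).filter fun c => par c = a

theorem mem_kids {n : ℕ} {par : ℕ → ℕ} {a c : ℕ} :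
    c ∈ kids n par a ↔ (1 ≤ c ∧ c ≤ n) ∧ par c = a := by
  simp [kids]

/-- The situation after `qh` nodes have been taken from the queue: `ord` contains the queue,
including the nodes taken, of length `qt`; `cnt` counts the children not yet taken, and `size` the
descendants by way of the children taken; `hv` is the heaviest child taken, and `hs` its size. The
sizes of the nodes not taken add up to `n + 1`, which keeps all numbers small. -/
structure Peel (n : ℕ) (par : ℕ → ℕ) (qh qt : ℕ) (ord cnt size hs hv : ℕ → ℕ) : Prop where
  le : qh ≤ qt
  qt_le : qt ≤ n + 1
  inj : Set.InjOn ord (Set.Iio qt)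
  lt : ∀ i < qt, ord i ≤ n
  cnt_zero : ∀ a ≤ n, cnt a = 0 → ∃ i < qt, ord i = a
  cnt_eq : ∀ a ≤ n, cnt a = ((kids n par a).filter fun c => c ∉ (range qh).image ord).card
  before : ∀ i < qt, ∀ c ∈ kids n par (ord i), ∃ j < i, j < qh ∧ ord j = c
  size_eq : ∀ a ≤ n, size a = 1 + ∑ c ∈ (kids n par a).filter fun c => c ∈ (range qh).image ord,
    size c
  hs_le : ∀ a ≤ n, ∀ c ∈ kids n par a, c ∈ (range qh).image ord → size c ≤ hs a
  hv_kid : ∀ a ≤ n, hv a ≠ 0 → hv a ∈ kids n par a ∧ hv a ∈ (range qh).image ord ∧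
    hs a = size (hv a)
  hv_zero : ∀ a ≤ n, hv a = 0 → hs a = 0
  total : ∑ a ∈ (range (n + 1)).filter fun a => a ∉ (range qh).image ord, size a = n + 1

namespace Peel
variable {n : ℕ} {par rk : ℕ → ℕ} {qh qt : ℕ} {ord cnt size hs hv : ℕ → ℕ}

/-- While some node has not been taken the queue is not empty, and the root is not at its front:
a node outside the queue that is farthest from the root would have no child left, and the
ancestors of a node outside the queue are outside the queue. -/
theorem front (h : Peel n par qh qt ord cnt size hs hv) (hq : qh < n)
    (hp : ∀ a, 1 ≤ a → a ≤ n → par a ≤ n) (hrk : ∀ a, 1 ≤ a → a ≤ n → rk (par a) < rk a) :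
    qh < qt ∧ 1 ≤ ord qh := by
  have hlt : qh < qt := by
    by_contra hcon
    have hqq : qh = qt := le_antisymm h.le (by omega)
    let S := (range (n + 1)).filter fun a => a ∉ (range qt).image ord
    have hS : S.Nonempty := by
      rw [Finset.nonempty_iff_ne_empty]
      intro hS
      have : range (n + 1) ⊆ (range qt).image ord := by
        intro a ha
        by_contra hna
        have : a ∈ S := by simp only [S, mem_filter]; exact ⟨ha, hna⟩
        rw [hS] at this; simp at this
      have := (card_le_card this).trans card_image_le
      simp at this; omega
    obtain ⟨a, ha, hmax⟩ := exists_max_image S rk hS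
    simp only [S, mem_filter, mem_range] at ha
    have hc : cnt a ≠ 0 := by
      intro h0
      obtain ⟨i, hi, rfl⟩ := h.cnt_zero a (by omega) h0
      exact ha.2 (mem_image_of_mem _ (by simpa using hi))
    rw [h.cnt_eq a (by omega), card_ne_zero] at hc
    obtain ⟨c, hc⟩ := hc
    simp only [mem_filter, mem_kids] at hc
    have := hrk c hc.1.1.1 hc.1.1.2
    have h2 := hmax c (by simp only [S, mem_filter, mem_range]; exact ⟨by omega, hqq ▸ hc.2⟩)
    rw [hc.1.2] at this
    omega
  refine ⟨hlt, ?_⟩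
  by_contra h0
  have h0 : ord qh = 0 := by omega
  have hnot : (0 : ℕ) ∉ (range qh).image ord := by
    simp only [mem_image, mem_range, not_exists, not_and]
    intro i hi hi0
    have := h.inj (show i ∈ Set.Iio qt by simp; omega) (show qh ∈ Set.Iio qt by simpa using hlt)
      (hi0.trans h0.symm)
    omega
  -- every node not taken has the root as an ancestor not in the queue
  have key : ∀ m a, rk a ≤ m → a ≤ n → a ≠ 0 → a ∉ (range qh).image ord → False := by
    intro m
    induction m with
    | zero =>
      intro a hm ha hne _
      have := hrk a (by omega) ha
      omega
    | succ m ih =>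
      intro a hm ha hne hnd
      have hr := hrk a (by omega) ha
      have hpn := hp a (by omega) ha
      have hcn : ∀ i < qt, ord i ≠ par a := by
        intro i hi hia
        obtain ⟨j, _, hj, hja⟩ := h.before i hi a (by rw [mem_kids]; exact ⟨⟨by omega, ha⟩, hia.symm⟩)
        exact hnd (by rw [← hja]; exact mem_image_of_mem _ (by simpa using hj))
      by_cases hp0 : par a = 0
      · exact hcn qh hlt (by rw [h0, hp0])
      · exact ih (par a) (by omega) hpn hp0 (by
          simp only [mem_image, mem_range, not_exists, not_and]
          intro i hi; exact hcn i (by omega))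
  have hex : ∃ a ∈ Icc 1 n, a ∉ (range qh).image ord := by
    by_contra hcon
    push Not at hcon
    have := (card_le_card (show Icc 1 n ⊆ _ from fun a ha => hcon a ha)).trans card_image_le
    simp at this; omega
  obtain ⟨a, ha, hna⟩ := hex
  simp at ha
  exact key (rk a) a le_rfl (by omega) (by omega) hna

/-- The sizes of two nodes that have not been taken add up to at most `n + 1`. -/
theorem size_le (h : Peel n par qh qt ord cnt size hs hv) {a b : ℕ} (ha : a ≤ n) (hb : b ≤ n)
    (hab : a ≠ b) (ha' : a ∉ (range qh).image ord) (hb' : b ∉ (range qh).image ord) :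
    size a + size b ≤ n + 1 := by
  rw [← h.total, ← sum_pair hab]
  refine sum_le_sum_of_subset fun c hc => ?_
  simp only [mem_insert, mem_singleton] at hc
  simp only [mem_filter, mem_range]
  rcases hc with rfl | rfl
  · exact ⟨by omega, ha'⟩
  · exact ⟨by omega, hb'⟩

/-- The front of the queue and its parent are not among the nodes taken. -/
theorem front_notMem (h : Peel n par qh qt ord cnt size hs hv) (hq : qh < qt) (hq0 : 1 ≤ ord qh) :
    (ord qh ∉ (range qh).image ord ∧ par (ord qh) ∉ (range qh).image ord) ∧
      ord qh ≠ par (ord qh) := by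
  have hna : ord qh ∉ (range qh).image ord := by
    simp only [mem_image, mem_range, not_exists, not_and]
    intro i hi hia
    have := h.inj (show i ∈ Set.Iio qt by simp; omega) (show qh ∈ Set.Iio qt by simpa using hq) hia
    omega
  have hpq : ∀ i < qt, ord i ≠ par (ord qh) := by
    intro i hi hip
    obtain ⟨j, _, hj, hja⟩ := h.before i hi (ord qh)
      (by rw [hip]; exact mem_kids.2 ⟨⟨hq0, h.lt qh hq⟩, rfl⟩)
    exact hna (by rw [← hja]; exact mem_image_of_mem _ (by simpa using hj))
  refine ⟨⟨hna, ?_⟩, hpq qh hq⟩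
  simp only [mem_image, mem_range, not_exists, not_and]
  exact fun i hi => hpq i (by omega)

/-- Taking the node `ord qh` from the queue. -/
theorem step (h : Peel n par qh qt ord cnt size hs hv) (hq : qh < qt) (hq0 : 1 ≤ ord qh)
    (hp : ∀ a, 1 ≤ a → a ≤ n → par a ≤ n) {p : ℕ} (hpa : par (ord qh) = p) {hs' hv' : ℕ → ℕ}
    (hh : hs p < size (ord qh) ∧ hs' = Function.update hs p (size (ord qh)) ∧
        hv' = Function.update hv p (ord qh) ∨ size (ord qh) ≤ hs p ∧ hs' = hs ∧ hv' = hv)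
    {qt' : ℕ} {ord' : ℕ → ℕ}
    (ho : cnt p - 1 = 0 ∧ qt' = qt + 1 ∧ ord' = Function.update ord qt p ∨
      cnt p - 1 ≠ 0 ∧ qt' = qt ∧ ord' = ord) :
    Peel n par (qh + 1) qt' ord' (Function.update cnt p (cnt p - 1))
      (Function.update size p (size p + size (ord qh))) hs' hv' := by
  set a := ord qh with ha
  have han : a ≤ n := h.lt qh hq
  have hpn : p ≤ n := hpa ▸ hp a hq0 han
  have hak : a ∈ kids n par p := by rw [mem_kids]; exact ⟨⟨hq0, han⟩, hpa⟩
  have hko : ∀ b, b ≠ p → a ∉ kids n par b := fun b hb hab => hb ((mem_kids.1 hab).2.symm.trans hpa)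
  have hna : a ∉ (range qh).image ord := (h.front_notMem hq hq0).1.1
  have hpq : ∀ i < qt, ord i ≠ p := by
    intro i hi hip
    obtain ⟨j, _, hj, hja⟩ := h.before i hi a (by rw [hip]; exact hak)
    exact hna (by rw [← hja]; exact mem_image_of_mem _ (by simpa using hj))
  have hap : a ≠ p := hpq qh hq
  have hord : ∀ i < qt, ord' i = ord i := by
    intro i hi
    rcases ho with ⟨_, _, rfl⟩ | ⟨_, _, rfl⟩
    · simp [show i ≠ qt by omega]
    · rfl
  have hD : (range (qh + 1)).image ord' = insert a ((range qh).image ord) := by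
    rw [range_add_one, image_insert, hord qh hq]
    congr 1
    apply image_congr
    intro i hi
    simp at hi
    exact hord i (by omega)
  have hpD : p ∉ insert a ((range qh).image ord) := by
    simp only [mem_insert, mem_image, mem_range, not_or, not_exists, not_and]
    exact ⟨fun e => hap e.symm, fun i hi => hpq i (by omega)⟩
  have hcp : cnt p = ((kids n par p).filter fun c => c ∉ insert a ((range qh).image ord)).card + 1 := by
    rw [h.cnt_eq p hpn, ← card_erase_add_one (a := a) (by simp only [mem_filter]; exact ⟨hak, hna⟩)]
    congr 2
    ext c
    simp only [mem_erase, mem_filter, mem_insert, not_or]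
    tauto
  have hco : ∀ b, b ≠ p → ((kids n par b).filter fun c => c ∉ insert a ((range qh).image ord)) =
      (kids n par b).filter fun c => c ∉ (range qh).image ord := by
    intro b hb
    apply filter_congr
    intro c hc
    have : c ≠ a := fun e => hko b hb (e ▸ hc)
    simp [this]
  have hqt : qt ≤ qt' := by rcases ho with ⟨_, rfl, _⟩ | ⟨_, rfl, _⟩ <;> omega
  have hqtn : qt' ≤ n + 1 ∧ Set.InjOn ord' (Set.Iio qt') := by
    have hI : Set.InjOn ord' (Set.Iio qt') := by
      rcases ho with ⟨_, rfl, rfl⟩ | ⟨_, rfl, rfl⟩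
      · intro i hi j hj hij
        simp only [Set.mem_Iio] at hi hj
        simp only [Function.update_apply] at hij
        split_ifs at hij with h1 h2 h2
        · omega
        · exact absurd hij.symm (hpq j (by omega))
        · exact absurd hij (hpq i (by omega))
        · exact h.inj (by simp; omega) (by simp; omega) hij
      · exact h.inj
    refine ⟨?_, hI⟩
    have := card_le_card_of_injOn (s := range qt') (t := range (n + 1)) ord' (by
      intro i hi
      simp only [coe_range, Set.mem_Iio] at hi ⊢
      rcases ho with ⟨_, rfl, rfl⟩ | ⟨_, rfl, rfl⟩
      · simp only [Function.update_apply]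
        split_ifs
        · omega
        · have := h.lt i (by omega); omega
      · have := h.lt i (by omega); omega) (by simpa using hI)
    simpa using this
  refine ⟨by omega, hqtn.1, hqtn.2, ?_, ?_, ?_, ?_, ?_, ?_, ?_, ?_, ?_⟩
  rotate_right
  · rw [hD]
    refine Eq.trans ?_ h.total
    have e1 : ((range (n + 1)).filter fun b => b ∉ (range qh).image ord) =
        insert a ((range (n + 1)).filter fun b => b ∉ insert a ((range qh).image ord)) := by
      ext c
      simp only [mem_filter, mem_insert, mem_range]
      constructor
      · tauto
      · rintro (rfl | hc)
        · exact ⟨by omega, hna⟩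
        · tauto
    rw [e1]
    have hpm : p ∈ (range (n + 1)).filter fun b => b ∉ insert a ((range qh).image ord) := by
      simp only [mem_filter, mem_range]; exact ⟨by omega, hpD⟩
    rw [sum_insert (by simp), sum_update_of_mem hpm, ← add_sum_erase _ _ hpm, sdiff_singleton_eq_erase]
    omega
  · intro i hi
    rcases ho with ⟨_, rfl, rfl⟩ | ⟨_, rfl, rfl⟩
    · simp only [Function.update_apply]
      split_ifs
      · omega
      · exact h.lt i (by omega)
    · exact h.lt i hi
  · intro b hb hb0
    by_cases hbp : b = p
    · subst hbp
      simp only [Function.update_self] at hb0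
      rcases ho with ⟨_, rfl, rfl⟩ | ⟨h1, _, _⟩
      · exact ⟨qt, by omega, by simp⟩
      · exact absurd hb0 h1
    · simp only [Function.update_of_ne hbp] at hb0
      obtain ⟨i, hi, hib⟩ := h.cnt_zero b hb hb0
      exact ⟨i, by omega, by rw [hord i hi, hib]⟩
  · intro b hb
    rw [hD]
    by_cases hbp : b = p
    · subst hbp; rw [Function.update_self, hcp]; rfl
    · rw [Function.update_of_ne hbp, hco b hbp, h.cnt_eq b hb]
  · intro i hi c hc
    by_cases hiq : i < qt
    · rw [hord i hiq] at hc
      obtain ⟨j, h1, h2, h3⟩ := h.before i hiq c hc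
      exact ⟨j, h1, by omega, by rw [hord j (by omega), h3]⟩
    · rcases ho with ⟨h0, rfl, rfl⟩ | ⟨h1, rfl, rfl⟩
      · have : i = qt := by omega
        subst this
        rw [Function.update_self] at hc
        have hem : ((kids n par p).filter fun c => c ∉ insert a ((range qh).image ord)) = ∅ := by
          rw [← card_eq_zero]; omega
        have hcD : c ∈ insert a ((range qh).image ord) := by
          by_contra hcD
          have : c ∈ (kids n par p).filter fun c => c ∉ insert a ((range qh).image ord) := by
            simp only [mem_filter]; exact ⟨hc, hcD⟩
          rw [hem] at this; simp at this
        simp only [mem_insert, mem_image, mem_range] at hcD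
        rcases hcD with rfl | ⟨j, hj, rfl⟩
        · exact ⟨qh, hq, by omega, by simp [show qh ≠ i by omega, ha]⟩
        · exact ⟨j, by omega, by omega, by simp [show j ≠ i by omega]⟩
      · omega
  · intro b hb
    rw [hD]
    by_cases hbp : b = p
    · subst hbp
      rw [Function.update_self, h.size_eq b hpn, add_assoc]
      congr 1
      have : ((kids n par b).filter fun c => c ∈ insert a ((range qh).image ord)) =
          insert a ((kids n par b).filter fun c => c ∈ (range qh).image ord) := by
        ext c
        simp only [mem_filter, mem_insert]
        constructor
        · tauto
        · rintro (rfl | hc)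
          · exact ⟨hak, Or.inl rfl⟩
          · tauto
      rw [this, sum_insert (by simp only [mem_filter]; tauto), Function.update_of_ne hap, add_comm]
      congr 1
      apply sum_congr rfl
      intro c hc
      rw [Function.update_of_ne]
      rintro rfl
      simp only [mem_filter] at hc
      exact hpD (mem_insert_of_mem hc.2)
    · rw [Function.update_of_ne hbp, h.size_eq b hb]
      congr 1
      apply sum_congr
      · apply filter_congr
        intro c hc
        have : c ≠ a := fun e => hko b hbp (e ▸ hc)
        simp [this]
      · intro c hc
        rw [Function.update_of_ne]
        rintro rfl
        simp only [mem_filter] at hc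
        exact hpD hc.2
  · intro b hb c hc hcD
    rw [hD] at hcD
    have hcp : c ≠ p := fun e => hpD (e ▸ hcD)
    rw [Function.update_of_ne hcp]
    have hold : c ∈ (range qh).image ord → size c ≤ hs b := h.hs_le b hb c hc
    rw [mem_insert] at hcD
    rcases hh with ⟨h1, rfl, rfl⟩ | ⟨h1, rfl, rfl⟩ <;> by_cases hbp : b = p
    · subst hbp
      rw [Function.update_self]
      rcases hcD with rfl | hcD
      · exact le_rfl
      · have := hold hcD; omega
    · rw [Function.update_of_ne hbp]
      rcases hcD with rfl | hcD
      · exact absurd hc (hko b hbp)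
      · exact hold hcD
    · subst hbp
      rcases hcD with rfl | hcD
      · exact h1
      · exact hold hcD
    · rcases hcD with rfl | hcD
      · exact absurd hc (hko b hbp)
      · exact hold hcD
  · intro b hb hb0
    rw [hD]
    have hold : hv b ≠ 0 → hv b ∈ kids n par b ∧ hv b ∈ insert a ((range qh).image ord) ∧
        hs b = Function.update size p (size p + size a) (hv b) := by
      intro h0
      obtain ⟨h1, h2, h3⟩ := h.hv_kid b hb h0
      refine ⟨h1, mem_insert_of_mem h2, ?_⟩
      rw [Function.update_of_ne, h3]
      intro e
      exact hpD (mem_insert_of_mem (e ▸ h2))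
    rcases hh with ⟨h1, rfl, rfl⟩ | ⟨h1, rfl, rfl⟩
    · by_cases hbp : b = p
      · subst hbp
        simp only [Function.update_self, Function.update_of_ne hap]
        exact ⟨hak, mem_insert_self _ _, trivial⟩
      · simp only [Function.update_of_ne hbp] at hb0 ⊢
        exact hold hb0
    · exact hold hb0
  · intro b hb
    rcases hh with ⟨h1, rfl, rfl⟩ | ⟨h1, rfl, rfl⟩
    · by_cases hbp : b = p
      · subst hbp
        simp only [Function.update_self]
        intro; omega
      · simp only [Function.update_of_ne hbp]
        exact h.hv_zero b hb
    · exact h.hv_zero b hb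

end Peel

/-- What the peeling achieves: `ord` lists all nodes, children before parents. -/
structure Peeled (n : ℕ) (par ord size hs hv : ℕ → ℕ) : Prop where
  inj : Set.InjOn ord (Set.Iic n)
  lt : ∀ i ≤ n, ord i ≤ n
  surj : ∀ a ≤ n, ∃ i ≤ n, ord i = a
  last : ord n = 0
  before : ∀ i ≤ n, 1 ≤ ord i → ∃ j ≤ n, i < j ∧ ord j = par (ord i)
  size_eq : ∀ a ≤ n, size a = 1 + ∑ c ∈ kids n par a, size c
  hs_le : ∀ a ≤ n, ∀ c ∈ kids n par a, size c ≤ hs a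
  hv_kid : ∀ a ≤ n, hv a ≠ 0 → hv a ∈ kids n par a ∧ hs a = size (hv a)
  hv_zero : ∀ a ≤ n, hv a = 0 → hs a = 0

theorem Peel.finish {n : ℕ} {par rk : ℕ → ℕ} {qt : ℕ} {ord cnt size hs hv : ℕ → ℕ}
    (h : Peel n par n qt ord cnt size hs hv) (hn : ∀ i < n, 1 ≤ ord i)
    (hp : ∀ a, 1 ≤ a → a ≤ n → par a ≤ n) (hrk : ∀ a, 1 ≤ a → a ≤ n → rk (par a) < rk a) :
    Peeled n par ord size hs hv := by
  have hall : ∀ a, 1 ≤ a → a ≤ n → a ∈ (range n).image ord := by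
    have h1 : (range n).image ord ⊆ Icc 1 n := by
      intro a ha
      simp only [mem_image, mem_range] at ha
      obtain ⟨i, hi, rfl⟩ := ha
      simp only [mem_Icc]
      exact ⟨hn i hi, h.lt i (lt_of_lt_of_le hi h.le)⟩
    have h2 : ((range n).image ord).card = n := by
      rw [card_image_of_injOn, card_range]
      intro i hi j hj hij
      simp at hi hj
      exact h.inj (by simp; exact lt_of_lt_of_le hi h.le) (by simp; exact lt_of_lt_of_le hj h.le) hij
    have := eq_of_subset_of_card_le h1 (by rw [h2]; simp)
    intro a h1 h2
    rw [this]; simp; omega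
  have hkid : ∀ b c, c ∈ kids n par b → c ∈ (range n).image ord := fun b c hc =>
    hall c (mem_kids.1 hc).1.1 (mem_kids.1 hc).1.2
  have hc0 : ∀ a ≤ n, cnt a = 0 := by
    intro a ha
    rw [h.cnt_eq a ha, card_eq_zero, filter_eq_empty_iff]
    intro c hc hcn
    exact hcn (hkid a c hc)
  obtain ⟨i0, hi0, hi00⟩ := h.cnt_zero 0 (by omega) (hc0 0 (by omega))
  have hqn : i0 = n := by
    have := h.qt_le
    by_contra hne
    have := hn i0 (by omega)
    omega
  subst hqn
  have hqt : qt = i0 + 1 := by have := h.qt_le; omega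
  subst hqt
  have hfil : ∀ a, ((kids i0 par a).filter fun c => c ∈ (range i0).image ord) = kids i0 par a :=
    fun a => filter_true_of_mem (hkid a)
  refine ⟨?_, fun i hi => h.lt i (by omega), ?_, hi00, ?_, ?_, ?_, ?_, h.hv_zero⟩
  · intro i hi j hj hij
    simp at hi hj
    exact h.inj (by simp; omega) (by simp; omega) hij
  · intro a ha
    obtain ⟨i, hi, h1⟩ := h.cnt_zero a ha (hc0 a ha)
    exact ⟨i, by omega, h1⟩
  · intro i hi hi1
    have hin := h.lt i (by omega)
    obtain ⟨j, hj, hj1⟩ := h.cnt_zero (par (ord i)) (hp _ hi1 hin) (hc0 _ (hp _ hi1 hin))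
    obtain ⟨l, hl, _, hl2⟩ := h.before j hj (ord i) (by rw [mem_kids, hj1]; exact ⟨⟨hi1, hin⟩, rfl⟩)
    have : l = i := h.inj (by simp; omega) (by simp; omega) hl2
    exact ⟨j, by omega, by omega, hj1⟩
  · intro a ha; rw [h.size_eq a ha, hfil]
  · intro a ha c hc; exact h.hs_le a ha c hc (hkid a c hc)
  · intro a ha h0
    obtain ⟨h1, _, h3⟩ := h.hv_kid a ha h0
    exact ⟨h1, h3⟩

/-- The root has size `n + 1`: when `size_eq` is summed over all nodes, the other sizes cancel. -/
theorem Peeled.size_zero {n : ℕ} {par ord size hs hv : ℕ → ℕ} (h : Peeled n par ord size hs hv)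
    (hp : ∀ a, 1 ≤ a → a ≤ n → par a ≤ n) : size 0 = n + 1 := by
  have h1 : ∑ a ∈ range (n + 1), size a = ∑ a ∈ range (n + 1), 1 +
      ∑ a ∈ range (n + 1), ∑ c ∈ kids n par a, size c := by
    rw [← sum_add_distrib]
    exact sum_congr rfl fun a ha => h.size_eq a (by simp at ha; omega)
  have h2 : ∑ a ∈ range (n + 1), ∑ c ∈ kids n par a, size c = ∑ c ∈ Icc 1 n, size c := by
    unfold kids
    exact sum_fiberwise_of_maps_to (g := par) (fun c hc => by
      simp at hc ⊢
      have := hp c hc.1 hc.2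
      omega) size
  have h3 : ∑ a ∈ range (n + 1), size a = size 0 + ∑ c ∈ Icc 1 n, size c := by
    rw [range_eq_Ico, sum_eq_sum_Ico_succ_bot (by omega)]
    rfl
  rw [h2, h3] at h1
  simp at h1
  omega

/-! ### Preorder labels -/

/-- The situation after the nodes `ord i, …, ord n` have got their labels `pre`: a heavy child
follows its parent, the others are placed behind the subtree of the heavy child, the next of them
at `nxt`. -/
structure Place (n : ℕ) (par ord size hs hv : ℕ → ℕ) (i : ℕ) (pre nxt : ℕ → ℕ) : Prop where
  zero : pre 0 = 0
  heavy : ∀ a ∈ (Icc i n).image ord, 1 ≤ a → hv (par a) = a → pre a = pre (par a) + 1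
  light : ∀ a ∈ (Icc i n).image ord, 1 ≤ a → hv (par a) ≠ a →
    pre (par a) + 1 + hs (par a) ≤ pre a ∧ pre a + size a ≤ nxt (par a)
  disj : ∀ a ∈ (Icc i n).image ord, ∀ b ∈ (Icc i n).image ord, 1 ≤ a → 1 ≤ b → a ≠ b →
    par a = par b → pre a + size a ≤ pre b ∨ pre b + size b ≤ pre a
  nxt_eq : ∀ a ∈ (Icc i n).image ord,
    nxt a + ∑ c ∈ (kids n par a).filter fun c => c ≠ hv a ∧ c ∉ (Icc i n).image ord, size c =
      pre a + size a
  nxt_ge : ∀ a ∈ (Icc i n).image ord, pre a + 1 + hs a ≤ nxt a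

section
variable {n : ℕ} {par rk ord size hs hv : ℕ → ℕ} (h : Peeled n par ord size hs hv)
include h

/-- The intervals of the light children fit exactly behind that of the heavy child. -/
theorem Peeled.sum_light {a : ℕ} (ha : a ≤ n) :
    1 + hs a + ∑ c ∈ (kids n par a).filter fun c => c ≠ hv a, size c = size a := by
  rw [h.size_eq a ha, add_assoc]
  congr 1
  by_cases h0 : hv a = 0
  · rw [h.hv_zero a ha h0, zero_add]
    apply sum_congr _ fun _ _ => rfl
    apply filter_true_of_mem
    intro c hc
    have := mem_kids.1 hc
    omega
  · obtain ⟨h1, h2⟩ := h.hv_kid a ha h0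
    rw [h2, filter_ne', add_sum_erase _ _ h1]

/-- No child of `ord i` is among `ord i, …, ord n`. -/
theorem Peeled.no_kid {i a : ℕ} (hi : i ≤ n) (ha : ord i = a) {c : ℕ} (hc : c ∈ kids n par a) :
    c ∉ (Icc i n).image ord := by
  simp only [mem_image, mem_Icc, not_exists, not_and]
  rintro l ⟨h1, h2⟩ rfl
  obtain ⟨h3, h4⟩ := mem_kids.1 hc
  obtain ⟨j, hj, hlj, hj2⟩ := h.before l h2 h3.1
  have : j = i := h.inj (show j ∈ Set.Iic n by simpa using hj) (by simpa using hi)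
    (by rw [hj2, h4, ha])
  omega

theorem Place.init {pre nxt : ℕ → ℕ} (h0 : pre 0 = 0) (h1 : nxt 0 = 1 + hs 0) :
    Place n par ord size hs hv n pre nxt := by
  have hP : ∀ a, a ∈ (Icc n n).image ord → a = 0 := by
    intro a ha
    simp [h.last] at ha
    exact ha
  refine ⟨h0, ?_, ?_, ?_, ?_, ?_⟩
  · intro a ha h1; have := hP a ha; omega
  · intro a ha h1; have := hP a ha; omega
  · intro a ha b hb h1; have := hP a ha; omega
  · intro a ha
    obtain rfl := hP a ha
    rw [h1, h0, zero_add, ← h.sum_light (Nat.zero_le n)]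
    congr 1
    apply sum_congr _ fun _ _ => rfl
    apply filter_congr
    intro c hc
    have := h.no_kid le_rfl h.last hc
    rw [iff_comm, and_iff_left this]
  · intro a ha
    obtain rfl := hP a ha
    omega

theorem Peeled.ord_pos {i : ℕ} (hi : i < n) : 1 ≤ ord i := by
  by_contra h0
  have : i = n := h.inj (by simpa using hi.le) (by simp) (by rw [h.last]; omega)
  omega

theorem Peeled.par_mem {i a : ℕ} (ha : a ∈ (Icc i n).image ord) (h1 : 1 ≤ a) :
    par a ∈ (Icc (i + 1) n).image ord := by
  simp only [mem_image, mem_Icc] at ha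
  obtain ⟨l, hl, rfl⟩ := ha
  obtain ⟨j, hj, hlj, hj2⟩ := h.before l hl.2 h1
  simp only [mem_image, mem_Icc]
  exact ⟨j, by omega, hj2⟩

/-- The next node `a` gets its label `x`: next to its parent if it is the heavy child, otherwise
at the first free label of the parent. -/
theorem Place.step {i : ℕ} (hi : i < n) {pre nxt : ℕ → ℕ}
    (hp : Place n par ord size hs hv (i + 1) pre nxt) {nxt' : ℕ → ℕ} {x a p : ℕ} (ha : ord i = a)
    (hpa : par a = p)
    (hx : hv p = a ∧ x = pre p + 1 ∧ nxt' = nxt ∨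
      hv p ≠ a ∧ x = nxt p ∧ nxt' = Function.update nxt p (nxt p + size a)) :
    Place n par ord size hs hv i (Function.update pre a x)
      (Function.update nxt' a (x + 1 + hs a)) := by
  have ha1 : 1 ≤ a := ha ▸ h.ord_pos hi
  have han : a ≤ n := ha ▸ h.lt i hi.le
  have hP : (Icc i n).image ord = insert a ((Icc (i + 1) n).image ord) := by
    rw [← ha, ← image_insert]
    congr 1
    ext j; simp only [mem_Icc, mem_insert]; omega
  have hpP : p ∈ (Icc (i + 1) n).image ord := by
    rw [← hpa]
    exact h.par_mem (i := i) (by rw [hP]; simp) ha1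
  have hpn : p ≤ n := by
    simp only [mem_image, mem_Icc] at hpP
    obtain ⟨l, hl, rfl⟩ := hpP
    exact h.lt l hl.2
  have haP : a ∉ (Icc (i + 1) n).image ord := by
    simp only [mem_image, mem_Icc, not_exists, not_and]
    intro l hl e
    have : l = i := h.inj (by simpa using hl.2) (by simpa using hi.le) (e.trans ha.symm)
    omega
  have hap : a ≠ p := fun e => haP (e ▸ hpP)
  have hak : a ∈ kids n par p := mem_kids.2 ⟨⟨ha1, han⟩, hpa⟩
  have hne : ∀ b ∈ (Icc (i + 1) n).image ord, b ≠ a := fun b hb e => haP (e ▸ hb)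
  have hpar : ∀ b ∈ (Icc (i + 1) n).image ord, 1 ≤ b → par b ≠ a := by
    intro b hb h1 e
    have := h.par_mem hb h1
    rw [e] at this
    exact haP (image_mono _ (Icc_subset_Icc_left (by omega)) this)
  have hnn : ∀ b, nxt b ≤ nxt' b := by
    intro b
    rcases hx with ⟨_, _, rfl⟩ | ⟨_, _, rfl⟩
    · exact le_rfl
    · by_cases hb : b = p
      · subst hb; simp
      · simp [hb]
  have hge := hp.nxt_ge p hpP
  have hszp := hp.nxt_eq p hpP
  refine ⟨by simp [show 0 ≠ a by omega, hp.zero], ?_, ?_, ?_, ?_, ?_⟩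
  · intro b hb h1 hbv
    rw [hP, mem_insert] at hb
    rcases hb with rfl | hb
    · simp only [hpa, Function.update_self, Function.update_of_ne hap.symm] at hbv ⊢
      rcases hx with ⟨_, e, _⟩ | ⟨h1, _⟩
      · exact e
      · exact absurd hbv h1
    · rw [Function.update_of_ne (hne b hb), Function.update_of_ne (hpar b hb h1)]
      exact hp.heavy b hb h1 hbv
  · intro b hb h1 hbv
    rw [hP, mem_insert] at hb
    rcases hb with rfl | hb
    · simp only [hpa, Function.update_self, Function.update_of_ne hap.symm] at hbv ⊢
      rcases hx with ⟨e, _⟩ | ⟨_, rfl, rfl⟩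
      · exact absurd e hbv
      · simp; exact hge
    · rw [Function.update_of_ne (hne b hb), Function.update_of_ne (hpar b hb h1),
        Function.update_of_ne (hpar b hb h1)]
      have := hp.light b hb h1 hbv
      have := hnn (par b)
      omega
  · have main : ∀ b ∈ (Icc (i + 1) n).image ord, 1 ≤ b → par a = par b →
        pre b + size b ≤ x ∨ x + size a ≤ pre b := by
      intro b hb h1 hab
      have hbp : par b = p := by rw [← hab, hpa]
      rcases hx with ⟨e, rfl, _⟩ | ⟨_, rfl, _⟩
      · right
        have hbl := hp.light b hb h1 (by rw [hbp, e]; exact (hne b hb).symm)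
        have := (h.hv_kid p hpn (by omega)).2
        rw [e] at this
        rw [hbp] at hbl
        omega
      · left
        by_cases hbv : hv (par b) = b
        · have h2 := hp.heavy b hb h1 hbv
          rw [hbp] at h2 hbv
          have := (h.hv_kid p hpn (by omega)).2
          rw [hbv] at this
          omega
        · have h2 := hp.light b hb h1 hbv
          rw [hbp] at h2
          omega
    intro b hb c hc hb1 hc1 hbc hpp
    rw [hP, mem_insert] at hb hc
    rcases hb with rfl | hb <;> rcases hc with rfl | hc
    · exact absurd rfl hbc
    · rw [Function.update_self, Function.update_of_ne (hne c hc)]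
      exact (main c hc hc1 hpp).symm
    · rw [Function.update_self, Function.update_of_ne (hne b hb)]
      exact main b hb hb1 hpp.symm
    · rw [Function.update_of_ne (hne b hb), Function.update_of_ne (hne c hc)]
      exact hp.disj b hb c hc hb1 hc1 hbc hpp
  · intro b hb
    rw [hP] at hb ⊢
    rw [mem_insert] at hb
    rcases hb with rfl | hb
    · rw [Function.update_self, Function.update_self, ← h.sum_light han]
      have : ((kids n par b).filter fun c => c ≠ hv b ∧ c ∉ insert b ((Icc (i + 1) n).image ord))
          = (kids n par b).filter fun c => c ≠ hv b := by
        apply filter_congr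
        intro c hc
        have := h.no_kid hi.le ha hc
        rw [hP] at this
        simp only [this, not_false_eq_true, and_true]
      rw [this]; omega
    · rw [Function.update_of_ne (hne b hb), Function.update_of_ne (hne b hb), ← hp.nxt_eq b hb]
      by_cases hbp : b = p
      · subst hbp
        rcases hx with ⟨e, _, rfl⟩ | ⟨e, _, rfl⟩
        · congr 1
          apply sum_congr _ fun _ _ => rfl
          apply filter_congr
          intro c _
          rw [e, mem_insert]; tauto
        · rw [Function.update_self, add_assoc]
          congr 1
          have : ((kids n par b).filter fun c => c ≠ hv b ∧ c ∉ (Icc (i + 1) n).image ord) =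
              insert a ((kids n par b).filter fun c => c ≠ hv b ∧
                c ∉ insert a ((Icc (i + 1) n).image ord)) := by
            ext c
            simp only [mem_filter, mem_insert]
            constructor
            · tauto
            · rintro (rfl | hc)
              · exact ⟨hak, e.symm, haP⟩
              · tauto
          rw [this, sum_insert]
          simp
      · have hb' : nxt' b = nxt b := by
          rcases hx with ⟨_, _, rfl⟩ | ⟨_, _, rfl⟩
          · rfl
          · simp [hbp]
        rw [hb']
        congr 1
        apply sum_congr _ fun _ _ => rfl
        apply filter_congr
        intro c hc
        have : c ≠ a := by
          rintro rfl
          exact hbp ((mem_kids.1 hc).2.symm.trans hpa)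
        rw [mem_insert]; tauto
  · intro b hb
    rw [hP, mem_insert] at hb
    rcases hb with rfl | hb
    · simp
    · rw [Function.update_of_ne (hne b hb), Function.update_of_ne (hne b hb)]
      have := hp.nxt_ge b hb
      have := hnn b
      omega

end

/-- The labels of the nodes, and the tree in terms of the labels: `pre` maps nodes to labels, `org`
labels to nodes. -/
structure Labels (n : ℕ) (par pre org pa sz : ℕ → ℕ) : Prop where
  tree : HTree n pa sz
  pre_le : ∀ a ≤ n, pre a ≤ n
  org_pre : ∀ a ≤ n, org (pre a) = a
  pre_zero : pre 0 = 0
  par_eq : ∀ a, 1 ≤ a → a ≤ n → pa (pre a) = pre (par a)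

/-- What is needed of a complete labelling: subtrees get nested or disjoint intervals. -/
structure Placed (n : ℕ) (par size hs hv pre : ℕ → ℕ) : Prop where
  zero : pre 0 = 0
  nested : ∀ a, 1 ≤ a → a ≤ n → pre (par a) < pre a ∧ pre a + size a ≤ pre (par a) + size (par a)
  heavy : ∀ a, 1 ≤ a → a ≤ n → hv (par a) = a → pre a = pre (par a) + 1
  disj : ∀ a b, 1 ≤ a → a ≤ n → 1 ≤ b → b ≤ n → a ≠ b →
    par a = par b → pre a + size a ≤ pre b ∨ pre b + size b ≤ pre a

/-- Each interval of a child is in that of the parent, because the first free label of the parent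
never exceeds the end of its interval. -/
theorem Place.finish {n : ℕ} {par ord size hs hv pre nxt : ℕ → ℕ}
    (h : Peeled n par ord size hs hv) (hp : Place n par ord size hs hv 0 pre nxt)
    (hpn : ∀ a, 1 ≤ a → a ≤ n → par a ≤ n) : Placed n par size hs hv pre := by
  have hm : ∀ a ≤ n, a ∈ (Icc 0 n).image ord := by
    intro a ha
    obtain ⟨i, hi, rfl⟩ := h.surj a ha
    exact mem_image_of_mem _ (by simpa using hi)
  refine ⟨hp.zero, ?_, fun a h1 h2 => hp.heavy a (hm a h2) h1,
    fun a b h1 h2 h3 h4 => hp.disj a (hm a h2) b (hm b h4) h1 h3⟩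
  intro a h1 h2
  have hpa := hpn a h1 h2
  have e1 := hp.nxt_eq _ (hm _ hpa)
  have e2 := hp.nxt_ge _ (hm _ hpa)
  by_cases hv' : hv (par a) = a
  · have := hp.heavy a (hm a h2) h1 hv'
    have := (h.hv_kid _ hpa (by omega)).2
    rw [hv'] at this
    omega
  · have := hp.light a (hm a h2) h1 hv'
    omega

section
variable {n : ℕ} {par rk ord size hs hv pre : ℕ → ℕ} (h : Peeled n par ord size hs hv)
  (hp : Placed n par size hs hv pre) (hpn : ∀ a, 1 ≤ a → a ≤ n → par a ≤ n)
  (hrk : ∀ a, 1 ≤ a → a ≤ n → rk (par a) < rk a)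

/-- The node `b` is an ancestor of `a`, or equal to it. -/
def Above (n : ℕ) (par : ℕ → ℕ) (b a : ℕ) : Prop :=
  Relation.ReflTransGen (fun u v => (1 ≤ v ∧ v ≤ n) ∧ par v = u) b a

include hrk hpn in
theorem Above.zero {a : ℕ} (ha : a ≤ n) : Above n par 0 a := by
  induction hm : rk a using Nat.strong_induction_on generalizing a with
  | _ m ih =>
    rcases Nat.eq_zero_or_pos a with rfl | h0
    · exact Relation.ReflTransGen.refl
    · exact (ih (rk (par a)) (hm ▸ hrk a h0 ha) (hpn a h0 ha) rfl).tail ⟨⟨h0, ha⟩, rfl⟩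

include hp in
theorem Above.le {a b : ℕ} (hab : Above n par b a) :
    pre b ≤ pre a ∧ pre a + size a ≤ pre b + size b := by
  induction hab with
  | refl => exact ⟨le_rfl, le_rfl⟩
  | tail _ h2 ih =>
    obtain ⟨h3, rfl⟩ := h2
    have := hp.nested _ h3.1 h3.2
    omega

theorem Above.cases_par {a b : ℕ} (hab : Above n par b a) : a = b ∨ (1 ≤ a ∧ a ≤ n) ∧ Above n par b (par a) := by
  rcases hab.cases_tail with h1 | ⟨c, h1, h2, rfl⟩
  · exact Or.inl h1
  · exact Or.inr ⟨h2, h1⟩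

include hp hpn hrk in
/-- Two subtrees are nested or have disjoint intervals of labels. -/
theorem laminar {a b : ℕ} (ha : a ≤ n) (hb : b ≤ n) :
    (pre a + size a ≤ pre b ∨ pre b + size b ≤ pre a) ∨ Above n par a b ∨ Above n par b a := by
  induction hm : rk a + rk b using Nat.strong_induction_on generalizing a b with
  | _ m ih =>
    rcases Nat.eq_zero_or_pos a with rfl | ha0
    · exact Or.inr (Or.inl (Above.zero hpn hrk hb))
    rcases Nat.eq_zero_or_pos b with rfl | hb0
    · exact Or.inr (Or.inr (Above.zero hpn hrk ha))
    by_cases hab : a = b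
    · subst hab; exact Or.inr (Or.inl Relation.ReflTransGen.refl)
    by_cases hpp : par a = par b
    · exact Or.inl (hp.disj a b ha0 ha hb0 hb hab hpp)
    have ra := hrk a ha0 ha
    have rb := hrk b hb0 hb
    have na := hp.nested a ha0 ha
    have nb := hp.nested b hb0 hb
    rcases ih (rk (par a) + rk b) (by omega) (hpn a ha0 ha) hb rfl with h1 | h1 | h1
    · left; omega
    · rcases ih (rk a + rk (par b)) (by omega) ha (hpn b hb0 hb) rfl with h2 | h2 | h2
      · left; omega
      · exact Or.inr (Or.inl (h2.tail ⟨⟨hb0, hb⟩, rfl⟩))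
      · rcases Above.cases_par h1 with h1 | h1
        · right; right; rw [h1]; exact Relation.ReflTransGen.single ⟨⟨ha0, ha⟩, rfl⟩
        · rcases Above.cases_par h2 with h2 | h2
          · right; left; rw [h2]; exact Relation.ReflTransGen.single ⟨⟨hb0, hb⟩, rfl⟩
          · have e1 := Above.le hp h1.2
            have e2 := Above.le hp h2.2
            rcases Above.cases_par h1.2 with h3 | h3
            · exact absurd h3.symm hpp
            · have := Above.le hp h3.2
              have := hp.nested _ h3.1.1 h3.1.2
              omega
    · exact Or.inr (Or.inr (h1.tail ⟨⟨ha0, ha⟩, rfl⟩))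

include h in
theorem Peeled.size_pos {a : ℕ} (ha : a ≤ n) : 1 ≤ size a := by rw [h.size_eq a ha]; omega

include h hp hpn hrk

/-- Labels are different: by `laminar`, nodes with equal labels are above each other, and the label
of a node is larger than that of a proper ancestor. -/
theorem pre_inj {a b : ℕ} (ha : a ≤ n) (hb : b ≤ n) (hab : pre a = pre b) : a = b := by
  have h1 := h.size_pos ha
  have h2 := h.size_pos hb
  rcases laminar hp hpn hrk ha hb with h3 | h3 | h3
  · omega
  · rcases Above.cases_par h3 with h4 | h4
    · exact h4.symm
    · have := Above.le hp h4.2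
      have := hp.nested _ h4.1.1 h4.1.2
      omega
  · rcases Above.cases_par h3 with h4 | h4
    · exact h4
    · have := Above.le hp h4.2
      have := hp.nested _ h4.1.1 h4.1.2
      omega

theorem pre_le {a : ℕ} (ha : a ≤ n) : pre a ≤ n := by
  have h1 := Above.le hp (Above.zero hpn hrk ha)
  have := h.size_pos ha
  have := h.size_zero hpn
  have := hp.zero
  omega

/-- The preorder properties, in terms of labels: light children have at most half the size of their
parent, because the heavy child is at least as large. -/
theorem Placed.labels {org pa sz : ℕ → ℕ} (ho : ∀ a ≤ n, org (pre a) = a)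
    (hs' : ∀ a ≤ n, sz (pre a) = size a)
    (hpa : ∀ a, 1 ≤ a → a ≤ n → pa (pre a) = pre (par a)) : Labels n par pre org pa sz := by
  have hz := h.size_zero hpn
  have hsurj : ∀ x ≤ n, ∃ a ≤ n, pre a = x := by
    have h1 : (range (n + 1)).image pre ⊆ range (n + 1) := by
      intro x hx
      simp only [mem_image, mem_range] at hx ⊢
      obtain ⟨a, ha, rfl⟩ := hx
      have := pre_le h hp hpn hrk (show a ≤ n by omega)
      omega
    have h2 : ((range (n + 1)).image pre).card = n + 1 := by
      rw [card_image_of_injOn, card_range]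
      intro a ha b hb hab
      simp at ha hb
      exact pre_inj h hp hpn hrk (by omega) (by omega) hab
    have h3 := eq_of_subset_of_card_le h1 (by rw [h2]; simp)
    intro x hx
    have : x ∈ (range (n + 1)).image pre := by rw [h3]; simp; omega
    simp only [mem_image, mem_range] at this
    obtain ⟨a, ha, e⟩ := this
    exact ⟨a, by omega, e⟩
  refine ⟨⟨?_, ?_, ?_, ?_, ?_⟩, fun a ha => pre_le h hp hpn hrk ha, ho, hp.zero, hpa⟩
  · rw [← hz, ← hs' 0 (by omega), hp.zero]
  · intro x hx
    obtain ⟨a, ha, rfl⟩ := hsurj x hx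
    rw [hs' a ha]; exact h.size_pos ha
  · intro x h1 hx
    obtain ⟨a, ha, rfl⟩ := hsurj x hx
    have ha1 : 1 ≤ a := by
      by_contra hn
      have : a = 0 := by omega
      subst this
      rw [hp.zero] at h1; omega
    rw [hpa a ha1 ha, hs' a ha, hs' _ (hpn a ha1 ha)]
    exact hp.nested a ha1 ha
  · intro p x hpl hlt hx
    have hend := Above.le hp (Above.zero hpn hrk (a := 0) (by omega))
    obtain ⟨b, hb, rfl⟩ := hsurj p hpl
    rw [hs' b hb] at hx
    have hb2 := Above.le hp (Above.zero hpn hrk hb)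
    have := hp.zero
    obtain ⟨a, ha, rfl⟩ := hsurj x (by omega)
    have hsa := h.size_pos ha
    have hsb := h.size_pos hb
    rcases laminar hp hpn hrk ha hb with h3 | h3 | h3
    · omega
    · have := Above.le hp h3; omega
    · rcases Above.cases_par h3 with rfl | h4
      · omega
      · rw [hpa a h4.1.1 ha]
        exact (Above.le hp h4.2).1
  · intro x h1 hx hne
    obtain ⟨a, ha, rfl⟩ := hsurj x hx
    have ha1 : 1 ≤ a := by
      by_contra hn
      have : a = 0 := by omega
      subst this
      rw [hp.zero] at h1; omega
    rw [hpa a ha1 ha] at hne ⊢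
    have hpl := hpn a ha1 ha
    rw [hs' a ha, hs' _ hpl]
    have hnv : hv (par a) ≠ a := fun e => hne (hp.heavy a ha1 ha e).symm
    have hak : a ∈ kids n par (par a) := mem_kids.2 ⟨⟨ha1, ha⟩, rfl⟩
    have h1 := h.hs_le _ hpl a hak
    rw [← h.sum_light hpl]
    have : size a ≤ ∑ c ∈ (kids n par (par a)).filter fun c => c ≠ hv (par a), size c :=
      single_le_sum (f := size) (fun _ _ => Nat.zero_le _) (by simp only [mem_filter]; exact ⟨hak, hnv.symm⟩)
    omega

end

/-! ### Computing the labels -/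

section
open E Cmd

/-- Variable `0` becomes `n`, array `10` the sizes of single nodes, array `9` the numbers of
children. -/
def countKids : Cmd :=
  .set 0 (i 0 (c 0)) ;; .put 10 (c 0) (c 1) ;; .set 1 (c 1) ;;
  forUp 1 (add (v 0) (c 1)) (.put 10 (v 1) (c 1) ;;
    .set 2 (i 0 (add (v 1) (c 1))) ;;
    .put 9 (v 2) (add (a 9 (v 2)) (c 1)))

/-- Put the leaves into the queue, array `13`; variable `3` is its length. -/
def fillQueue : Cmd :=
  .set 3 (c 0) ;; .set 1 (c 0) ;;
  forUp 1 (add (v 0) (c 1)) (.ite (eq (a 9 (v 1)) (c 0))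
    (.put 13 (v 3) (v 1) ;; .set 3 (add (v 3) (c 1))) .skip)

/-- Peel off leaves. Arrays `11`, `12` get the heavy child and its size. -/
def peelLoop : Cmd :=
  .set 1 (c 0) ;;
  forUp 1 (v 0)
    (.set 4 (a 13 (v 1)) ;; .set 2 (i 0 (add (v 4) (c 1))) ;;
    .put 10 (v 2) (add (a 10 (v 2)) (a 10 (v 4))) ;;
    .ite (lt (a 12 (v 2)) (a 10 (v 4)))
      (.put 12 (v 2) (a 10 (v 4)) ;; .put 11 (v 2) (v 4)) .skip ;;
    .put 9 (v 2) (sub (a 9 (v 2)) (c 1)) ;;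
    .ite (eq (a 9 (v 2)) (c 0)) (.put 13 (v 3) (v 2) ;; .set 3 (add (v 3) (c 1))) .skip)

end

/-- Parents of the nodes as given in the input. -/
def ParentInput (Γ : Env) (n : ℕ) (par : ℕ → ℕ) : Prop :=
  Γ.get 0 0 = n ∧
    ∀ a, 1 ≤ a → a ≤ n → Γ.get 0 (a + 1) = par a

theorem countKids_spec {Γ : Env} {n : ℕ} {par : ℕ → ℕ} (hin : ParentInput Γ n par)
    (hB : 2 * n + 10 ≤ Γ.B) (hp : ∀ a, 1 ≤ a → a ≤ n → par a ≤ n)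
    {σ : Mach} {k k₀ : ℕ} {Q : Mach → ℕ → Prop} (h9 : ∀ a, σ.arr 9 a = 0)
    (hk : 100 * (n + 1) + k₀ ≤ k)
    (hQ : ∀ τ l, Fr countKids σ τ → τ.reg 0 = n → (∀ a ≤ n, τ.arr 9 a = (kids n par a).card) →
      (∀ a ≤ n, τ.arr 10 a = 1) → k₀ ≤ l → Q τ l) : WP Γ countKids Q σ k := by
  refine WP_conseq (Q := fun τ l => τ.reg 0 = n ∧ (∀ a ≤ n, τ.arr 9 a = (kids n par a).card) ∧
      (∀ a ≤ n, τ.arr 10 a = 1) ∧ k₀ ≤ l) ?_ fun τ l hF h => hQ τ l hF h.1 h.2.1 h.2.2.1 h.2.2.2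
  simp only [countKids, WP, E.ev, E.ok, E.cost, hin.1]
  and_intros
  all_goals try first | omega | trivial
  refine WP_for 1 (n + 1) (fun i τ => (∀ a ≤ n, τ.arr 9 a = ((Ico 1 i).filter (par · = a)).card) ∧
      (∀ a < i, τ.arr 10 a = 1)) (fun _ => 50) k₀ (by simp) (by omega) (by omega) (by omega) ?_ ?_ ?_ ?_ ?_
  · refine ⟨by simp [h9], ?_⟩
    intro a ha
    have : a = 0 := by omega
    subst this; simp
  · simp [E.cost]; omega
  · intro τ hF
    have := hF.r 0 rfl
    simp [E.ev, E.ok] at this ⊢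
    omega
  · rintro j τ l h1 h2 hF hr ⟨i1, i2⟩ hl
    have hj := hin.2 j h1 (by omega)
    have hpj := hp j h1 (by omega)
    have hc := i1 _ hpj
    have hle : ((Ico 1 j).filter (par · = par j)).card ≤ n := by
      refine (card_filter_le _ _).trans ?_
      simp; omega
    simp [WP, E.ev, E.ok, E.cost, hr, hj]
    and_intros
    all_goals try omega
    · intro a ha
      rw [← insert_Ico_right_eq_Ico_add_one h1, filter_insert]
      by_cases hpa : par j = a
      · subst hpa
        rw [if_pos rfl, card_insert_of_notMem (by simp), Function.update_self, hc]
      · rw [if_neg hpa, Function.update_of_ne (fun e => hpa e.symm), i1 a ha]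
    · intro a ha
      rw [Function.update_apply]
      split_ifs
      · rfl
      · exact i2 a (by omega)
  · rintro τ l hF hr ⟨i1, i2⟩ hl
    refine ⟨by have := hF.r 0 rfl; simpa using this, ?_, ?_, hl⟩
    · intro a ha
      rw [i1 a ha]; rfl
    · intro a ha; exact i2 a (by omega)

/-- The initial situation of the peeling. -/
theorem fillQueue_spec {Γ : Env} {n : ℕ} {par : ℕ → ℕ}
    (hB : 2 * n + 10 ≤ Γ.B)
    {σ : Mach} {k k₀ : ℕ} {Q : Mach → ℕ → Prop} (h0 : σ.reg 0 = n)
    (h9 : ∀ a ≤ n, σ.arr 9 a = (kids n par a).card) (h10 : ∀ a ≤ n, σ.arr 10 a = 1)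
    (h11 : ∀ a, σ.arr 11 a = 0) (h12 : ∀ a, σ.arr 12 a = 0)
    (hk : 100 * (n + 1) + k₀ ≤ k)
    (hQ : ∀ τ l, Fr fillQueue σ τ → Peel n par 0 (τ.reg 3) (τ.arr 13) (τ.arr 9) (τ.arr 10)
      (τ.arr 12) (τ.arr 11) → k₀ ≤ l → Q τ l) : WP Γ fillQueue Q σ k := by
  refine WP_conseq (Q := fun τ l => Peel n par 0 (τ.reg 3) (τ.arr 13) (τ.arr 9) (τ.arr 10)
      (τ.arr 12) (τ.arr 11) ∧ k₀ ≤ l) ?_ fun τ l hF h => hQ τ l hF h.1 h.2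
  simp only [fillQueue, WP, E.ev, E.ok, E.cost]
  and_intros
  all_goals try first | omega | trivial
  refine WP_for 0 (n + 1) (fun i τ => τ.reg 3 ≤ i ∧ Set.InjOn (τ.arr 13) (Set.Iio (τ.reg 3)) ∧
      (∀ j < τ.reg 3, τ.arr 13 j < i ∧ σ.arr 9 (τ.arr 13 j) = 0) ∧
      ∀ a < i, σ.arr 9 a = 0 → ∃ j < τ.reg 3, τ.arr 13 j = a)
    (fun _ => 50) k₀ (by simp) (by omega) (by omega) (by omega) ?_ ?_ ?_ ?_ ?_
  · simp [Set.InjOn]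
  · simp [E.cost]; omega
  · intro τ hF
    have := hF.r 0 rfl
    simp [E.ev, E.ok] at this ⊢
    omega
  · rintro j τ l h1 h2 hF hr ⟨i1, i2, i3, i4⟩ hl
    have h9' := hF.a 9 rfl
    simp only [Mach.setr_arr] at h9'
    simp [WP, E.ev, E.ok, E.cost, hr, h9']
    and_intros
    all_goals try omega
    · intro hz
      and_intros
      all_goals try omega
      · intro x hx y hy hxy
        simp only [Set.mem_Iio] at hx hy
        simp only [Function.update_apply] at hxy
        split_ifs at hxy
        · omega
        · have := (i3 y (by omega)).1; omega
        · have := (i3 x (by omega)).1; omega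
        · exact i2 (by simp; omega) (by simp; omega) hxy
      · intro x hx
        rw [Function.update_apply]
        split_ifs
        · exact ⟨by omega, hz⟩
        · have := i3 x (by omega)
          exact ⟨by omega, this.2⟩
      · intro a ha hz'
        by_cases haj : a = j
        · exact ⟨τ.reg 3, by omega, by simp [haj]⟩
        · obtain ⟨x, hx, e⟩ := i4 a (by omega) hz'
          exact ⟨x, by omega, by rw [Function.update_of_ne (by omega), e]⟩
    · intro hz
      refine ⟨by omega, ⟨by omega, i2, fun x hx => ⟨by have := (i3 x hx).1; omega, (i3 x hx).2⟩, ?_⟩, by omega⟩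
      intro a ha hz'
      have : a ≠ j := fun e => hz (e ▸ hz')
      exact i4 a (by omega) hz'
  · rintro τ l hF hr ⟨i1, i2, i3, i4⟩ hl
    have e9 := hF.a 9 rfl
    have e10 := hF.a 10 rfl
    have e11 := hF.a 11 rfl
    have e12 := hF.a 12 rfl
    simp only [Mach.setr_arr] at e9 e10 e11 e12
    refine ⟨⟨by omega, i1, i2, fun i hi => by have := (i3 i hi).1; omega, ?_, ?_, ?_, ?_, ?_, ?_, ?_, ?_⟩, hl⟩
    · intro a ha hz
      exact i4 a (by omega) (e9 ▸ hz)
    · intro a ha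
      simp [e9, h9 a ha]
    · intro i hi c hc
      have := i3 i hi
      rw [h9 _ (by omega), card_eq_zero] at this
      rw [this.2] at hc
      simp at hc
    · intro a ha; simp [e10, h10 a ha]
    · intro a ha c _ hc; simp at hc
    · intro a ha hc; rw [e11, h11] at hc; exact absurd rfl hc
    · intro a ha _; rw [e12, h12]
    · rw [sum_congr rfl (g := fun _ => 1)]
      · simp
      · intro a ha
        simp at ha
        rw [e10, h10 a (by omega)]

/-- Children are taken before their parents, and sizes and heavy children are computed on the way.
-/
theorem peelLoop_spec {Γ : Env} {n : ℕ} {par rk : ℕ → ℕ} (hin : ParentInput Γ n par)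
    (hB : 2 * n + 10 ≤ Γ.B) (hp : ∀ a, 1 ≤ a → a ≤ n → par a ≤ n)
    (hrk : ∀ a, 1 ≤ a → a ≤ n → rk (par a) < rk a)
    {σ : Mach} {k k₀ : ℕ} {Q : Mach → ℕ → Prop} (h0 : σ.reg 0 = n)
    (hP : Peel n par 0 (σ.reg 3) (σ.arr 13) (σ.arr 9) (σ.arr 10) (σ.arr 12) (σ.arr 11))
    (hk : 300 * (n + 1) + k₀ ≤ k)
    (hQ : ∀ τ l, Fr peelLoop σ τ → Peeled n par (τ.arr 13) (τ.arr 10)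
      (τ.arr 12) (τ.arr 11) → k₀ ≤ l → Q τ l) : WP Γ peelLoop Q σ k := by
  refine WP_conseq (Q := fun τ l => Peeled n par (τ.arr 13) (τ.arr 10)
      (τ.arr 12) (τ.arr 11) ∧ k₀ ≤ l) ?_ fun τ l hF h => hQ τ l hF h.1 h.2
  simp only [peelLoop, WP, E.ev, E.ok, E.cost]
  and_intros
  all_goals try first | omega | trivial
  refine WP_for 0 n (fun i τ => Peel n par i (τ.reg 3) (τ.arr 13) (τ.arr 9) (τ.arr 10)
      (τ.arr 12) (τ.arr 11) ∧ ∀ j < i, 1 ≤ τ.arr 13 j)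
    (fun _ => 200) k₀ (by simp) (by omega) (by omega) (by omega) ?_ ?_ ?_ ?_ ?_
  · simpa using hP
  · simp [E.cost]; omega
  · intro τ hF
    have := hF.r 0 rfl
    simp [E.ev, E.ok] at this ⊢
    omega
  · rintro j τ l h1 h2 hF hr ⟨i1, i2⟩ hl
    obtain ⟨f1, f2⟩ := i1.front h2 hp hrk
    have hlt := i1.lt j f1
    obtain ⟨⟨g1, g2⟩, g3⟩ := i1.front_notMem f1 f2
    have hpn := hp _ f2 hlt
    have hsz := i1.size_le hlt hpn g3 g1 g2
    have hj := hin.2 _ f2 hlt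
    have hqt : τ.reg 3 ≤ n + 1 := i1.qt_le
    -- with the new size of the parent, its other fields are updated in one of four ways
    have hst := @Peel.step n par j _ _ _ _ _ _ i1 f1 f2 hp _ rfl
    have hpos : ∀ (o : ℕ → ℕ), (∀ x < τ.reg 3, o x = τ.arr 13 x) → ∀ x ≤ j, 1 ≤ o x := by
      intro o ho x hx
      rw [ho x (by omega)]
      by_cases hxj : x = j
      · subst hxj; exact f2
      · exact i2 x (by omega)
    simp [WP, E.ev, E.ok, E.cost, hr, hj, Function.update_of_ne g3]
    and_intros
    all_goals try omega
    · intro hh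
      and_intros
      all_goals try omega
      · intro hz
        and_intros
        all_goals try omega
        · exact hst (Or.inl ⟨hh, rfl, rfl⟩) (Or.inl ⟨by omega, rfl, rfl⟩)
        · exact hpos _ fun x hx => Function.update_of_ne (Nat.ne_of_lt hx) _ _
      · intro hz
        and_intros
        all_goals try omega
        · exact hst (Or.inl ⟨hh, rfl, rfl⟩) (Or.inr ⟨by omega, rfl, rfl⟩)
        · exact hpos _ fun x hx => rfl
    · intro hh
      and_intros
      all_goals try omega
      · intro hz
        and_intros
        all_goals try omega
        · exact hst (Or.inr ⟨hh, rfl, rfl⟩) (Or.inl ⟨by omega, rfl, rfl⟩)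
        · exact hpos _ fun x hx => Function.update_of_ne (Nat.ne_of_lt hx) _ _
      · intro hz
        and_intros
        all_goals try omega
        · exact hst (Or.inr ⟨hh, rfl, rfl⟩) (Or.inr ⟨by omega, rfl, rfl⟩)
        · exact hpos _ fun x hx => rfl
  · rintro τ l hF hr ⟨i1, i2⟩ hl
    exact ⟨i1.finish i2 hp hrk, hl⟩

section
open E Cmd

/-- Assign the labels, array `1`, in reverse order of the queue. Array `14` contains the next free
label for a light child. -/
def placeLoop : Cmd :=
  .put 14 (c 0) (add (a 12 (c 0)) (c 1)) ;; .set 1 (c 0) ;;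
  forUp 1 (v 0)
    (.set 4 (a 13 (sub (sub (v 0) (c 1)) (v 1))) ;; .set 2 (i 0 (add (v 4) (c 1))) ;;
    .ite (eq (a 11 (v 2)) (v 4))
      (.set 5 (add (a 1 (v 2)) (c 1)))
      (.set 5 (a 14 (v 2)) ;; .put 14 (v 2) (add (a 14 (v 2)) (a 10 (v 4)))) ;;
    .put 1 (v 4) (v 5) ;;
    .put 14 (v 4) (add (add (v 5) (c 1)) (a 12 (v 4))))

/-- Transfer node, parent and size to the labels. -/
def relabel : Cmd :=
  .set 1 (c 0) ;;
  forUp 1 (add (v 0) (c 1))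
    (.set 5 (a 1 (v 1)) ;; .put 2 (v 5) (v 1) ;; .put 4 (v 5) (a 10 (v 1)) ;;
    .put 3 (v 5) (a 1 (i 0 (add (v 1) (c 1)))))

/-- Computation of the labels from the parent array. -/
def labelCmd : Cmd := countKids ;; fillQueue ;; peelLoop ;; placeLoop ;; relabel

end

/-- All intervals assigned so far are within `n + 1`. -/
theorem Place.bound {n : ℕ} {par rk ord size hs hv pre nxt : ℕ → ℕ} {i : ℕ}
    (h : Peeled n par ord size hs hv) (hp : Place n par ord size hs hv i pre nxt)
    (hpn : ∀ a, 1 ≤ a → a ≤ n → par a ≤ n) (hrk : ∀ a, 1 ≤ a → a ≤ n → rk (par a) < rk a)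
    {a : ℕ} (ha : a ∈ (Icc i n).image ord) : pre a + size a ≤ n + 1 := by
  induction hm : rk a using Nat.strong_induction_on generalizing a with
  | _ m ih =>
    rcases Nat.eq_zero_or_pos a with rfl | h0
    · rw [hp.zero, h.size_zero hpn]; omega
    have hpP := image_mono ord (Icc_subset_Icc_left (show i ≤ i + 1 by omega)) (h.par_mem ha h0)
    have han : a ≤ n := by
      simp only [mem_image, mem_Icc] at ha
      obtain ⟨l, hl, rfl⟩ := ha
      exact h.lt l hl.2
    have h1 := ih (rk (par a)) (hm ▸ hrk a h0 han) hpP rfl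
    have e1 := hp.nxt_eq _ hpP
    have e2 := hp.nxt_ge _ hpP
    by_cases hv' : hv (par a) = a
    · have := hp.heavy a ha h0 hv'
      have := (h.hv_kid _ (hpn a h0 han) (by omega)).2
      rw [hv'] at this
      omega
    · have := hp.light a ha h0 hv'
      omega

/-- The queue is traversed backwards, so that parents get their labels before their children. -/
theorem placeLoop_spec {Γ : Env} {n : ℕ} {par rk : ℕ → ℕ} (hin : ParentInput Γ n par)
    (hB : 2 * n + 10 ≤ Γ.B) (hp : ∀ a, 1 ≤ a → a ≤ n → par a ≤ n)
    (hrk : ∀ a, 1 ≤ a → a ≤ n → rk (par a) < rk a)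
    {σ : Mach} {k k₀ : ℕ} {Q : Mach → ℕ → Prop} (h0 : σ.reg 0 = n)
    (hP : Peeled n par (σ.arr 13) (σ.arr 10) (σ.arr 12) (σ.arr 11)) (h1 : ∀ a, σ.arr 1 a = 0)
    (hk : 300 * (n + 1) + k₀ ≤ k)
    (hQ : ∀ τ l, Fr placeLoop σ τ → Placed n par (σ.arr 10) (σ.arr 12) (σ.arr 11) (τ.arr 1) →
      k₀ ≤ l → Q τ l) : WP Γ placeLoop Q σ k := by
  refine WP_conseq (Q := fun τ l => Placed n par (σ.arr 10) (σ.arr 12) (σ.arr 11) (τ.arr 1) ∧ k₀ ≤ l)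
    ?_ fun τ l hF h => hQ τ l hF h.1 h.2
  have hsum := hP.sum_light (Nat.zero_le n)
  have hsz := hP.size_zero hp
  simp only [placeLoop, WP, E.ev, E.ok, E.cost]
  and_intros
  all_goals try first | omega | trivial
  refine WP_for 0 n (fun i τ => Place n par (σ.arr 13) (σ.arr 10) (σ.arr 12) (σ.arr 11) (n - i)
      (τ.arr 1) (τ.arr 14))
    (fun _ => 200) k₀ (by simp) (by omega) (by omega) (by omega) ?_ ?_ ?_ ?_ ?_
  · exact Place.init hP (by simp [h1]) (by simp; omega)
  · simp [E.cost]; omega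
  · intro τ hF
    have := hF.r 0 rfl
    simp [E.ev, E.ok] at this ⊢
    omega
  · rintro j τ l h1 h2 hF hr hi hl
    have e0 := hF.r 0 rfl
    have e10 := hF.a 10 rfl
    have e11 := hF.a 11 rfl
    have e12 := hF.a 12 rfl
    have e13 := hF.a 13 rfl
    simp at e0 e10 e11 e12 e13
    obtain ⟨q, hq⟩ : ∃ q, q = n - 1 - j := ⟨_, rfl⟩
    rw [show n - j = q + 1 by omega] at hi
    have hqn : q < n := by omega
    have ha1 := hP.ord_pos hqn
    have han := hP.lt q hqn.le
    have hpn := hp _ ha1 han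
    have hap : par (σ.arr 13 q) ≠ σ.arr 13 q := fun e => by
      have := hrk _ ha1 han
      rw [e] at this; omega
    have hj := hin.2 _ ha1 han
    have hpm := hP.par_mem (i := q) (mem_image_of_mem _ (by simp; omega)) ha1
    have b1 := hi.bound hP hp hrk hpm
    have b2 := hi.nxt_eq _ hpm
    have b3 := hi.nxt_ge _ hpm
    have hst := @Place.step n par _ _ _ _ hP q hqn _ _ hi
    have hbd := fun x nx hx => Place.bound (a := σ.arr 13 q) hP (hst (nxt' := nx) (x := x) rfl rfl hx)
      hp hrk (mem_image_of_mem _ (by simp; omega))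
    simp only [Function.update_self] at hbd
    have hsa := hP.sum_light han
    simp [WP, E.ev, E.ok, E.cost, hr, e0, e10, e11, e12, e13, h0, ← hq, hj, show n - (j + 1) = q by omega]
    and_intros
    all_goals try omega
    · intro hv'
      have := hbd _ _ (Or.inl ⟨hv', rfl, rfl⟩)
      and_intros
      all_goals try omega
      exact hst rfl rfl (Or.inl ⟨hv', rfl, rfl⟩)
    · intro hv'
      have := hbd _ _ (Or.inr ⟨hv', rfl, rfl⟩)
      and_intros
      all_goals try omega
      exact hst rfl rfl (Or.inr ⟨hv', rfl, rfl⟩)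
  · rintro τ l hF hr hi hl
    simp only [Nat.sub_self] at hi
    exact ⟨hi.finish hP hp, hl⟩

theorem relabel_spec {Γ : Env} {n : ℕ} {par rk : ℕ → ℕ} (hin : ParentInput Γ n par)
    (hB : 2 * n + 10 ≤ Γ.B) (hp : ∀ a, 1 ≤ a → a ≤ n → par a ≤ n)
    (hrk : ∀ a, 1 ≤ a → a ≤ n → rk (par a) < rk a)
    {σ : Mach} {k k₀ : ℕ} {Q : Mach → ℕ → Prop} (h0 : σ.reg 0 = n)
    (hP : Peeled n par (σ.arr 13) (σ.arr 10) (σ.arr 12) (σ.arr 11))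
    (hL : Placed n par (σ.arr 10) (σ.arr 12) (σ.arr 11) (σ.arr 1))
    (hk : 300 * (n + 1) + k₀ ≤ k)
    (hQ : ∀ τ l, Fr relabel σ τ → Labels n par (τ.arr 1) (τ.arr 2) (τ.arr 3) (τ.arr 4) →
      k₀ ≤ l → Q τ l) : WP Γ relabel Q σ k := by
  refine WP_conseq (Q := fun τ l => Labels n par (τ.arr 1) (τ.arr 2) (τ.arr 3) (τ.arr 4) ∧ k₀ ≤ l)
    ?_ fun τ l hF h => hQ τ l hF h.1 h.2
  simp only [relabel, WP, E.ev, E.ok, E.cost]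
  and_intros
  all_goals try first | omega | trivial
  refine WP_for 0 (n + 1) (fun i τ => ∀ a < i, τ.arr 2 (σ.arr 1 a) = a ∧
      τ.arr 4 (σ.arr 1 a) = σ.arr 10 a ∧ (1 ≤ a → τ.arr 3 (σ.arr 1 a) = σ.arr 1 (par a)))
    (fun _ => 200) k₀ (by simp) (by omega) (by omega) (by omega) ?_ ?_ ?_ ?_ ?_
  · simp
  · simp [E.cost]; omega
  · intro τ hF
    have := hF.r 0 rfl
    simp [E.ev, E.ok] at this ⊢
    omega
  · rintro j τ l h1 h2 hF hr hi hl
    have e1 := hF.a 1 rfl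
    have e10 := hF.a 10 rfl
    simp at e1 e10
    simp [WP, E.ev, E.ok, E.cost, hr, e1, e10]
    and_intros
    all_goals try omega
    intro a ha
    by_cases haj : a = j
    · subst haj
      simp only [Function.update_self, true_and]
      intro h1
      rw [hin.2 a h1 (by omega)]
    · have : σ.arr 1 a ≠ σ.arr 1 j := fun e => haj (pre_inj hP hL hp hrk (by omega) (by omega) e)
      simp only [Function.update_of_ne this]
      exact hi a (by omega)
  · rintro τ l hF hr hi hl
    have e1 := hF.a 1 rfl
    simp at e1
    refine ⟨?_, hl⟩
    rw [e1]
    exact Placed.labels hP hL hp hrk (fun a ha => (hi a (by omega)).1)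
      (fun a ha => (hi a (by omega)).2.1) (fun a h1 ha => (hi a (by omega)).2.2 h1)

theorem labelCmd_spec {Γ : Env} {n : ℕ} {par rk : ℕ → ℕ} (hin : ParentInput Γ n par)
    (hB : 2 * n + 10 ≤ Γ.B) (hp : ∀ a, 1 ≤ a → a ≤ n → par a ≤ n)
    (hrk : ∀ a, 1 ≤ a → a ≤ n → rk (par a) < rk a)
    {σ : Mach} {k k₀ : ℕ} {Q : Mach → ℕ → Prop} (hz : ∀ j a, σ.arr j a = 0)
    (hk : 1500 * (n + 1) + k₀ ≤ k)
    (hQ : ∀ τ l, Fr labelCmd σ τ → τ.reg 0 = n →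
      Labels n par (τ.arr 1) (τ.arr 2) (τ.arr 3) (τ.arr 4) → k₀ ≤ l → Q τ l) :
    WP Γ labelCmd Q σ k := by
  refine WP_conseq (Q := fun τ l => τ.reg 0 = n ∧
    Labels n par (τ.arr 1) (τ.arr 2) (τ.arr 3) (τ.arr 4) ∧ k₀ ≤ l)
    ?_ fun τ l hF h => hQ τ l hF h.1 h.2.1 h.2.2
  simp only [labelCmd, WP]
  refine countKids_spec (k₀ := 1200 * (n + 1) + k₀) hin hB hp (hz 9) (by omega) ?_
  intro τ l hF h0 h9 h10 hl
  have z1 := hF.a 1 rfl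
  have z11 := hF.a 11 rfl
  have z12 := hF.a 12 rfl
  refine fillQueue_spec (k₀ := 1000 * (n + 1) + k₀) hB h0 h9 h10 (by simp [z11, hz]) (by simp [z12, hz])
    (by omega) ?_
  intro τ2 l2 hF2 hP hl2
  have z1' := hF2.a 1 rfl
  have h0' := hF2.r 0 rfl
  refine peelLoop_spec (k₀ := 700 * (n + 1) + k₀) hin hB hp hrk (by omega) hP (by omega) ?_
  intro τ3 l3 hF3 hP3 hl3
  have z1'' := hF3.a 1 rfl
  have h0'' := hF3.r 0 rfl
  refine placeLoop_spec (k₀ := 300 * (n + 1) + k₀) hin hB hp hrk (by omega) hP3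
    (by rw [z1'', z1', z1]; exact hz 1) (by omega) ?_
  intro τ4 l4 hF4 hL hl4
  have h0''' := hF4.r 0 rfl
  rw [← hF4.a 10 rfl, ← hF4.a 11 rfl, ← hF4.a 12 rfl] at hL
  refine relabel_spec (k₀ := k₀) hin hB hp hrk (by omega)
    (by rw [hF4.a 13 rfl, hF4.a 10 rfl, hF4.a 12 rfl, hF4.a 11 rfl]; exact hP3) hL (by omega) ?_
  intro τ5 l5 hF5 hL5 hl5
  exact ⟨by rw [hF5.r 0 rfl]; omega, hL5, hl5⟩

/-! ### Stable sorting by counting -/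

/-- The place of item `j` of `m` items when they are sorted stably by their keys. -/
def slot (key : ℕ → ℕ) (m j : ℕ) : ℕ :=
  ((range m).filter (key · < key j)).card + ((range j).filter (key · = key j)).card

theorem card_lt_succ (key : ℕ → ℕ) (m k : ℕ) : ((range m).filter (key · < k + 1)).card =
    ((range m).filter (key · < k)).card + ((range m).filter (key · = k)).card := by
  rw [← card_union_of_disjoint]
  · congr 1
    ext i
    simp only [mem_filter, mem_union]
    grind
  · rw [disjoint_left]
    intro i
    simp only [mem_filter]
    omega

theorem card_lt_mono (key : ℕ → ℕ) (m : ℕ) {k l : ℕ} (h : k ≤ l) :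
    ((range m).filter (key · < k)).card ≤ ((range m).filter (key · < l)).card := by
  apply card_le_card
  intro i hi
  simp only [mem_filter] at hi ⊢
  exact ⟨hi.1, by omega⟩

theorem slot_lt_succ {key : ℕ → ℕ} {m j : ℕ} (hj : j < m) :
    slot key m j < ((range m).filter (key · < key j + 1)).card := by
  rw [card_lt_succ, slot]
  apply Nat.add_lt_add_left
  apply card_lt_card
  refine ⟨?_, fun h => ?_⟩
  · intro i
    simp only [mem_filter, mem_range]
    omega
  · have := h (show j ∈ _ by simpa using hj)
    simp at this

theorem slot_lt {key : ℕ → ℕ} {m j : ℕ} (hj : j < m) : slot key m j < m := by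
  refine (slot_lt_succ hj).trans_le ?_
  exact (card_filter_le _ _).trans (by simp)

theorem slot_lt_slot {key : ℕ → ℕ} {m i j : ℕ} (hi : i < m) (h : key i < key j) :
    slot key m i < slot key m j :=
  (slot_lt_succ hi).trans_le ((card_lt_mono key m (show key i + 1 ≤ key j by omega)).trans
    (Nat.le_add_right _ _))

theorem slot_lt_slot_of_eq {key : ℕ → ℕ} {m i j : ℕ} (h : key i = key j) (hij : i < j) :
    slot key m i < slot key m j := by
  rw [slot, slot, h]
  apply Nat.add_lt_add_left
  apply card_lt_card
  refine ⟨?_, fun h' => ?_⟩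
  · intro x
    simp only [mem_filter, mem_range]
    omega
  · have := h' (show i ∈ _ by simp [hij, h])
    simp at this

theorem slot_inj {key : ℕ → ℕ} {m i j : ℕ} (hi : i < m) (hj : j < m)
    (h : slot key m i = slot key m j) : i = j := by
  rcases lt_trichotomy (key i) (key j) with h1 | h1 | h1
  · have := slot_lt_slot hi h1; omega
  · rcases lt_trichotomy i j with h2 | h2 | h2
    · have := slot_lt_slot_of_eq (m := m) h1 h2; omega
    · exact h2
    · have := slot_lt_slot_of_eq (m := m) h1.symm h2; omega
  · have := slot_lt_slot hj h1; omega

/-- The slots are a permutation of the positions. -/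
theorem slot_surj {key : ℕ → ℕ} {m t : ℕ} (ht : t < m) : ∃ j < m, slot key m j = t := by
  have h1 : (range m).image (slot key m) ⊆ range m := by
    intro x hx
    simp only [mem_image, mem_range] at hx ⊢
    obtain ⟨j, hj, rfl⟩ := hx
    exact slot_lt hj
  have h2 := eq_of_subset_of_card_le h1 (by
    rw [card_image_of_injOn]
    intro i hi j hj h
    simp at hi hj
    exact slot_inj hi hj h)
  have : t ∈ (range m).image (slot key m) := by rw [h2]; simpa using ht
  simpa using this

/-- The arrays `d₁`, `d₂` contain the items of `s₁`, `s₂` stably sorted, and `off` the numbers of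
smaller keys. -/
structure SortedBy (n m : ℕ) (key s₁ s₂ d₁ d₂ off : ℕ → ℕ) : Prop where
  off_eq : ∀ k ≤ n + 1, off k = ((range m).filter (key · < k)).card
  fst : ∀ j < m, d₁ (slot key m j) = s₁ j
  snd : ∀ j < m, d₂ (slot key m j) = s₂ j

section
open E Cmd

/-- Counting sort of the items `0, …, m - 1` (`m` in variable `6`) with keys at most `n`. -/
def countSort (key s₁ s₂ d₁ d₂ off pos : ℕ) : Cmd :=
  .set 1 (c 0) ;;
  forUp 1 (v 6) (.set 2 (add (a key (v 1)) (c 1)) ;; .put off (v 2) (add (a off (v 2)) (c 1))) ;;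
  .set 1 (c 0) ;;
  forUp 1 (add (v 0) (c 1)) (.set 2 (add (v 1) (c 1)) ;; .put pos (v 1) (a off (v 1)) ;;
    .put off (v 2) (add (a off (v 2)) (a off (v 1)))) ;;
  .set 1 (c 0) ;;
  forUp 1 (v 6) (.set 2 (a key (v 1)) ;; .set 3 (a pos (v 2)) ;; .put d₁ (v 3) (a s₁ (v 1)) ;;
    .put d₂ (v 3) (a s₂ (v 1)) ;; .put pos (v 2) (add (v 3) (c 1)))

end

theorem countSort_spec {Γ : Env} {n m key s₁ s₂ d₁ d₂ off pos : ℕ} {σ : Mach}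
    (hB : 2 * n + m + 10 ≤ Γ.B)
    (h0 : σ.reg 0 = n) (h6 : σ.reg 6 = m) (hkey : ∀ j < m, σ.arr key j ≤ n)
    (hoff : ∀ k, σ.arr off k = 0)
    (h32 : key < 32 ∧ s₁ < 32 ∧ s₂ < 32 ∧ d₁ < 32 ∧ d₂ < 32 ∧ off < 32 ∧ pos < 32)
    (n1 : key ≠ d₁ ∧ key ≠ d₂ ∧ key ≠ off ∧ key ≠ pos) (n2 : s₁ ≠ d₁ ∧ s₁ ≠ d₂ ∧ s₁ ≠ off ∧ s₁ ≠ pos)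
    (n3 : s₂ ≠ d₁ ∧ s₂ ≠ d₂ ∧ s₂ ≠ off ∧ s₂ ≠ pos)
    (n4 : d₁ ≠ d₂ ∧ d₁ ≠ off ∧ d₁ ≠ pos) (n5 : d₂ ≠ off ∧ d₂ ≠ pos) (n6 : off ≠ pos)
    {k k₀ : ℕ} {Q : Mach → ℕ → Prop} (hk : 300 * (n + m + 1) + k₀ ≤ k)
    (hQ : ∀ τ l, Fr (countSort key s₁ s₂ d₁ d₂ off pos) σ τ →
      SortedBy n m (σ.arr key) (σ.arr s₁) (σ.arr s₂) (τ.arr d₁) (τ.arr d₂) (τ.arr off) →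
      k₀ ≤ l → Q τ l) :
    WP Γ (countSort key s₁ s₂ d₁ d₂ off pos) Q σ k := by
  obtain ⟨a1, a2, a3, a4, a5, a6, a7⟩ := h32
  obtain ⟨b1, b2, b3, b4⟩ := n1
  obtain ⟨c1, c2, c3, c4⟩ := n2
  obtain ⟨d1, d2, d3, d4⟩ := n3
  obtain ⟨e1, e2, e3⟩ := n4
  obtain ⟨f1, f2⟩ := n5
  refine WP_conseq (Q := fun τ l => SortedBy n m (σ.arr key) (σ.arr s₁) (σ.arr s₂) (τ.arr d₁)
    (τ.arr d₂) (τ.arr off) ∧ k₀ ≤ l) ?_ fun τ l hF h => hQ τ l hF h.1 h.2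
  have hle : ∀ {k}, ((range m).filter (σ.arr key · < k)).card ≤ m :=
    (card_filter_le _ _).trans (by simp)
  have hle' : ∀ {j k}, ((range j).filter (σ.arr key · = k)).card ≤ j :=
    (card_filter_le _ _).trans (by simp)
  have hsucc : ∀ j k, ((range (j + 1)).filter (σ.arr key · = k)).card =
      ((range j).filter (σ.arr key · = k)).card + if σ.arr key j = k then 1 else 0 := by
    intro j k
    rw [range_add_one, filter_insert]
    split_ifs
    · rw [card_insert_of_notMem (by simp)]
    · rfl
  simp only [countSort, WP, E.ev, E.ok, E.cost]
  and_intros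
  all_goals try first | omega | trivial
  refine WP_for 0 m (fun i τ => τ.arr off 0 = 0 ∧ ∀ x, τ.arr off (x + 1) =
    ((range i).filter (σ.arr key · = x)).card) (fun _ => 70) (200 * (n + m + 1) + k₀) (by simp)
    (by omega) (by omega) (by omega) ?_ ?_ ?_ ?_ ?_
  · simp [hoff]
  · simp [E.cost]; omega
  · intro τ hF
    have := hF.r 6 rfl
    simp [E.ev, E.ok] at this ⊢
    omega
  · rintro j τ l h1 h2 hF hr ⟨i1, i2⟩ hl
    have ek := hF.a key (by simp [Cmd.moda, forUp, b3])
    simp at ek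
    have := hkey j h2
    have := @hle' j (σ.arr key j)
    simp [WP, E.ev, E.ok, E.cost, hr, ek, a1, a6, i2]
    and_intros
    all_goals try omega
    · intro x
      rw [hsucc, Function.update_apply]
      by_cases hx : x = σ.arr key j
      · subst hx; simp
      · rw [if_neg (by omega), i2, if_neg (Ne.symm hx)]; rfl
  rintro τ l hF hr ⟨i1, i2⟩ hl
  have q0 := hF.r 0 rfl
  have q6 := hF.r 6 rfl
  have qk := hF.a key (by simp [Cmd.moda, forUp, b3])
  have qs1 := hF.a s₁ (by simp [Cmd.moda, forUp, c3])
  have qs2 := hF.a s₂ (by simp [Cmd.moda, forUp, d3])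
  simp at q0 q6 qk qs1 qs2
  and_intros
  all_goals try first | omega | trivial
  refine WP_for 0 (n + 1) (fun i τ => (∀ x ≤ i, τ.arr off x = ((range m).filter (σ.arr key · < x)).card) ∧
    (∀ x, i ≤ x → τ.arr off (x + 1) = ((range m).filter (σ.arr key · = x)).card) ∧
    ∀ x < i, τ.arr pos x = ((range m).filter (σ.arr key · < x)).card)
    (fun _ => 70) (100 * (n + m + 1) + k₀) (by simp) (by omega) (by omega) (by omega) ?_ ?_ ?_ ?_ ?_
  · simp [i1, i2]
  · simp [E.cost]; omega
  · intro τ hF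
    have := hF.r 0 rfl
    simp [E.ev, E.ok] at this ⊢
    omega
  · rintro j τ l h1 h2 hF hr ⟨i1, i2, i3⟩ hl
    have := @hle (j + 1)
    have g1 := i1 j le_rfl
    have g2 := i2 j le_rfl
    have g3 := card_lt_succ (σ.arr key) m j
    simp [WP, E.ev, E.ok, E.cost, hr, a6, a7, n6]
    and_intros
    all_goals try omega
    · intro x hx
      by_cases hxj : x = j + 1
      · subst hxj; rw [Function.update_self]; omega
      · rw [Function.update_of_ne hxj]; exact i1 x (by omega)
    · intro x hx
      rw [Function.update_of_ne (by omega)]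
      exact i2 x (by omega)
    · intro x hx
      rw [if_neg n6.symm, Function.update_apply]
      split_ifs with hxj
      · rw [hxj, g1]
      · exact i3 x (by omega)
  rintro τ' l' hF' hr' ⟨i1', -, i3⟩ hl'
  have p0 := hF'.r 0 rfl
  have p6 := hF'.r 6 rfl
  have pk := hF'.a key (by simp [Cmd.moda, forUp, b3, b4])
  have ps1 := hF'.a s₁ (by simp [Cmd.moda, forUp, c3, c4])
  have ps2 := hF'.a s₂ (by simp [Cmd.moda, forUp, d3, d4])
  simp at p0 p6 pk ps1 ps2
  and_intros
  all_goals try first | omega | trivial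
  refine WP_for 0 m (fun i τ => (∀ x ≤ n, τ.arr pos x = ((range m).filter (σ.arr key · < x)).card +
      ((range i).filter (σ.arr key · = x)).card) ∧
      ∀ j < i, τ.arr d₁ (slot (σ.arr key) m j) = σ.arr s₁ j ∧
        τ.arr d₂ (slot (σ.arr key) m j) = σ.arr s₂ j)
    (fun _ => 80) k₀ (by simp) (by omega) (by omega) (by omega) ?_ ?_ ?_ ?_ ?_
  · simp only [Mach.setr_arr, range_zero, filter_empty, card_empty, add_zero]
    exact ⟨fun x hx => i3 x (by omega), by simp⟩
  · simp [E.cost]; omega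
  · intro τ hF
    have := hF.r 6 rfl
    simp [E.ev, E.ok] at this ⊢
    omega
  · rintro j τ l h1 h2 hF hr ⟨i1, i2⟩ hl
    have ek := hF.a key (by simp [Cmd.moda, forUp, b1, b2, b4])
    have es1 := hF.a s₁ (by simp [Cmd.moda, forUp, c1, c2, c4])
    have es2 := hF.a s₂ (by simp [Cmd.moda, forUp, d1, d2, d4])
    simp only [Mach.setr_arr, pk, ps1, ps2, qk, qs1, qs2] at ek es1 es2
    have hkj := hkey j h2
    have hs : τ.arr pos (σ.arr key j) = slot (σ.arr key) m j := i1 _ hkj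
    have hsl := slot_lt (key := σ.arr key) h2
    simp [WP, E.ev, E.ok, E.cost, hr, ek, es1, es2, a1, a2, a3, a4, a5, a7, e1, e3, f2, hs,
      e3.symm, f2.symm, e1.symm, d1]
    and_intros
    all_goals try omega
    · intro x hx
      rw [hsucc, Function.update_apply]
      by_cases hxk : x = σ.arr key j
      · subst hxk; simp [slot]; omega
      · rw [if_neg hxk, i1 x hx, if_neg (Ne.symm hxk)]; rfl
    · intro x hx
      by_cases hxj : x = j
      · subst hxj; simp
      · have : slot (σ.arr key) m x ≠ slot (σ.arr key) m j :=
          fun e => hxj (slot_inj (by omega) h2 e)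
        rw [Function.update_of_ne this, Function.update_of_ne this]
        exact i2 x (by omega)
  · rintro τ2 l2 hF2 hr2 ⟨i1, i2⟩ hl2
    have eo := hF2.a off (by simp [Cmd.moda, forUp, e2.symm, f1.symm, n6])
    simp at eo
    refine ⟨⟨?_, fun j hj => (i2 j hj).1, fun j hj => (i2 j hj).2⟩, hl2⟩
    intro x hx
    rw [eo]
    exact i1' x hx

/-! ### The lists of upper neighbours -/

/-- The upper neighbours of `w` are `up t` for `t` from `off w` up to `off (w + 1)`, exclusively,
in increasing order; `A u w` means that `u < w` are adjacent. -/
structure UpLists (n m : ℕ) (A : ℕ → ℕ → Prop) (off up : ℕ → ℕ) : Prop where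
  zero : off 0 = 0
  mono : ∀ w ≤ n, off w ≤ off (w + 1)
  last : off (n + 1) = m
  mem : ∀ w ≤ n, ∀ t, off w ≤ t → t < off (w + 1) → A (up t) w
  incr : ∀ w ≤ n, ∀ t t', off w ≤ t → t < t' → t' < off (w + 1) → up t < up t'
  surj : ∀ u w, w ≤ n → A u w → ∃ t, off w ≤ t ∧ t < off (w + 1) ∧ up t = u

/-- Sorting stably by the smaller endpoint and then by the larger one yields, for each label, its
upper neighbours in increasing order. The offsets of the first sorting count the edges by the
smaller endpoint. -/
theorem SortedBy.upLists {n m : ℕ} {lo hi lo₂ hi₂ up hi₃ dn off : ℕ → ℕ}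
    (h1 : SortedBy n m lo lo hi lo₂ hi₂ dn) (h2 : SortedBy n m hi₂ lo₂ hi₂ up hi₃ off)
    (hhi : ∀ j < m, hi j ≤ n)
    (hinj : ∀ i < m, ∀ j < m, lo i = lo j → hi i = hi j → i = j) :
    UpLists n m (fun u w => ∃ j < m, lo j = u ∧ hi j = w) off up ∧
      ∀ k ≤ n + 1, dn k = ((range m).filter (up · < k)).card := by
  have hb : ∀ i < m, ∀ w ≤ n, off w ≤ slot hi₂ m i → slot hi₂ m i < off (w + 1) → hi₂ i = w := by
    intro i him w hw ha hb
    rw [h2.off_eq w (by omega)] at ha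
    rw [h2.off_eq (w + 1) (by omega)] at hb
    have e1 := slot_lt_succ (key := hi₂) him
    by_contra hne
    rcases Nat.lt_or_gt_of_ne hne with h | h
    · have := card_lt_mono hi₂ m (show hi₂ i + 1 ≤ w by omega); omega
    · have := card_lt_mono hi₂ m (show w + 1 ≤ hi₂ i by omega)
      have : ((range m).filter (hi₂ · < hi₂ i)).card ≤ slot hi₂ m i := Nat.le_add_right _ _
      omega
  have hoffm : ∀ k ≤ n + 1, off k ≤ m := fun k hk => by
    rw [h2.off_eq k hk]; exact (card_filter_le _ _).trans (by simp)
  refine ⟨⟨?_, ?_, ?_, ?_, ?_, ?_⟩, ?_⟩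
  · rw [h2.off_eq 0 (by omega)]; simp
  · intro w hw
    rw [h2.off_eq w (by omega), h2.off_eq (w + 1) (by omega)]
    exact card_lt_mono _ _ (by omega)
  · rw [h2.off_eq (n + 1) le_rfl, filter_true_of_mem]
    · simp
    · intro i hi'
      simp only [mem_range] at hi'
      obtain ⟨j, hj, rfl⟩ := slot_surj (key := lo) hi'
      rw [h1.snd j hj]
      have := hhi j hj; omega
  · intro w hw t ht ht'
    obtain ⟨i, hi', rfl⟩ := slot_surj (key := hi₂) (lt_of_lt_of_le ht' (hoffm (w + 1) (by omega)))
    have e := hb i hi' w hw ht ht'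
    obtain ⟨j, hj, rfl⟩ := slot_surj (key := lo) hi'
    exact ⟨j, hj, by rw [h2.fst _ hi', h1.fst j hj], by rw [← e, h1.snd j hj]⟩
  · intro w hw t t' ht htt ht'
    have htm := lt_of_lt_of_le ht' (hoffm (w + 1) (by omega))
    obtain ⟨i', hi', rfl⟩ := slot_surj (key := hi₂) htm
    obtain ⟨i, hi, rfl⟩ := slot_surj (key := hi₂) (htt.trans htm)
    have e := hb i hi w hw ht (by omega)
    have e' := hb i' hi' w hw (by omega) ht'
    have hii : i < i' := by
      by_contra hge
      rcases Nat.lt_or_eq_of_le (Nat.le_of_not_lt hge) with h | h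
      · have := slot_lt_slot_of_eq (m := m) (e'.trans e.symm) h; omega
      · subst h; omega
    rw [h2.fst _ hi', h2.fst _ hi]
    obtain ⟨j', hj', rfl⟩ := slot_surj (key := lo) hi'
    obtain ⟨j, hj, rfl⟩ := slot_surj (key := lo) hi
    rw [h1.fst j hj, h1.fst j' hj']
    rw [h1.snd j hj] at e
    rw [h1.snd j' hj'] at e'
    rcases lt_trichotomy (lo j) (lo j') with h | h | h
    · exact h
    · have := hinj j hj j' hj' h (e.trans e'.symm)
      subst this; omega
    · have := slot_lt_slot hj' h; omega
  · rintro u w hw ⟨j, hj, rfl, rfl⟩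
    have hs := slot_lt (key := lo) hj
    have es := h1.snd j hj
    refine ⟨slot hi₂ m (slot lo m j), ?_, ?_, ?_⟩
    · rw [h2.off_eq _ (by omega), ← es]; exact Nat.le_add_right _ _
    · rw [h2.off_eq _ (by omega), ← es]; exact slot_lt_succ hs
    · rw [h2.fst _ hs, h1.fst j hj]
  · intro k hk
    rw [h1.off_eq k hk]
    apply card_bij (fun j _ => slot hi₂ m (slot lo m j))
    · intro j hj
      simp only [mem_filter, mem_range] at hj ⊢
      have hs := slot_lt (key := lo) hj.1
      exact ⟨slot_lt hs, by rw [h2.fst _ hs, h1.fst j hj.1]; exact hj.2⟩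
    · intro i hi j hj hij
      simp only [mem_filter, mem_range] at hi hj
      exact slot_inj hi.1 hj.1 (slot_inj (slot_lt hi.1) (slot_lt hj.1) hij)
    · intro t ht
      simp only [mem_filter, mem_range] at ht
      obtain ⟨i, hi, rfl⟩ := slot_surj (key := hi₂) ht.1
      obtain ⟨j, hj, rfl⟩ := slot_surj (key := lo) hi
      rw [h2.fst _ hi, h1.fst j hj] at ht
      exact ⟨j, by simpa using ⟨hj, ht.2⟩, rfl⟩

/-! ### Ranks in the lists of upper neighbours -/

/-- The number of upper neighbours of `w` below `z`; that is, the position in the list of `w` of its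
first upper neighbour that is at least `z`. -/
def rank (off up : ℕ → ℕ) (w z : ℕ) : ℕ := ((Ico (off w) (off (w + 1))).filter (up · < z)).card

theorem rank_le (off up : ℕ → ℕ) (w z : ℕ) : rank off up w z ≤ off (w + 1) - off w :=
  (card_filter_le _ _).trans (by simp)

theorem rank_mono (off up : ℕ → ℕ) (w : ℕ) {y z : ℕ} (h : y ≤ z) :
    rank off up w y ≤ rank off up w z := by
  apply card_le_card
  intro t
  simp only [mem_filter]
  exact fun ht => ⟨ht.1, by omega⟩

namespace UpLists
variable {n m : ℕ} {A : ℕ → ℕ → Prop} {off up : ℕ → ℕ} (h : UpLists n m A off up)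
include h

theorem up_lt_iff {w z t : ℕ} (hw : w ≤ n) (h1 : off w ≤ t) (h2 : t < off (w + 1)) :
    up t < z ↔ t < off w + rank off up w z := by
  constructor
  · intro ht
    have : Ico (off w) (t + 1) ⊆ (Ico (off w) (off (w + 1))).filter (up · < z) := by
      intro s hs
      simp only [mem_Ico, mem_filter] at hs ⊢
      refine ⟨by omega, ?_⟩
      rcases Nat.lt_or_ge s t with hst | hst
      · exact (h.incr w hw s t hs.1 hst h2).trans ht
      · obtain rfl : s = t := by omega
        exact ht
    have := card_le_card this
    simp only [Nat.card_Ico] at this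
    unfold rank
    omega
  · intro ht
    by_contra hn
    have : (Ico (off w) (off (w + 1))).filter (up · < z) ⊆ Ico (off w) t := by
      intro s hs
      simp only [mem_Ico, mem_filter] at hs ⊢
      refine ⟨hs.1.1, ?_⟩
      by_contra hst
      rcases Nat.lt_or_ge t s with hts | hts
      · have := h.incr w hw t s h1 hts hs.1.2
        omega
      · obtain rfl : s = t := by omega
        omega
    have := card_le_card this
    simp only [Nat.card_Ico] at this
    unfold rank at ht
    omega

theorem off_mono {v w : ℕ} (hvw : v ≤ w) (hw : w ≤ n + 1) : off v ≤ off w := by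
  induction w, hvw using Nat.le_induction with
  | base => rfl
  | succ k hk ih => exact (ih (by omega)).trans (h.mono k (by omega))

theorem off_le {w : ℕ} (hw : w ≤ n + 1) : off w ≤ m := by
  rw [← h.last]; exact h.off_mono hw le_rfl

theorem exists_block {t : ℕ} (ht : t < m) : ∃ w ≤ n, off w ≤ t ∧ t < off (w + 1) := by
  by_contra hn
  have : ∀ w ≤ n + 1, off w ≤ t := by
    intro w
    induction w with
    | zero => intro _; rw [h.zero]; omega
    | succ w ih =>
      intro hw
      by_contra h1
      exact hn ⟨w, by omega, ih (by omega), by omega⟩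
  have := this (n + 1) le_rfl
  rw [h.last] at this
  omega

/-- The numbers of upper neighbours of `a, …, b - 1` are found from the offsets. -/
theorem sum_deg {a b : ℕ} (hab : a ≤ b) (hb : b ≤ n + 1) :
    ∑ w ∈ Ico a b, (off (w + 1) - off w) = off b - off a := by
  induction b, hab using Nat.le_induction with
  | base => simp
  | succ k hk ih =>
    rw [sum_Ico_succ_top hk, ih (by omega)]
    have := h.mono k (by omega)
    have := h.off_mono hk (by omega)
    omega

theorem card_filter_Ico (P : ℕ → Prop) [DecidablePred P] {a b : ℕ} (hab : a ≤ b) (hb : b ≤ n + 1) :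
    ((Ico (off a) (off b)).filter P).card =
      ∑ w ∈ Ico a b, ((Ico (off w) (off (w + 1))).filter P).card := by
  induction b, hab using Nat.le_induction with
  | base => simp
  | succ k hk ih =>
    rw [sum_Ico_succ_top hk, ← ih (by omega), ← card_union_of_disjoint, ← filter_union,
      Ico_union_Ico_eq_Ico (h.off_mono hk (by omega)) (h.mono k (by omega))]
    apply disjoint_filter_filter
    rw [disjoint_left]
    simp only [mem_Ico]
    omega

/-- The sum of the ranks at `p` over the subtree of `p`, which tells whether a new snapshot is
needed without looking at the ranks: of the edges whose larger endpoint is in the subtree, those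
are subtracted whose smaller endpoint is there as well, and these are all edges whose smaller
endpoint is in the subtree. -/
theorem sum_rank {pa sz : ℕ → ℕ} (hT : HTree n pa sz)
    (hA : ∀ u w, A u w → u < w ∧ w < u + sz u) {dn : ℕ → ℕ}
    (hdn : ∀ k ≤ n + 1, dn k = ((range m).filter (up · < k)).card) {p : ℕ} (hp : p ≤ n) :
    ∑ w ∈ Ico p (p + sz p), rank off up w p =
      (off (p + sz p) - off p) - (dn (p + sz p) - dn p) := by
  have he := hT.le_end hp
  have h1 := h.card_filter_Ico (up · < p) (Nat.le_add_right p (sz p)) he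
  change _ = ∑ w ∈ Ico p (p + sz p), rank off up w p at h1
  rw [← h1]
  have h2 : ((Ico (off p) (off (p + sz p))).filter (up · < p)).card +
      ((Ico (off p) (off (p + sz p))).filter (¬ up · < p)).card = off (p + sz p) - off p := by
    rw [card_filter_add_card_filter_not]; simp
  -- an edge whose smaller endpoint is in the subtree has the larger one there, too
  have h3 : (range m).filter (up · < p + sz p) = (range m).filter (up · < p) ∪
      (Ico (off p) (off (p + sz p))).filter (¬ up · < p) := by
    ext t
    simp only [mem_filter, mem_union, mem_range, mem_Ico]
    constructor
    · rintro ⟨ht, hu⟩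
      by_cases hup : up t < p
      · exact Or.inl ⟨ht, hup⟩
      right
      obtain ⟨w, hw, g1, g2⟩ := h.exists_block ht
      have := hA _ _ (h.mem w hw t g1 g2)
      have hn := hT.nest hp (by omega : p ≤ up t) hu
      refine ⟨⟨?_, ?_⟩, hup⟩
      · exact (h.off_mono (by omega) (by omega)).trans g1
      · exact g2.trans_le (h.off_mono (by omega) he)
    · rintro (⟨ht, hu⟩ | ⟨⟨g1, g2⟩, hu⟩)
      · exact ⟨ht, by omega⟩
      · have ht : t < m := g2.trans_le (h.off_le he)
        refine ⟨ht, ?_⟩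
        obtain ⟨w, hw, k1, k2⟩ := h.exists_block ht
        have := hA _ _ (h.mem w hw t k1 k2)
        have : w < p + sz p := by
          by_contra hn
          have := h.off_mono (by omega : p + sz p ≤ w) (by omega)
          omega
        omega
  have h4 : ((range m).filter (up · < p + sz p)).card = ((range m).filter (up · < p)).card +
      ((Ico (off p) (off (p + sz p))).filter (¬ up · < p)).card := by
    rw [h3, card_union_of_disjoint]
    rw [disjoint_left]
    simp only [mem_filter]
    tauto
  rw [hdn _ he, hdn p (by omega)]
  omega

end UpLists

/-! ### Snapshots of ranks -/

/-- The entry for `w` of the snapshot that `x` uses. Snapshots are stored as prefix sums. -/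
def snap (adr S : ℕ → ℕ) (x w : ℕ) : ℕ := S (adr x + w + 1) - S (adr x + w)

theorem sum_snap {adr S : ℕ → ℕ} {x a b : ℕ} (hab : a ≤ b)
    (hm : ∀ w, a ≤ w → w < b → S (adr x + w) ≤ S (adr x + w + 1)) :
    S (adr x + a) ≤ S (adr x + b) ∧
      ∑ w ∈ Ico a b, snap adr S x w = S (adr x + b) - S (adr x + a) := by
  induction b, hab using Nat.le_induction with
  | base => simp
  | succ k hk ih =>
    obtain ⟨i1, i2⟩ := ih fun w h1 h2 => hm w h1 (by omega)
    have := hm k hk (by omega)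
    rw [sum_Ico_succ_top hk, i2, snap]
    constructor
    · rw [← add_assoc]; omega
    · rw [show adr x + (k + 1) = adr x + k + 1 by omega]; omega

/-- Every vertex has a snapshot that contains, for the vertices of its subtree, lower bounds on
the ranks which are exact up to a total error of the size of the subtree. -/
structure Snaps (n : ℕ) (sz off up adr S : ℕ → ℕ) (lim len : ℕ) : Prop where
  adr_le : ∀ x < lim, adr x + x + sz x < len
  mono : ∀ x < lim, ∀ w, x ≤ w → w < x + sz x → S (adr x + w) ≤ S (adr x + w + 1)
  le : ∀ x < lim, ∀ w, x ≤ w → w < x + sz x → snap adr S x w ≤ rank off up w x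
  sum : ∀ x < lim, ∑ w ∈ Ico x (x + sz x), (rank off up w x - snap adr S x w) ≤ sz x

/-- The situation when the vertices below `p` have their snapshots, in the cells below `len`: the
most recent snapshot that covers `w` has the entry `cur w` for `w`. Since a new snapshot of a
subtree raises the sum of these entries by at least the size of the subtree, the number of cells is
bounded in terms of that sum (`len_le`). -/
structure Snapping (n m : ℕ) (sz off up adr S : ℕ → ℕ) (p len : ℕ) (cur : ℕ → ℕ) : Prop
    extends Snaps n sz off up adr S p len where
  val_le : ∀ i, S i ≤ m
  fresh : ∀ i, len ≤ i → S i = 0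
  len_ge : n + 2 ≤ len
  len_le : len ≤ n + 2 + 2 * ∑ w ∈ range (n + 1), cur w
  cur_le : ∀ w ≤ n, cur w ≤ off (w + 1) - off w
  cur_eq : ∀ x < p, ∀ w, p ≤ w → w < x + sz x → (∀ y < p, w < y + sz y → y ≤ x) →
    snap adr S x w = cur w

namespace Snapping
variable {n m : ℕ} {A : ℕ → ℕ → Prop} {pa sz off up adr S cur : ℕ → ℕ} {p len : ℕ}

theorem sum_cur (hU : UpLists n m A off up) (h : Snapping n m sz off up adr S p len cur) :
    ∑ w ∈ range (n + 1), cur w ≤ m := by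
  have := hU.sum_deg (Nat.zero_le (n + 1)) le_rfl
  rw [hU.last, hU.zero] at this
  calc ∑ w ∈ range (n + 1), cur w ≤ ∑ w ∈ Ico 0 (n + 1), (off (w + 1) - off w) := by
        rw [range_eq_Ico]
        exact sum_le_sum fun w hw => h.cur_le w (by simp at hw; omega)
    _ = m := by omega

/-- For the vertices in the subtree of `p`, the snapshot of the parent is the most recent one. -/
theorem snap_par (hT : HTree n pa sz) (h : Snapping n m sz off up adr S p len cur) (hp1 : 1 ≤ p)
    (hpn : p ≤ n) {w : ℕ} (h1 : p ≤ w) (h2 : w < p + sz p) :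
    snap adr S (pa p) w = cur w ∧ cur w ≤ rank off up w p := by
  have hq := hT.par p hp1 hpn
  have he := hT.le_end hpn
  have e : snap adr S (pa p) w = cur w := by
    refine h.cur_eq (pa p) hq.1 w h1 (by omega) fun y hy hwy => ?_
    exact hT.inner y p (by omega) hy (by omega)
  refine ⟨e, ?_⟩
  rw [← e]
  exact (h.le (pa p) hq.1 w (by omega) (by omega)).trans (rank_mono _ _ _ hq.1.le)

/-- `p` uses the snapshot of its parent. -/
theorem share (hT : HTree n pa sz) (h : Snapping n m sz off up adr S p len cur) (hp1 : 1 ≤ p)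
    (hpn : p ≤ n) (hacc : ∑ w ∈ Ico p (p + sz p), (rank off up w p - cur w) < sz p) :
    Snapping n m sz off up (Function.update adr p (adr (pa p))) S (p + 1) len cur := by
  have hq := hT.par p hp1 hpn
  have e1 : ∀ w, snap (Function.update adr p (adr (pa p))) S p w = snap adr S (pa p) w := by
    intro w; simp [snap]
  have e2 : ∀ x w, x ≠ p → snap (Function.update adr p (adr (pa p))) S x w = snap adr S x w := by
    intro x w hx; simp [snap, hx]
  refine { h with adr_le := ?_, mono := ?_, le := ?_, sum := ?_, cur_eq := ?_ }
  · intro x hx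
    by_cases hxp : x = p
    · subst hxp; simp; have := h.adr_le (pa x) hq.1; omega
    · simp [hxp]; exact h.adr_le x (by omega)
  · intro x hx w h1 h2
    by_cases hxp : x = p
    · subst hxp; simp; exact h.mono (pa x) hq.1 w (by omega) (by omega)
    · simp [hxp]; exact h.mono x (by omega) w h1 h2
  · intro x hx w h1 h2
    by_cases hxp : x = p
    · subst hxp
      have := h.snap_par hT hp1 hpn h1 h2
      rw [e1]; omega
    · rw [e2 _ _ hxp]; exact h.le x (by omega) w h1 h2
  · intro x hx
    by_cases hxp : x = p
    · subst hxp
      refine le_trans (le_of_eq (sum_congr rfl fun w hw => ?_)) hacc.le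
      simp only [mem_Ico] at hw
      rw [e1, (h.snap_par hT hp1 hpn hw.1 hw.2).1]
    · refine le_trans (le_of_eq (sum_congr rfl fun w hw => ?_)) (h.sum x (by omega))
      rw [e2 _ _ hxp]
  · intro x hx w h1 h2 h3
    by_cases hxp : x = p
    · subst hxp
      rw [e1, (h.snap_par hT hp1 hpn (by omega) h2).1]
    · rw [e2 _ _ hxp]
      exact h.cur_eq x (by omega) w (by omega) h2 fun y hy hw => h3 y (by omega) hw

/-- `p` gets a new snapshot; every entry that increases pays for it. -/
theorem fresh_snap (hT : HTree n pa sz) (hU : UpLists n m A off up)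
    (h : Snapping n m sz off up adr S p len cur) (hp1 : 1 ≤ p)
    (hpn : p ≤ n) (hacc : sz p ≤ ∑ w ∈ Ico p (p + sz p), (rank off up w p - cur w)) {S' : ℕ → ℕ}
    (hS : ∀ i, i ≤ len ∨ len + sz p < i → S' i = S i)
    (hS' : ∀ w, p ≤ w → w < p + sz p → S' (len - p + w + 1) = S' (len - p + w) + rank off up w p) :
    ∃ cur', Snapping n m sz off up (Function.update adr p (len - p)) S' (p + 1)
        (len + sz p + 1) cur' ∧
      ∑ w ∈ range (n + 1), cur' w =
        ∑ w ∈ range (n + 1), cur w + ∑ w ∈ Ico p (p + sz p), (rank off up w p - cur w) := by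
  have hq := hT.par p hp1 hpn
  have hen := hT.le_end hpn
  have hlen := h.len_ge
  have e1 : ∀ w, p ≤ w → w < p + sz p →
      snap (Function.update adr p (len - p)) S' p w = rank off up w p := by
    intro w h1 h2; simp [snap, hS' w h1 h2]
  have e3 : ∀ x < p, ∀ w, x ≤ w → w ≤ x + sz x → S' (adr x + w) = S (adr x + w) := by
    intro x hx w h1 h2
    have := h.adr_le x hx
    exact hS _ (by omega)
  have e2 : ∀ x < p, ∀ w, x ≤ w → w < x + sz x →
      snap (Function.update adr p (len - p)) S' x w = snap adr S x w := by
    intro x hx w h1 h2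
    have := e3 x hx (w + 1) (by omega) (by omega)
    rw [← add_assoc] at this
    simp [snap, hx.ne, this, e3 x hx w h1 (by omega)]
  -- the most recent entries are now the ranks at `p` within the subtree, and unchanged outside
  have hsum : ∑ w ∈ range (n + 1), (if p ≤ w ∧ w < p + sz p then rank off up w p else cur w) =
        ∑ w ∈ range (n + 1), cur w + ∑ w ∈ Ico p (p + sz p), (rank off up w p - cur w) := by
    have : Ico p (p + sz p) = (range (n + 1)).filter fun w => p ≤ w ∧ w < p + sz p := by
      ext w; simp; omega
    rw [this, sum_filter, ← sum_add_distrib]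
    refine sum_congr rfl fun w hw => ?_
    split_ifs with hw'
    · have := (h.snap_par hT hp1 hpn hw'.1 hw'.2).2
      omega
    · rfl
  have hval : ∀ w, p ≤ w → w ≤ p + sz p → S' (len - p + w) = ∑ v ∈ Ico p w, rank off up v p := by
    intro w h1
    induction w, h1 using Nat.le_induction with
    | base =>
      intro _
      rw [show len - p + p = len by omega, hS _ (Or.inl le_rfl), h.fresh _ le_rfl]; simp
    | succ k hk ih =>
      intro h2
      rw [sum_Ico_succ_top hk, ← ih (by omega), ← hS' k hk (by omega)]; rfl
  refine ⟨_, ?_, hsum⟩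
  constructor
  · constructor
    · intro x hx
      by_cases hxp : x = p
      · subst hxp; simp; omega
      · simp [hxp]; have := h.adr_le x (by omega); omega
    · intro x hx w h1 h2
      by_cases hxp : x = p
      · subst hxp; simp [hS' w h1 h2]
      · have g1 := e3 x (by omega) w h1 (by omega)
        have g2 := e3 x (by omega) (w + 1) (by omega) (by omega)
        rw [← add_assoc] at g2
        simp [hxp, g1, g2]
        exact h.mono x (by omega) w h1 h2
    · intro x hx w h1 h2
      by_cases hxp : x = p
      · subst hxp; rw [e1 w h1 h2]
      · rw [e2 x (by omega) w h1 h2]; exact h.le x (by omega) w h1 h2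
    · intro x hx
      by_cases hxp : x = p
      · subst hxp
        rw [sum_eq_zero]
        · omega
        · intro w hw
          simp only [mem_Ico] at hw
          rw [e1 w hw.1 hw.2, Nat.sub_self]
      · refine le_trans (le_of_eq (sum_congr rfl fun w hw => ?_)) (h.sum x (by omega))
        simp only [mem_Ico] at hw
        rw [e2 x (by omega) w hw.1 hw.2]
  · intro i
    by_cases hi : i ≤ len ∨ len + sz p < i
    · rw [hS i hi]; exact h.val_le i
    · have := hval (i - (len - p)) (by omega) (by omega)
      rw [show len - p + (i - (len - p)) = i by omega] at this
      rw [this]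
      calc _ ≤ ∑ v ∈ Ico p (i - (len - p)), (off (v + 1) - off v) :=
            sum_le_sum fun v _ => rank_le _ _ _ _
        _ = off (i - (len - p)) - off p := hU.sum_deg (by omega) (by omega)
        _ ≤ m := by have := hU.off_le (show i - (len - p) ≤ n + 1 by omega); omega
  · intro i hi
    rw [hS i (by omega)]; exact h.fresh i (by omega)
  · omega
  · have := h.len_le
    have := hT.pos p hpn
    rw [hsum]; omega
  · intro w hw
    split_ifs
    · exact rank_le _ _ _ _
    · exact h.cur_le w hw
  · intro x hx w h1 h2 h3
    by_cases hxp : x = p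
    · subst hxp
      rw [e1 w (by omega) h2, if_pos ⟨by omega, h2⟩]
    · have : ¬ (p ≤ w ∧ w < p + sz p) := by
        rintro ⟨h4, h5⟩
        have := h3 p (by omega) h5
        omega
      rw [if_neg this, e2 x (by omega) w (by omega) h2]
      exact h.cur_eq x (by omega) w (by omega) h2 fun y hy hw => h3 y (by omega) hw

end Snapping

section
open E Cmd

/-- Compute one entry of a new snapshot from the entry of the snapshot of the parent. -/
def snapCell : Cmd :=
  .set 3 (add (a 5 (v 2)) (sub (a 8 (add (add (v 11) (v 2)) (c 1))) (a 8 (add (v 11) (v 2))))) ;;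
  scanUp 3 (a 5 (add (v 2) (c 1))) (lt (a 6 (v 3)) (v 1)) ;;
  .put 8 (add (v 8) (c 1)) (add (a 8 (v 8)) (sub (v 3) (a 5 (v 2)))) ;;
  .set 8 (add (v 8) (c 1))

/-- Decide for each vertex whether to share the snapshot of its parent. The vertices are taken in
preorder, and variable `8` is the number of cells of array `8` in use. -/
def snapLoop : Cmd :=
  .set 8 (add (v 0) (c 2)) ;; .set 1 (c 1) ;;
  forUp 1 (add (v 0) (c 1)) (
    .set 9 (a 3 (v 1)) ;;
    .set 10 (add (v 1) (a 4 (v 1))) ;;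
    .set 11 (a 7 (v 9)) ;;
    .set 12 (sub (sub (sub (a 5 (v 10)) (a 5 (v 1))) (sub (a 17 (v 10)) (a 17 (v 1))))
      (sub (a 8 (add (v 11) (v 10))) (a 8 (add (v 11) (v 1))))) ;;
    .ite (lt (v 12) (a 4 (v 1)))
      (.put 7 (v 1) (v 11))
      (.put 7 (v 1) (sub (v 8) (v 1)) ;; .set 2 (v 1) ;; forUp 2 (v 10) snapCell ;;
        .set 8 (add (v 8) (c 1))))

end

/-- A new snapshot for the vertices from `p` below `e`, from the snapshot at address `b`: the time
is proportional to the number of vertices and the total increase of the entries. -/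
theorem snapCells_spec {Γ : Env} {n m p e b len : ℕ} {A : ℕ → ℕ → Prop} {off up S : ℕ → ℕ}
    (hU : UpLists n m A off up) (hpe : p ≤ e) (hen : e ≤ n + 1) (hbe : b + e < len)
    (hB : 2 * len + 4 * n + 2 * m + 100 ≤ Γ.B)
    (hS0 : S len = 0)
    (hm : ∀ w, p ≤ w → w < e → S (b + w + 1) - S (b + w) ≤ rank off up w p)
    {σ : Mach} {k k₀ : ℕ} {Q : Mach → ℕ → Prop}
    (a5 : σ.arr 5 = off) (a6 : σ.arr 6 = up) (a8 : σ.arr 8 = S) (r1 : σ.reg 1 = p)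
    (r2 : σ.reg 2 = p) (r8 : σ.reg 8 = len) (r10 : σ.reg 10 = e) (r11 : σ.reg 11 = b)
    (hk : 180 * (e - p) + 32 * ∑ w ∈ Ico p e, (rank off up w p - (S (b + w + 1) - S (b + w))) +
      10 + k₀ ≤ k)
    (hQ : ∀ τ l, Fr (forUp 2 (.v 10) snapCell) σ τ → τ.reg 8 = len + (e - p) →
      (∀ i, i ≤ len ∨ len + (e - p) < i → τ.arr 8 i = S i) →
      (∀ w, p ≤ w → w < e → τ.arr 8 (len - p + w + 1) = τ.arr 8 (len - p + w) + rank off up w p) →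
      k₀ ≤ l → Q τ l) :
    WP Γ (forUp 2 (.v 10) snapCell) Q σ k := by
  refine WP_for p e (fun i τ => τ.reg 8 = len + (i - p) ∧
      (∀ i', i' ≤ len ∨ len + (i - p) < i' → τ.arr 8 i' = S i') ∧
      τ.arr 8 (len + (i - p)) ≤ off i - off p ∧
      ∀ w, p ≤ w → w < i → τ.arr 8 (len - p + w + 1) = τ.arr 8 (len - p + w) + rank off up w p)
    (fun w => 32 * (rank off up w p - (S (b + w + 1) - S (b + w))) + 150) k₀ r2 hpe (by omega)
    (by omega) ?_ ?_ ?_ ?_ ?_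
  · simp [r8, a8, hS0]
    intro w h1 h2; omega
  · simp only [E.cost, add_assoc] at hk ⊢
    rw [sum_add_distrib, ← mul_sum]
    simp; omega
  · intro τ hF
    have := hF.r 10 rfl
    simp [E.ev, E.ok, this, r10]
  · rintro w τ l h1 h2 hF hr ⟨i1, i2, i3, i4⟩ hl
    have e5 := hF.a 5 rfl
    have e6 := hF.a 6 rfl
    have q1 := hF.r 1 rfl
    have q11 := hF.r 11 rfl
    have g1 := i2 (b + w) (by omega)
    have g2 := i2 (b + w + 1) (by omega)
    have hw1 := hm w h1 h2
    have hw2 := rank_le off up w p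
    have hw3 := hU.mono w (by omega)
    have hw4 := hU.off_le (show w + 1 ≤ n + 1 by omega)
    have hw5 := hU.off_mono h1 (by omega)
    obtain ⟨s, hs⟩ : ∃ s, s = S (b + w + 1) - S (b + w) := ⟨_, rfl⟩
    rw [← hs] at hw1 hl ⊢
    simp only [snapCell, WP, E.ev, E.ok, E.cost, hr, e5, q11, r11, a5, g1, g2, ← hs]
    and_intros
    all_goals try first | omega | trivial
    refine WP_scanUp (fun t => up t < p) (off w + s) (off w + rank off up w p) (off (w + 1))
      (l - 32 * (rank off up w p - s) - 90) (by omega) (by omega) ?_ ?_ (by simp) (by omega) (by omega)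
      ?_ ?_ ?_
    · intro t ht1 ht2
      exact (hU.up_lt_iff (by omega) (by omega) (by omega)).2 ht2
    · intro ht
      rw [hU.up_lt_iff (by omega) (by omega) ht]; omega
    · intro t ht1 ht2
      simp [E.ev, E.ok, hr, e5, e6, q1, r1, a5, a6]
      omega
    · simp only [E.cost]; omega
    · intro l' hl'
      have hn : off w - off p + rank off up w p ≤ off (w + 1) - off p := by omega
      simp [hr, e5, a5, i1, Mach.setr_setr]
      and_intros
      all_goals try omega
      · intro i hi
        rw [Function.update_of_ne (by omega)]
        exact i2 i (by omega)
      · rw [show len + (w + 1 - p) = len + (w - p) + 1 by omega, Function.update_self]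
        omega
      · intro w' g1 g2
        by_cases hw' : w' = w
        · subst hw'
          rw [show len - p + w' + 1 = len + (w' - p) + 1 by omega,
            show len - p + w' = len + (w' - p) by omega, Function.update_self,
            Function.update_of_ne (by omega)]
        · rw [Function.update_of_ne (by omega), Function.update_of_ne (by omega)]
          exact i4 w' g1 (by omega)
  · rintro τ l hF hr ⟨i1, i2, i3, i4⟩ hl
    exact hQ τ l hF i1 i2 i4 hl

/-- The credits `300 * (m - ∑ w, cur w)` pay for new snapshots. A new snapshot takes time
proportional to the size of the subtree and the increase of `∑ w, cur w`, which is at least this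
size. -/
theorem snapLoop_spec {Γ : Env} {n m : ℕ} {A : ℕ → ℕ → Prop} {off up dn pa sz : ℕ → ℕ}
    (hT : HTree n pa sz) (hU : UpLists n m A off up)
    (hA : ∀ u w, A u w → u < w ∧ w < u + sz u)
    (hdn : ∀ k ≤ n + 1, dn k = ((range m).filter (up · < k)).card)
    (hB : 20 * n + 20 * m + 200 ≤ Γ.B)
    {σ : Mach} {k k₀ : ℕ} {Q : Mach → ℕ → Prop}
    (a3 : σ.arr 3 = pa) (a4 : σ.arr 4 = sz) (a5 : σ.arr 5 = off) (a6 : σ.arr 6 = up)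
    (a17 : σ.arr 17 = dn) (a7 : ∀ i, σ.arr 7 i = 0) (a8 : ∀ i, σ.arr 8 i = 0) (r0 : σ.reg 0 = n)
    (hk : 400 * (n + 1) + 300 * m + k₀ ≤ k)
    (hQ : ∀ τ l len, Fr snapLoop σ τ → Snaps n sz off up (τ.arr 7) (τ.arr 8) (n + 1) len →
      len ≤ n + 2 + 2 * m → k₀ ≤ l → Q τ l) : WP Γ snapLoop Q σ k := by
  refine WP_conseq (Q := fun τ l => (∃ len, Snaps n sz off up (τ.arr 7) (τ.arr 8) (n + 1) len ∧
      len ≤ n + 2 + 2 * m) ∧ k₀ ≤ l) ?_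
    fun τ l hF ⟨⟨len, h1, h2⟩, h3⟩ => hQ τ l len hF h1 h2 h3
  simp only [snapLoop, WP, E.ev, E.ok, E.cost]
  and_intros
  all_goals try first | omega | trivial
  refine WP_forK 1 (n + 1) (fun p τ l => ∃ len cur,
    Snapping n m sz off up (τ.arr 7) (τ.arr 8) p len cur ∧ τ.reg 8 = len ∧
    400 * (n + 1 - p) + 300 * (m - ∑ w ∈ range (n + 1), cur w) + 10 + k₀ ≤ l)
    (by simp) (by omega) (by omega) (by omega) ?_ ?_ ?_ ?_
  · refine ⟨n + 2, fun _ => 0, ?_, by simp [r0], ?_⟩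
    · have h7 : σ.arr 7 = fun _ => 0 := funext a7
      have h8 : σ.arr 8 = fun _ => 0 := funext a8
      have := hT.sz_zero
      simp only [Mach.setr_arr, h7, h8]
      refine ⟨⟨?_, ?_, ?_, ?_⟩, ?_, ?_, ?_, ?_, ?_, ?_⟩ <;> simp [snap]
      · omega
      · refine (sum_le_sum (g := fun _ => 0) fun w _ => ?_).trans (by simp)
        simp [rank]
    · simp; omega
  · intro τ hF
    have := hF.r 0 rfl
    simp [E.ev, E.ok] at this ⊢
    omega
  · rintro p τ l h1 h2 hF hr ⟨len, cur, hS, h8, hl⟩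
    have e0 := hF.r 0 rfl
    have e3 := hF.a 3 rfl
    have e4 := hF.a 4 rfl
    have e5 := hF.a 5 rfl
    have e6 := hF.a 6 rfl
    have e17 := hF.a 17 rfl
    simp only [Mach.setr_arr, Mach.setr_reg, a3, a4, a5, a6, a17, r0] at e0 e3 e4 e5 e6 e17
    have hpn : p ≤ n := by omega
    have hq := hT.par p h1 hpn
    have hen := hT.le_end hpn
    have hsc := hS.sum_cur hU
    have hll := hS.len_le
    have hlg := hS.len_ge
    have hadr := hS.adr_le _ hq.1
    have hv := hS.val_le
    have hso := hU.off_le hen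
    have hqsum := (sum_snap (adr := τ.arr 7) (S := τ.arr 8) (x := pa p) (Nat.le_add_right p (sz p))
      fun w g1 g2 => hS.mono _ hq.1 w (by omega) (by omega)).2
    have hcsum : ∑ w ∈ Ico p (p + sz p), snap (τ.arr 7) (τ.arr 8) (pa p) w =
        ∑ w ∈ Ico p (p + sz p), cur w := sum_congr rfl fun w hw => by
      simp only [mem_Ico] at hw
      exact (hS.snap_par hT h1 hpn hw.1 hw.2).1
    -- the total error at `p` of the snapshot of the parent, as computed in variable `12`
    have hacc : ∑ w ∈ Ico p (p + sz p), (rank off up w p - cur w) =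
        (off (p + sz p) - off p - (dn (p + sz p) - dn p)) -
          (τ.arr 8 (τ.arr 7 (pa p) + (p + sz p)) - τ.arr 8 (τ.arr 7 (pa p) + p)) := by
      rw [← hU.sum_rank hT hA hdn hpn, ← hqsum, hcsum]
      refine sum_tsub_distrib _ fun w hw => ?_
      simp only [mem_Ico] at hw
      exact (hS.snap_par hT h1 hpn hw.1 hw.2).2
    refine ⟨by simp only [E.cost]; omega, ?_⟩
    simp only [WP, E.ev, E.ok, E.cost]
    simp [hr, e3, e4, e5, e17, ← hacc]
    have hv1 := hv (τ.arr 7 (pa p) + (p + sz p))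
    have hpos := hT.pos p hpn
    and_intros
    all_goals try omega
    · intro hlt
      refine ⟨by omega, by omega, cur, ?_, by omega⟩
      rw [h8]
      exact hS.share hT h1 hpn hlt
    · intro hge
      and_intros
      all_goals try omega
      refine snapCells_spec (p := p) (e := p + sz p) (b := τ.arr 7 (pa p)) (len := len)
        (k₀ := l - 200 - 180 * sz p - 32 * ∑ w ∈ Ico p (p + sz p), (rank off up w p - cur w))
        hU (by omega) (by omega) (by omega) (by omega) (hS.fresh _ le_rfl) ?_ (by simp [e5])
        (by simp [e6]) (by simp) (by simp [hr]) (by simp) (by simp [h8]) (by simp)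
        (by simp) ?_ ?_
      · intro w g1 g2
        have := hS.snap_par hT h1 hpn g1 g2
        rw [snap] at this
        omega
      · have : ∀ w ∈ Ico p (p + sz p), rank off up w p -
            (τ.arr 8 (τ.arr 7 (pa p) + w + 1) - τ.arr 8 (τ.arr 7 (pa p) + w)) =
            rank off up w p - cur w := by
          intro w hw
          simp only [mem_Ico] at hw
          have := (hS.snap_par hT h1 hpn hw.1 hw.2).1
          rw [snap] at this
          rw [this]
        rw [sum_congr rfl this]
        have hle : ∑ w ∈ Ico p (p + sz p), (rank off up w p - cur w) ≤
            m - ∑ w ∈ range (n + 1), cur w := by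
          obtain ⟨cur', c1, c2⟩ := hS.fresh_snap hT hU h1 hpn hge (S' := fun i =>
            if i ≤ len then τ.arr 8 i else if len + sz p < i then τ.arr 8 i else
              ∑ v ∈ Ico p (i - (len - p)), rank off up v p) (by
              intro i hi
              by_cases h : i ≤ len
              · simp [h]
              · simp [h, show len + sz p < i by omega]) (by
              intro w g1 g2
              rw [if_neg (by omega), if_neg (by omega),
                show len - p + w + 1 - (len - p) = w + 1 by omega, sum_Ico_succ_top g1]
              by_cases h : len - p + w ≤ len
              · obtain rfl : w = p := by omega
                rw [if_pos h, show len - w + w = len by omega, hS.fresh _ le_rfl]; simp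
              · rw [if_neg h, if_neg (by omega), show len - p + w - (len - p) = w by omega])
          have := c1.sum_cur hU
          omega
        omega
      · intro υ l' hF' q8 i1 i2 hl'
        rw [show p + sz p - p = sz p by omega] at q8 i1
        have q1 := hF'.r 1 rfl
        have q7 := hF'.a 7 rfl
        simp at q1 q7
        obtain ⟨cur', c1, c2⟩ := hS.fresh_snap hT hU h1 hpn hge i1 i2
        have hsc' := c1.sum_cur hU
        refine ⟨⟨by omega, by omega⟩, by omega, by omega, by omega, cur', ?_, by omega⟩
        rw [q7, h8, q8]; exact c1
  · rintro τ l hF hr ⟨len, cur, hS, h8, hl⟩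
    have hsc := hS.sum_cur hU
    have hll := hS.len_le
    simp only [E.cost]
    exact ⟨by omega, ⟨len, hS.toSnaps, by omega⟩, by omega⟩

/-! ### The data structure -/

section
open E Cmd

/-- Read the edges and name their endpoints by labels: arrays `15` and `16` get the smaller and
the larger label. -/
def edgeLoop : Cmd :=
  .set 6 (i 0 (c 1)) ;; .set 7 (add (v 0) (c 2)) ;; .set 1 (c 0) ;;
  forUp 1 (v 6) (
    .set 4 (a 1 (add (i 0 (v 7)) (c 1))) ;;
    .set 5 (a 1 (add (i 0 (add (v 7) (c 1))) (c 1))) ;;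
    .ite (lt (v 4) (v 5)) (.put 15 (v 1) (v 4) ;; .put 16 (v 1) (v 5))
      (.put 15 (v 1) (v 5) ;; .put 16 (v 1) (v 4)) ;;
    .set 7 (add (v 7) (c 2)))

/-- The preprocessing. -/
def prepCmd : Cmd :=
  labelCmd ;; edgeLoop ;; countSort 15 15 16 18 19 17 20 ;; countSort 19 18 19 6 21 5 20 ;;
  snapLoop ;; .put 0 (c 0) (v 0)

end

/-- The edge list of the input. -/
def EdgeInput (Γ : Env) (n m : ℕ) (ea eb : ℕ → ℕ) : Prop :=
  Γ.get 0 1 = m ∧ ∀ j < m, Γ.get 0 (n + 2 + 2 * j) + 1 = ea j ∧ Γ.get 0 (n + 2 + 2 * j + 1) + 1 = eb j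

theorem edgeLoop_spec {Γ : Env} {n m : ℕ} {ea eb : ℕ → ℕ} (hin : EdgeInput Γ n m ea eb)
    (hB : 4 * n + 4 * m + 20 ≤ Γ.B) (hle : ∀ j < m, ea j ≤ n ∧ eb j ≤ n)
    {σ : Mach} {k k₀ : ℕ} {Q : Mach → ℕ → Prop} (h0 : σ.reg 0 = n)
    (hk : 200 * (m + 1) + k₀ ≤ k)
    (hQ : ∀ τ l, Fr edgeLoop σ τ → τ.reg 6 = m →
      (∀ j < m, τ.arr 15 j = min (σ.arr 1 (ea j)) (σ.arr 1 (eb j)) ∧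
        τ.arr 16 j = max (σ.arr 1 (ea j)) (σ.arr 1 (eb j))) → k₀ ≤ l → Q τ l) :
    WP Γ edgeLoop Q σ k := by
  refine WP_conseq (Q := fun τ l => τ.reg 6 = m ∧
      (∀ j < m, τ.arr 15 j = min (σ.arr 1 (ea j)) (σ.arr 1 (eb j)) ∧
        τ.arr 16 j = max (σ.arr 1 (ea j)) (σ.arr 1 (eb j))) ∧ k₀ ≤ l) ?_
    fun τ l hF h => hQ τ l hF h.1 h.2.1 h.2.2
  simp only [edgeLoop, WP, E.ev, E.ok, E.cost]
  and_intros
  all_goals try first | omega | trivial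
  · simp; omega
  refine WP_for 0 m (fun i τ => τ.reg 7 = n + 2 + 2 * i ∧
      ∀ j < i, τ.arr 15 j = min (σ.arr 1 (ea j)) (σ.arr 1 (eb j)) ∧
        τ.arr 16 j = max (σ.arr 1 (ea j)) (σ.arr 1 (eb j)))
    (fun _ => 150) k₀ (by simp) (by omega) (by omega) (by omega) ?_ ?_ ?_ ?_ ?_
  · simp [h0]
  · simp [E.cost]; omega
  · intro τ hF
    have := hF.r 6 rfl
    simp [E.ev, E.ok, hin.1] at this ⊢
    omega
  · rintro j τ l h1 h2 hF hr ⟨i1, i2⟩ hl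
    have e1 := hF.a 1 rfl
    simp only [Mach.setr_arr] at e1
    obtain ⟨g1, g2⟩ := hin.2 j h2
    have := hle j h2
    have hst : ∀ x y : ℕ → ℕ, x j = min (σ.arr 1 (ea j)) (σ.arr 1 (eb j)) →
        y j = max (σ.arr 1 (ea j)) (σ.arr 1 (eb j)) → (∀ i < j, x i = τ.arr 15 i) →
        (∀ i < j, y i = τ.arr 16 i) → ∀ i ≤ j, x i = min (σ.arr 1 (ea i)) (σ.arr 1 (eb i)) ∧
        y i = max (σ.arr 1 (ea i)) (σ.arr 1 (eb i)) := by
      intro x y hx hy hx' hy' i hi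
      rcases Nat.lt_or_eq_of_le hi with h | rfl
      · rw [hx' i h, hy' i h]; exact i2 i h
      · exact ⟨hx, hy⟩
    have hst' := hst (Function.update (τ.arr 15) j (min (σ.arr 1 (ea j)) (σ.arr 1 (eb j))))
      (Function.update (τ.arr 16) j (max (σ.arr 1 (ea j)) (σ.arr 1 (eb j)))) (by simp) (by simp)
      (fun i hi => by simp [hi.ne]) (fun i hi => by simp [hi.ne])
    simp [WP, E.ev, E.ok, E.cost, hr, e1, i1, g1, g2]
    and_intros
    all_goals try omega
    · intro hlt
      rw [min_eq_left hlt.le, max_eq_right hlt.le] at hst'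
      and_intros
      all_goals try omega
    · intro hge
      rw [min_eq_right hge, max_eq_left hge] at hst'
      and_intros
      all_goals try omega
  · rintro τ l hF hr ⟨i1, i2⟩ hl
    have := hF.r 6 rfl
    simp [hin.1] at this
    exact ⟨this, i2, hl⟩

/-- What the preprocessing computes, apart from `n` itself: labels, lists of upper neighbours and
snapshots. `adj` is the adjacency of labels, smaller label first. -/
structure Data (n m : ℕ) (par : ℕ → ℕ) (adj : ℕ → ℕ → Prop) (D : ℕ → ℕ → ℕ) : Prop where
  size : D 0 0 = n
  labels : Labels n par (D 1) (D 2) (D 3) (D 4)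
  ups : UpLists n m adj (D 5) (D 6)
  snaps : ∃ len ≤ n + 2 + 2 * m, Snaps n (D 4) (D 5) (D 6) (D 7) (D 8) (n + 1) len

/-- The preprocessing. The hypothesis `hanc` says that each edge joins a label to a larger label in
its interval, whatever the labelling: it holds because the given forest is a depth first search
forest. -/
theorem prepCmd_spec {Γ : Env} {n m : ℕ} {par rk ea eb : ℕ → ℕ} (hin : ParentInput Γ n par)
    (hin' : EdgeInput Γ n m ea eb)
    (hB : 20 * n + 20 * m + 200 ≤ Γ.B) (hp : ∀ a, 1 ≤ a → a ≤ n → par a ≤ n)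
    (hrk : ∀ a, 1 ≤ a → a ≤ n → rk (par a) < rk a)
    (hle : ∀ j < m, ea j ≤ n ∧ eb j ≤ n)
    (hinj : ∀ i < m, ∀ j < m, (ea i = ea j ∧ eb i = eb j ∨ ea i = eb j ∧ eb i = ea j) → i = j)
    (hanc : ∀ pre org pa sz, Labels n par pre org pa sz → ∀ j < m,
      min (pre (ea j)) (pre (eb j)) < max (pre (ea j)) (pre (eb j)) ∧
      max (pre (ea j)) (pre (eb j)) <
        min (pre (ea j)) (pre (eb j)) + sz (min (pre (ea j)) (pre (eb j))))
    {σ : Mach} {k k₀ : ℕ} {Q : Mach → ℕ → Prop} (hz : ∀ j a, σ.arr j a = 0)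
    (hk : 3000 * (n + m + 1) + k₀ ≤ k)
    (hQ : ∀ τ l, τ.reg 0 = n → Data n m par (fun u w => ∃ j < m,
      min (τ.arr 1 (ea j)) (τ.arr 1 (eb j)) = u ∧ max (τ.arr 1 (ea j)) (τ.arr 1 (eb j)) = w) τ.arr →
      k₀ ≤ l → Q τ l) :
    WP Γ prepCmd Q σ k := by
  simp only [prepCmd, WP]
  refine labelCmd_spec (k₀ := 1400 * (n + m + 1) + k₀) hin (by omega) hp hrk hz (by omega) ?_
  intro τ1 l1 F1 r0 hL hl1
  refine edgeLoop_spec (k₀ := 1200 * (n + m + 1) + k₀) hin' (by omega) hle r0 (by omega) ?_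
  intro τ2 l2 F2 r6 hE hl2
  have r0' := F2.r 0 rfl
  rw [← F2.a 1 rfl, ← F2.a 2 rfl, ← F2.a 3 rfl, ← F2.a 4 rfl] at hL
  rw [← F2.a 1 rfl] at hE
  have hpe := fun j hj => hL.pre_le _ (hle j hj).1
  have hpe' := fun j hj => hL.pre_le _ (hle j hj).2
  refine countSort_spec (k₀ := 900 * (n + m + 1) + k₀) (by omega) (r0'.trans r0) r6 ?_ ?_ (by decide)
    (by decide) (by decide) (by decide) (by decide) (by decide) (by decide) (by omega) ?_
  · intro j hj
    rw [(hE j hj).1]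
    have := hpe j hj
    omega
  · intro k
    rw [F2.a 17 rfl, F1.a 17 rfl, hz]
  intro τ3 l3 F3 h1 hl3
  rw [← F3.a 1 rfl, ← F3.a 2 rfl, ← F3.a 3 rfl, ← F3.a 4 rfl] at hL
  rw [← F3.a 1 rfl] at hE hpe hpe'
  have r0'' := F3.r 0 rfl
  have r6' := F3.r 6 rfl
  refine countSort_spec (n := n) (m := m) (k₀ := 600 * (n + m + 1) + k₀) (by omega) (by omega)
    (by omega) ?_ ?_ (by decide)
    (by decide) (by decide) (by decide) (by decide) (by decide) (by decide) (by omega) ?_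
  · intro j hj
    obtain ⟨i, hi, rfl⟩ := slot_surj (key := τ2.arr 15) hj
    rw [h1.snd i hi, (hE i hi).2]
    have := hpe i hi
    have := hpe' i hi
    omega
  · intro k
    rw [F3.a 5 rfl, F2.a 5 rfl, F1.a 5 rfl, hz]
  intro τ4 l4 F4 h2 hl4
  rw [← F4.a 1 rfl, ← F4.a 2 rfl, ← F4.a 3 rfl, ← F4.a 4 rfl] at hL
  rw [← F4.a 1 rfl] at hE hpe hpe'
  have r0''' := F4.r 0 rfl
  -- different edges have different pairs of labels, smaller one first
  obtain ⟨hU, hdn⟩ := h1.upLists h2 (fun j hj => by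
      rw [(hE j hj).2]; have := hpe j hj; have := hpe' j hj; omega) (fun i hi j hj e1 e2 => by
      rw [(hE j hj).1, (hE i hi).1] at e1
      rw [(hE j hj).2, (hE i hi).2] at e2
      refine hinj i hi j hj ?_
      have hpi : ∀ x y, x ≤ n → y ≤ n → τ4.arr 1 x = τ4.arr 1 y → x = y := fun x y hx hy h => by
        rw [← hL.org_pre x hx, h, hL.org_pre y hy]
      have h3 := hpi (ea i) (ea j) (hle i hi).1 (hle j hj).1
      have h4 := hpi (eb i) (eb j) (hle i hi).2 (hle j hj).2
      have h5 := hpi (ea i) (eb j) (hle i hi).1 (hle j hj).2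
      have h6 := hpi (eb i) (ea j) (hle i hi).2 (hle j hj).1
      omega)
  have hAE : (fun u w => ∃ j < m, τ2.arr 15 j = u ∧ τ2.arr 16 j = w) = fun u w => ∃ j < m,
      min (τ4.arr 1 (ea j)) (τ4.arr 1 (eb j)) = u ∧ max (τ4.arr 1 (ea j)) (τ4.arr 1 (eb j)) = w := by
    funext u w
    simp only [eq_iff_iff]
    refine exists_congr fun j => and_congr_right fun hj => ?_
    rw [(hE j hj).1, (hE j hj).2]
  rw [hAE] at hU
  rw [← F4.a 17 rfl] at hdn
  refine snapLoop_spec (k₀ := 10 + k₀) hL.tree hU ?_ hdn (by omega) rfl rfl rfl rfl rfl ?_ ?_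
    (r0'''.trans (r0''.trans (r0'.trans r0))) (by omega) ?_
  · rintro u w ⟨j, hj, rfl, rfl⟩
    exact hanc _ _ _ _ hL j hj
  · intro k
    rw [F4.a 7 rfl, F3.a 7 rfl, F2.a 7 rfl, F1.a 7 rfl, hz]
  · intro k
    rw [F4.a 8 rfl, F3.a 8 rfl, F2.a 8 rfl, F1.a 8 rfl, hz]
  intro τ5 l5 len F5 hS hlen hl5
  have r5 := F5.r 0 rfl
  rw [← F5.a 1 rfl] at hU
  rw [← F5.a 1 rfl, ← F5.a 2 rfl, ← F5.a 3 rfl, ← F5.a 4 rfl] at hL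
  rw [← F5.a 5 rfl, ← F5.a 6 rfl] at hU hS
  rw [← F5.a 4 rfl] at hS
  simp only [E.ok, E.ev, E.cost]
  refine ⟨⟨by omega, by omega, trivial⟩, by omega, hQ _ _ ?_ ?_ ?_⟩
  · simp; omega
  · refine ⟨?_, ?_, ?_, len, hlen, ?_⟩
    · simp; omega
    · simpa using hL
    · simpa using hU
    · simpa using hS
  · omega

/-! ### Partial depth first traversals -/

/-- A depth first traversal of the graph with adjacency `H` has been carried out up to a current
vertex `cur`: `dfn` numbers the visited vertices from `1` to `c` (it is `0` at the others), `ps`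
contains the parents (`0` for roots), and `dep` the depths. If `cur = 0`, then a new root is to be
chosen. The field `dfs` is the condition that defines depth first search: when `v` was visited,
no vertex visited after its parent had an unvisited neighbour, and if `v` is a root, then no visited
vertex had one. The field `front` says that now
no vertex visited after `cur` has an unvisited neighbour. -/
structure Traversal (H : ℕ → ℕ → Prop) (dfn ps dep : ℕ → ℕ) (cur c : ℕ) : Prop where
  le : ∀ x, dfn x ≤ c
  inj : ∀ x y, dfn x ≠ 0 → dfn x = dfn y → x = y
  zero : dfn 0 = 0
  par : ∀ v, dfn v ≠ 0 → ps v ≠ 0 → H (ps v) v ∧ dfn (ps v) ≠ 0 ∧ dfn (ps v) < dfn v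
  none : ∀ v, dfn v = 0 → ps v = 0
  dfs : ∀ v w x, dfn v ≠ 0 → H w x → dfn w ≠ 0 → dfn w < dfn v → (dfn x = 0 ∨ dfn v ≤ dfn x) →
    ps v ≠ 0 ∧ dfn w ≤ dfn (ps v)
  depth : ∀ v, dfn v ≠ 0 → dep v = dep (ps v) + 1
  at_cur : cur = 0 ∨ dfn cur ≠ 0
  front : ∀ w x, H w x → dfn w ≠ 0 → dfn x = 0 → dfn w ≤ dfn cur

namespace Traversal
variable {H : ℕ → ℕ → Prop} {dfn ps dep : ℕ → ℕ} {cur c : ℕ}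

theorem init (H : ℕ → ℕ → Prop) : Traversal H (fun _ => 0) (fun _ => 0) (fun _ => 0) 0 0 := by
  constructor <;> simp

/-- The vertex `x` is visited as a child of `cur`, or as a root if `cur = 0`. -/
theorem enter (h : Traversal H dfn ps dep cur c) {x : ℕ} (hx : x ≠ 0) (hd : dfn x = 0)
    (hc : cur = 0 ∨ H cur x) :
    Traversal H (Function.update dfn x (c + 1)) (Function.update ps x cur)
      (Function.update dep x (dep cur + 1)) x (c + 1) := by
  have hcx : cur ≠ x := by
    rintro rfl
    rcases h.at_cur with h1 | h1
    · exact hx h1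
    · exact h1 hd
  have hps : ∀ v, dfn v ≠ 0 → ps v ≠ x := by
    rintro v hv rfl
    exact (h.par v hv hx).2.1 hd
  have hlt : ∀ v, dfn v < c + 1 := fun v => Nat.lt_succ_of_le (h.le v)
  constructor
  · intro y
    rw [Function.update_apply]
    split_ifs
    · rfl
    · exact (hlt y).le
  · intro y z
    simp only [Function.update_apply]
    have h1 := hlt y
    have h2 := hlt z
    split_ifs with g1 g2 g2
    · intros; rw [g1, g2]
    · omega
    · omega
    · exact h.inj y z
  · rw [Function.update_of_ne hx.symm]; exact h.zero
  · intro v hv hv'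
    by_cases hvx : v = x
    · subst hvx
      simp only [Function.update_self] at hv' ⊢
      rw [Function.update_of_ne hcx]
      have := h.at_cur
      have := hlt cur
      refine ⟨by tauto, by tauto, this⟩
    · rw [Function.update_of_ne hvx] at hv hv' ⊢
      rw [Function.update_of_ne (hps v hv), Function.update_of_ne hvx]
      exact h.par v hv hv'
  · intro v hv
    by_cases hvx : v = x
    · subst hvx; simp at hv
    · rw [Function.update_of_ne hvx] at hv ⊢
      exact h.none v hv
  · intro v w y hv hwy hw hwv hy
    have hwx : w ≠ x := by
      rintro rfl
      rw [Function.update_self] at hwv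
      have := hlt v
      rw [Function.update_apply] at hwv
      split_ifs at hwv <;> omega
    rw [Function.update_of_ne hwx] at hw hwv ⊢
    by_cases hvx : v = x
    · subst hvx
      rw [Function.update_self] at hwv hy ⊢
      have hy0 : dfn y = 0 := by
        by_cases hyv : y = v
        · rw [hyv, hd]
        · rw [Function.update_of_ne hyv] at hy
          have := hlt y
          omega
      rw [Function.update_of_ne hcx]
      -- when `x` is visited, `front` says what `dfs` demands of its parent `cur`
      have h1 := h.front w y hwy hw hy0
      refine ⟨?_, h1⟩
      rintro rfl
      rw [h.zero] at h1
      omega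
    · rw [Function.update_of_ne hvx] at hwv hv hy ⊢
      rw [Function.update_of_ne (hps v hv)]
      refine h.dfs v w y hv hwy hw hwv ?_
      by_cases hyx : y = x
      · left; rw [hyx, hd]
      · rwa [Function.update_of_ne hyx] at hy
  · intro v hv
    by_cases hvx : v = x
    · subst hvx
      simp [hcx]
    · rw [Function.update_of_ne hvx] at hv ⊢
      rw [Function.update_of_ne hvx, Function.update_of_ne (hps v hv)]
      exact h.depth v hv
  · right; simp
  · intro w y hwy hw hy
    rw [Function.update_self, Function.update_apply]
    have := hlt w
    split_ifs <;> omega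

/-- When all neighbours of `cur` are visited, the traversal may go back to the parent of `cur`: any
earlier vertex that has an unvisited neighbour now had it already when `cur` was visited, so it is
not later than the parent. -/
theorem back (h : Traversal H dfn ps dep cur c) (hc : cur ≠ 0)
    (hn : ∀ x, H cur x → dfn x ≠ 0) : Traversal H dfn ps dep (ps cur) c := by
  have hd : dfn cur ≠ 0 := h.at_cur.resolve_left hc
  refine { h with at_cur := ?_, front := ?_ }
  · by_cases hp : ps cur = 0
    · exact Or.inl hp
    · exact Or.inr (h.par cur hd hp).2.1
  · intro w x hwx hw hx
    have h1 := h.front w x hwx hw hx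
    have h2 : w ≠ cur := by rintro rfl; exact hn x hwx hx
    have h3 : dfn w ≠ dfn cur := fun e => h2 (h.inj w cur hw e)
    exact (h.dfs cur w x hd hwx hw (by omega) (Or.inl hx)).2

end Traversal

/-- The cell `h` is the head of the linked list `l`, whose nodes are below `N + 1`. The items are
in `W`, the links in `X`, and `0` ends a list. -/
def Chain (W X : ℕ → ℕ) (N : ℕ) : ℕ → List ℕ → Prop
  | h, [] => h = 0
  | h, w :: l => h ≠ 0 ∧ h ≤ N ∧ W h = w ∧ Chain W X N (X h) l

theorem Chain.mono {W X W' X' : ℕ → ℕ} {N N' : ℕ} (hN : N ≤ N')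
    (hW : ∀ i ≤ N, W' i = W i) (hX : ∀ i ≤ N, X' i = X i) {h : ℕ} {l : List ℕ}
    (hc : Chain W X N h l) : Chain W' X' N' h l := by
  induction l generalizing h with
  | nil => exact hc
  | cons w l ih =>
    obtain ⟨h1, h2, h3, h4⟩ := hc
    exact ⟨h1, h2.trans hN, by rw [hW h h2, h3], by rw [hX h h2]; exact ih h4⟩

/-! ### Light ancestors and segments -/

/-- Halving a number decreases its binary length. -/
theorem size_half {a b : ℕ} (h : 2 * a ≤ b) (hb : b ≠ 0) : Nat.size a + 1 ≤ Nat.size b := by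
  have h1 : 0 < Nat.size b := Nat.size_pos.2 (Nat.pos_of_ne_zero hb)
  have h2 : b < 2 ^ Nat.size b := Nat.lt_size_self b
  obtain ⟨s, hs⟩ : ∃ s, Nat.size b = s + 1 := ⟨Nat.size b - 1, by omega⟩
  rw [hs] at h2 ⊢
  have : Nat.size a ≤ s := by
    rw [Nat.size_le]
    rw [pow_succ] at h2
    omega
  omega

theorem size_le_log {a n : ℕ} (h : a ≤ n) : Nat.size a ≤ Nat.log 2 n + 1 := by
  rw [Nat.size_le]
  exact h.trans_lt (Nat.lt_pow_succ_log_self (by omega) n)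

open Classical in
/-- The number of ancestors of `w` (including `w`, without the virtual root `0`) that have the
property `P`. -/
noncomputable def ancCard (n : ℕ) (sz : ℕ → ℕ) (P : ℕ → Prop) (w : ℕ) : ℕ :=
  ((Icc 1 n).filter fun x => P x ∧ x ≤ w ∧ w < x + sz x).card

section
variable {n : ℕ} {pa sz : ℕ → ℕ}

theorem ancCard_mono {P Q : ℕ → Prop} {w : ℕ}
    (h : ∀ x, 1 ≤ x → x ≤ n → x ≤ w → w < x + sz x → P x → Q x) :
    ancCard n sz P w ≤ ancCard n sz Q w := by
  classical
  apply card_le_card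
  intro x
  simp only [mem_filter, mem_Icc]
  exact fun ⟨h1, h2, h3, h4⟩ => ⟨h1, h x h1.1 h1.2 h3 h4 h2, h3, h4⟩

theorem ancCard_or {P Q : ℕ → Prop} {w : ℕ} :
    ancCard n sz (fun x => P x ∨ Q x) w ≤ ancCard n sz P w + ancCard n sz Q w := by
  classical
  refine le_trans (card_le_card ?_) (card_union_le _ _)
  intro x
  simp only [mem_filter, mem_union]
  tauto

theorem ancCard_eq_one {a w : ℕ} : ancCard n sz (fun x => x = a) w ≤ 1 := by
  classical
  refine le_trans (card_le_card (t := {a}) ?_) (by simp)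
  intro x
  simp only [mem_filter, mem_singleton]
  tauto

theorem ancCard_zero {P : ℕ → Prop} : ancCard n sz P 0 = 0 := by
  classical
  rw [ancCard, card_eq_zero]
  ext x
  simp
  omega

/-- Counting the pairs of a vertex with property `P` and a vertex in its subtree in two ways. -/
theorem HTree.sum_ancCard (h : HTree n pa sz) (P : ℕ → Prop) [DecidablePred P] :
    ∑ w ∈ range (n + 1), ancCard n sz P w = ∑ x ∈ (Icc 1 n).filter P, sz x := by
  classical
  have h1 : ∀ w, ancCard n sz P w =
      ∑ x ∈ (Icc 1 n).filter P, if x ≤ w ∧ w < x + sz x then 1 else 0 := by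
    intro w
    rw [← card_filter, filter_filter, ancCard]
    congr
  rw [sum_congr rfl fun w _ => h1 w, sum_comm]
  refine sum_congr rfl fun x hx => ?_
  simp only [mem_filter, mem_Icc] at hx
  rw [← card_filter]
  have := h.le_end hx.1.2
  rw [show (range (n + 1)).filter (fun w => x ≤ w ∧ w < x + sz x) = Ico x (x + sz x) by
    ext w; simp; omega]
  simp

/-- The size of the subtree is at least halved at each light vertex on the way from the root. -/
theorem HTree.light_le (h : HTree n pa sz) {w : ℕ} (hw : w ≤ n) :
    2 ^ ancCard n sz (fun x => pa x + 1 ≠ x) w * sz w ≤ n + 1 := by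
  classical
  induction w using Nat.strong_induction_on with
  | _ w ih =>
    rcases Nat.eq_zero_or_pos w with rfl | h0
    · rw [h.sz_zero]
      rw [ancCard_zero]; simp
    · have hp := h.par w h0 hw
      have ih := ih (pa w) hp.1 (by omega)
      -- an ancestor of `w` is `w` itself or an ancestor of its parent
      have key : ∀ x, 1 ≤ x → x ≤ n → x ≤ w → w < x + sz x → x = w ∨ (x ≤ pa w ∧ pa w < x + sz x) := by
        intro x h1 h2 h3 h4
        rcases Nat.lt_or_eq_of_le h3 with h5 | h5
        · have := h.inner x w h2 h5 h4
          exact Or.inr ⟨this, by omega⟩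
        · exact Or.inl h5
      by_cases hl : pa w + 1 = w
      · have : ancCard n sz (fun x => pa x + 1 ≠ x) w ≤ ancCard n sz (fun x => pa x + 1 ≠ x) (pa w) := by
          apply card_le_card
          intro x
          simp only [mem_filter, mem_Icc]
          rintro ⟨h1, h2, h3, h4⟩
          rcases key x h1.1 h1.2 h3 h4 with rfl | h5
          · exact absurd hl h2
          · exact ⟨h1, h2, h5⟩
        calc _ ≤ 2 ^ ancCard n sz (fun x => pa x + 1 ≠ x) (pa w) * sz (pa w) :=
              Nat.mul_le_mul (Nat.pow_le_pow_right (by omega) this) (by omega)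
          _ ≤ _ := ih
      · have : ancCard n sz (fun x => pa x + 1 ≠ x) w ≤
            ancCard n sz (fun x => pa x + 1 ≠ x) (pa w) + 1 := by
          refine le_trans (card_le_card (t := insert w _) ?_) (card_insert_le _ _)
          intro x
          simp only [mem_filter, mem_Icc, mem_insert]
          rintro ⟨h1, h2, h3, h4⟩
          rcases key x h1.1 h1.2 h3 h4 with rfl | h5
          · exact Or.inl rfl
          · exact Or.inr ⟨h1, h2, h5⟩
        calc _ ≤ 2 ^ (ancCard n sz (fun x => pa x + 1 ≠ x) (pa w) + 1) * sz w :=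
              Nat.mul_le_mul (Nat.pow_le_pow_right (by omega) this) le_rfl
          _ = 2 ^ ancCard n sz (fun x => pa x + 1 ≠ x) (pa w) * (2 * sz w) := by ring
          _ ≤ 2 ^ ancCard n sz (fun x => pa x + 1 ≠ x) (pa w) * sz (pa w) :=
              Nat.mul_le_mul le_rfl (h.light w h0 hw hl)
          _ ≤ _ := ih

/-- Only logarithmically many ancestors are light. -/
theorem HTree.light_le_log (h : HTree n pa sz) {w : ℕ} (hw : w ≤ n) :
    ancCard n sz (fun x => pa x + 1 ≠ x) w ≤ Nat.log 2 n + 1 := by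
  have h1 := h.light_le hw
  have h2 := h.pos w hw
  have h3 := Nat.lt_pow_succ_log_self (b := 2) (by omega) n
  have h4 : 2 ^ ancCard n sz (fun x => pa x + 1 ≠ x) w ≤ 2 ^ (Nat.log 2 n + 1) :=
    (Nat.le_mul_of_pos_right _ h2).trans (h1.trans h3)
  exact (Nat.pow_le_pow_iff_right (by omega)).1 h4

/-- The number of vertices in the subtree of `x`, but not in that of its heavy child. -/
def lightSize (n : ℕ) (pa sz : ℕ → ℕ) (x : ℕ) : ℕ :=
  sz x - if x + 1 ≤ n ∧ pa (x + 1) = x then sz (x + 1) else 0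

theorem HTree.heavy_lt (h : HTree n pa sz) {x : ℕ} (hx : x + 1 ≤ n) (hp : pa (x + 1) = x) :
    sz (x + 1) < sz x := by
  have := h.par (x + 1) (by omega) hx
  rw [hp] at this
  omega

/-- In the sum of the sizes of the subtrees, the contributions of heavy children cancel; what
remains are the subtrees of the light vertices, which contain each vertex logarithmically often. -/
theorem HTree.sum_lightSize (h : HTree n pa sz) :
    ∑ x ∈ Icc 1 n, lightSize n pa sz x ≤ (n + 1) * (Nat.log 2 n + 2) := by
  classical
  have h1 : ∑ x ∈ Icc 1 n, lightSize n pa sz x +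
      ∑ x ∈ Icc 1 n, (if x + 1 ≤ n ∧ pa (x + 1) = x then sz (x + 1) else 0) =
      ∑ x ∈ Icc 1 n, sz x := by
    rw [← sum_add_distrib]
    refine sum_congr rfl fun x _ => ?_
    rw [lightSize]
    split_ifs with hx
    · have := h.heavy_lt hx.1 hx.2; omega
    · rfl
  have h2 : ∑ x ∈ Icc 1 n, sz x = ∑ x ∈ (Icc 1 n).filter (fun x => pa x + 1 ≠ x), sz x +
      ∑ x ∈ (Icc 1 n).filter (fun x => ¬ pa x + 1 ≠ x), sz x :=
    (sum_filter_add_sum_filter_not _ _ _).symm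
  have h3 : ∑ x ∈ (Icc 1 n).filter (fun x => ¬ pa x + 1 ≠ x), sz x ≤ (n + 1) +
      ∑ x ∈ Icc 1 n, (if x + 1 ≤ n ∧ pa (x + 1) = x then sz (x + 1) else 0) := by
    have e : ∑ x ∈ Icc 1 n, (if x + 1 ≤ n ∧ pa (x + 1) = x then sz (x + 1) else 0) =
        ∑ y ∈ (Icc 2 n).filter (fun x => pa x + 1 = x), sz y := by
      rw [← sum_filter]
      refine sum_bij (fun x _ => x + 1) ?_ ?_ ?_ ?_
      · intro x hx
        simp only [mem_filter, mem_Icc] at hx ⊢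
        omega
      · intro x _ y _ hxy; omega
      · intro y hy
        simp only [mem_filter, mem_Icc] at hy
        refine ⟨y - 1, ?_, by omega⟩
        simp only [mem_filter, mem_Icc]
        rw [show y - 1 + 1 = y by omega]
        omega
      · intros; rfl
    rw [e]
    rcases Nat.eq_zero_or_pos n with rfl | hn
    · simp
    · have h1n := h.le_end (x := 1) hn
      calc ∑ x ∈ (Icc 1 n).filter (fun x => ¬ pa x + 1 ≠ x), sz x
          ≤ ∑ x ∈ insert 1 ((Icc 2 n).filter (fun x => pa x + 1 = x)), sz x := by
            refine sum_le_sum_of_subset ?_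
            intro x
            simp only [mem_filter, mem_insert, mem_Icc]
            omega
        _ = sz 1 + ∑ x ∈ (Icc 2 n).filter (fun x => pa x + 1 = x), sz x :=
            sum_insert (by simp)
        _ ≤ _ := by omega
  have h4 : ∑ x ∈ (Icc 1 n).filter (fun x => pa x + 1 ≠ x), sz x ≤
      (n + 1) * (Nat.log 2 n + 1) := by
    rw [← h.sum_ancCard]
    refine (sum_le_sum fun w hw => h.light_le_log (w := w) ?_).trans (by simp)
    simp at hw; omega
  rw [show Nat.log 2 n + 2 = Nat.log 2 n + 1 + 1 by rfl, Nat.mul_add, Nat.mul_one]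
  omega

/-- `top x` is the first vertex of the segment of `x`, a part of a heavy path whose consecutive
vertices are adjacent in the surviving graph (with adjacency `H`). Failed vertices form segments of
their own. -/
structure Segs (n : ℕ) (pa : ℕ → ℕ) (H : ℕ → ℕ → Prop) (top : ℕ → ℕ) : Prop where
  top_le : ∀ x, 1 ≤ x → x ≤ n → 1 ≤ top x ∧ top x ≤ x
  link : ∀ x, 1 ≤ x → x ≤ n → top x ≠ x → pa x + 1 = x ∧ 2 ≤ x ∧ top (x - 1) = top x ∧ H (x - 1) x

namespace Segs
variable {H : ℕ → ℕ → Prop} {top : ℕ → ℕ} (hs : Segs n pa H top)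
include hs

theorem top_eq {x y : ℕ} (h1 : 1 ≤ x) (hx : x ≤ n) (hy : top x ≤ y) (hyx : y ≤ x) :
    top y = top x := by
  induction x using Nat.strong_induction_on with
  | _ x ih =>
    rcases Nat.lt_or_eq_of_le hyx with h | rfl
    · have h3 := hs.link x h1 hx (by omega)
      rw [← h3.2.2.1] at hy ⊢
      exact ih (x - 1) (by omega) (by omega) (by omega) hy (by omega)
    · rfl

theorem top_top {x : ℕ} (h1 : 1 ≤ x) (hx : x ≤ n) : top (top x) = top x :=
  hs.top_eq h1 hx le_rfl (hs.top_le x h1 hx).2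

theorem step {x y : ℕ} (h1 : 1 ≤ x) (hx : x ≤ n) (hy : top x < y) (hyx : y ≤ x) :
    pa y + 1 = y ∧ H (y - 1) y := by
  have e := hs.top_eq h1 hx hy.le hyx
  have := hs.link y (by omega) (by omega) (by omega)
  tauto

theorem nest (h : HTree n pa sz) {x : ℕ} (h1 : 1 ≤ x) (hx : x ≤ n) :
    x + sz x ≤ top x + sz (top x) := by
  induction x using Nat.strong_induction_on with
  | _ x ih =>
    by_cases hxt : top x = x
    · rw [hxt]
    · have h3 := hs.link x h1 hx hxt
      have := ih (x - 1) (by omega) (by omega) (by omega)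
      have h4 := h.par x h1 hx
      rw [h3.2.2.1] at this
      rw [show pa x = x - 1 by omega] at h4
      omega

/-- The ancestors between a vertex and the parent of the top of its segment are in its segment. -/
theorem top_eq_of_anc (h : HTree n pa sz) {u z w : ℕ} (hz1 : 1 ≤ z) (hw : w ≤ n) (hzw : z ≤ w)
    (hwu : w < u + sz u) (huz : u ≤ z) (hpu : pa (top z) < u) :
    top u = top z ∧ top z ≤ u := by
  have ht := hs.top_le z hz1 (by omega)
  have hn := hs.nest h hz1 (by omega)
  have : top z ≤ u := by
    by_contra hlt
    have := h.inner u (top z) (by omega) (by omega) (by omega)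
    omega
  exact ⟨hs.top_eq hz1 (by omega) this huz, this⟩

/-- The number of segments on the path to the root drops by one when a segment is left. -/
theorem ancCard_step (h : HTree n pa sz) {z : ℕ} (hz1 : 1 ≤ z) (hz : z ≤ n) :
    ancCard n sz (fun x => top x = x) (pa (top z)) + 1 ≤ ancCard n sz (fun x => top x = x) z := by
  classical
  have ht := hs.top_le z hz1 hz
  have hn := hs.nest h hz1 hz
  have hp := h.par (top z) ht.1 (by omega)
  have hpz := h.pos z hz
  rw [ancCard, ancCard, ← card_insert_of_notMem (a := top z)]
  · apply card_le_card
    intro x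
    simp only [mem_filter, mem_Icc, mem_insert]
    rintro (rfl | ⟨h1, h2, h3, h4⟩)
    · exact ⟨⟨ht.1, by omega⟩, hs.top_top hz1 hz, ht.2, by omega⟩
    · have := h.nest h1.2 h3 h4
      exact ⟨h1, h2, by omega, by omega⟩
  · simp only [mem_filter, mem_Icc]
    omega

end Segs

/-- If a segment starts only at a light vertex or at a failure, then there are few of them on
each path to the root. -/
theorem HTree.segs_le (h : HTree n pa sz) {top : ℕ → ℕ} {F C : ℕ → Prop} {kk : ℕ}
    (hstart : ∀ x, 1 ≤ x → x ≤ n → top x = x → pa x + 1 ≠ x ∨ x = 1 ∨ F x ∨ F (pa x) ∨ C x)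
    {w : ℕ} (hw : w ≤ n) (hF : ancCard n sz F w ≤ kk) (hC : ancCard n sz C w ≤ kk) :
    ancCard n sz (fun x => top x = x) w ≤ Nat.log 2 n + 2 + 3 * kk := by
  classical
  have h1 : ancCard n sz (fun x => top x = x) w ≤ ancCard n sz (fun x => pa x + 1 ≠ x ∨ x = 1 ∨ F x ∨
      (pa x + 1 = x ∧ 2 ≤ x ∧ F (pa x)) ∨ C x) w := ancCard_mono fun x h1 h2 _ _ h3 => by
    have := hstart x h1 h2 h3
    by_cases e : pa x + 1 = x
    · by_cases e' : x = 1
      · exact Or.inr (Or.inl e')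
      · have : 2 ≤ x := by omega
        tauto
    · exact Or.inl e
  -- a heavy child of a failed vertex is charged to this vertex
  have h2 : ancCard n sz (fun x => pa x + 1 = x ∧ 2 ≤ x ∧ F (pa x)) w ≤ ancCard n sz F w := by
    refine card_le_card_of_injOn (fun x => x - 1) ?_ ?_
    · intro x hx
      simp only [coe_filter, mem_Icc, Set.mem_ofPred_eq] at hx ⊢
      obtain ⟨h1, ⟨h2, h3, h4⟩, h5, h6⟩ := hx
      have := h.par x h1.1 h1.2
      rw [show pa x = x - 1 by omega] at this h4
      exact ⟨by omega, h4, by omega, by omega⟩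
    · intro x hx y hy hxy
      simp only [coe_filter, mem_Icc, Set.mem_ofPred_eq] at hx hy hxy
      omega
  have h3 := h.light_le_log hw
  have h4 := ancCard_eq_one (n := n) (sz := sz) (a := 1) (w := w)
  have i1 := ancCard_or (n := n) (sz := sz) (w := w) (P := fun x => pa x + 1 ≠ x) (Q := fun x => x = 1 ∨ F x ∨
      (pa x + 1 = x ∧ 2 ≤ x ∧ F (pa x)) ∨ C x)
  have i2 := ancCard_or (n := n) (sz := sz) (w := w) (P := fun x => x = 1) (Q := fun x => F x ∨
      (pa x + 1 = x ∧ 2 ≤ x ∧ F (pa x)) ∨ C x)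
  have i3 := ancCard_or (n := n) (sz := sz) (w := w) (P := F) (Q := fun x =>
      (pa x + 1 = x ∧ 2 ≤ x ∧ F (pa x)) ∨ C x)
  have i4 := ancCard_or (n := n) (sz := sz) (w := w) (P := fun x =>
      (pa x + 1 = x ∧ 2 ≤ x ∧ F (pa x))) (Q := C)
  omega

end

/-! ### Searching the lists of upper neighbours -/

section
open E Cmd

/-- The loop of a binary search for `v 11`. -/
def searchLoop : Cmd :=
  .loop (lt (v 12) (v 13)) (
    .set 14 (half (add (v 12) (v 13))) ;;
    .ite (lt (d 6 (v 14)) (v 11)) (.set 12 (add (v 14) (c 1))) (.set 13 (v 14)))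

/-- Binary search: variable `12` becomes the first position in the list of upper neighbours of
`v 10` whose entry is not below `v 11`. -/
def searchCmd : Cmd :=
  .set 12 (d 5 (v 10)) ;; .set 13 (d 5 (add (v 10) (c 1))) ;; searchLoop

/-- The same result as that of `searchCmd`, by means of the snapshot of `v 11` if `v 10` is in the
subtree of `v 11`. -/
def rankCmd : Cmd :=
  .ite (and (lt (v 11) (add (v 10) (c 1))) (lt (sub (v 10) (v 11)) (d 4 (v 11))))
    (.set 13 (d 7 (v 11)) ;;
      .set 12 (add (d 5 (v 10)) (sub (d 8 (add (add (v 13) (v 10)) (c 1))) (d 8 (add (v 13) (v 10))))) ;;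
      scanUp 12 (d 5 (add (v 10) (c 1))) (lt (d 6 (v 12)) (v 11)))
    searchCmd

/-- Decrease `x` down to `bound`, as long as `test` is true. -/
def scanDown (x : ℕ) (bound test : E) : Cmd :=
  .loop (.and (.lt bound (.v x)) test) (.set x (.sub (.v x) (.c 1)))

end

theorem scanDown_exists (P : ℕ → Prop) {a b : ℕ} (h : a ≤ b) :
    ∃ t, a ≤ t ∧ t ≤ b ∧ (∀ s, t < s → s ≤ b → P s) ∧ (a < t → ¬ P t) := by
  obtain ⟨t, -, h2, h3, h4⟩ := scan_exists (fun s => P (b - s)) (Nat.zero_le (b - a))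
  refine ⟨b - t, by omega, by omega, fun s h5 h6 => ?_, fun h5 => h4 (by omega)⟩
  have := h3 (b - s) (by omega) (by omega)
  rwa [show b - (b - s) = s by omega] at this

theorem WP_scanDown {Γ : Env} {x : ℕ} {bound test : E} {Q : Mach → ℕ → Prop} {σ : Mach} {k : ℕ}
    (P : ℕ → Prop) (t₀ t₁ lo k₀ : ℕ) (h1 : t₁ ≤ t₀) (h2 : lo ≤ t₁)
    (h3 : ∀ s, t₁ < s → s ≤ t₀ → P s) (h4 : lo < t₁ → ¬ P t₁) (hx : σ.reg x = t₀)
    (hB1 : 1 < Γ.B)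
    (hE : ∀ s, lo ≤ s → s ≤ t₀ → bound.ok Γ (σ.setr x s) ∧ test.ok Γ (σ.setr x s) ∧
      bound.ev Γ (σ.setr x s) = lo ∧ (lo < s → (test.ev Γ (σ.setr x s) ≠ 0 ↔ P s)))
    (hk : (t₀ - t₁ + 1) * (bound.cost + test.cost + 12) + k₀ ≤ k)
    (hQ : ∀ l, k₀ ≤ l → Q (σ.setr x t₁) l) : WP Γ (scanDown x bound test) Q σ k := by
  refine WP_loop (fun τ l => ∃ s, t₁ ≤ s ∧ s ≤ t₀ ∧ τ = σ.setr x s ∧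
    (s - t₁ + 1) * (bound.cost + test.cost + 12) + k₀ ≤ l)
    ⟨t₀, h1, le_rfl, (Mach.setr_self hx).symm, hk⟩ ?_
  rintro τ l - ⟨s, g1, g2, rfl, g3⟩
  obtain ⟨o1, o2, o3, o4⟩ := hE s (by omega) g2
  rw [Nat.add_mul] at g3
  simp only [E.ok, E.cost, E.ev, o3, o1, o2, Mach.setr_reg, if_true, true_and, and_true]
  refine ⟨by omega, fun h => ?_, fun h => ?_⟩
  · have hs : lo < s := by
      by_contra hn
      simp [hn] at h
    have ht : test.ev Γ (σ.setr x s) ≠ 0 := by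
      intro h0
      simp [h0] at h
    have hst : t₁ < s := by
      by_contra hn
      have : s = t₁ := by omega
      subst this
      exact h4 hs ((o4 hs).1 ht)
    obtain ⟨d, rfl⟩ : ∃ d, s = t₁ + 1 + d := ⟨s - (t₁ + 1), by omega⟩
    rw [show t₁ + 1 + d - t₁ = d + 1 by omega, Nat.add_mul] at g3
    refine ⟨⟨trivial, hB1⟩, ?_, t₁ + d, by omega, by omega, ?_, ?_⟩
    · simp only [E.cost]; omega
    · simp only [E.ev, Mach.setr_reg, if_true, Mach.setr_setr]
      rw [show t₁ + 1 + d - 1 = t₁ + d by omega]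
    · simp only [E.cost]
      rw [show t₁ + d - t₁ = d by omega, Nat.add_mul]
      omega
  · have hst : s = t₁ := by
      by_contra hn
      have hs : lo < s := by omega
      have := (o4 hs).2 (h3 s (by omega) g2)
      simp [hs, this] at h
    subst hst
    exact hQ _ (by omega)

/-- The list of `w` has at most `w` entries, since they are distinct and below `w`. -/
theorem UpLists.deg_le {n m : ℕ} {A : ℕ → ℕ → Prop} {off up : ℕ → ℕ} (h : UpLists n m A off up)
    (hA : ∀ u w, A u w → u < w) {w : ℕ} (hw : w ≤ n) : off (w + 1) - off w ≤ w := by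
  have : (Ico (off w) (off (w + 1))).card ≤ (range w).card := by
    refine card_le_card_of_injOn up ?_ ?_
    · intro t ht
      simp only [coe_Ico, Set.mem_Ico, coe_range, Set.mem_Iio] at ht ⊢
      exact hA _ _ (h.mem w hw t ht.1 ht.2)
    · intro t ht s hs hts
      simp only [coe_Ico, Set.mem_Ico] at ht hs
      by_contra hne
      rcases Nat.lt_or_gt_of_ne hne with hlt | hlt
      · have := h.incr w hw t s ht.1 hlt hs.2; omega
      · have := h.incr w hw s t hs.1 hlt ht.2; omega
  simpa using this

section
variable {Γ : Env} {n m : ℕ} {A : ℕ → ℕ → Prop} (hU : UpLists n m A (Γ.dat 5) (Γ.dat 6))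
  (hA : ∀ u w, A u w → u < w)
include hU hA

/-- The binary search takes logarithmic time: the length of the interval in question is halved. -/
theorem searchCmd_spec {w z : ℕ} (hw : w ≤ n) (hB : 2 * n + 2 * m + 100 ≤ Γ.B) {σ : Mach} {k k₀ : ℕ}
    {Q : Mach → ℕ → Prop} (r10 : σ.reg 10 = w) (r11 : σ.reg 11 = z)
    (hk : 70 * (Nat.log 2 n + 1) + k₀ ≤ k)
    (hQ : ∀ τ l, Fr searchCmd σ τ → τ.reg 12 = Γ.dat 5 w + rank (Γ.dat 5) (Γ.dat 6) w z →
      k₀ ≤ l → Q τ l) : WP Γ searchCmd Q σ k := by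
  refine WP_conseq (Q := fun τ l => τ.reg 12 = Γ.dat 5 w + rank (Γ.dat 5) (Γ.dat 6) w z ∧ k₀ ≤ l)
    ?_ fun τ l hF h => hQ τ l hF h.1 h.2
  have h1 := hU.mono w hw
  have h2 := hU.off_le (show w + 1 ≤ n + 1 by omega)
  have h3 := hU.deg_le hA hw
  have h4 := rank_le (Γ.dat 5) (Γ.dat 6) w z
  have h5 := size_le_log (h3.trans hw)
  simp only [searchCmd, WP, E.ev, E.ok, E.cost]
  simp [r10]
  and_intros
  all_goals try omega
  refine WP_loop (fun τ l => Γ.dat 5 w ≤ τ.reg 12 ∧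
      τ.reg 12 ≤ Γ.dat 5 w + rank (Γ.dat 5) (Γ.dat 6) w z ∧
      Γ.dat 5 w + rank (Γ.dat 5) (Γ.dat 6) w z ≤ τ.reg 13 ∧ τ.reg 13 ≤ Γ.dat 5 (w + 1) ∧
      30 * Nat.size (τ.reg 13 - τ.reg 12) + 10 + k₀ ≤ l) ?_ ?_
  · simp; omega
  · rintro τ l hF ⟨i1, i2, i3, i4, i5⟩
    have e11 := hF.r 11 rfl
    simp [r11] at e11
    simp only [E.ok, E.ev, E.cost]
    refine ⟨by simp, by omega, fun hc => ?_, fun hc => ?_⟩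
    · have hlt : τ.reg 12 < τ.reg 13 := by
        by_contra hn; simp [hn] at hc
      have hiff := hU.up_lt_iff (z := z) hw (t := (τ.reg 12 + τ.reg 13) / 2) (by omega) (by omega)
      have s1 := size_half (a := τ.reg 13 - ((τ.reg 12 + τ.reg 13) / 2 + 1))
        (b := τ.reg 13 - τ.reg 12) (by omega) (by omega)
      have s2 := size_half (a := (τ.reg 12 + τ.reg 13) / 2 - τ.reg 12)
        (b := τ.reg 13 - τ.reg 12) (by omega) (by omega)
      simp [WP, E.ev, E.ok, E.cost, e11]
      and_intros
      all_goals try omega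
    · have hlt : ¬ τ.reg 12 < τ.reg 13 := by
        intro hn; simp [hn] at hc
      omega

/-- If `w` is in the subtree of `z`, then the time is proportional to the error of the snapshot at
`w`; otherwise it is the time for a binary search. -/
theorem rankCmd_spec {len : ℕ}
    (hS : Snaps n (Γ.dat 4) (Γ.dat 5) (Γ.dat 6) (Γ.dat 7) (Γ.dat 8) (n + 1) len) {w z : ℕ} (hw : w ≤ n)
    (hB : 2 * n + 2 * m + len + 100 ≤ Γ.B) {σ : Mach} {k k₀ : ℕ}
    {Q : Mach → ℕ → Prop} (r10 : σ.reg 10 = w) (r11 : σ.reg 11 = z)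
    (hk : (if z ≤ w ∧ w < z + Γ.dat 4 z then
        40 * (rank (Γ.dat 5) (Γ.dat 6) w z - snap (Γ.dat 7) (Γ.dat 8) z w)
        else 70 * (Nat.log 2 n + 1)) + 150 + k₀ ≤ k)
    (hQ : ∀ τ l, Fr rankCmd σ τ → τ.reg 12 = Γ.dat 5 w + rank (Γ.dat 5) (Γ.dat 6) w z →
      k₀ ≤ l → Q τ l) : WP Γ rankCmd Q σ k := by
  refine WP_conseq (Q := fun τ l => τ.reg 12 = Γ.dat 5 w + rank (Γ.dat 5) (Γ.dat 6) w z ∧ k₀ ≤ l)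
    ?_ fun τ l hF h => hQ τ l hF h.1 h.2
  have h1 := hU.mono w hw
  have h2 := hU.off_le (show w + 1 ≤ n + 1 by omega)
  have h4 := rank_le (Γ.dat 5) (Γ.dat 6) w z
  simp only [rankCmd, WP, E.ev, E.ok, E.cost]
  simp only [r10, r11]
  and_intros
  all_goals try first | omega | trivial
  · intro hc
    have hc : z ≤ w ∧ w < z + Γ.dat 4 z := by
      by_contra hn
      apply hc
      rw [if_neg]
      simp
      omega
    rw [if_pos hc] at hk
    have ha := hS.adr_le z (by omega)
    have hl := hS.le z (by omega) w hc.1 hc.2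
    rw [snap] at hk hl
    simp [r10]
    and_intros
    all_goals try omega
    refine WP_scanUp (fun t => Γ.dat 6 t < z)
      (Γ.dat 5 w + (Γ.dat 8 (Γ.dat 7 z + w + 1) - Γ.dat 8 (Γ.dat 7 z + w)))
      (Γ.dat 5 w + rank (Γ.dat 5) (Γ.dat 6) w z) (Γ.dat 5 (w + 1)) k₀ (by omega) (by omega) ?_ ?_
      (by simp) (by omega) (by omega) ?_ ?_ ?_
    · intro t ht1 ht2
      exact (hU.up_lt_iff hw (by omega) (by omega)).2 ht2
    · intro ht
      rw [hU.up_lt_iff hw (by omega) ht]; omega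
    · intro t ht1 ht2
      simp [E.ev, E.ok, r10, r11]
      omega
    · simp only [E.cost]; omega
    · intro l hl
      simp [hl]
  · intro hc
    have hc : ¬ (z ≤ w ∧ w < z + Γ.dat 4 z) := by
      rintro ⟨c1, c2⟩
      simp [show z < w + 1 by omega, show w - z < Γ.dat 4 z by omega] at hc
    rw [if_neg hc] at hk
    exact searchCmd_spec hU hA hw (by omega) r10 r11 (k₀ := k₀) (by omega)
      fun τ l _ h1 h2 => ⟨h1, h2⟩

end

/-! ### Marking the failures -/

section
open E Cmd

/-- Mark the failed vertices in array `0`, and also the virtual root. -/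
def markVerts : Cmd :=
  .set 0 (d 0 (c 0)) ;; .put 0 (c 0) (c 1) ;; .set 6 (i 1 (c 0)) ;; .set 1 (c 0) ;;
  forUp 1 (v 6) (.put 0 (d 1 (add (i 1 (add (v 1) (c 2))) (c 1))) (c 1))

/-- Mark the positions of the failed edges in array `1`, and the lower endpoints of failed tree
edges in array `2`. -/
def markEdges : Cmd :=
  .set 6 (i 1 (c 1)) ;; .set 7 (add (i 1 (c 0)) (c 2)) ;; .set 1 (c 0) ;;
  forUp 1 (v 6) (
    .set 4 (d 1 (add (i 1 (v 7)) (c 1))) ;;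
    .set 5 (d 1 (add (i 1 (add (v 7) (c 1))) (c 1))) ;;
    .ite (lt (v 4) (v 5)) (.set 10 (v 5) ;; .set 11 (v 4)) (.set 10 (v 4) ;; .set 11 (v 5)) ;;
    searchCmd ;;
    .put 1 (v 12) (c 1) ;;
    .ite (eq (d 3 (v 10)) (v 11)) (.put 2 (v 10) (c 1)) .skip ;;
    .set 7 (add (v 7) (c 2)))

/-- Split the heavy paths into segments: array `3` contains the first vertex of the segment, and
arrays `4` and `5` the limits of the segment, at its first vertex. -/
def segLoop : Cmd :=
  .set 1 (c 1) ;;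
  forUp 1 (add (v 0) (c 1)) (
    .set 4 (sub (v 1) (c 1)) ;;
    .ite (and (and (eq (d 3 (v 1)) (v 4)) (eq (a 2 (v 1)) (c 0)))
        (and (eq (a 0 (v 1)) (c 0)) (eq (a 0 (v 4)) (c 0))))
      (.put 3 (v 1) (a 3 (v 4)) ;; .put 5 (a 3 (v 1)) (v 1))
      (.put 3 (v 1) (v 1) ;;
        .ite (a 0 (v 1)) (.put 4 (v 1) (c 1) ;; .put 5 (v 1) (c 0))
          (.put 4 (v 1) (v 1) ;; .put 5 (v 1) (v 1))))

end

/-- The list of failures in the input. -/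
structure FaultInput (Γ : Env) (kv ke : ℕ) (fv fa fb : ℕ → ℕ) : Prop where
  verts : Γ.get 1 0 = kv
  edges : Γ.get 1 1 = ke
  vert : ∀ i < kv, Γ.get 1 (i + 2) + 1 = fv i
  fst : ∀ j < ke, Γ.get 1 (kv + 2 + 2 * j) + 1 = fa j
  snd : ∀ j < ke, Γ.get 1 (kv + 2 + 2 * j + 1) + 1 = fb j

theorem markVerts_spec {Γ : Env} {n kv ke : ℕ} {fv fa fb : ℕ → ℕ}
    (hin : FaultInput Γ kv ke fv fa fb) (hn : Γ.dat 0 0 = n) (hB : n + kv + 10 ≤ Γ.B)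
    (hfv : ∀ i < kv, fv i ≤ n)
    {σ : Mach} {k k₀ : ℕ} {Q : Mach → ℕ → Prop} (h0 : ∀ x, σ.arr 0 x = 0)
    (hk : 100 * (kv + 1) + k₀ ≤ k)
    (hQ : ∀ τ l, Fr markVerts σ τ → τ.reg 0 = n →
      (∀ x, τ.arr 0 x ≠ 0 ↔ x = 0 ∨ ∃ i < kv, Γ.dat 1 (fv i) = x) → k₀ ≤ l → Q τ l) :
    WP Γ markVerts Q σ k := by
  refine WP_conseq (Q := fun τ l => τ.reg 0 = n ∧
      (∀ x, τ.arr 0 x ≠ 0 ↔ x = 0 ∨ ∃ i < kv, Γ.dat 1 (fv i) = x) ∧ k₀ ≤ l) ?_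
    fun τ l hF h => hQ τ l hF h.1 h.2.1 h.2.2
  simp only [markVerts, WP, E.ev, E.ok, E.cost]
  and_intros
  all_goals try first | omega | trivial
  refine WP_for 0 kv (fun i τ => ∀ x, τ.arr 0 x ≠ 0 ↔ x = 0 ∨ ∃ i' < i, Γ.dat 1 (fv i') = x)
    (fun _ => 60) k₀ (by simp) (by omega) (by omega) (by omega) ?_ ?_ ?_ ?_ ?_
  · intro x
    simp [Function.update_apply, h0]
  · simp [E.cost]; omega
  · intro τ hF
    have := hF.r 6 rfl
    simp [E.ev, E.ok, hin.verts] at this ⊢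
    omega
  · rintro j τ l h1 h2 hF hr hi hl
    have := hin.vert j h2
    have := hfv j h2
    simp [WP, E.ev, E.ok, E.cost, hr, hin.vert j h2]
    and_intros
    all_goals try omega
    intro x
    rw [Function.update_apply]
    split_ifs with hx
    · simp only [not_false_eq_true, true_iff]
      exact Or.inr ⟨j, le_rfl, hx.symm⟩
    · refine (hi x).trans ?_
      refine or_congr_right ⟨?_, ?_⟩
      · rintro ⟨i', h3, h4⟩; exact ⟨i', h3.le, h4⟩
      · rintro ⟨i', h3, h4⟩
        refine ⟨i', lt_of_le_of_ne h3 ?_, h4⟩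
        rintro rfl
        exact hx h4.symm
  · rintro τ l hF hr hi hl
    have := hF.r 0 rfl
    simp at this
    exact ⟨this.trans hn, hi, hl⟩

theorem UpLists.rank_eq {n m : ℕ} {A : ℕ → ℕ → Prop} {off up : ℕ → ℕ} (h : UpLists n m A off up)
    {w t : ℕ} (hw : w ≤ n) (h1 : off w ≤ t) (h2 : t < off (w + 1)) :
    off w + rank off up w (up t) = t := by
  have h3 := h.up_lt_iff (z := up t) hw h1 h2
  rcases Nat.lt_or_ge (off w + rank off up w (up t)) t with h4 | h4
  · have h5 := h.up_lt_iff (z := up t) hw (t := off w + rank off up w (up t)) (by omega) (by omega)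
    have := h.incr w hw (off w + rank off up w (up t)) t (by omega) h4 h2
    omega
  · omega

/-- Each failed edge is found in the list of its lower endpoint by a binary search. -/
theorem markEdges_spec {Γ : Env} {n m kv ke : ℕ} {fv fa fb lo hi : ℕ → ℕ} {A : ℕ → ℕ → Prop}
    (hin : FaultInput Γ kv ke fv fa fb) (hU : UpLists n m A (Γ.dat 5) (Γ.dat 6))
    (hA : ∀ u w, A u w → u < w) (hB : 2 * n + 2 * m + kv + 2 * ke + 100 ≤ Γ.B)
    (hf : ∀ j < ke, fa j ≤ n ∧ fb j ≤ n)
    (hlo : ∀ j < ke, lo j = min (Γ.dat 1 (fa j)) (Γ.dat 1 (fb j)))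
    (hhi : ∀ j < ke, hi j = max (Γ.dat 1 (fa j)) (Γ.dat 1 (fb j)))
    (hhn : ∀ j < ke, hi j ≤ n) (hadj : ∀ j < ke, A (lo j) (hi j))
    {σ : Mach} {k k₀ : ℕ} {Q : Mach → ℕ → Prop}
    (h1 : ∀ x, σ.arr 1 x = 0) (h2 : ∀ x, σ.arr 2 x = 0)
    (hk : 500 * (Nat.log 2 n + 1) * ke + 100 + k₀ ≤ k)
    (hQ : ∀ τ l, Fr markEdges σ τ →
      (∀ t, τ.arr 1 t ≠ 0 ↔ ∃ j < ke, Γ.dat 5 (hi j) ≤ t ∧ t < Γ.dat 5 (hi j + 1) ∧ Γ.dat 6 t = lo j) →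
      (∀ x, τ.arr 2 x ≠ 0 ↔ ∃ j < ke, hi j = x ∧ Γ.dat 3 x = lo j) → k₀ ≤ l → Q τ l) :
    WP Γ markEdges Q σ k := by
  refine WP_conseq (Q := fun τ l =>
      (∀ t, τ.arr 1 t ≠ 0 ↔ ∃ j < ke, Γ.dat 5 (hi j) ≤ t ∧ t < Γ.dat 5 (hi j + 1) ∧ Γ.dat 6 t = lo j) ∧
      (∀ x, τ.arr 2 x ≠ 0 ↔ ∃ j < ke, hi j = x ∧ Γ.dat 3 x = lo j) ∧ k₀ ≤ l) ?_
    fun τ l hF h => hQ τ l hF h.1 h.2.1 h.2.2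
  have hkv := hin.verts
  simp only [markEdges, WP, E.ev, E.ok, E.cost]
  and_intros
  all_goals try first | omega | trivial
  refine WP_for 0 ke (fun i τ => τ.reg 7 = kv + 2 + 2 * i ∧
      (∀ t, τ.arr 1 t ≠ 0 ↔ ∃ j < i, Γ.dat 5 (hi j) ≤ t ∧ t < Γ.dat 5 (hi j + 1) ∧ Γ.dat 6 t = lo j) ∧
      (∀ x, τ.arr 2 x ≠ 0 ↔ ∃ j < i, hi j = x ∧ Γ.dat 3 x = lo j))
    (fun _ => 70 * (Nat.log 2 n + 1) + 300) k₀ (by simp) (by omega) (by omega) (by omega) ?_ ?_ ?_ ?_ ?_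
  · simp [hkv, h1, h2]
  · simp only [sum_const, E.cost, Nat.card_Ico, smul_eq_mul]
    have h3 : ke * (70 * (Nat.log 2 n + 1) + 300 + 1 + 7) ≤ ke * (500 * (Nat.log 2 n + 1)) :=
      Nat.mul_le_mul le_rfl (by omega)
    rw [mul_comm ke (500 * _)] at h3
    rw [Nat.sub_zero]
    exact (Nat.add_le_add_right (Nat.add_le_add h3 (by norm_num : (1 + 3 : ℕ) ≤ 50)) k₀).trans (by omega)
  · intro τ hF
    have := hF.r 6 rfl
    simp [E.ev, E.ok, hin.edges] at this ⊢
    omega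
  · rintro j τ l - h2 hF hr ⟨i1, i2, i3⟩ hl
    have := hin.fst j h2
    have := hin.snd j h2
    have := hf j h2
    have ha := hhn j h2
    have hb := hadj j h2
    have hlt := hA _ _ hb
    have eh := hhi j h2
    have el := hlo j h2
    obtain ⟨t, t1, t2, t3⟩ := hU.surj _ _ ha hb
    have hrk := hU.rank_eq ha t1 t2
    have hom := hU.off_le (show hi j + 1 ≤ n + 1 by omega)
    have key : ∀ υ l', Fr searchCmd
        ((((τ.setr 4 (Γ.dat 1 (fa j))).setr 5 (Γ.dat 1 (fb j))).setr 10 (hi j)).setr 11 (lo j)) υ →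
        υ.reg 12 = Γ.dat 5 (hi j) + rank (Γ.dat 5) (Γ.dat 6) (hi j) (lo j) →
        l - 70 * (Nat.log 2 n + 1) - 150 ≤ l' →
        WP Γ (.put 1 (.v 12) (.c 1) ;; .ite (.eq (.d 3 (.v 10)) (.v 11)) (.put 2 (.v 10) (.c 1)) .skip ;;
          .set 7 (.add (.v 7) (.c 2))) (fun τ' l' => τ'.reg 1 = j ∧ ((τ'.setr 1 (j + 1)).reg 7 =
            kv + 2 + 2 * (j + 1) ∧ (∀ t, (τ'.setr 1 (j + 1)).arr 1 t ≠ 0 ↔ ∃ i < j + 1, Γ.dat 5 (hi i) ≤ t ∧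
            t < Γ.dat 5 (hi i + 1) ∧ Γ.dat 6 t = lo i) ∧ (∀ x, (τ'.setr 1 (j + 1)).arr 2 x ≠ 0 ↔
            ∃ i < j + 1, hi i = x ∧ Γ.dat 3 x = lo i)) ∧ l ≤ l' + (70 * (Nat.log 2 n + 1) + 300)) υ l' := by
      intro υ l' hF' h12 hl'
      have q1 := hF'.r 1 rfl
      have q7 := hF'.r 7 rfl
      have q10 := hF'.r 10 rfl
      have q11 := hF'.r 11 rfl
      have b1 := hF'.a 1 rfl
      have b2 := hF'.a 2 rfl
      simp [hr, i1] at q1 q7 q10 q11 b1 b2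
      rw [← t3, hrk] at h12
      have c1 : ∀ s, Function.update (τ.arr 1) t 1 s ≠ 0 ↔ ∃ i < j + 1, Γ.dat 5 (hi i) ≤ s ∧
            s < Γ.dat 5 (hi i + 1) ∧ Γ.dat 6 s = lo i := by
        intro s
        rw [Function.update_apply]
        split_ifs with hs
        · simp only [ne_eq, one_ne_zero, not_false_eq_true, true_iff]
          exact ⟨j, by omega, by rw [hs]; exact ⟨t1, t2, t3⟩⟩
        · rw [i2 s]
          refine ⟨?_, ?_⟩
          · rintro ⟨i', h3, h4⟩; exact ⟨i', by omega, h4⟩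
          · rintro ⟨i', h3, h4⟩
            refine ⟨i', lt_of_le_of_ne (Nat.le_of_lt_succ h3) ?_, h4⟩
            rintro rfl
            have h5 := hU.rank_eq ha h4.1 h4.2.1
            rw [h4.2.2, ← t3] at h5
            omega
      have c2 : ∀ x, (if x = hi j ∧ Γ.dat 3 x = lo j then 1 else τ.arr 2 x) ≠ 0 ↔
            ∃ i < j + 1, hi i = x ∧ Γ.dat 3 x = lo i := by
        intro x
        split_ifs with hx
        · simp only [ne_eq, one_ne_zero, not_false_eq_true, true_iff]
          exact ⟨j, by omega, hx.1.symm, hx.2⟩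
        · rw [i3 x]
          refine ⟨?_, ?_⟩
          · rintro ⟨i', h3, h4⟩; exact ⟨i', by omega, h4⟩
          · rintro ⟨i', h3, h4⟩
            refine ⟨i', lt_of_le_of_ne (Nat.le_of_lt_succ h3) ?_, h4⟩
            rintro rfl
            exact hx ⟨h4.1.symm, h4.2⟩
      simp only [WP, E.ev, E.ok, E.cost, Mach.put_reg, q10, q11, q7, h12]
      and_intros
      all_goals try first | omega | trivial
      · intro hc
        have hc : Γ.dat 3 (hi j) = lo j := by
          by_contra hn; simp [hn] at hc
        simp [q1, b1, b2]
        and_intros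
        all_goals try omega
        · intro s; have := c1 s; simpa [Nat.lt_succ_iff] using this
        · intro x; have := c2 x; rw [Function.update_apply]
          by_cases hx : x = hi j
          · subst hx; simpa [hc, Nat.lt_succ_iff] using this
          · simpa [hx, Nat.lt_succ_iff] using this
      · intro hc
        have hc : Γ.dat 3 (hi j) ≠ lo j := by
          intro hn; simp [hn] at hc
        simp [q1, b1, b2]
        and_intros
        all_goals try omega
        · intro s; have := c1 s; simpa [Nat.lt_succ_iff] using this
        · intro x; have := c2 x
          rw [if_neg (by rintro ⟨rfl, h⟩; exact hc h)] at this
          simpa [Nat.lt_succ_iff] using this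
    have e1 : Γ.get 1 (kv + 2 + 2 * j) + 1 = fa j := hin.fst j h2
    have e2 : Γ.get 1 (kv + 2 + 2 * j + 1) + 1 = fb j := hin.snd j h2
    have hcost := Nat.le_add_left 1 (Nat.log 2 n)
    simp only [WP, E.ev, E.ok, E.cost, i1, e1, Mach.setr_reg]
    simp only [show (7 = 4) = False by simp, if_false, e2]
    and_intros
    all_goals try first | omega | trivial
    · intro hc
      have hc : Γ.dat 1 (fa j) < Γ.dat 1 (fb j) := by
        by_contra hn; simp [hn] at hc
      rw [max_eq_right hc.le] at eh
      rw [min_eq_left hc.le] at el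
      refine ⟨trivial, by omega, trivial, by omega, ?_⟩
      simp only [show (4 = 10) = False by simp, show (4 = 5) = False by simp, if_false, if_true]
      rw [← eh, ← el]
      rw [← eh, ← el] at key
      refine searchCmd_spec hU hA ha (by omega) (z := lo j) (by simp) (by simp)
        (k₀ := l - 70 * (Nat.log 2 n + 1) - 150) (by omega) key
    · intro hc
      have hc : ¬ Γ.dat 1 (fa j) < Γ.dat 1 (fb j) := by
        intro hn; simp [hn] at hc
      rw [max_eq_left (by omega)] at eh
      rw [min_eq_right (by omega)] at el
      refine ⟨trivial, by omega, trivial, by omega, ?_⟩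
      simp only [show (5 = 10) = False by simp, show (4 = 5) = False by simp, if_false, if_true]
      rw [← eh, ← el]
      rw [← eh, ← el] at key
      refine searchCmd_spec hU hA ha (by omega) (z := lo j) (by simp) (by simp)
        (k₀ := l - 70 * (Nat.log 2 n + 1) - 150) (by omega) key
  · rintro τ l hF hr ⟨i1, i2, i3⟩ hl
    exact ⟨i2, i3, hl⟩

/-! ### The unvisited parts of the segments -/

/-- The unvisited vertices of a segment are those between two limits, which are stored at the top
of the segment. -/
structure Limits (n : ℕ) (vis top loq hiq : ℕ → ℕ) : Prop where
  mem : ∀ x, 1 ≤ x → x ≤ n → vis x = 0 → loq (top x) ≤ x ∧ x ≤ hiq (top x)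
  own : ∀ q, 1 ≤ q → q ≤ n → top q = q → ∀ x, loq q ≤ x → x ≤ hiq q →
    1 ≤ x ∧ x ≤ n ∧ vis x = 0 ∧ top x = q

/-- The property of the tops of segments that limits their number. -/
def SegStart (n : ℕ) (pa vis cut top : ℕ → ℕ) : Prop :=
  ∀ x, 1 ≤ x → x ≤ n → top x = x →
    pa x + 1 ≠ x ∨ x = 1 ∨ vis x ≠ 0 ∨ vis (pa x) ≠ 0 ∨ cut x ≠ 0

section
variable {n : ℕ} {pa vis cut top loq hiq : ℕ → ℕ} {H : ℕ → ℕ → Prop}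

/-- The vertex `n + 1` joins the segment of its parent `n`. -/
theorem Segs.extend (h : Segs n pa H top) (h2 : 1 ≤ n) (hp : pa (n + 1) = n) (hH : H n (n + 1)) :
    Segs (n + 1) pa H (Function.update top (n + 1) (top n)) := by
  constructor
  · intro x h1 hx
    by_cases hxn : x = n + 1
    · subst hxn
      have := h.top_le n h2 le_rfl
      simp; omega
    · rw [Function.update_of_ne hxn]; exact h.top_le x h1 (by omega)
  · intro x h1 hx
    by_cases hxn : x = n + 1
    · subst hxn
      intro _
      simp [hp, hH]; omega
    · rw [Function.update_of_ne hxn, Function.update_of_ne (show x - 1 ≠ n + 1 by omega)]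
      exact h.link x h1 (by omega)

/-- The vertex `n + 1` starts a new segment. -/
theorem Segs.start (h : Segs n pa H top) : Segs (n + 1) pa H (Function.update top (n + 1) (n + 1)) := by
  constructor
  · intro x h1 hx
    by_cases hxn : x = n + 1
    · subst hxn; simp
    · rw [Function.update_of_ne hxn]; exact h.top_le x h1 (by omega)
  · intro x h1 hx
    by_cases hxn : x = n + 1
    · subst hxn; simp
    · rw [Function.update_of_ne hxn, Function.update_of_ne (show x - 1 ≠ n + 1 by omega)]
      exact h.link x h1 (by omega)

theorem Limits.extend (hs : Segs n pa H top) (h : Limits n vis top loq hiq) (h2 : 1 ≤ n)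
    (hv : vis n = 0) (hv' : vis (n + 1) = 0) :
    Limits (n + 1) vis (Function.update top (n + 1) (top n)) loq
      (Function.update hiq (top n) (n + 1)) := by
  have hm := h.mem n h2 le_rfl hv
  have ht := hs.top_le n h2 le_rfl
  constructor
  · intro x h1 hx hvx
    by_cases hxn : x = n + 1
    · subst hxn; simp; omega
    · rw [Function.update_of_ne hxn]
      have := h.mem x h1 (by omega) hvx
      rw [Function.update_apply]
      split_ifs <;> omega
  · intro q h1 hq htq x hx1 hx2
    by_cases hqn : q = n + 1
    · subst hqn; simp at htq; omega
    rw [Function.update_of_ne hqn] at htq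
    by_cases hqt : q = top n
    · subst hqt
      rw [Function.update_self] at hx2
      by_cases hxn : x = n + 1
      · subst hxn; simp [hv']
      · rw [Function.update_of_ne hxn]
        have := h.own (top n) ht.1 ht.2 (hs.top_top h2 le_rfl) x hx1 (by omega)
        refine ⟨this.1, by omega, this.2.2⟩
    · rw [Function.update_of_ne hqt] at hx2
      have := h.own q h1 (by omega) htq x hx1 hx2
      rw [Function.update_of_ne (by omega)]
      exact ⟨this.1, by omega, this.2.2⟩

theorem Limits.start (h : Limits n vis top loq hiq) (hs : Segs n pa H top) {lo hi : ℕ}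
    (hlh : vis (n + 1) = 0 ∧ lo = n + 1 ∧ hi = n + 1 ∨ vis (n + 1) ≠ 0 ∧ lo = 1 ∧ hi = 0) :
    Limits (n + 1) vis (Function.update top (n + 1) (n + 1)) (Function.update loq (n + 1) lo)
      (Function.update hiq (n + 1) hi) := by
  constructor
  · intro x h1 hx hvx
    by_cases hxn : x = n + 1
    · subst hxn; simp; omega
    · have := h.mem x h1 (by omega) hvx
      have := hs.top_le x h1 (by omega)
      rw [Function.update_of_ne hxn, Function.update_of_ne (by omega),
        Function.update_of_ne (by omega)]
      omega
  · intro q h1 hq htq x hx1 hx2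
    by_cases hqn : q = n + 1
    · subst hqn
      rw [Function.update_self] at hx1 hx2
      obtain rfl : x = n + 1 := by omega
      simp; omega
    · rw [Function.update_of_ne hqn] at hx1 hx2 htq
      have := h.own q h1 (by omega) htq x hx1 hx2
      rw [Function.update_of_ne (by omega)]
      exact ⟨this.1, by omega, this.2.2⟩

end

/-- The segments: they follow the heavy paths and are cut at failed vertices and failed tree edges.
-/
theorem segLoop_spec {Γ : Env} {n : ℕ} {H : ℕ → ℕ → Prop} {vis cut : ℕ → ℕ}
    (hB : 2 * n + 10 ≤ Γ.B) (hv0 : vis 0 ≠ 0)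
    (hH : ∀ x, 2 ≤ x → x ≤ n → Γ.dat 3 x + 1 = x → vis x = 0 → vis (x - 1) = 0 → cut x = 0 → H (x - 1) x)
    {σ : Mach} {k k₀ : ℕ} {Q : Mach → ℕ → Prop} (r0 : σ.reg 0 = n) (a0 : σ.arr 0 = vis)
    (a2 : σ.arr 2 = cut) (hk : 200 * (n + 1) + k₀ ≤ k)
    (hQ : ∀ τ l, Fr segLoop σ τ → Segs n (Γ.dat 3) H (τ.arr 3) →
      Limits n vis (τ.arr 3) (τ.arr 4) (τ.arr 5) → SegStart n (Γ.dat 3) vis cut (τ.arr 3) →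
      k₀ ≤ l → Q τ l) :
    WP Γ segLoop Q σ k := by
  refine WP_conseq (Q := fun τ l => Segs n (Γ.dat 3) H (τ.arr 3) ∧
      Limits n vis (τ.arr 3) (τ.arr 4) (τ.arr 5) ∧ SegStart n (Γ.dat 3) vis cut (τ.arr 3) ∧ k₀ ≤ l) ?_
    fun τ l hF h => hQ τ l hF h.1 h.2.1 h.2.2.1 h.2.2.2
  simp only [segLoop, WP, E.ev, E.ok, E.cost]
  and_intros
  all_goals try first | omega | trivial
  refine WP_for 1 (n + 1) (fun i τ => Segs (i - 1) (Γ.dat 3) H (τ.arr 3) ∧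
      Limits (i - 1) vis (τ.arr 3) (τ.arr 4) (τ.arr 5) ∧ SegStart (i - 1) (Γ.dat 3) vis cut (τ.arr 3))
    (fun _ => 150) k₀ (by simp) (by omega) (by omega) (by omega) ?_ ?_ ?_ ?_ ?_
  · refine ⟨⟨?_, ?_⟩, ⟨?_, ?_⟩, fun x => ?_⟩ <;> intros <;> omega
  · simp [E.cost]; omega
  · intro τ hF
    have := hF.r 0 rfl
    simp [E.ev, E.ok] at this ⊢
    omega
  · rintro x τ l h1 h2 hF hr ⟨i1, i2, i3⟩ hl
    have e0 := hF.a 0 rfl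
    have e2 := hF.a 2 rfl
    simp only [Mach.setr_arr, a0, a2] at e0 e2
    obtain ⟨p, rfl⟩ : ∃ p, x = p + 1 := ⟨x - 1, by omega⟩
    simp only [Nat.add_sub_cancel] at i1 i2 i3
    simp only [WP, E.ev, E.ok, E.cost, hr]
    simp only [Mach.setr_reg, Mach.setr_arr, e0, e2, hr, if_true, if_false,
      show (1 = 4) = False by simp, Nat.add_sub_cancel]
    and_intros
    all_goals try first | omega | trivial
    · intro hc
      have hc : Γ.dat 3 (p + 1) = p ∧ cut (p + 1) = 0 ∧ vis (p + 1) = 0 ∧ vis p = 0 := by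
        simp at hc; tauto
      have hp1 : 1 ≤ p := by
        by_contra hn
        obtain rfl : p = 0 := by omega
        exact hv0 hc.2.2.2
      simp [hr]
      and_intros
      all_goals try omega
      · exact i1.extend hp1 hc.1 (hH (p + 1) (by omega) (by omega) (by omega) hc.2.2.1 hc.2.2.2 hc.2.1)
      · have := i2.extend i1 hp1 hc.2.2.2 hc.2.2.1
        exact this
      · intro y g1 g2 g3
        by_cases hy : y = p + 1
        · subst hy
          have := i1.top_le p hp1 le_rfl
          simp at g3; omega
        · rw [Function.update_of_ne hy] at g3
          exact i3 y g1 (by omega) g3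
    · intro hc
      have hc : Γ.dat 3 (p + 1) ≠ p ∨ cut (p + 1) ≠ 0 ∨ vis (p + 1) ≠ 0 ∨ vis p ≠ 0 := by
        simp at hc; tauto
      have hst : SegStart (p + 1) (Γ.dat 3) vis cut (Function.update (τ.arr 3) (p + 1) (p + 1)) := by
        intro y g1 g2 g3
        by_cases hy : y = p + 1
        · subst hy
          by_cases e : Γ.dat 3 (p + 1) = p
          · rw [e]; tauto
          · left; omega
        · rw [Function.update_of_ne hy] at g3
          exact i3 y g1 (by omega) g3
      simp [hr, e0]
      and_intros
      all_goals try omega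
      · intro hv
        and_intros
        all_goals try omega
        · exact i1.start
        · exact i2.start i1 (Or.inr ⟨hv, rfl, rfl⟩)
      · intro hv
        and_intros
        all_goals try omega
        · exact i1.start
        · exact i2.start i1 (Or.inl ⟨hv, rfl, rfl⟩)
  · rintro τ l hF hr ⟨i1, i2, i3⟩ hl
    exact ⟨i1, i2, i3, hl⟩

/-! ### Recording edges below newly visited vertices -/

section
open E Cmd

/-- Push `v 10` on the list of `v 15`. -/
def pushCmd : Cmd :=
  .set 3 (add (v 3) (c 1)) ;; .put 8 (v 3) (v 10) ;; .put 9 (v 3) (a 7 (v 15)) ;;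
  .put 7 (v 15) (v 3)

/-- Push `v 10` on the list of its upper neighbour at position `v 12`, if there is one and it is
between `v 7` and `v 8`. -/
def tryPush : Cmd :=
  .ite (and (lt (v 12) (d 5 (add (v 10) (c 1))))
      (and (lt (d 6 (v 12)) (add (v 8) (c 1))) (lt (v 7) (add (d 6 (v 12)) (c 1)))))
    (.set 15 (d 6 (v 12)) ;; pushCmd) .skip

/-- From position `v 12` on, find the first upper neighbour that is not above `v 8` and whose edge
has not failed. -/
def pickUp : Cmd :=
  scanUp 12 (d 5 (add (v 10) (c 1))) (and (a 1 (v 12)) (lt (d 6 (v 12)) (add (v 8) (c 1))))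

/-- Before position `v 12`, find the last upper neighbour that is not below `v 7` and whose edge
has not failed. -/
def pickDown : Cmd :=
  scanDown 12 (d 5 (v 10))
    (and (a 1 (sub (v 12) (c 1))) (lt (v 7) (add (d 6 (sub (v 12) (c 1))) (c 1)))) ;;
  .ite (lt (d 5 (v 10)) (v 12)) (.set 12 (sub (v 12) (c 1))) (.set 12 (d 5 (add (v 10) (c 1))))

/-- For each vertex in the subtree of `v 7`, record one upper neighbour among the vertices from
`v 7` to `v 8`, if there is one. -/
def recordCmd (pick : Cmd) : Cmd :=
  .set 10 (v 7) ;; .set 16 (add (v 7) (d 4 (v 7))) ;;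
  forUp 10 (v 16) (rankCmd ;; pick ;; tryPush)

end

/-- `u` is an upper neighbour of `w`, by an edge that has not failed. -/
def UpEdge (n : ℕ) (off up bad : ℕ → ℕ) (u w : ℕ) : Prop :=
  w ≤ n ∧ ∃ t, off w ≤ t ∧ t < off (w + 1) ∧ up t = u ∧ bad t = 0

/-- The number of failed edges from `w` to vertices from `a` to `b`. -/
def badCount (off up bad : ℕ → ℕ) (a b w : ℕ) : ℕ :=
  ((Ico (off w) (off (w + 1))).filter fun t => bad t ≠ 0 ∧ a ≤ up t ∧ up t ≤ b).card

/-- The linked lists in the arrays `7` (heads), `8` (items) and `9` (links) are `lst`. -/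
def HasLists (τ : Mach) (lst : ℕ → List ℕ) : Prop :=
  ∀ u, Chain (τ.arr 8) (τ.arr 9) (τ.reg 3) (τ.arr 7 u) (lst u)

/-- The lists `lst'` arise from `lst` by recording, for the vertices from `a` below `e`, a most
preferred (in the sense of `R`) upper neighbour among the vertices from `a` to `b`. -/
structure Recorded (P : ℕ → ℕ → Prop) (R : ℕ → ℕ → Prop) (n a b e : ℕ) (lst lst' : ℕ → List ℕ) :
    Prop where
  keep : ∀ u w, w ∈ lst u → w ∈ lst' u
  sound : ∀ u w, w ∈ lst' u → w ∈ lst u ∨ (a ≤ u ∧ u ≤ b ∧ P u w)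
  compl : ∀ w, a ≤ w → w < e → ∀ u, a ≤ u → u ≤ b → P u w →
    ∃ u', a ≤ u' ∧ u' ≤ b ∧ R u' u ∧ w ∈ lst' u'
  length : ∑ u ∈ Icc 1 n, (lst' u).length ≤ ∑ u ∈ Icc 1 n, (lst u).length + (e - a)

/-- The vertex `e` has no edge to record. -/
theorem Recorded.skip {P R : ℕ → ℕ → Prop} {n a b e : ℕ} {lst lst' : ℕ → List ℕ}
    (h : Recorded P R n a b e lst lst') (hn : ∀ u, a ≤ u → u ≤ b → ¬ P u e) :
    Recorded P R n a b (e + 1) lst lst' := by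
  refine ⟨h.keep, h.sound, fun w h1 h2 u h3 h4 h5 => ?_, h.length.trans (by omega)⟩
  rcases Nat.lt_or_ge w e with hw | hw
  · exact h.compl w h1 hw u h3 h4 h5
  · obtain rfl : w = e := by omega
    exact absurd h5 (hn u h3 h4)

/-- The upper neighbour `u₀` of `e` is recorded. -/
theorem Recorded.push {P R : ℕ → ℕ → Prop} {n a b e u₀ : ℕ} {lst lst' : ℕ → List ℕ}
    (h : Recorded P R n a b e lst lst') (hae : a ≤ e) (h1 : a ≤ u₀) (h2 : u₀ ≤ b) (h3 : P u₀ e)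
    (hR : ∀ u, a ≤ u → u ≤ b → P u e → R u₀ u) :
    Recorded P R n a b (e + 1) lst (Function.update lst' u₀ (e :: lst' u₀)) := by
  have hm : ∀ u w, w ∈ lst' u → w ∈ Function.update lst' u₀ (e :: lst' u₀) u := by
    intro u w hw
    by_cases hu : u = u₀
    · subst hu; simp [hw]
    · simpa [hu] using hw
  refine ⟨fun u w hw => hm u w (h.keep u w hw), fun u w hw => ?_, fun w g1 g2 u g3 g4 g5 => ?_, ?_⟩
  · by_cases hu : u = u₀
    · subst hu
      simp only [Function.update_self, List.mem_cons] at hw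
      rcases hw with rfl | hw
      · exact Or.inr ⟨h1, h2, h3⟩
      · exact h.sound u w hw
    · rw [Function.update_of_ne hu] at hw
      exact h.sound u w hw
  · rcases Nat.lt_or_ge w e with hw | hw
    · obtain ⟨u', k1, k2, k3, k4⟩ := h.compl w g1 hw u g3 g4 g5
      exact ⟨u', k1, k2, k3, hm u' w k4⟩
    · obtain rfl : w = e := by omega
      exact ⟨u₀, h1, h2, hR u g3 g4 g5, by simp⟩
  · have : ∀ u, (Function.update lst' u₀ (e :: lst' u₀) u).length =
        (lst' u).length + if u = u₀ then 1 else 0 := by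
      intro u
      by_cases hu : u = u₀
      · subst hu; simp
      · simp [hu]
    rw [sum_congr rfl fun u _ => this u, sum_add_distrib]
    have h4 : ∑ u ∈ Icc 1 n, (if u = u₀ then 1 else 0) ≤ 1 := by
      rw [sum_ite_eq']; split_ifs <;> simp
    have := h.length
    omega

theorem HasLists.push {τ : Mach} {lst : ℕ → List ℕ} (h : HasLists τ lst) (u w : ℕ)
    (τ' : Mach) (h3 : τ'.reg 3 = τ.reg 3 + 1)
    (h7 : τ'.arr 7 = Function.update (τ.arr 7) u (τ.reg 3 + 1))
    (h8 : τ'.arr 8 = Function.update (τ.arr 8) (τ.reg 3 + 1) w)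
    (h9 : τ'.arr 9 = Function.update (τ.arr 9) (τ.reg 3 + 1) (τ.arr 7 u)) :
    HasLists τ' (Function.update lst u (w :: lst u)) := by
  have hm : ∀ {x l}, Chain (τ.arr 8) (τ.arr 9) (τ.reg 3) x l →
      Chain (τ'.arr 8) (τ'.arr 9) (τ'.reg 3) x l := by
    intro x l
    refine Chain.mono (by omega) (fun i hi => ?_) (fun i hi => ?_)
    · rw [h8, Function.update_of_ne (by omega)]
    · rw [h9, Function.update_of_ne (by omega)]
  intro u'
  by_cases hu : u' = u
  · subst hu
    rw [h7]
    simp only [Function.update_self]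
    refine ⟨by omega, by omega, by rw [h8]; simp, ?_⟩
    have e : τ'.arr 9 (τ.reg 3 + 1) = τ.arr 7 u' := by rw [h9, Function.update_self]
    rw [e]
    exact hm (h u')
  · rw [h7, Function.update_of_ne hu, Function.update_of_ne hu]
    exact hm (h u')

section
variable {Γ : Env} {n m : ℕ} {A : ℕ → ℕ → Prop} {bad : ℕ → ℕ}

/-- What `pickUp` and `pickDown` are required to do after `rankCmd`, for the preference `R`. -/
def Picks (Γ : Env) (n : ℕ) (bad : ℕ → ℕ) (R : ℕ → ℕ → Prop) (a b z : ℕ) (pick : Cmd) : Prop :=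
  ∀ (w : ℕ) (σ : Mach) (k k₀ : ℕ) (Q : Mach → ℕ → Prop), w ≤ n → σ.arr 1 = bad → σ.reg 7 = a →
    σ.reg 8 = b → σ.reg 10 = w → σ.reg 12 = Γ.dat 5 w + rank (Γ.dat 5) (Γ.dat 6) w z →
    60 * badCount (Γ.dat 5) (Γ.dat 6) bad a b w + 150 + k₀ ≤ k →
    (∀ τ l, Fr pick σ τ → τ.reg 12 ≤ Γ.dat 5 (w + 1) → Γ.dat 5 w ≤ τ.reg 12 →
      (τ.reg 12 < Γ.dat 5 (w + 1) → a ≤ Γ.dat 6 (τ.reg 12) → Γ.dat 6 (τ.reg 12) ≤ b →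
        bad (τ.reg 12) = 0) →
      (∀ u, a ≤ u → u ≤ b → UpEdge n (Γ.dat 5) (Γ.dat 6) bad u w →
        τ.reg 12 < Γ.dat 5 (w + 1) ∧ a ≤ Γ.dat 6 (τ.reg 12) ∧ Γ.dat 6 (τ.reg 12) ≤ b ∧
          R (Γ.dat 6 (τ.reg 12)) u) → k₀ ≤ l → Q τ l) →
    WP Γ pick Q σ k

theorem UpLists.up_mono {off up : ℕ → ℕ} (h : UpLists n m A off up) {w t t' : ℕ} (hw : w ≤ n)
    (h1 : off w ≤ t) (h2 : t ≤ t') (h3 : t' < off (w + 1)) : up t ≤ up t' := by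
  rcases Nat.lt_or_eq_of_le h2 with h4 | rfl
  · exact (h.incr w hw t t' h1 h4 h3).le
  · exact le_rfl

/-- The part from `a` to `b` has been visited upwards, so that the smallest upper neighbour in it
was visited last. It is found by a scan from the rank at `a`. -/
theorem pickUp_spec (hU : UpLists n m A (Γ.dat 5) (Γ.dat 6)) {a b : ℕ} (hb : b ≤ n)
    (hB : 2 * n + 2 * m + 100 ≤ Γ.B) : Picks Γ n bad (· ≤ ·) a b a pickUp := by
  intro w σ k k₀ Q hw a1 r7 r8 r10 r12 hk hQ
  have h1 := hU.mono w hw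
  have h2 := hU.off_le (show w + 1 ≤ n + 1 by omega)
  have h4 := rank_le (Γ.dat 5) (Γ.dat 6) w a
  obtain ⟨t, t1, t2, t3, t4⟩ := scan_exists (fun s => bad s ≠ 0 ∧ Γ.dat 6 s ≤ b)
    (show Γ.dat 5 w + rank (Γ.dat 5) (Γ.dat 6) w a ≤ Γ.dat 5 (w + 1) by omega)
  have hge : ∀ s, Γ.dat 5 w + rank (Γ.dat 5) (Γ.dat 6) w a ≤ s → s < Γ.dat 5 (w + 1) →
      a ≤ Γ.dat 6 s := by
    intro s hs1 hs2
    have := hU.up_lt_iff (z := a) hw (t := s) (by omega) hs2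
    omega
  have hcount : t - (Γ.dat 5 w + rank (Γ.dat 5) (Γ.dat 6) w a) ≤
      badCount (Γ.dat 5) (Γ.dat 6) bad a b w := by
    have : Ico (Γ.dat 5 w + rank (Γ.dat 5) (Γ.dat 6) w a) t ⊆
        (Ico (Γ.dat 5 w) (Γ.dat 5 (w + 1))).filter
          fun t => bad t ≠ 0 ∧ a ≤ Γ.dat 6 t ∧ Γ.dat 6 t ≤ b := by
      intro s
      simp only [mem_Ico, mem_filter]
      intro hs
      have := t3 s hs.1 hs.2
      exact ⟨by omega, this.1, hge s hs.1 (by omega), this.2⟩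
    simpa [badCount] using card_le_card this
  refine WP_conseq (WP_scanUp (fun s => bad s ≠ 0 ∧ Γ.dat 6 s ≤ b) _ t (Γ.dat 5 (w + 1)) k₀ t1 t2 t3 t4
    r12 (by omega) (by omega) ?_ ?_ (Q := fun τ l => τ = σ.setr 12 t ∧ k₀ ≤ l) ?_) ?_
  · intro s hs1 hs2
    simp [E.ok, E.ev, r10, a1, r8]
    omega
  · simp only [E.cost]; omega
  · exact fun l hl => ⟨rfl, hl⟩
  · rintro τ l hF ⟨rfl, hl⟩
    refine hQ _ l hF (by simpa using t2) (by simp; omega) ?_ ?_ hl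
    · simp only [Mach.setr_reg, if_true]
      intro g1 g2 g3
      have := t4 g1
      by_contra hne
      exact this ⟨hne, g3⟩
    · rintro u g1 g2 ⟨-, s, s1, s2, rfl, s4⟩
      simp only [Mach.setr_reg, if_true]
      have hs : Γ.dat 5 w + rank (Γ.dat 5) (Γ.dat 6) w a ≤ s := by
        have := hU.up_lt_iff (z := a) hw (t := s) (by omega) s2
        omega
      have hts : t ≤ s := by
        by_contra hlt
        exact (t3 s hs (by omega)).1 s4
      have hm := hU.up_mono hw (by omega) hts s2
      exact ⟨by omega, hge t t1 (by omega), by omega, hm⟩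

/-- The part from `a` to `b` has been visited downwards, so that the largest upper neighbour in it
was visited last. It is found by a scan from the rank at `b + 1`. -/
theorem pickDown_spec (hU : UpLists n m A (Γ.dat 5) (Γ.dat 6)) {a b : ℕ}
    (hB : 2 * n + 2 * m + 100 ≤ Γ.B) (hup : ∀ t, Γ.dat 6 t + 1 < Γ.B) :
    Picks Γ n bad (fun u' u => u ≤ u') a b (b + 1) pickDown := by
  intro w σ k k₀ Q hw a1 r7 r8 r10 r12 hk hQ
  have h1 := hU.mono w hw
  have h2 := hU.off_le (show w + 1 ≤ n + 1 by omega)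
  have h4 := rank_le (Γ.dat 5) (Γ.dat 6) w (b + 1)
  obtain ⟨t, t1, t2, t3, t4⟩ := scanDown_exists (fun s => bad (s - 1) ≠ 0 ∧ a ≤ Γ.dat 6 (s - 1))
    (show Γ.dat 5 w ≤ Γ.dat 5 w + rank (Γ.dat 5) (Γ.dat 6) w (b + 1) by omega)
  have hle : ∀ s, Γ.dat 5 w ≤ s → s < Γ.dat 5 w + rank (Γ.dat 5) (Γ.dat 6) w (b + 1) →
      Γ.dat 6 s ≤ b := by
    intro s hs1 hs2
    have := hU.up_lt_iff (z := b + 1) hw (t := s) hs1 (by omega)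
    omega
  have hcount : (Γ.dat 5 w + rank (Γ.dat 5) (Γ.dat 6) w (b + 1)) - t ≤
      badCount (Γ.dat 5) (Γ.dat 6) bad a b w := by
    have : Ico t (Γ.dat 5 w + rank (Γ.dat 5) (Γ.dat 6) w (b + 1)) ⊆
        (Ico (Γ.dat 5 w) (Γ.dat 5 (w + 1))).filter
          fun t => bad t ≠ 0 ∧ a ≤ Γ.dat 6 t ∧ Γ.dat 6 t ≤ b := by
      intro s
      simp only [mem_Ico, mem_filter]
      intro hs
      have := t3 (s + 1) (by omega) (by omega)
      exact ⟨by omega, this.1, this.2, hle s (by omega) hs.2⟩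
    simpa [badCount] using card_le_card this
  have hfin : ∀ s, (Γ.dat 5 w < t → s = t - 1) → (¬ Γ.dat 5 w < t → s = Γ.dat 5 (w + 1)) →
      s ≤ Γ.dat 5 (w + 1) ∧ Γ.dat 5 w ≤ s ∧ (s < Γ.dat 5 (w + 1) → a ≤ Γ.dat 6 s →
        Γ.dat 6 s ≤ b → bad s = 0) ∧ (∀ u, a ≤ u → u ≤ b → UpEdge n (Γ.dat 5) (Γ.dat 6) bad u w →
        s < Γ.dat 5 (w + 1) ∧ a ≤ Γ.dat 6 s ∧ Γ.dat 6 s ≤ b ∧ u ≤ Γ.dat 6 s) := by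
    intro s hs1 hs2
    by_cases hlt : Γ.dat 5 w < t
    · obtain rfl := hs1 hlt
      refine ⟨by omega, by omega, fun g1 g2 g3 => ?_, ?_⟩
      · have := t4 hlt
        by_contra hne
        exact this ⟨hne, g2⟩
      · rintro u g1 g2 ⟨-, s, s1, s2, rfl, s4⟩
        have hs : s < Γ.dat 5 w + rank (Γ.dat 5) (Γ.dat 6) w (b + 1) := by
          have := hU.up_lt_iff (z := b + 1) hw (t := s) (by omega) s2
          omega
        have hts : s ≤ t - 1 := by
          by_contra hlt
          exact (t3 (s + 1) (by omega) (by omega)).1 s4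
        have hm := hU.up_mono hw s1 hts (by omega)
        exact ⟨by omega, by omega, hle (t - 1) (by omega) (by omega), hm⟩
    · obtain rfl := hs2 hlt
      refine ⟨by omega, by omega, fun g1 g2 g3 => by omega, ?_⟩
      · rintro u g1 g2 ⟨-, s, s1, s2, rfl, s4⟩
        have hs : s < Γ.dat 5 w + rank (Γ.dat 5) (Γ.dat 6) w (b + 1) := by
          have := hU.up_lt_iff (z := b + 1) hw (t := s) (by omega) s2
          omega
        exact absurd s4 (t3 (s + 1) (by omega) (by omega)).1
  have hmain : WP Γ pickDown (fun τ l => τ.reg 12 =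
      (if Γ.dat 5 w < t then t - 1 else Γ.dat 5 (w + 1)) ∧ k₀ ≤ l) σ k := by
    simp only [pickDown, WP]
    refine WP_scanDown (fun s => bad (s - 1) ≠ 0 ∧ a ≤ Γ.dat 6 (s - 1)) _ t (Γ.dat 5 w) (50 + k₀) t2 t1 t3 t4
      r12 (by omega) ?_ ?_ ?_
    · intro s hs1 hs2
      have := hup (s - 1)
      simp [E.ok, E.ev, r10, a1, r7]
      omega
    · simp only [E.cost]; omega
    · intro l hl
      simp [E.ok, E.ev, E.cost, r10]
      and_intros
      all_goals try omega
  refine WP_conseq hmain ?_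
  rintro τ l hF ⟨h12, hl⟩
  obtain ⟨f1, f2, f3, f4⟩ := hfin (τ.reg 12) (fun h => by rw [h12, if_pos h])
    (fun h => by rw [h12, if_neg h])
  exact hQ τ l hF f1 f2 f3 f4 hl

/-- The time for ranks in the subtree of `a` with respect to `z`: only vertices outside the
subtree of `z` need a binary search. -/
theorem sum_rank_cost {pa sz off up adr S : ℕ → ℕ} {len L : ℕ} (hT : HTree n pa sz)
    (hS : Snaps n sz off up adr S (n + 1) len) {a z : ℕ} (ha : a ≤ n) (haz : a ≤ z) :
    ∑ w ∈ Ico a (a + sz a), (if z ≤ w ∧ w < z + sz z then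
      40 * (rank off up w z - snap adr S z w) else L) ≤
    40 * sz a + L * ((Ico a (a + sz a)).filter fun w => ¬ (z ≤ w ∧ w < z + sz z)).card := by
  rw [sum_ite, sum_const, smul_eq_mul, mul_comm L]
  apply Nat.add_le_add_right
  have he := hT.le_end ha
  rcases Nat.lt_or_ge z (a + sz a) with hz | hz
  · have hn := hT.nest ha haz hz
    have : (Ico a (a + sz a)).filter (fun w => z ≤ w ∧ w < z + sz z) = Ico z (z + sz z) := by
      ext w; simp; omega
    rw [this, ← mul_sum]
    have := hS.sum z (by omega)
    omega
  · rw [sum_eq_zero]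
    · omega
    · intro w hw
      simp only [mem_filter, mem_Ico] at hw
      omega

/-- Recording edges below the vertices from `a` to `b` takes time proportional to the size of the
subtree of `a`, apart from the binary searches outside the subtree of `z` and the failed edges
skipped. -/
theorem recordCmd_spec {pa : ℕ → ℕ} {len : ℕ} (hT : HTree n pa (Γ.dat 4))
    (hU : UpLists n m A (Γ.dat 5) (Γ.dat 6))
    (hS : Snaps n (Γ.dat 4) (Γ.dat 5) (Γ.dat 6) (Γ.dat 7) (Γ.dat 8) (n + 1) len)
    (hA : ∀ u w, A u w → u < w) {R : ℕ → ℕ → Prop} {a b z : ℕ} {pick : Cmd}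
    (ha1 : 1 ≤ a) (hab : a ≤ b) (hb : b ≤ n) (haz : a ≤ z)
    (hp : Picks Γ n bad R a b z pick) (hpr : ∀ x, x ≠ 12 → pick.modr x = false)
    (hpa : ∀ j, pick.moda j = false) (hup : ∀ t, Γ.dat 6 t + 1 < Γ.B)
    {σ : Mach} {k k₀ : ℕ} {Q : Mach → ℕ → Prop} {lst : ℕ → List ℕ}
    (hB : 2 * n + 2 * m + len + 100 ≤ Γ.B) (hB3 : σ.reg 3 + n + 10 ≤ Γ.B)
    (a1 : σ.arr 1 = bad) (r7 : σ.reg 7 = a) (r8 : σ.reg 8 = b) (r11 : σ.reg 11 = z)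
    (hl : HasLists σ lst)
    (hk : 800 * Γ.dat 4 a + 70 * (Nat.log 2 n + 1) * ((Ico a (a + Γ.dat 4 a)).filter
        fun w => ¬ (z ≤ w ∧ w < z + Γ.dat 4 z)).card +
      60 * ∑ w ∈ Ico a (a + Γ.dat 4 a), badCount (Γ.dat 5) (Γ.dat 6) bad a b w + 100 + k₀ ≤ k)
    (hQ : ∀ τ l lst', Fr (recordCmd pick) σ τ → HasLists τ lst' →
      Recorded (UpEdge n (Γ.dat 5) (Γ.dat 6) bad) R n a b (a + Γ.dat 4 a) lst lst' →
      τ.reg 3 ≤ σ.reg 3 + Γ.dat 4 a → k₀ ≤ l → Q τ l) :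
    WP Γ (recordCmd pick) Q σ k := by
  refine WP_conseq (Q := fun τ l => (∃ lst', HasLists τ lst' ∧
      Recorded (UpEdge n (Γ.dat 5) (Γ.dat 6) bad) R n a b (a + Γ.dat 4 a) lst lst') ∧
      τ.reg 3 ≤ σ.reg 3 + Γ.dat 4 a ∧ k₀ ≤ l) ?_
    fun τ l hF ⟨⟨lst', h1, h2⟩, h3, h4⟩ => hQ τ l lst' hF h1 h2 h3 h4
  have he := hT.le_end (show a ≤ n by omega)
  simp only [recordCmd, WP, E.ev, E.ok, E.cost, r7]
  simp only [Mach.setr_reg, r7]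
  simp only [show (7 = 10) = False by simp, if_false]
  refine ⟨trivial, by omega, ⟨trivial, by simp, by omega⟩, by omega, ?_⟩
  have hcost := sum_rank_cost (L := 70 * (Nat.log 2 n + 1)) hT hS (show a ≤ n by omega) haz
  refine WP_for a (a + Γ.dat 4 a) (fun e τ => (∃ lst', HasLists τ lst' ∧
      Recorded (UpEdge n (Γ.dat 5) (Γ.dat 6) bad) R n a b e lst lst') ∧
      τ.reg 3 ≤ σ.reg 3 + (e - a))
    (fun w => (if z ≤ w ∧ w < z + Γ.dat 4 z then
      40 * (rank (Γ.dat 5) (Γ.dat 6) w z - snap (Γ.dat 7) (Γ.dat 8) z w) else 70 * (Nat.log 2 n + 1)) +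
      60 * badCount (Γ.dat 5) (Γ.dat 6) bad a b w + 500) k₀ (by simp) (by omega)
      (by omega) (by omega) ?_ ?_ ?_ ?_ ?_
  · refine ⟨⟨lst, hl, fun _ _ h => h, fun _ _ h => Or.inl h, fun w h1 h2 => by omega, by omega⟩, ?_⟩
    simp
  · simp only [E.cost, sum_add_distrib, sum_const, Nat.card_Ico, smul_eq_mul, ← mul_sum]
    rw [show a + Γ.dat 4 a - a = Γ.dat 4 a by omega]
    omega
  · intro τ hF
    have := hF.r 16 (by simp [Cmd.modr, forUp, rankCmd, searchCmd, searchLoop, scanUp, tryPush,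
      pushCmd, hpr])
    simp [E.ev, E.ok] at this ⊢
    exact this
  · rintro w τ l h1 h2 hF hr ⟨⟨lst', i1, i2⟩, i3⟩ hl
    have hwn : w ≤ n := by omega
    have q7 := hF.r 7 (by simp [Cmd.modr, forUp, rankCmd, searchCmd, searchLoop, scanUp, tryPush,
      pushCmd, hpr])
    have q8 := hF.r 8 (by simp [Cmd.modr, forUp, rankCmd, searchCmd, searchLoop, scanUp, tryPush,
      pushCmd, hpr])
    have q11 := hF.r 11 (by simp [Cmd.modr, forUp, rankCmd, searchCmd, searchLoop, scanUp, tryPush,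
      pushCmd, hpr])
    have q1 := hF.a 1 (by simp [Cmd.moda, forUp, rankCmd, searchCmd, searchLoop, scanUp, tryPush,
      pushCmd, hpa])
    simp [r7, r8, r11, a1] at q7 q8 q11 q1
    simp only [WP]
    refine rankCmd_spec (k₀ := 60 * badCount (Γ.dat 5) (Γ.dat 6) bad a b w + 350 + (l - ((if z ≤ w ∧ w < z + Γ.dat 4 z then
      40 * (rank (Γ.dat 5) (Γ.dat 6) w z - snap (Γ.dat 7) (Γ.dat 8) z w) else 70 * (Nat.log 2 n + 1)) +
      60 * badCount (Γ.dat 5) (Γ.dat 6) bad a b w + 500))) hU hA hS hwn (by omega) hr q11 (by omega) ?_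
    intro τ2 l2 F2 e12 hl2
    have p3 := F2.r 3 rfl
    have p7 := F2.r 7 rfl
    have p8 := F2.r 8 rfl
    have p10 := F2.r 10 rfl
    have b1 := F2.a 1 rfl
    have b7 := F2.a 7 rfl
    have b8 := F2.a 8 rfl
    have b9 := F2.a 9 rfl
    refine hp w τ2 l2 (200 + (l - ((if z ≤ w ∧ w < z + Γ.dat 4 z then
      40 * (rank (Γ.dat 5) (Γ.dat 6) w z - snap (Γ.dat 7) (Γ.dat 8) z w) else 70 * (Nat.log 2 n + 1)) +
      60 * badCount (Γ.dat 5) (Γ.dat 6) bad a b w + 500))) _ hwn (b1.trans q1)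
      (p7.trans q7) (p8.trans q8) (p10.trans hr) e12 (by omega) ?_
    intro τ3 l3 F3 g1 g2 g3 g4 hl3
    have s3 := F3.r 3 (hpr _ (by decide))
    have s7 := F3.r 7 (hpr _ (by decide))
    have s8 := F3.r 8 (hpr _ (by decide))
    have s10 := F3.r 10 (hpr _ (by decide))
    have c7 := F3.a 7 (hpa _)
    have c8 := F3.a 8 (hpa _)
    have c9 := F3.a 9 (hpa _)
    rw [p3] at s3
    rw [p7, q7] at s7
    rw [p8, q8] at s8
    rw [p10, hr] at s10
    have hm := hU.off_le (show w + 1 ≤ n + 1 by omega)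
    have hut := hup (τ3.reg 12)
    simp only [tryPush, pushCmd, WP, E.ev, E.ok, E.cost, s7, s8, s10]
    refine ⟨?_, by omega, fun hc => ?_, fun hc => ?_⟩
    · and_intros
      all_goals try first | omega | trivial
    · have hc : τ3.reg 12 < Γ.dat 5 (w + 1) ∧ Γ.dat 6 (τ3.reg 12) ≤ b ∧ a ≤ Γ.dat 6 (τ3.reg 12) := by
        by_contra hn
        apply hc
        rw [if_neg]
        simp
        omega
      have hbad := g3 hc.1 hc.2.2 hc.2.1
      simp [s3, s10]
      and_intros
      all_goals try omega
      refine ⟨Function.update lst' (Γ.dat 6 (τ3.reg 12)) (w :: lst' (Γ.dat 6 (τ3.reg 12))), ?_, ?_⟩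
      · refine i1.push _ w _ ?_ ?_ ?_ ?_ <;> simp [c7, c8, c9, b7, b8, b9]
      · exact i2.push h1 hc.2.2 hc.2.1 ⟨hwn, _, g2, hc.1, rfl, hbad⟩ fun u k1 k2 k3 => (g4 u k1 k2 k3).2.2.2
    · have hc : ¬ (τ3.reg 12 < Γ.dat 5 (w + 1) ∧ Γ.dat 6 (τ3.reg 12) ≤ b ∧ a ≤ Γ.dat 6 (τ3.reg 12)) := by
        rintro ⟨k1, k2, k3⟩
        simp [k1, show Γ.dat 6 (τ3.reg 12) < b + 1 by omega, show a < Γ.dat 6 (τ3.reg 12) + 1 by omega] at hc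
      simp [s3]
      and_intros
      all_goals try omega
      refine ⟨lst', ?_, ?_⟩
      · intro u
        have := i1 u
        simpa [s3, c7, c8, c9, b7, b8, b9] using this
      · refine i2.skip fun u k1 k2 k3 => hc ?_
        have := g4 u k1 k2 k3
        tauto
  · rintro τ l hF hr ⟨i1, i2⟩ hl
    exact ⟨i1, by omega, hl⟩

end

/-! ### Walking along a segment -/

/-- After walking along the vertices in `S`, whose numbers are in accordance with the preference
`R` for late vertices. Before, the traversal had numbers `dfn` up to `c`, and the current vertex
had depth `d`. -/
structure Walk (H : ℕ → ℕ → Prop) (dfn : ℕ → ℕ) (c d : ℕ) (S : ℕ → Prop) (R : ℕ → ℕ → Prop)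
    (dfn' ps' dep' : ℕ → ℕ) (cur' len : ℕ) : Prop where
  trav : Traversal H dfn' ps' dep' cur' (c + len)
  out : ∀ y, ¬ S y → dfn' y = dfn y
  inside : ∀ y, S y → c < dfn' y
  ord : ∀ u u', S u → S u' → R u' u → dfn' u ≤ dfn' u'
  depth : dep' cur' = d + len

theorem Walk.start {H : ℕ → ℕ → Prop} {dfn ps dep : ℕ → ℕ} {cur c : ℕ}
    (h : Traversal H dfn ps dep cur c) {x : ℕ} (hx : x ≠ 0) (hd : dfn x = 0)
    (hc : cur = 0 ∨ H cur x) (R : ℕ → ℕ → Prop) :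
    Walk H dfn c (dep cur) (fun y => y = x) R (Function.update dfn x (c + 1))
      (Function.update ps x cur) (Function.update dep x (dep cur + 1)) x 1 := by
  refine ⟨h.enter hx hd hc, fun y hy => Function.update_of_ne hy _ _, ?_, ?_, by simp⟩
  · rintro y rfl; simp
  · rintro u u' rfl rfl _; exact le_rfl

/-- The walk proceeds to `e`, which becomes the latest vertex. -/
theorem Walk.step {H : ℕ → ℕ → Prop} {dfn dfn' ps' dep' : ℕ → ℕ} {c d cur' len : ℕ}
    {S S' : ℕ → Prop} {R : ℕ → ℕ → Prop} (h : Walk H dfn c d S R dfn' ps' dep' cur' len) {e : ℕ}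
    (he : e ≠ 0) (heS : ¬ S e) (hd : dfn e = 0) (hc : H cur' e) (hS : ∀ y, S' y ↔ S y ∨ y = e)
    (hR : ∀ u, S u → ¬ R u e) :
    Walk H dfn c d S' R (Function.update dfn' e (c + len + 1)) (Function.update ps' e cur')
      (Function.update dep' e (dep' cur' + 1)) e (len + 1) := by
  have hd' : dfn' e = 0 := by rw [h.out e heS, hd]
  refine ⟨h.trav.enter he hd' (Or.inr hc), fun y hy => ?_, fun y hy => ?_, fun u u' hu hu' hr => ?_, ?_⟩
  · rw [hS] at hy
    rw [Function.update_of_ne (by tauto)]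
    exact h.out y (by tauto)
  · rw [Function.update_apply]
    split_ifs with hye
    · omega
    · exact h.inside y (((hS y).1 hy).resolve_right hye)
  · rw [hS] at hu hu'
    have := h.trav.le u
    by_cases hue : u = e
    · subst hue
      by_cases hue' : u' = u
      · rw [hue']
      · exact absurd hr (hR u' (hu'.resolve_right hue'))
    · rw [Function.update_of_ne hue]
      by_cases hue' : u' = e
      · subst hue'; simp; omega
      · rw [Function.update_of_ne hue']
        exact h.ord u u' (hu.resolve_right hue) (hu'.resolve_right hue') hr
  · rw [Function.update_self, h.depth]; ring

section
open E Cmd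

/-- Visit the vertices after `v 5` up to `v 17`. -/
def walkDown : Cmd :=
  .loop (lt (v 5) (v 17)) (.put 6 (add (v 5) (c 1)) (v 5) ;; .set 5 (add (v 5) (c 1)) ;;
    .put 0 (v 5) (c 1))

/-- Visit the vertices before `v 5` down to `v 9`. -/
def walkUp : Cmd :=
  .loop (lt (v 9) (v 5)) (.put 6 (sub (v 5) (c 1)) (v 5) ;; .set 5 (sub (v 5) (c 1)) ;;
    .put 0 (v 5) (c 1))

/-- Visit the vertex `v 4` as a child of the current vertex `v 1`, continue along its segment to
the end that is farther away, and record the edges below the vertices visited. -/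
def enterCmd : Cmd :=
  .set 6 (a 3 (v 4)) ;; .set 9 (a 4 (v 6)) ;; .set 17 (a 5 (v 6)) ;;
  .put 6 (v 4) (v 1) ;; .put 0 (v 4) (c 1) ;; .set 5 (v 4) ;;
  .ite (lt (sub (v 4) (v 9)) (sub (v 17) (v 4)))
    (.put 5 (v 6) (sub (v 4) (c 1)) ;; walkDown ;; .set 7 (v 4) ;; .set 8 (v 17) ;;
      .set 1 (v 17) ;; .set 11 (add (v 8) (c 1)) ;; recordCmd pickDown)
    (.put 4 (v 6) (add (v 4) (c 1)) ;; walkUp ;; .set 7 (v 9) ;; .set 8 (v 4) ;;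
      .set 1 (v 9) ;; .set 11 (v 7) ;; recordCmd pickUp)

end

section
variable {Γ : Env} {H : ℕ → ℕ → Prop} {dfn dfn' dep' : ℕ → ℕ} {c d x e : ℕ}

/-- Walking from `x` down to `e`: the vertices with larger labels are visited later. -/
theorem walkDown_spec (hxe : x ≤ e) (hB : e + 10 ≤ Γ.B)
    (hd : ∀ y, x ≤ y → y ≤ e → dfn y = 0) (hH : ∀ y, x < y → y ≤ e → H (y - 1) y)
    {σ : Mach} {k k₀ : ℕ} {Q : Mach → ℕ → Prop} (r5 : σ.reg 5 = x) (r17 : σ.reg 17 = e)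
    (hW : Walk H dfn c d (fun y => y = x) (fun u' u => u ≤ u') dfn' (σ.arr 6) dep' x 1)
    (hv : σ.arr 0 x ≠ 0) (hk : 30 * (e + 1 - x) + k₀ ≤ k)
    (hQ : ∀ τ l dfn' dep', Fr walkDown σ τ →
      Walk H dfn c d (fun y => x ≤ y ∧ y ≤ e) (fun u' u => u ≤ u') dfn' (τ.arr 6) dep' e (e + 1 - x) →
      (∀ y, τ.arr 0 y = 0 ↔ σ.arr 0 y = 0 ∧ ¬ (x ≤ y ∧ y ≤ e)) → k₀ ≤ l → Q τ l) :
    WP Γ walkDown Q σ k := by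
  refine WP_conseq (WP_loop (fun τ l => ∃ y dfn' dep', τ.reg 5 = y ∧ x ≤ y ∧ y ≤ e ∧
      Walk H dfn c d (fun z => x ≤ z ∧ z ≤ y) (fun u' u => u ≤ u') dfn' (τ.arr 6) dep' y (y + 1 - x) ∧
      (∀ z, τ.arr 0 z = 0 ↔ σ.arr 0 z = 0 ∧ ¬ (x ≤ z ∧ z ≤ y)) ∧ 30 * (e + 1 - y) + k₀ ≤ l) ?_ ?_
    (Q := fun τ l => ∃ dfn' dep', Walk H dfn c d (fun y => x ≤ y ∧ y ≤ e) (fun u' u => u ≤ u') dfn'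
      (τ.arr 6) dep' e (e + 1 - x) ∧ (∀ y, τ.arr 0 y = 0 ↔ σ.arr 0 y = 0 ∧ ¬ (x ≤ y ∧ y ≤ e)) ∧ k₀ ≤ l))
    fun τ l hF ⟨dfn', dep', h1, h2, h3⟩ => hQ τ l dfn' dep' hF h1 h2 h3
  · refine ⟨x, dfn', dep', r5, le_rfl, hxe, ?_, ?_, hk⟩
    · have : (fun z => x ≤ z ∧ z ≤ x) = fun z => z = x := by ext z; omega
      rw [this, show x + 1 - x = 1 by omega]; exact hW
    · intro z
      constructor
      · intro hz
        refine ⟨hz, fun h => hv ?_⟩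
        rwa [show x = z by omega]
      · exact fun h => h.1
  · rintro τ l hF ⟨y, dfn', dep', i1, i2, i3, i4, i5, i6⟩
    have e17 := hF.r 17 rfl
    rw [r17] at e17
    simp only [E.ok, E.ev, E.cost, i1, e17]
    refine ⟨by simp, by omega, fun hc => ?_, fun hc => ?_⟩
    · have hlt : y < e := by
        by_contra hn; simp [hn] at hc
      have hst := i4.step (e := y + 1) (S' := fun z => x ≤ z ∧ z ≤ y + 1) (by omega) (by omega)
        (hd _ (by omega) (by omega)) (by simpa using hH (y + 1) (by omega) (by omega))
        (fun z => by omega) (fun u hu => by omega)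
      simp [WP, E.ev, E.ok, E.cost, i1]
      and_intros
      all_goals try omega
      · exact ⟨_, _, by rw [show y + 1 + 1 - x = y + 1 - x + 1 by omega]; exact hst⟩
      intro z
      rw [Function.update_apply]
      have := i5 z
      split_ifs with hz
      · simp; omega
      · rw [this]
        constructor <;> rintro ⟨g1, g2⟩ <;> refine ⟨g1, ?_⟩ <;> omega
    · have hlt : ¬ y < e := by
        intro hn; simp [hn] at hc
      obtain rfl : y = e := by omega
      exact ⟨dfn', dep', i4, i5, by omega⟩

/-- Walking from `x` up to `e`: the vertices with smaller labels are visited later. -/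
theorem walkUp_spec (he : 1 ≤ e) (hxe : e ≤ x) (hB : x + 10 ≤ Γ.B)
    (hd : ∀ y, e ≤ y → y ≤ x → dfn y = 0) (hH : ∀ y, e < y → y ≤ x → H y (y - 1))
    {σ : Mach} {k k₀ : ℕ} {Q : Mach → ℕ → Prop} (r5 : σ.reg 5 = x) (r9 : σ.reg 9 = e)
    (hW : Walk H dfn c d (fun y => y = x) (· ≤ ·) dfn' (σ.arr 6) dep' x 1)
    (hv : σ.arr 0 x ≠ 0) (hk : 30 * (x + 1 - e) + k₀ ≤ k)
    (hQ : ∀ τ l dfn' dep', Fr walkUp σ τ →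
      Walk H dfn c d (fun y => e ≤ y ∧ y ≤ x) (· ≤ ·) dfn' (τ.arr 6) dep' e (x + 1 - e) →
      (∀ y, τ.arr 0 y = 0 ↔ σ.arr 0 y = 0 ∧ ¬ (e ≤ y ∧ y ≤ x)) → k₀ ≤ l → Q τ l) :
    WP Γ walkUp Q σ k := by
  refine WP_conseq (WP_loop (fun τ l => ∃ y dfn' dep', τ.reg 5 = y ∧ e ≤ y ∧ y ≤ x ∧
      Walk H dfn c d (fun z => y ≤ z ∧ z ≤ x) (· ≤ ·) dfn' (τ.arr 6) dep' y (x + 1 - y) ∧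
      (∀ z, τ.arr 0 z = 0 ↔ σ.arr 0 z = 0 ∧ ¬ (y ≤ z ∧ z ≤ x)) ∧ 30 * (y + 1 - e) + k₀ ≤ l) ?_ ?_
    (Q := fun τ l => ∃ dfn' dep', Walk H dfn c d (fun y => e ≤ y ∧ y ≤ x) (· ≤ ·) dfn'
      (τ.arr 6) dep' e (x + 1 - e) ∧ (∀ y, τ.arr 0 y = 0 ↔ σ.arr 0 y = 0 ∧ ¬ (e ≤ y ∧ y ≤ x)) ∧ k₀ ≤ l))
    fun τ l hF ⟨dfn', dep', h1, h2, h3⟩ => hQ τ l dfn' dep' hF h1 h2 h3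
  · refine ⟨x, dfn', dep', r5, hxe, le_rfl, ?_, ?_, hk⟩
    · have : (fun z => x ≤ z ∧ z ≤ x) = fun z => z = x := by ext z; omega
      rw [this, show x + 1 - x = 1 by omega]; exact hW
    · intro z
      constructor
      · intro hz
        refine ⟨hz, fun h => hv ?_⟩
        rwa [show x = z by omega]
      · exact fun h => h.1
  · rintro τ l hF ⟨y, dfn', dep', i1, i2, i3, i4, i5, i6⟩
    have e9 := hF.r 9 rfl
    rw [r9] at e9
    simp only [E.ok, E.ev, E.cost, i1, e9]
    refine ⟨by simp, by omega, fun hc => ?_, fun hc => ?_⟩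
    · have hlt : e < y := by
        by_contra hn; simp [hn] at hc
      have hst := i4.step (e := y - 1) (S' := fun z => y - 1 ≤ z ∧ z ≤ x) (by omega) (by omega)
        (hd _ (by omega) (by omega)) (hH y (by omega) (by omega))
        (fun z => by omega) (fun u hu => by omega)
      simp [WP, E.ev, E.ok, E.cost, i1]
      and_intros
      all_goals try omega
      · rw [show (fun z => y - 1 ≤ z ∧ z ≤ x) = fun z => y ≤ z + 1 ∧ z ≤ x by ext z; omega] at hst
        exact ⟨_, _, by rw [show x + 1 - (y - 1) = x + 1 - y + 1 by omega]; exact hst⟩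
      intro z
      rw [Function.update_apply]
      have := i5 z
      split_ifs with hz
      · simp; omega
      · rw [this]
        constructor <;> rintro ⟨g1, g2⟩ <;> refine ⟨g1, ?_⟩ <;> omega
    · have hlt : ¬ e < y := by
        intro hn; simp [hn] at hc
      obtain rfl : y = e := by omega
      exact ⟨dfn', dep', i4, i5, by omega⟩

end

section
variable {n : ℕ} {vis vis' top loq hiq : ℕ → ℕ}

/-- The vertices from `a` to `b`, at an end of the unvisited part of the segment with top `q`, have
been visited. -/
theorem Limits.cut (h : Limits n vis top loq hiq) {loq' hiq' : ℕ → ℕ} {q a b : ℕ}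
    (hv : ∀ y, vis' y = 0 ↔ vis y = 0 ∧ ¬ (a ≤ y ∧ y ≤ b))
    (hlo : ∀ q', q' ≠ q → loq' q' = loq q') (hhi : ∀ q', q' ≠ q → hiq' q' = hiq q')
    (hab : ∀ y, a ≤ y → y ≤ b → loq q ≤ y ∧ y ≤ hiq q) (hq : 1 ≤ q ∧ q ≤ n ∧ top q = q)
    (hnew : ∀ y, (loq' q ≤ y ∧ y ≤ hiq' q) ↔ (loq q ≤ y ∧ y ≤ hiq q) ∧ ¬ (a ≤ y ∧ y ≤ b)) :
    Limits n vis' top loq' hiq' := by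
  constructor
  · intro x h1 hx hvx
    obtain ⟨h2, h3⟩ := (hv x).1 hvx
    have := h.mem x h1 hx h2
    by_cases hq' : top x = q
    · rw [hq'] at this ⊢
      exact (hnew x).2 ⟨this, h3⟩
    · rw [hlo _ hq', hhi _ hq']; exact this
  · intro q' h1 hq' ht x hx1 hx2
    by_cases hqq : q' = q
    · subst hqq
      have := (hnew x).1 ⟨hx1, hx2⟩
      have h4 := h.own q' h1 hq' ht x this.1.1 this.1.2
      exact ⟨h4.1, h4.2.1, (hv x).2 ⟨h4.2.2.1, this.2⟩, h4.2.2.2⟩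
    · rw [hlo _ hqq] at hx1
      rw [hhi _ hqq] at hx2
      have h4 := h.own q' h1 hq' ht x hx1 hx2
      refine ⟨h4.1, h4.2.1, (hv x).2 ⟨h4.2.2.1, fun h5 => ?_⟩, h4.2.2.2⟩
      have h6 := hab x h5.1 h5.2
      have h7 := h.own q hq.1 hq.2.1 hq.2.2 x h6.1 h6.2
      exact hqq (h4.2.2.2.symm.trans h7.2.2.2)

end

/-! ### The state of a query and its potential -/

/-- Adjacency in the surviving graph; `vis₀` marks the failed vertices. -/
def LiveAdj (n : ℕ) (off up bad vis₀ : ℕ → ℕ) (u w : ℕ) : Prop :=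
  (UpEdge n off up bad u w ∨ UpEdge n off up bad w u) ∧ vis₀ u = 0 ∧ vis₀ w = 0

/-- What remains constant during the traversal: the data structure, the failures and the
segments. `N` is a bound on the number of list nodes. -/
structure Query (Γ : Env) (n m len N : ℕ) (adj : ℕ → ℕ → Prop) (bad vis₀ top : ℕ → ℕ) : Prop where
  tree : HTree n (Γ.dat 3) (Γ.dat 4)
  ups : UpLists n m adj (Γ.dat 5) (Γ.dat 6)
  snaps : Snaps n (Γ.dat 4) (Γ.dat 5) (Γ.dat 6) (Γ.dat 7) (Γ.dat 8) (n + 1) len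
  anc : ∀ u w, adj u w → 1 ≤ u ∧ u < w ∧ w < u + Γ.dat 4 u
  segs : Segs n (Γ.dat 3) (LiveAdj n (Γ.dat 5) (Γ.dat 6) bad vis₀) top
  up_lt : ∀ t, Γ.dat 6 t + 1 < Γ.B
  bound : 10 * n + 10 * m + len + N + 1000 ≤ Γ.B

/-- The work that is paid for by visiting `x`: the credits `F` are for the search that led to `x`,
and the same amount, kept as part of `F * dep`, is for the search before the traversal goes back
from `x`. The other terms are for binary searches and for failed edges skipped when edges to `x`
are recorded. -/
def weight (Γ : Env) (n m F : ℕ) (bad : ℕ → ℕ) (x : ℕ) : ℕ :=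
  2 * F + 100 + 70 * (Nat.log 2 n + 1) * lightSize n (Γ.dat 3) (Γ.dat 4) x +
    60 * ((range m).filter fun t => bad t ≠ 0 ∧ Γ.dat 6 t = x).card

/-- The part of the potential that decreases when a segment is halved. -/
def segPot (Γ : Env) (n : ℕ) (top loq hiq : ℕ → ℕ) : ℕ :=
  ∑ q ∈ (Icc 1 n).filter (fun q => top q = q), Γ.dat 4 q * Nat.size (hiq q + 1 - loq q)

/-- The potential that pays for the traversal. -/
def pot (Γ : Env) (n m F : ℕ) (bad top : ℕ → ℕ) (τ : Mach) (dep : ℕ → ℕ) (lst : ℕ → List ℕ) : ℕ :=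
  ∑ x ∈ (Icc 1 n).filter (fun x => τ.arr 0 x = 0), weight Γ n m F bad x +
    1200 * segPot Γ n top (τ.arr 4) (τ.arr 5) + F * dep (τ.reg 1) +
    60 * ∑ u ∈ Icc 1 n, (lst u).length

/-- The invariant of the traversal. The last condition is the main point: below a visited vertex
`u`, each unvisited neighbour is recorded for a vertex visited no earlier than `u`. When a
part of a segment is visited, the number of list nodes increases no more than `segPot` decreases,
whence `nodes`. -/
structure Visiting (Γ : Env) (n N : ℕ) (bad vis₀ top : ℕ → ℕ) (τ : Mach)
    (dfn dep : ℕ → ℕ) (c : ℕ) (lst : ℕ → List ℕ) : Prop where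
  size : τ.reg 0 = n
  bad_eq : τ.arr 1 = bad
  top_eq : τ.arr 3 = top
  trav : Traversal (LiveAdj n (Γ.dat 5) (Γ.dat 6) bad vis₀) dfn (τ.arr 6) dep (τ.reg 1) c
  vis : ∀ x, 1 ≤ x → x ≤ n → (τ.arr 0 x = 0 ↔ vis₀ x = 0 ∧ dfn x = 0)
  visited : ∀ x, dfn x ≠ 0 → 1 ≤ x ∧ x ≤ n ∧ vis₀ x = 0
  limits : Limits n (τ.arr 0) top (τ.arr 4) (τ.arr 5)
  lists : HasLists τ lst
  nodes : τ.reg 3 + segPot Γ n top (τ.arr 4) (τ.arr 5) ≤ N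
  sound : ∀ u w, w ∈ lst u → UpEdge n (Γ.dat 5) (Γ.dat 6) bad u w ∧ 1 ≤ u ∧ u ≤ n ∧ vis₀ u = 0
  recorded : ∀ u w, UpEdge n (Γ.dat 5) (Γ.dat 6) bad u w → dfn u ≠ 0 → vis₀ w = 0 → dfn w = 0 →
    ∃ u', dfn u ≤ dfn u' ∧ w ∈ lst u'

/-- When a segment is halved, credits in proportion to the subtree of its top are set free. -/
theorem segPot_cut {Γ : Env} {n : ℕ} {top loq hiq loq' hiq' : ℕ → ℕ} {q : ℕ}
    (hlo : ∀ q', q' ≠ q → loq' q' = loq q') (hhi : ∀ q', q' ≠ q → hiq' q' = hiq q')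
    (hq : 1 ≤ q ∧ q ≤ n ∧ top q = q)
    (hhalf : 2 * (hiq' q + 1 - loq' q) ≤ hiq q + 1 - loq q) (h0 : hiq q + 1 - loq q ≠ 0) :
    segPot Γ n top loq' hiq' + Γ.dat 4 q ≤ segPot Γ n top loq hiq := by
  have hm : q ∈ (Icc 1 n).filter (fun q => top q = q) := by simp; omega
  rw [segPot, segPot, ← add_sum_erase _ _ hm, ← add_sum_erase _ _ hm]
  have h1 := Nat.mul_le_mul_left (Γ.dat 4 q) (size_half hhalf h0)
  rw [Nat.mul_add, Nat.mul_one] at h1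
  have h2 : ∀ q' ∈ ((Icc 1 n).filter (fun q => top q = q)).erase q,
      Γ.dat 4 q' * Nat.size (hiq' q' + 1 - loq' q') = Γ.dat 4 q' * Nat.size (hiq q' + 1 - loq q') := by
    intro q' hq'
    have := ne_of_mem_erase hq'
    rw [hlo _ this, hhi _ this]
  rw [sum_congr rfl h2]
  omega

/-- The subtrees along a part of a heavy path are nested. -/
theorem HTree.nest_chain {n : ℕ} {pa sz : ℕ → ℕ} (h : HTree n pa sz) {a b : ℕ} (hab : a ≤ b)
    (hb : b ≤ n) (hp : ∀ y, a < y → y ≤ b → pa y + 1 = y) : b + sz b ≤ a + sz a := by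
  induction b, hab using Nat.le_induction with
  | base => exact le_rfl
  | succ b hab ih =>
    have := ih (by omega) fun y h1 h2 => hp y h1 (by omega)
    have h2 := h.par (b + 1) (by omega) hb
    have := hp (b + 1) (by omega) le_rfl
    rw [show pa (b + 1) = b by omega] at h2
    omega

/-- Along a part of a heavy path, the vertices that hang off it are counted by `lightSize`. -/
theorem HTree.card_light {n : ℕ} {pa sz : ℕ → ℕ} (h : HTree n pa sz) {a b : ℕ} (hab : a ≤ b)
    (hb : b ≤ n) (hp : ∀ y, a < y → y ≤ b → pa y + 1 = y) :
    ((Ico a (a + sz a)).filter fun w => ¬ (b + 1 ≤ w ∧ w < b + 1 + sz (b + 1))).card ≤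
      ∑ x ∈ Icc a b, lightSize n pa sz x := by
  have key : ∑ x ∈ Icc a b, lightSize n pa sz x +
      (if b + 1 ≤ n ∧ pa (b + 1) = b then sz (b + 1) else 0) = sz a := by
    induction b, hab using Nat.le_induction with
    | base =>
      rw [Icc_self, sum_singleton, lightSize]
      split_ifs with hx
      · have := h.heavy_lt hx.1 hx.2; omega
      · rfl
    | succ b hab ih =>
      have ih := ih (by omega) fun y h1 h2 => hp y h1 (by omega)
      have h1 := hp (b + 1) (by omega) le_rfl
      rw [if_pos (by omega)] at ih
      rw [sum_Icc_succ_top (by omega), lightSize]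
      split_ifs with hx
      · have := h.heavy_lt hx.1 hx.2; omega
      · omega
  have he := h.le_end (show a ≤ n by omega)
  have hz := h.nest_chain hab hb hp
  have hpos := h.pos b hb
  split_ifs at key with hx
  · have h1 := h.par (b + 1) (by omega) hx.1
    rw [hx.2] at h1
    have : Ico (b + 1) (b + 1 + sz (b + 1)) ⊆ Ico a (a + sz a) := by
      intro w; simp only [mem_Ico]; omega
    have h2 := card_sdiff_of_subset this
    have h3 : ((Ico a (a + sz a)).filter fun w => ¬ (b + 1 ≤ w ∧ w < b + 1 + sz (b + 1))) =
        Ico a (a + sz a) \ Ico (b + 1) (b + 1 + sz (b + 1)) := by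
      ext w; simp
    rw [h3, h2]
    simp only [Nat.card_Ico]
    omega
  · refine (card_filter_le _ _).trans ?_
    simp only [Nat.card_Ico]
    omega

/-- Each failed edge is passed by the ranks of only one segment part. -/
theorem UpLists.sum_badCount {n m : ℕ} {A : ℕ → ℕ → Prop} {off up bad : ℕ → ℕ}
    (hU : UpLists n m A off up) {a b e : ℕ} (he : e ≤ n + 1) :
    ∑ w ∈ Ico a e, badCount off up bad a b w ≤
      ∑ x ∈ Icc a b, ((range m).filter fun t => bad t ≠ 0 ∧ up t = x).card := by
  rcases Nat.lt_or_ge e a with hae | hae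
  · rw [Ico_eq_empty (by omega)]; simp
  have h1 := hU.card_filter_Ico (fun t => bad t ≠ 0 ∧ a ≤ up t ∧ up t ≤ b) hae he
  have h2 := hU.off_le he
  simp only [badCount]
  rw [← h1, ← card_biUnion]
  · apply card_le_card
    intro t
    simp only [mem_filter, mem_Ico, mem_biUnion, mem_Icc, mem_range]
    rintro ⟨h3, h4, h5⟩
    exact ⟨up t, h5, by omega, h4, rfl⟩
  · intro x _ y _ hxy
    rw [Function.onFun, disjoint_left]
    intro t h3 h4
    simp only [mem_filter] at h3 h4
    exact hxy (h3.2.2.symm.trans h4.2.2)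

section
variable {Γ : Env} {n m len N F : ℕ} {adj : ℕ → ℕ → Prop} {bad vis₀ top : ℕ → ℕ}

theorem LiveAdj.symm {off up : ℕ → ℕ} {u w : ℕ} (h : LiveAdj n off up bad vis₀ u w) :
    LiveAdj n off up bad vis₀ w u :=
  ⟨h.1.symm, h.2.2, h.2.1⟩

theorem Query.upEdge_anc (hq : Query Γ n m len N adj bad vis₀ top) {u w : ℕ}
    (h : UpEdge n (Γ.dat 5) (Γ.dat 6) bad u w) : 1 ≤ u ∧ u < w ∧ w < u + Γ.dat 4 u ∧ w ≤ n := by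
  obtain ⟨h1, t, h2, h3, rfl, -⟩ := h
  have := hq.anc _ _ (hq.ups.mem w h1 t h2 h3)
  exact ⟨this.1, this.2.1, this.2.2, h1⟩

/-- The invariant after the vertices from `a` to `b` have been visited and recorded. -/
theorem Visiting.enter (hq : Query Γ n m len N adj bad vis₀ top) {σ τ : Mach}
    {dfn dep dfn' dep' : ℕ → ℕ} {c : ℕ} {lst lst' : ℕ → List ℕ}
    (h : Visiting Γ n N bad vis₀ top σ dfn dep c lst) {a b e d : ℕ} {R : ℕ → ℕ → Prop}
    (hS : ∀ y, a ≤ y → y ≤ b → 1 ≤ y ∧ y ≤ n ∧ σ.arr 0 y = 0) (hp : ∀ y, a < y → y ≤ b → Γ.dat 3 y + 1 = y)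
    (r0 : τ.reg 0 = n) (a1 : τ.arr 1 = bad) (a3 : τ.arr 3 = top) (r1 : τ.reg 1 = e)
    (hW : Walk (LiveAdj n (Γ.dat 5) (Γ.dat 6) bad vis₀) dfn c d (fun y => a ≤ y ∧ y ≤ b) R dfn'
      (τ.arr 6) dep' e (b + 1 - a))
    (hv : ∀ y, τ.arr 0 y = 0 ↔ σ.arr 0 y = 0 ∧ ¬ (a ≤ y ∧ y ≤ b))
    (hL : Limits n (τ.arr 0) top (τ.arr 4) (τ.arr 5)) (hl : HasLists τ lst')
    (hR : Recorded (UpEdge n (Γ.dat 5) (Γ.dat 6) bad) R n a b (a + Γ.dat 4 a) lst lst')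
    (h3 : τ.reg 3 ≤ σ.reg 3 + Γ.dat 4 a)
    (hseg : segPot Γ n top (τ.arr 4) (τ.arr 5) + Γ.dat 4 a ≤ segPot Γ n top (σ.arr 4) (σ.arr 5)) :
    Visiting Γ n N bad vis₀ top τ dfn' dep' (c + (b + 1 - a)) lst' := by
  have hout : ∀ y, ¬ (a ≤ y ∧ y ≤ b) → dfn' y = dfn y := hW.out
  have hin : ∀ y, (a ≤ y ∧ y ≤ b) → c < dfn' y := hW.inside
  have hvis₀ : ∀ y, a ≤ y ∧ y ≤ b → vis₀ y = 0 := fun y hy =>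
    have h1 := hS y hy.1 hy.2
    ((h.vis y h1.1 h1.2.1).1 h1.2.2).1
  refine ⟨r0, a1, a3, by rw [r1]; exact hW.trav, fun x h1 h2 => ?_, fun x hx => ?_, hL, hl, ?_,
    fun u w hw => ?_, fun u w huw hu hw0 hw => ?_⟩
  · by_cases hx : a ≤ x ∧ x ≤ b
    · have := hin x hx
      have := hv x
      constructor
      · intro h; exact absurd hx (this.1 h).2
      · intro h; omega
    · rw [hv, hout x hx, h.vis x h1 h2]; tauto
  · by_cases hx' : a ≤ x ∧ x ≤ b
    · have := hS x hx'.1 hx'.2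
      exact ⟨this.1, this.2.1, hvis₀ x hx'⟩
    · rw [hout x hx'] at hx
      exact h.visited x hx
  · have := h.nodes
    omega
  · rcases hR.sound u w hw with h1 | ⟨h1, h2, h3⟩
    · exact h.sound u w h1
    · have := hS u h1 h2
      exact ⟨h3, this.1, this.2.1, hvis₀ u ⟨h1, h2⟩⟩
  · have hwS : ¬ (a ≤ w ∧ w ≤ b) := fun hx => by have := hin w hx; omega
    rw [hout w hwS] at hw
    by_cases huS : a ≤ u ∧ u ≤ b
    -- a neighbour below one of the new vertices has been recorded for the one visited last
    · have h1 := hq.upEdge_anc huw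
      have h2 := hq.tree.nest_chain huS.1 (by have := hS u huS.1 huS.2; omega)
        fun y h1 h2 => hp y h1 (by omega)
      obtain ⟨u', k1, k2, k3, k4⟩ := hR.compl w (by omega) (by omega) u huS.1 huS.2 huw
      exact ⟨u', hW.ord u u' huS ⟨k1, k2⟩ k3, k4⟩
    · rw [hout u huS] at hu ⊢
      obtain ⟨u', k1, k2⟩ := h.recorded u w huw hu hw0 hw
      refine ⟨u', ?_, hR.keep u' w k2⟩
      by_cases hu' : a ≤ u' ∧ u' ≤ b
      · have := hin u' hu'
        have := h.trav.le u
        omega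
      · rw [hout u' hu']; exact k1

/-- Visiting the vertices from `a` to `b` sets free the credits for recording edges below them,
where `K` binary searches are needed, and for the increase of the potential in the terms for the
depth and for the lists. The amount `F * (b + 1 - a)` that remains contains the credits for the
search. -/
theorem pot_drop {σ : Mach} {dep : ℕ → ℕ} {lst : ℕ → List ℕ} {loq' hiq' : ℕ → ℕ} {a b K : ℕ}
    (hS : ∀ y, a ≤ y → y ≤ b → 1 ≤ y ∧ y ≤ n ∧ σ.arr 0 y = 0)
    (hseg : segPot Γ n top loq' hiq' + Γ.dat 4 a ≤ segPot Γ n top (σ.arr 4) (σ.arr 5))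
    (hK : K ≤ ∑ x ∈ Icc a b, lightSize n (Γ.dat 3) (Γ.dat 4) x) :
    ∑ x ∈ (Icc 1 n).filter (fun x => σ.arr 0 x = 0 ∧ ¬ (a ≤ x ∧ x ≤ b)), weight Γ n m F bad x +
      1200 * segPot Γ n top loq' hiq' + F * (dep (σ.reg 1) + (b + 1 - a)) +
      60 * (∑ u ∈ Icc 1 n, (lst u).length + Γ.dat 4 a) +
      ((F + 100) * (b + 1 - a) + 1140 * Γ.dat 4 a + 70 * (Nat.log 2 n + 1) * K +
        60 * ∑ x ∈ Icc a b, ((range m).filter fun t => bad t ≠ 0 ∧ Γ.dat 6 t = x).card) ≤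
    pot Γ n m F bad top σ dep lst := by
  have h1 : ∑ x ∈ (Icc 1 n).filter (fun x => σ.arr 0 x = 0), weight Γ n m F bad x =
      ∑ x ∈ (Icc 1 n).filter (fun x => σ.arr 0 x = 0 ∧ ¬ (a ≤ x ∧ x ≤ b)), weight Γ n m F bad x +
      ∑ x ∈ Icc a b, weight Γ n m F bad x := by
    rw [← sum_filter_add_sum_filter_not ((Icc 1 n).filter (fun x => σ.arr 0 x = 0))
      (fun x => a ≤ x ∧ x ≤ b), filter_filter, filter_filter, add_comm]
    congr 2
    ext x
    simp only [mem_filter, mem_Icc]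
    constructor
    · exact fun h => h.2.2
    · intro h; have := hS x h.1 h.2; tauto
  have h2 : ∑ x ∈ Icc a b, weight Γ n m F bad x = (2 * F + 100) * (b + 1 - a) +
      70 * (Nat.log 2 n + 1) * ∑ x ∈ Icc a b, lightSize n (Γ.dat 3) (Γ.dat 4) x +
      60 * ∑ x ∈ Icc a b, ((range m).filter fun t => bad t ≠ 0 ∧ Γ.dat 6 t = x).card := by
    simp only [weight, sum_add_distrib, sum_const, smul_eq_mul, Nat.card_Icc, mul_sum]
    rw [mul_add]
    ring
  have h3 := Nat.mul_le_mul_left (70 * (Nat.log 2 n + 1)) hK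
  rw [pot, h1, h2, Nat.mul_add F]
  have h4 : (2 * F + 100) * (b + 1 - a) = (F + 100) * (b + 1 - a) + F * (b + 1 - a) := by ring
  rw [h4]
  omega

/-- Entering the vertex `x` preserves the invariant. The potential also returns the `F` credits that
the search for `x` may have consumed. -/
theorem enterCmd_spec (hq : Query Γ n m len N adj bad vis₀ top) {σ : Mach}
    {dfn dep : ℕ → ℕ} {c x : ℕ} {lst : ℕ → List ℕ}
    (h : Visiting Γ n N bad vis₀ top σ dfn dep c lst) (hx1 : 1 ≤ x) (hxn : x ≤ n)
    (r4 : σ.reg 4 = x) (hx : σ.arr 0 x = 0)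
    (hc : σ.reg 1 = 0 ∨ LiveAdj n (Γ.dat 5) (Γ.dat 6) bad vis₀ (σ.reg 1) x)
    {k k₀ : ℕ} {Q : Mach → ℕ → Prop} (hk : pot Γ n m F bad top σ dep lst + k₀ ≤ k + F)
    (hQ : ∀ τ l dfn' dep' c' lst', Fr enterCmd σ τ →
      Visiting Γ n N bad vis₀ top τ dfn' dep' c' lst' →
      (∀ y, τ.arr 0 y = 0 → σ.arr 0 y = 0) →
      pot Γ n m F bad top τ dep' lst' + k₀ ≤ l → Q τ l) :
    WP Γ enterCmd Q σ k := by
  refine WP_conseq (Q := fun τ l => ∃ dfn' dep' c' lst',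
      Visiting Γ n N bad vis₀ top τ dfn' dep' c' lst' ∧ (∀ y, τ.arr 0 y = 0 → σ.arr 0 y = 0) ∧
      pot Γ n m F bad top τ dep' lst' + k₀ ≤ l) ?_
    fun τ l hF ⟨dfn', dep', c', lst', h1, h2, h3⟩ => hQ τ l dfn' dep' c' lst' hF h1 h2 h3
  -- the unvisited part of the segment of `x` reaches from `lo` to `hi`
  obtain ⟨lo, hlo⟩ : ∃ lo, σ.arr 4 (top x) = lo := ⟨_, rfl⟩
  obtain ⟨hi, hhi⟩ : ∃ hi, σ.arr 5 (top x) = hi := ⟨_, rfl⟩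
  have hm := h.limits.mem x hx1 hxn hx
  rw [hlo, hhi] at hm
  have htop := hq.segs.top_le x hx1 hxn
  have htt := hq.segs.top_top hx1 hxn
  have hown := h.limits.own (top x) htop.1 (by omega) htt
  rw [hlo, hhi] at hown
  have hlo' := hown lo le_rfl (by omega)
  have hhi' := hown hi (by omega) le_rfl
  have hB := hq.bound
  have hstep : ∀ y, lo < y → y ≤ hi → Γ.dat 3 y + 1 = y ∧
      LiveAdj n (Γ.dat 5) (Γ.dat 6) bad vis₀ (y - 1) y := by
    intro y h1 h2
    have h3 := hown y (by omega) h2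
    have h4 := hq.segs.top_le lo hlo'.1 hlo'.2.1
    exact hq.segs.step h3.1 h3.2.1 (by rw [h3.2.2.2, ← hlo'.2.2.2]; omega) le_rfl
  have hdfn : ∀ y, lo ≤ y → y ≤ hi → dfn y = 0 := by
    intro y h1 h2
    have h3 := hown y h1 h2
    exact ((h.vis y h3.1 h3.2.1).1 h3.2.2.1).2
  have hsz : ∀ a, lo ≤ a → a ≤ hi → Γ.dat 4 a ≤ Γ.dat 4 (top x) := by
    intro a h1 h2
    have h3 := hown a h1 h2
    have h4 := hq.segs.nest hq.tree h3.1 h3.2.1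
    have h5 := hq.segs.top_le a h3.1 h3.2.1
    rw [h3.2.2.2] at h4 h5
    omega
  have hqn : 1 ≤ top x ∧ top x ≤ n ∧ top (top x) = top x := ⟨htop.1, by omega, htt⟩
  have hst : ∀ R, _ := fun R => Walk.start h.trav (x := x) (by omega) (hdfn x hm.1 hm.2) hc R
  have hszx : ∀ y, y ≤ n → 1 ≤ Γ.dat 4 y := fun y hy => hq.tree.pos y hy
  have hsegd : ∀ a b loq' hiq', lo ≤ a → a ≤ b → b ≤ hi → (∀ q', q' ≠ top x → loq' q' = σ.arr 4 q') →
      (∀ q', q' ≠ top x → hiq' q' = σ.arr 5 q') →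
      2 * (hiq' (top x) + 1 - loq' (top x)) ≤ hi + 1 - lo →
      segPot Γ n top loq' hiq' + Γ.dat 4 a ≤ segPot Γ n top (σ.arr 4) (σ.arr 5) := by
    intro a b loq' hiq' h1 h2 h3 h4 h5 h6
    have := segPot_cut (Γ := Γ) h4 h5 hqn (by rw [hlo, hhi]; exact h6) (by omega)
    have := hsz a h1 (by omega)
    omega
  have hchain : ∀ a b, lo ≤ a → b ≤ hi → ∀ y, a < y → y ≤ b → Γ.dat 3 y + 1 = y :=
    fun a b h1 h2 y h3 h4 => (hstep y (by omega) (by omega)).1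
  have hSab : ∀ a b, lo ≤ a → b ≤ hi → ∀ y, a ≤ y → y ≤ b → 1 ≤ y ∧ y ≤ n ∧ σ.arr 0 y = 0 := by
    intro a b h1 h2 y h3 h4
    have h3 := hown y (by omega) (by omega)
    exact ⟨h3.1, h3.2.1, h3.2.2.1⟩
  -- the end of both cases: `P` is the potential afterwards, and the vertices from `a` to `b` have
  -- been visited and their edges recorded
  have hfin : ∀ {a b K : ℕ} {R : ℕ → ℕ → Prop} {loq' hiq' : ℕ → ℕ}, lo ≤ a → a ≤ b → b ≤ hi →
      (∀ q', q' ≠ top x → loq' q' = σ.arr 4 q') → (∀ q', q' ≠ top x → hiq' q' = σ.arr 5 q') →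
      2 * (hiq' (top x) + 1 - loq' (top x)) ≤ hi + 1 - lo →
      (∀ y, (loq' (top x) ≤ y ∧ y ≤ hiq' (top x)) ↔ (lo ≤ y ∧ y ≤ hi) ∧ ¬ (a ≤ y ∧ y ≤ b)) →
      K ≤ ∑ x ∈ Icc a b, lightSize n (Γ.dat 3) (Γ.dat 4) x →
      ∃ P, P + ((F + 100) * (b + 1 - a) + 1140 * Γ.dat 4 a + 70 * (Nat.log 2 n + 1) * K +
          60 * ∑ w ∈ Ico a (a + Γ.dat 4 a), badCount (Γ.dat 5) (Γ.dat 6) bad a b w) + k₀ ≤ k + F ∧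
      ∀ τ l e dfn' dep' lst', τ.reg 0 = n → τ.arr 1 = bad → τ.arr 3 = top → τ.reg 1 = e →
        Walk (LiveAdj n (Γ.dat 5) (Γ.dat 6) bad vis₀) dfn c (dep (σ.reg 1)) (fun y => a ≤ y ∧ y ≤ b) R
          dfn' (τ.arr 6) dep' e (b + 1 - a) →
        (∀ y, τ.arr 0 y = 0 ↔ σ.arr 0 y = 0 ∧ ¬ (a ≤ y ∧ y ≤ b)) → τ.arr 4 = loq' → τ.arr 5 = hiq' →
        HasLists τ lst' →
        Recorded (UpEdge n (Γ.dat 5) (Γ.dat 6) bad) R n a b (a + Γ.dat 4 a) lst lst' →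
        τ.reg 3 ≤ σ.reg 3 + Γ.dat 4 a → P + k₀ ≤ l → ∃ dfn' dep' c' lst',
          Visiting Γ n N bad vis₀ top τ dfn' dep' c' lst' ∧ (∀ y, τ.arr 0 y = 0 → σ.arr 0 y = 0) ∧
          pot Γ n m F bad top τ dep' lst' + k₀ ≤ l := by
    intro a b K R loq' hiq' h1 h2 h3 h4 h5 h6 h7 h8
    have hd := pot_drop (m := m) (F := F) (bad := bad) (dep := dep) (lst := lst) (hSab a b h1 h3)
      (hsegd a b loq' hiq' h1 h2 h3 h4 h5 h6) h8
    have hbn := hown b (by omega) h3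
    have hbad := hq.ups.sum_badCount (bad := bad) (a := a) (b := b) (e := a + Γ.dat 4 a)
      (hq.tree.le_end (by omega))
    refine ⟨_, (Nat.add_le_add_right ((Nat.add_le_add_left (Nat.add_le_add_left
      (Nat.mul_le_mul_left 60 hbad) _) _).trans hd) k₀).trans hk, ?_⟩
    intro τ l e dfn' dep' lst' r0 a1 a3 r1 hW hv e4 e5 hl hR r3 hP
    have hL : Limits n (τ.arr 0) top (τ.arr 4) (τ.arr 5) := by
      refine h.limits.cut hv (by rwa [e4]) (by rwa [e5]) ?_ hqn ?_
      · intro y g1 g2; rw [hlo, hhi]; omega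
      · rwa [e4, e5, hlo, hhi]
    refine ⟨dfn', dep', _, lst', h.enter hq (hSab a b h1 h3) (hchain a b h1 h3) r0 a1 a3 r1 hW hv hL hl
      hR r3 ?_, fun y hy => ((hv y).1 hy).1, ?_⟩
    · rw [e4, e5]
      exact hsegd a b loq' hiq' h1 h2 h3 h4 h5 h6
    · have g1 := hR.length
      have g2 := hW.depth
      rw [pot, e4, e5, r1, g2]
      simp only [hv]
      omega
  have htop' := h.top_eq
  -- the walk goes to the end that is farther away, so that at most half of the part remains
  by_cases hdir : x - lo < hi - x
  · obtain ⟨P, hP, hend⟩ := hfin (a := x) (b := hi) (R := fun u' u => u ≤ u') (loq' := σ.arr 4)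
      (hiq' := Function.update (σ.arr 5) (top x) (x - 1)) hm.1 hm.2 le_rfl (fun _ _ => rfl)
      (fun q' hq' => Function.update_of_ne hq' _ _) (by rw [Function.update_self, hlo]; omega)
      (fun y => by rw [Function.update_self, hlo]; omega)
      (hq.tree.card_light hm.2 hhi'.2.1 (hchain x hi hm.1 le_rfl))
    have := hszx x hxn
    rw [Nat.add_mul] at hP
    have hF1 : F ≤ F * (hi + 1 - x) := Nat.le_mul_of_pos_right _ (by omega)
    simp only [enterCmd, WP, E.ev, E.ok, E.cost]
    simp only [Mach.setr_reg, Mach.setr_arr, Mach.put_reg, h.top_eq, r4, if_true,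
      Nat.reduceEqDiff, if_false, hlo, hhi]
    refine ⟨⟨by omega, trivial⟩, by omega, ⟨by omega, trivial⟩, by omega, ⟨by omega, trivial⟩, by omega,
      ⟨by omega, trivial, trivial⟩, by omega, ⟨by omega, trivial, by omega⟩, by omega, trivial, by omega,
      by simp, by omega, fun _ => ?_, fun hc => by simp [hdir] at hc⟩
    refine ⟨⟨by omega, trivial, trivial, by omega⟩, by omega, ?_⟩
    refine walkDown_spec (k₀ := k - 140 - 30 * (hi + 1 - x)) hm.2 (by omega) (fun y h1 h2 => hdfn y (by omega) h2)
      (fun y h1 h2 => (hstep y (by omega) h2).2) (by simp) (by simp)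
      (by simpa using hst (fun u' u => u ≤ u')) (by simp) (by omega) ?_
    intro τ l dfn' dep' hF hW hv hl
    have q0 := hF.r 0 rfl
    have q3 := hF.r 3 rfl
    have q4 := hF.r 4 rfl
    have q17 := hF.r 17 rfl
    have b1 := hF.a 1 rfl
    have b3 := hF.a 3 rfl
    have b4 := hF.a 4 rfl
    have b5 := hF.a 5 rfl
    have b7 := hF.a 7 rfl
    have b8 := hF.a 8 rfl
    have b9 := hF.a 9 rfl
    simp [r4] at q0 q3 q4 q17 b1 b3 b4 b5 b7 b8 b9
    simp only [q4, q17]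
    refine ⟨trivial, by omega, trivial, by omega, trivial, by omega, ⟨trivial, by omega, by omega⟩,
      by omega, ?_⟩
    refine recordCmd_spec (bad := bad) (k₀ := P + k₀) (lst := lst) hq.tree hq.ups hq.snaps
      (fun u w huw => (hq.anc u w huw).2.1) hx1 hm.2 hhi'.2.1 (by omega)
      (pickDown_spec hq.ups (by omega) hq.up_lt)
      (fun y hy => by simp [pickDown, scanDown, Cmd.modr, hy]) (fun j => rfl) hq.up_lt (by omega) ?_
      (by simp [b1, h.bad_eq]) (by simp) (by simp) (by simp) ?_ (by omega) ?_
    · have := h.nodes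
      simp [q3]; omega
    · intro u
      have := h.lists u
      simpa [q3, b7, b8, b9] using this
    · intro τ2 l2 lst' F2 g1 g2 g3 g4
      have p0 := F2.r 0 rfl
      have p1 := F2.r 1 rfl
      have c0 := F2.a 0 rfl
      have c1 := F2.a 1 rfl
      have c3 := F2.a 3 rfl
      have c4 := F2.a 4 rfl
      have c5 := F2.a 5 rfl
      have c6 := F2.a 6 rfl
      simp [q0, b1, b3, b4, b5] at p0 p1 c0 c1 c3 c4 c5 c6
      refine hend τ2 l2 hi dfn' dep' lst' (p0.trans h.size) (c1.trans h.bad_eq) (c3.trans h.top_eq) p1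
        (by rw [c6]; exact hW) ?_ c4 c5 g1 g2 (by simpa [q3] using g3) g4
      intro y
      rw [c0, hv]
      simp only [Mach.setr_arr, Mach.put_arr, if_true, Nat.reduceEqDiff, if_false,
        Function.update_apply]
      split_ifs with hy
      · simp; omega
      · rfl
  · obtain ⟨P, hP, hend⟩ := hfin (a := lo) (b := x) (K := 0) (R := (· ≤ ·))
      (loq' := Function.update (σ.arr 4) (top x) (x + 1)) (hiq' := σ.arr 5) le_rfl hm.1 hm.2
      (fun q' hq' => Function.update_of_ne hq' _ _) (fun _ _ => rfl)
      (by rw [Function.update_self, hhi]; omega)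
      (fun y => by rw [Function.update_self, hhi]; omega) (Nat.zero_le _)
    have := hszx lo hlo'.2.1
    -- upwards, the ranks are those at `lo`, and all vertices in question are in the subtree of `lo`
    have hK : 70 * (Nat.log 2 n + 1) * ((Ico lo (lo + Γ.dat 4 lo)).filter
        fun w => ¬ (lo ≤ w ∧ w < lo + Γ.dat 4 lo)).card = 0 := by
      rw [filter_false_of_mem (by simp), card_empty, Nat.mul_zero]
    rw [Nat.add_mul] at hP
    have hF1 : F ≤ F * (x + 1 - lo) := Nat.le_mul_of_pos_right _ (by omega)
    simp only [enterCmd, WP, E.ev, E.ok, E.cost]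
    simp only [Mach.setr_reg, Mach.setr_arr, Mach.put_reg, h.top_eq, r4, if_true,
      Nat.reduceEqDiff, if_false, hlo, hhi]
    refine ⟨⟨by omega, trivial⟩, by omega, ⟨by omega, trivial⟩, by omega, ⟨by omega, trivial⟩, by omega,
      ⟨by omega, trivial, trivial⟩, by omega, ⟨by omega, trivial, by omega⟩, by omega, trivial, by omega,
      by simp, by omega, fun hc => by simp [hdir] at hc, fun _ => ?_⟩
    refine ⟨⟨by omega, trivial, trivial, by omega, by omega⟩, by omega, ?_⟩
    refine walkUp_spec (k₀ := k - 140 - 30 * (x + 1 - lo)) hlo'.1 hm.1 (by omega) (fun y h1 h2 => hdfn y h1 (by omega))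
      (fun y h1 h2 => (hstep y h1 (by omega)).2.symm) (by simp) (by simp)
      (by simpa using hst (· ≤ ·)) (by simp) (by omega) ?_
    intro τ l dfn' dep' hF hW hv hl
    have q0 := hF.r 0 rfl
    have q3 := hF.r 3 rfl
    have q4 := hF.r 4 rfl
    have q9 := hF.r 9 rfl
    have b1 := hF.a 1 rfl
    have b3 := hF.a 3 rfl
    have b4 := hF.a 4 rfl
    have b5 := hF.a 5 rfl
    have b7 := hF.a 7 rfl
    have b8 := hF.a 8 rfl
    have b9 := hF.a 9 rfl
    simp [r4] at q0 q3 q4 q9 b1 b3 b4 b5 b7 b8 b9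
    simp only [q4, q9]
    refine ⟨trivial, by omega, trivial, by omega, trivial, by omega, trivial, by omega, ?_⟩
    refine recordCmd_spec (bad := bad) (k₀ := P + k₀) (lst := lst) hq.tree hq.ups hq.snaps
      (fun u w huw => (hq.anc u w huw).2.1) hlo'.1 hm.1 hxn le_rfl
      (pickUp_spec hq.ups hxn (by omega))
      (fun y hy => by simp [pickUp, scanUp, Cmd.modr, hy]) (fun j => rfl) hq.up_lt (by omega) ?_
      (by simp [b1, h.bad_eq]) (by simp) (by simp) (by simp) ?_ (by omega) ?_
    · have := h.nodes
      simp [q3]; omega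
    · intro u
      have := h.lists u
      simpa [q3, b7, b8, b9] using this
    · intro τ2 l2 lst' F2 g1 g2 g3 g4
      have p0 := F2.r 0 rfl
      have p1 := F2.r 1 rfl
      have c0 := F2.a 0 rfl
      have c1 := F2.a 1 rfl
      have c3 := F2.a 3 rfl
      have c4 := F2.a 4 rfl
      have c5 := F2.a 5 rfl
      have c6 := F2.a 6 rfl
      simp [q0, b1, b3, b4, b5] at p0 p1 c0 c1 c3 c4 c5 c6
      refine hend τ2 l2 lo dfn' dep' lst' (p0.trans h.size) (c1.trans h.bad_eq) (c3.trans h.top_eq) p1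
        (by rw [c6]; exact hW) ?_ c4 c5 g1 g2 (by simpa [q3] using g3) g4
      intro y
      rw [c0, hv]
      simp only [Mach.setr_arr, Mach.put_arr, if_true, Nat.reduceEqDiff, if_false,
        Function.update_apply]
      split_ifs with hy
      · simp; omega
      · rfl

end

/-! ### Finding an unvisited neighbour -/

theorem E.ev_and {Γ : Env} {σ : Mach} {e f : E} :
    (E.and e f).ev Γ σ ≠ 0 ↔ e.ev Γ σ ≠ 0 ∧ f.ev Γ σ ≠ 0 := by
  simp [E.ev]

theorem E.ev_and_zero {Γ : Env} {σ : Mach} {e f : E} :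
    (E.and e f).ev Γ σ = 0 ↔ ¬ (e.ev Γ σ ≠ 0 ∧ f.ev Γ σ ≠ 0) := by
  rw [← E.ev_and, not_not]

theorem E.ev_eq {Γ : Env} {σ : Mach} {e f : E} : (E.eq e f).ev Γ σ ≠ 0 ↔ e.ev Γ σ = f.ev Γ σ := by
  simp [E.ev]

section
open E Cmd

/-- Find an edge from `v 10` to a vertex that is neither above `v 11` nor below `v 8 - 1`; then
proceed to the segment above `v 6`. -/
def segmentSearch : Cmd :=
  searchCmd ;;
  scanUp 12 (d 5 (add (v 10) (c 1))) (and (a 1 (v 12)) (lt (d 6 (v 12)) (v 8))) ;;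
  .ite (and (lt (v 12) (d 5 (add (v 10) (c 1)))) (lt (d 6 (v 12)) (v 8)))
    (.set 4 (d 6 (v 12))) .skip ;;
  .set 5 (d 3 (v 6))

/-- For the segment of the vertex `v 5`, find an edge from `v 10` to an unvisited vertex of this
segment that is not below `v 5`; then proceed to the segment above. -/
def segmentStep : Cmd :=
  .set 6 (a 3 (v 5)) ;; .set 11 (a 4 (v 6)) ;;
  .ite (lt (a 5 (v 6)) (v 5)) (.set 8 (add (a 5 (v 6)) (c 1))) (.set 8 (add (v 5) (c 1))) ;;
  segmentSearch

/-- Go through the segments above `v 5`, until a vertex has been found or the root is reached. -/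
def segmentLoop : Cmd := .loop (and (v 5) (eq (v 4) (c 0))) segmentStep

/-- Find an unvisited upper neighbour of the current vertex. -/
def findUp : Cmd := .set 5 (v 1) ;; .set 10 (v 1) ;; segmentLoop

/-- If none has been found, find an unvisited vertex on the list of the current vertex. -/
def findDown : Cmd :=
  .loop (and (eq (v 4) (c 0)) (a 7 (v 1))) (.set 6 (a 7 (v 1)) ;; .set 10 (a 8 (v 6)) ;;
    .ite (a 0 (v 10)) (.put 7 (v 1) (a 9 (v 6))) (.set 4 (v 10)))

end

section
variable {Γ : Env} {n m len N F : ℕ} {adj : ℕ → ℕ → Prop} {bad vis₀ top : ℕ → ℕ}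

/-- The number of failed edges from `w` to vertices up to `z`. -/
def badUpTo (off up bad : ℕ → ℕ) (w z : ℕ) : ℕ :=
  ((Ico (off w) (off (w + 1))).filter fun t => bad t ≠ 0 ∧ up t ≤ z).card

/-- One segment on the path from `w` to the root, from `z` upwards. The scan starts at the first
edge to the unvisited part of the segment and passes only failed edges; each of them is passed for
one segment only, so that the bound `badUpTo` decreases accordingly. -/
theorem segmentStep_spec (hq : Query Γ n m len N adj bad vis₀ top) {σ : Mach} {w z q : ℕ}
    (a1 : σ.arr 1 = bad) (a3 : σ.arr 3 = top) (hL : Limits n (σ.arr 0) top (σ.arr 4) (σ.arr 5))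
    (r4 : σ.reg 4 = 0) (r5 : σ.reg 5 = z) (r10 : σ.reg 10 = w) (hz1 : 1 ≤ z) (hzw : z ≤ w) (hw : w ≤ n)
    (hqz : top z = q) {k k₀ : ℕ} {Q : Mach → ℕ → Prop}
    (hk : 70 * (Nat.log 2 n + 1) + 250 + 60 * badUpTo (Γ.dat 5) (Γ.dat 6) bad w z + k₀ ≤ k)
    (hQ : ∀ τ l, Fr segmentStep σ τ → τ.reg 5 = Γ.dat 3 q →
      (τ.reg 4 ≠ 0 → σ.arr 0 (τ.reg 4) = 0 ∧ UpEdge n (Γ.dat 5) (Γ.dat 6) bad (τ.reg 4) w) →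
      (τ.reg 4 = 0 → ∀ u, u ≤ z → top u = q → UpEdge n (Γ.dat 5) (Γ.dat 6) bad u w → σ.arr 0 u ≠ 0) →
      60 * badUpTo (Γ.dat 5) (Γ.dat 6) bad w (Γ.dat 3 q) + k₀ ≤ l → Q τ l) :
    WP Γ segmentStep Q σ k := by
  refine WP_conseq (Q := fun τ l => τ.reg 5 = Γ.dat 3 q ∧
      (τ.reg 4 ≠ 0 → σ.arr 0 (τ.reg 4) = 0 ∧ UpEdge n (Γ.dat 5) (Γ.dat 6) bad (τ.reg 4) w) ∧
      (τ.reg 4 = 0 → ∀ u, u ≤ z → top u = q → UpEdge n (Γ.dat 5) (Γ.dat 6) bad u w → σ.arr 0 u ≠ 0) ∧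
      60 * badUpTo (Γ.dat 5) (Γ.dat 6) bad w (Γ.dat 3 q) + k₀ ≤ l) ?_
    fun τ l hF ⟨h1, h2, h3, h4⟩ => hQ τ l hF h1 h2 h3 h4
  have hB := hq.bound
  have htop := hq.segs.top_le z hz1 (by omega)
  have htt := hq.segs.top_top hz1 (by omega : z ≤ n)
  rw [hqz] at htop htt
  have hown := hL.own q htop.1 (by omega) htt
  have hmem : ∀ u, 1 ≤ u → u ≤ n → top u = q → σ.arr 0 u = 0 → σ.arr 4 q ≤ u ∧ u ≤ σ.arr 5 q := by
    intro u h1 h2 h3 h4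
    have := hL.mem u h1 h2 h4
    rwa [h3] at this
  obtain ⟨lo, hlo⟩ : ∃ lo, σ.arr 4 q = lo := ⟨_, rfl⟩
  obtain ⟨hi, hhi⟩ : ∃ hi, σ.arr 5 q = hi := ⟨_, rfl⟩
  rw [hlo, hhi] at hown hmem
  -- vertices of the segment below `z` are not ancestors of `w`
  obtain ⟨e, he⟩ : ∃ e, min hi z = e := ⟨_, rfl⟩
  have hU := hq.ups
  have h1 := hU.mono w hw
  have h2 := hU.off_le (show w + 1 ≤ n + 1 by omega)
  have h4 := rank_le (Γ.dat 5) (Γ.dat 6) w lo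
  obtain ⟨t, t1, t2, t3, t4⟩ := scan_exists (fun s => bad s ≠ 0 ∧ Γ.dat 6 s ≤ e)
    (show Γ.dat 5 w + rank (Γ.dat 5) (Γ.dat 6) w lo ≤ Γ.dat 5 (w + 1) by omega)
  have hge : ∀ s, Γ.dat 5 w + rank (Γ.dat 5) (Γ.dat 6) w lo ≤ s → s < Γ.dat 5 (w + 1) →
      lo ≤ Γ.dat 6 s := by
    intro s hs1 hs2
    have := hU.up_lt_iff (z := lo) hw (t := s) (by omega) hs2
    omega
  have hpq := hq.tree.par q htop.1 (by omega)
  -- the failed edges passed end in this segment, hence are not counted for the segments above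
  have hcount : t - (Γ.dat 5 w + rank (Γ.dat 5) (Γ.dat 6) w lo) +
      badUpTo (Γ.dat 5) (Γ.dat 6) bad w (Γ.dat 3 q) ≤ badUpTo (Γ.dat 5) (Γ.dat 6) bad w z := by
    rw [← Nat.card_Ico, badUpTo, badUpTo, ← card_union_of_disjoint]
    · apply card_le_card
      intro s
      simp only [mem_union, mem_Ico, mem_filter]
      rintro (⟨g1, g2⟩ | ⟨g1, g2, g3⟩)
      · have := t3 s g1 g2
        exact ⟨by omega, this.1, by omega⟩
      · exact ⟨g1, g2, by omega⟩
    · rw [disjoint_left]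
      intro s
      simp only [mem_Ico, mem_filter]
      rintro ⟨g1, g2⟩ ⟨g3, g4, g5⟩
      have g6 := t3 s g1 g2
      have g7 := hown (Γ.dat 6 s) (hge s g1 (by omega)) (by omega)
      have := hq.segs.top_le (Γ.dat 6 s) g7.1 g7.2.1
      omega
  simp only [segmentStep, WP, E.ev, E.ok, E.cost]
  simp only [Mach.setr_reg, Mach.setr_arr, a3, r5, if_true, Nat.reduceEqDiff, if_false, hqz,
    hlo, hhi]
  refine ⟨⟨by omega, trivial⟩, by omega, ⟨by omega, trivial⟩, by omega, ?_⟩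
  have hmid : ∀ σ' l', σ'.reg 6 = q → σ'.reg 11 = lo → σ'.reg 8 = e + 1 → σ'.reg 4 = 0 →
      σ'.reg 10 = w → σ'.arr 1 = bad →
      70 * (Nat.log 2 n + 1) + 200 + 60 * badUpTo (Γ.dat 5) (Γ.dat 6) bad w z + k₀ ≤ l' →
      WP Γ segmentSearch (fun τ l => τ.reg 5 = Γ.dat 3 q ∧
      (τ.reg 4 ≠ 0 → σ.arr 0 (τ.reg 4) = 0 ∧ UpEdge n (Γ.dat 5) (Γ.dat 6) bad (τ.reg 4) w) ∧
      (τ.reg 4 = 0 → ∀ u, u ≤ z → top u = q → UpEdge n (Γ.dat 5) (Γ.dat 6) bad u w → σ.arr 0 u ≠ 0) ∧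
      60 * badUpTo (Γ.dat 5) (Γ.dat 6) bad w (Γ.dat 3 q) + k₀ ≤ l) σ' l' := by
    intro σ' l' g6 g11 g8 g4 g10 b1 hl'
    simp only [segmentSearch, WP]
    refine searchCmd_spec (k₀ := 200 + 60 * badUpTo (Γ.dat 5) (Γ.dat 6) bad w z + k₀) hU
      (fun u w huw => (hq.anc u w huw).2.1) hw (by omega) g10 g11 (by omega) ?_
    intro τ l hF e12 hl
    have p6 := (hF.r 6 rfl).trans g6
    have p8 := (hF.r 8 rfl).trans g8
    have p4 := (hF.r 4 rfl).trans g4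
    have p10 := (hF.r 10 rfl).trans g10
    have c1 := (hF.a 1 rfl).trans b1
    refine WP_scanUp (fun s => bad s ≠ 0 ∧ Γ.dat 6 s ≤ e) _ t (Γ.dat 5 (w + 1))
      (100 + 60 * badUpTo (Γ.dat 5) (Γ.dat 6) bad w (Γ.dat 3 q) + k₀) t1 t2 t3 t4 e12
      (by omega) (by omega) ?_ ?_ ?_
    · intro s hs1 hs2
      simp [E.ok, E.ev, p10, c1, p8]
      omega
    · simp only [E.cost]; omega
    · intro l2 hl2
      simp only [E.ev, E.ok, E.cost]
      simp only [Mach.setr_reg, p6, p8, p10, if_true, Nat.reduceEqDiff, if_false]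
      refine ⟨⟨⟨trivial, by omega, trivial, by omega, by omega⟩, ⟨by omega, trivial⟩, trivial⟩, by omega,
        fun hc => ?_, fun hc => ?_⟩
      · have hc : t < Γ.dat 5 (w + 1) ∧ Γ.dat 6 t < e + 1 := by
          by_contra hn
          apply hc
          rw [if_neg]
          simp; omega
        have g7 := hown (Γ.dat 6 t) (hge t t1 hc.1) (by omega)
        have hbt : bad t = 0 := by
          by_contra hne
          exact t4 hc.1 ⟨hne, by omega⟩
        refine ⟨⟨by omega, trivial⟩, by omega, ⟨by omega, trivial⟩, by omega, trivial, fun _ => ?_,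
          fun h0 => ?_, by omega⟩
        · exact ⟨g7.2.2.1, hw, t, by omega, hc.1, rfl, hbt⟩
        · change Γ.dat 6 t = 0 at h0
          omega
      · refine ⟨by omega, ⟨by omega, trivial⟩, by omega, trivial, fun h => absurd p4 h, fun _ => ?_, by omega⟩
        rintro u hu1 hu2 ⟨-, s, s1, s2, rfl, s4⟩ hvu
        have hanc := hq.anc _ _ (hU.mem w hw s s1 s2)
        have hmu := hmem _ hanc.1 (by omega) hu2 hvu
        have hs : Γ.dat 5 w + rank (Γ.dat 5) (Γ.dat 6) w lo ≤ s := by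
          have := hU.up_lt_iff (z := lo) hw (t := s) (by omega) s2
          omega
        have hts : t ≤ s := by
          by_contra hlt
          exact (t3 s hs (by omega)).1 s4
        have hm := hU.up_mono hw (by omega) hts s2
        rw [if_pos] at hc
        · cases hc
        · simp; omega
  refine ⟨⟨⟨by omega, trivial⟩, trivial⟩, by omega, fun hc => ?_, fun hc => ?_⟩
  · have hc : hi < z := by
      by_contra hn; simp [hn] at hc
    refine ⟨⟨⟨by omega, trivial⟩, by omega, by omega⟩, by omega, ?_⟩
    refine hmid _ _ ?_ ?_ ?_ ?_ ?_ ?_ (by omega) <;> simp [r4, r10, a1]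
    omega
  · have hc : ¬ hi < z := by
      intro hn; simp [hn] at hc
    refine ⟨⟨trivial, by omega, by omega⟩, by omega, ?_⟩
    refine hmid _ _ ?_ ?_ ?_ ?_ ?_ ?_ (by omega) <;> simp [r4, r10, a1]
    omega

/-- The search for an unvisited upper neighbour takes a binary search for each segment above `w`,
and time for the failed edges from `w` to ancestors. -/
theorem findUp_spec (hq : Query Γ n m len N adj bad vis₀ top) {σ : Mach} {w : ℕ}
    (a1 : σ.arr 1 = bad) (a3 : σ.arr 3 = top) (hL : Limits n (σ.arr 0) top (σ.arr 4) (σ.arr 5))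
    (r4 : σ.reg 4 = 0) (r1 : σ.reg 1 = w) (hw1 : 1 ≤ w) (hw : w ≤ n)
    {k k₀ : ℕ} {Q : Mach → ℕ → Prop}
    (hk : (70 * (Nat.log 2 n + 1) + 350) * ancCard n (Γ.dat 4) (fun x => top x = x) w +
      60 * badUpTo (Γ.dat 5) (Γ.dat 6) bad w w + 50 + k₀ ≤ k)
    (hQ : ∀ τ l, Fr findUp σ τ →
      (τ.reg 4 ≠ 0 → σ.arr 0 (τ.reg 4) = 0 ∧ UpEdge n (Γ.dat 5) (Γ.dat 6) bad (τ.reg 4) w) →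
      (τ.reg 4 = 0 → ∀ u, UpEdge n (Γ.dat 5) (Γ.dat 6) bad u w → σ.arr 0 u ≠ 0) →
      k₀ ≤ l → Q τ l) :
    WP Γ findUp Q σ k := by
  refine WP_conseq (Q := fun τ l =>
      (τ.reg 4 ≠ 0 → σ.arr 0 (τ.reg 4) = 0 ∧ UpEdge n (Γ.dat 5) (Γ.dat 6) bad (τ.reg 4) w) ∧
      (τ.reg 4 = 0 → ∀ u, UpEdge n (Γ.dat 5) (Γ.dat 6) bad u w → σ.arr 0 u ≠ 0) ∧ k₀ ≤ l) ?_
    fun τ l hF ⟨h1, h2, h3⟩ => hQ τ l hF h1 h2 h3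
  have hT := hq.tree
  have hB := hq.bound
  refine ⟨trivial, by simp only [E.cost]; omega, trivial, by simp only [E.cost]; omega, ?_⟩
  refine WP_loop (fun τ l => ∃ z, τ.reg 5 = z ∧ z ≤ w ∧ w < z + Γ.dat 4 z ∧
      (τ.reg 4 ≠ 0 → σ.arr 0 (τ.reg 4) = 0 ∧ UpEdge n (Γ.dat 5) (Γ.dat 6) bad (τ.reg 4) w) ∧
      (τ.reg 4 = 0 → ∀ u, z < u → UpEdge n (Γ.dat 5) (Γ.dat 6) bad u w → σ.arr 0 u ≠ 0) ∧
      (70 * (Nat.log 2 n + 1) + 350) * ancCard n (Γ.dat 4) (fun x => top x = x) z +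
        60 * badUpTo (Γ.dat 5) (Γ.dat 6) bad w z + 40 + k₀ ≤ l) ?_ ?_
  · have := hT.pos w hw
    refine ⟨w, by simp [E.ev, r1], le_rfl, by omega, fun h => ?_, fun _ u hu huw => ?_, ?_⟩
    · simp [r4] at h
    · have := hq.upEdge_anc huw; omega
    · simp only [E.cost]; omega
  · rintro τ l hF ⟨z, i1, i2, i3, i4, i5, i6⟩
    rw [E.ev_and, E.ev_and_zero, E.ev_eq]
    simp only [E.ok, E.ev, E.cost, i1]
    refine ⟨⟨trivial, trivial, by omega⟩, by omega, fun hc => ?_, fun hc => ?_⟩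
    · have e0 := hF.a 0 rfl
      have e1 := hF.a 1 rfl
      have e3 := hF.a 3 rfl
      have e4 := hF.a 4 rfl
      have e5 := hF.a 5 rfl
      have e10 := hF.r 10 rfl
      simp [E.ev, r1] at e0 e1 e3 e4 e5 e10
      have hD := hq.segs.ancCard_step hT (show 1 ≤ z by omega) (show z ≤ n by omega)
      have htop := hq.segs.top_le z (by omega) (by omega)
      have hn := hq.segs.nest hT (show 1 ≤ z by omega) (show z ≤ n by omega)
      have hp := hT.par (top z) htop.1 (by omega)
      have hD' := Nat.mul_le_mul_left (70 * (Nat.log 2 n + 1) + 350) hD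
      rw [Nat.mul_add, Nat.mul_one] at hD'
      refine segmentStep_spec (w := w) (z := z) (k₀ := (70 * (Nat.log 2 n + 1) + 350) *
          ancCard n (Γ.dat 4) (fun x => top x = x) (Γ.dat 3 (top z)) + 40 + k₀) hq (e1.trans a1)
        (e3.trans a3) (by rwa [e0, e4, e5]) hc.2 i1 e10 (by omega) i2 hw rfl (by omega) ?_
      intro τ' l' hF' g5 g4 g4' hl'
      rw [e0] at g4 g4'
      refine ⟨Γ.dat 3 (top z), g5, by omega, by omega, g4, fun h0 u hu huw => ?_, by omega⟩
      rcases Nat.lt_or_ge z u with hzu | hzu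
      · exact i5 hc.2 u hzu huw
      · have h1 := hq.upEdge_anc huw
        exact g4' h0 u hzu (hq.segs.top_eq_of_anc hT (by omega) hw i2 h1.2.2.1 hzu hu).1 huw
    · refine ⟨i4, fun h0 u huw => i5 h0 u ?_ huw, by omega⟩
      have h1 := hq.upEdge_anc huw
      have : z = 0 := by
        by_contra hz
        exact hc ⟨hz, h0⟩
      omega

/-- Visited vertices are removed from the list of the current vertex, until an unvisited one is at
its head or the list is empty. The credits for list entries pay for this. -/
theorem findDown_spec (hq : Query Γ n m len N adj bad vis₀ top) {σ : Mach} {dfn dep : ℕ → ℕ} {c : ℕ}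
    {lst : ℕ → List ℕ} (h : Visiting Γ n N bad vis₀ top σ dfn dep c lst) {k k₀ : ℕ}
    {Q : Mach → ℕ → Prop} (hk : 60 * ∑ u ∈ Icc 1 n, (lst u).length + 100 + k₀ ≤ k) (hn : σ.reg 1 ≤ n)
    (hQ : ∀ τ l lst', Fr findDown σ τ → Visiting Γ n N bad vis₀ top τ dfn dep c lst' →
      (τ.reg 4 = 0 → σ.reg 4 = 0 ∧ lst' (τ.reg 1) = []) →
      (τ.reg 4 ≠ 0 → τ.reg 4 = σ.reg 4 ∨
        σ.arr 0 (τ.reg 4) = 0 ∧ UpEdge n (Γ.dat 5) (Γ.dat 6) bad (σ.reg 1) (τ.reg 4)) →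
      60 * ∑ u ∈ Icc 1 n, (lst' u).length + k₀ ≤ l → Q τ l) :
    WP Γ findDown Q σ k := by
  refine WP_conseq (Q := fun τ l => ∃ lst', Visiting Γ n N bad vis₀ top τ dfn dep c lst' ∧
      (τ.reg 4 = 0 → σ.reg 4 = 0 ∧ lst' (τ.reg 1) = []) ∧
      (τ.reg 4 ≠ 0 → τ.reg 4 = σ.reg 4 ∨
        σ.arr 0 (τ.reg 4) = 0 ∧ UpEdge n (Γ.dat 5) (Γ.dat 6) bad (σ.reg 1) (τ.reg 4)) ∧
      60 * ∑ u ∈ Icc 1 n, (lst' u).length + k₀ ≤ l) ?_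
    fun τ l hF ⟨lst', h1, h2, h3, h4⟩ => hQ τ l lst' hF h1 h2 h3 h4
  have hB := hq.bound
  refine WP_loop (fun τ l => ∃ lst', Visiting Γ n N bad vis₀ top τ dfn dep c lst' ∧
      (τ.reg 4 = 0 → σ.reg 4 = 0) ∧
      (τ.reg 4 ≠ 0 → τ.reg 4 = σ.reg 4 ∨
        σ.arr 0 (τ.reg 4) = 0 ∧ UpEdge n (Γ.dat 5) (Γ.dat 6) bad (σ.reg 1) (τ.reg 4)) ∧
      (τ.reg 4 = 0 → 60 * ∑ u ∈ Icc 1 n, (lst' u).length + 100 + k₀ ≤ l) ∧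
      60 * ∑ u ∈ Icc 1 n, (lst' u).length + 50 + k₀ ≤ l) ?_ ?_
  · exact ⟨lst, h, fun h => h, fun _ => Or.inl rfl, fun _ => by omega, by omega⟩
  · rintro τ l hF ⟨lst', i1, i2, i3, i4⟩
    have e1 := hF.r 1 rfl
    have e0 := hF.a 0 rfl
    rw [E.ev_and, E.ev_and_zero, E.ev_eq]
    simp only [E.ok, E.ev, E.cost]
    refine ⟨⟨⟨trivial, by omega⟩, by omega, trivial⟩, by omega, fun hc => ?_,
      fun hc => ?_⟩
    · have i4 := i4.1 hc.1
      have hch := i1.lists (τ.reg 1)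
      rcases hlw : lst' (τ.reg 1) with _ | ⟨w, ws⟩
      · rw [hlw] at hch; exact absurd hch hc.2
      rw [hlw] at hch
      obtain ⟨-, hch2, hch3, hch4⟩ := hch
      have hs := i1.sound (τ.reg 1) w (by rw [hlw]; simp)
      have ha := hq.upEdge_anc hs.1
      simp only [WP, E.ok, E.ev, E.cost]
      refine ⟨⟨by omega, trivial⟩, by omega, ⟨by omega, trivial⟩, by omega, ?_⟩
      simp only [Mach.setr_reg, Mach.setr_arr, if_true, Nat.reduceEqDiff, if_false, hch3]
      refine ⟨⟨by omega, trivial⟩, by omega, fun hv => ?_, fun hv => ?_⟩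
      · refine ⟨⟨by omega, trivial, by omega, trivial⟩, by omega, ?_⟩
        have hlen : ∑ u ∈ Icc 1 n, (Function.update lst' (τ.reg 1) ws u).length + 1 =
            ∑ u ∈ Icc 1 n, (lst' u).length := by
          have hmem : τ.reg 1 ∈ Icc 1 n := by simp; omega
          rw [← add_sum_erase _ _ hmem, ← add_sum_erase _ _ hmem, Function.update_self, hlw,
            List.length_cons]
          rw [sum_congr rfl fun u hu => by rw [Function.update_of_ne (ne_of_mem_erase hu)]]
          omega
        refine ⟨Function.update lst' (τ.reg 1) ws, ?_, by simpa using i2, by simpa using i3,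
          fun _ => by omega, by omega⟩
        refine ⟨?_, ?_, ?_, ?_, ?_, ?_, ?_, ?_, ?_, ?_, ?_⟩
        · simpa using i1.size
        · simpa using i1.bad_eq
        · simpa using i1.top_eq
        · simpa using i1.trav
        · simpa using i1.vis
        · simpa using i1.visited
        · simpa using i1.limits
        · intro u
          by_cases hu : u = τ.reg 1
          · subst hu; simpa using hch4
          · simpa [hu] using i1.lists u
        · simpa using i1.nodes
        · intro u x hx
          refine i1.sound u x ?_
          by_cases hu : u = τ.reg 1
          · subst hu
            rw [Function.update_self] at hx
            rw [hlw]; exact List.mem_cons_of_mem _ hx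
          · rwa [Function.update_of_ne hu] at hx
        · intro u x hux hu hx0 hx
          obtain ⟨u', k1, k2⟩ := i1.recorded u x hux hu hx0 hx
          refine ⟨u', k1, ?_⟩
          by_cases hu' : u' = τ.reg 1
          · subst hu'
            rw [Function.update_self]
            rw [hlw, List.mem_cons] at k2
            refine k2.resolve_left ?_
            rintro rfl
            exact hv ((i1.vis x (by omega) (by omega)).2 ⟨hx0, hx⟩)
          · rwa [Function.update_of_ne hu']
      · refine ⟨trivial, by omega, lst', ?_, ?_, ?_, ?_, ?_⟩
        · exact ⟨i1.size, i1.bad_eq, i1.top_eq, i1.trav, i1.vis, i1.visited, i1.limits, i1.lists,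
            i1.nodes, i1.sound, i1.recorded⟩
        · intro h0
          change w = 0 at h0
          omega
        · intro _
          right
          rw [← e1]
          exact ⟨by rwa [← e0], hs.1⟩
        · intro h0
          change w = 0 at h0
          omega
        · omega
    · have hc : τ.reg 4 = 0 → τ.arr 7 (τ.reg 1) = 0 := by tauto
      refine ⟨lst', i1, fun h0 => ⟨i2 h0, ?_⟩, i3, by omega⟩
      have hch := i1.lists (τ.reg 1)
      rcases hlw : lst' (τ.reg 1) with _ | ⟨w, ws⟩
      · rfl
      · rw [hlw] at hch
        exact absurd (hc h0) hch.1

end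

/-! ### The traversal -/

section
open E Cmd

/-- Find the next vertex to visit and put it in `v 4`; if there is none, go back to the parent of
the current vertex, or proceed to the next candidate `v 2` for a root. -/
def nextCmd : Cmd :=
  .set 4 (c 0) ;;
  .ite (v 1) (findUp ;; findDown ;; .ite (v 4) .skip (.set 1 (a 6 (v 1))))
    (.ite (a 0 (v 2)) (.set 2 (add (v 2) (c 1))) (.set 4 (v 2)))

/-- Traverse the surviving graph. -/
def traverse : Cmd :=
  .loop (add (v 1) (sub (add (v 0) (c 1)) (v 2))) (nextCmd ;; .ite (v 4) enterCmd .skip)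

end

section
variable {Γ : Env} {n m len N F : ℕ} {adj : ℕ → ℕ → Prop} {bad vis₀ top : ℕ → ℕ}

theorem Visiting.congr {σ τ : Mach} {dfn dep : ℕ → ℕ} {c : ℕ} {lst : ℕ → List ℕ}
    (h : Visiting Γ n N bad vis₀ top σ dfn dep c lst) (h0 : τ.reg 0 = σ.reg 0)
    (h1 : τ.reg 1 = σ.reg 1) (h3 : τ.reg 3 = σ.reg 3) (ha : τ.arr = σ.arr) :
    Visiting Γ n N bad vis₀ top τ dfn dep c lst := by
  refine ⟨h0.trans h.size, by rw [ha]; exact h.bad_eq, by rw [ha]; exact h.top_eq,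
    by rw [ha, h1]; exact h.trav, by rw [ha]; exact h.vis, h.visited, by rw [ha]; exact h.limits,
    fun u => ?_, by rw [ha, h3]; exact h.nodes, h.sound, h.recorded⟩
  have := h.lists u
  rwa [ha, h3]

theorem pot_congr {σ τ : Mach} {dep : ℕ → ℕ} {lst : ℕ → List ℕ} (h1 : τ.reg 1 = σ.reg 1)
    (ha : τ.arr = σ.arr) : pot Γ n m F bad top τ dep lst = pot Γ n m F bad top σ dep lst := by
  rw [pot, pot, h1, ha]

/-- When the lists and the upper neighbours of the current vertex are exhausted, then all its
neighbours are visited. -/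
theorem Visiting.exhausted {τ : Mach} (hq : Query Γ n m len N adj bad vis₀ top)
    {dfn dep : ℕ → ℕ} {c : ℕ} {lst : ℕ → List ℕ}
    (h : Visiting Γ n N bad vis₀ top τ dfn dep c lst) (hc : τ.reg 1 ≠ 0) (hl : lst (τ.reg 1) = [])
    (hu : ∀ u, UpEdge n (Γ.dat 5) (Γ.dat 6) bad u (τ.reg 1) → τ.arr 0 u ≠ 0) :
    Traversal (LiveAdj n (Γ.dat 5) (Γ.dat 6) bad vis₀) dfn (τ.arr 6) dep (τ.arr 6 (τ.reg 1)) c := by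
  refine h.trav.back hc fun x hx hd => ?_
  have hdc := h.trav.at_cur.resolve_left hc
  rcases hx.1 with hx' | hx'
  · obtain ⟨u', h1, h2⟩ := h.recorded _ x hx' hdc hx.2.2 hd
    have h3 := h.sound u' x h2
    -- no vertex visited after the current one has an unvisited neighbour
    have h4 := h.trav.front u' x ⟨Or.inl h3.1, h3.2.2.2, hx.2.2⟩ (by omega) hd
    have h5 := h.trav.inj u' _ (by omega) (le_antisymm h4 h1)
    rw [h5, hl] at h2
    cases h2
  · have h1 := hq.upEdge_anc hx'
    exact hu x hx' ((h.vis x h1.1 (by omega)).2 ⟨hx.2.2, hd⟩)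

/-- If no vertex is found, then the depth of the current vertex decreases or the next candidate for
a root is taken, which pays for the search. Otherwise `F` credits may be missing afterwards, which
`enterCmd_spec` provides. -/
theorem nextCmd_spec (hq : Query Γ n m len N adj bad vis₀ top)
    (hF : ∀ w, 1 ≤ w → w ≤ n → (70 * (Nat.log 2 n + 1) + 350) *
      ancCard n (Γ.dat 4) (fun x => top x = x) w + 60 * badUpTo (Γ.dat 5) (Γ.dat 6) bad w w + 400 ≤ F)
    {σ : Mach} {dfn dep : ℕ → ℕ} {c r : ℕ} {lst : ℕ → List ℕ}
    (h : Visiting Γ n N bad vis₀ top σ dfn dep c lst) (hr : σ.reg 2 = r) (hr1 : 1 ≤ r)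
    (hrn : σ.reg 1 = 0 → r ≤ n) (hrv : ∀ x, 1 ≤ x → x < r → σ.arr 0 x ≠ 0)
    {k k₀ : ℕ} {Q : Mach → ℕ → Prop}
    (hk : pot Γ n m F bad top σ dep lst + 100 * (n + 1 - r) + k₀ ≤ k + 10)
    (hQ : ∀ τ l r' lst', Fr nextCmd σ τ → Visiting Γ n N bad vis₀ top τ dfn dep c lst' →
      τ.reg 2 = r' → 1 ≤ r' → r' ≤ max r (n + 1) → (∀ x, 1 ≤ x → x < r' → τ.arr 0 x ≠ 0) →
      (τ.reg 4 = 0 → pot Γ n m F bad top τ dep lst' + 100 * (n + 1 - r') + 40 + k₀ ≤ l) →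
      (τ.reg 4 ≠ 0 → pot Γ n m F bad top τ dep lst' + 100 * (n + 1 - r') + 40 + k₀ ≤ l + F ∧
        1 ≤ τ.reg 4 ∧ τ.reg 4 ≤ n ∧ τ.arr 0 (τ.reg 4) = 0 ∧
        (τ.reg 1 = 0 ∨ LiveAdj n (Γ.dat 5) (Γ.dat 6) bad vis₀ (τ.reg 1) (τ.reg 4)) ∧ 10 ≤ l) → Q τ l) :
    WP Γ nextCmd Q σ k := by
  refine WP_conseq (Q := fun τ l => ∃ r' lst', Visiting Γ n N bad vis₀ top τ dfn dep c lst' ∧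
      τ.reg 2 = r' ∧ 1 ≤ r' ∧ r' ≤ max r (n + 1) ∧ (∀ x, 1 ≤ x → x < r' → τ.arr 0 x ≠ 0) ∧
      (τ.reg 4 = 0 → pot Γ n m F bad top τ dep lst' + 100 * (n + 1 - r') + 40 + k₀ ≤ l) ∧
      (τ.reg 4 ≠ 0 → pot Γ n m F bad top τ dep lst' + 100 * (n + 1 - r') + 40 + k₀ ≤ l + F ∧
        1 ≤ τ.reg 4 ∧ τ.reg 4 ≤ n ∧ τ.arr 0 (τ.reg 4) = 0 ∧
        (τ.reg 1 = 0 ∨ LiveAdj n (Γ.dat 5) (Γ.dat 6) bad vis₀ (τ.reg 1) (τ.reg 4)) ∧ 10 ≤ l)) ?_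
    fun τ l hF ⟨r', lst', h1, h2, h3, h4, h5, h6, h7⟩ => hQ τ l r' lst' hF h1 h2 h3 h4 h5 h6 h7
  have hB := hq.bound
  by_cases hc : σ.reg 1 = 0
  · have hrn := hrn hc
    simp only [nextCmd, WP, E.ok, E.ev, E.cost]
    simp only [Mach.setr_reg, Mach.setr_arr, if_true, Nat.reduceEqDiff, if_false, hr, hc]
    refine ⟨by omega, by omega, trivial, by omega, fun h => absurd rfl h, fun _ => ?_⟩
    refine ⟨⟨by omega, trivial⟩, by omega, fun hv => ?_, fun hv => ?_⟩
    · refine ⟨⟨trivial, by omega, by omega⟩, by omega, ?_⟩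
      refine ⟨r + 1, lst, h.congr rfl rfl rfl rfl, rfl, by omega, by omega, fun x h1 h2 => ?_,
        fun _ => ?_, fun h0 => absurd rfl h0⟩
      · rcases Nat.lt_or_ge x r with h3 | h3
        · exact hrv x h1 h3
        · obtain rfl : x = r := by omega
          exact hv
      · have e : pot Γ n m F bad top ((σ.setr 4 0).setr 2 (r + 1)) dep lst =
            pot Γ n m F bad top σ dep lst := pot_congr rfl rfl
        omega
    · refine ⟨trivial, by omega, ?_⟩
      refine ⟨r, lst, h.congr rfl rfl rfl rfl, rfl, hr1, by omega, hrv, fun h0 => ?_, fun _ => ?_⟩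
      · change r = 0 at h0; omega
      · have e : pot Γ n m F bad top ((σ.setr 4 0).setr 4 r) dep lst =
            pot Γ n m F bad top σ dep lst := pot_congr rfl rfl
        have := hF r hr1 hrn
        exact ⟨by omega, hr1, hrn, hv, Or.inl trivial, by omega⟩
  · have hdc := h.trav.at_cur.resolve_left hc
    have hcn := h.visited _ hdc
    have hdep := h.trav.depth _ hdc
    have hFc := hF _ hcn.1 hcn.2.1
    have hpotF : F * dep (σ.reg 1) + 60 * ∑ u ∈ Icc 1 n, (lst u).length ≤
        pot Γ n m F bad top σ dep lst := by rw [pot]; omega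
    have hFd : F ≤ F * dep (σ.reg 1) := Nat.le_mul_of_pos_right _ (by omega)
    simp only [nextCmd, WP, E.ok, E.ev, E.cost]
    refine ⟨by omega, by omega, trivial, by omega, fun _ => ?_, fun h => absurd h hc⟩
    obtain ⟨X, hX⟩ : ∃ X, (70 * (Nat.log 2 n + 1) + 350) *
      ancCard n (Γ.dat 4) (fun x => top x = x) (σ.reg 1) + 60 * badUpTo (Γ.dat 5) (Γ.dat 6) bad
      (σ.reg 1) (σ.reg 1) = X := ⟨_, rfl⟩
    rw [hX] at hFc
    refine findUp_spec (σ := σ.setr 4 0) (w := σ.reg 1) (k₀ := k - 4 - X - 50) hq h.bad_eq h.top_eq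
      h.limits rfl rfl hcn.1 hcn.2.1 (by rw [hX]; omega) ?_
    intro τ l hF1 u1 u2 hl
    have ea : τ.arr = σ.arr := funext fun j => hF1.a j rfl
    have e1 : τ.reg 1 = σ.reg 1 := hF1.r 1 rfl
    have e2 : τ.reg 2 = σ.reg 2 := hF1.r 2 rfl
    have h' := h.congr (hF1.r 0 rfl) e1 (hF1.r 3 rfl) ea
    refine findDown_spec (k₀ := l - 100 - 60 * ∑ u ∈ Icc 1 n, (lst u).length) hq h' (by omega)
      (by omega) ?_
    intro τ' l' lst' hF2 h2 d1 d2 hl'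
    have f1 : τ'.reg 1 = σ.reg 1 := (hF2.r 1 rfl).trans e1
    have f2 : τ'.reg 2 = σ.reg 2 := (hF2.r 2 rfl).trans e2
    have b0 : τ'.arr 0 = σ.arr 0 := (hF2.a 0 rfl).trans (by rw [ea])
    have b4 : τ'.arr 4 = σ.arr 4 := (hF2.a 4 rfl).trans (by rw [ea])
    have b5 : τ'.arr 5 = σ.arr 5 := (hF2.a 5 rfl).trans (by rw [ea])
    have hpot : pot Γ n m F bad top τ' dep lst' + 60 * ∑ u ∈ Icc 1 n, (lst u).length =
        pot Γ n m F bad top σ dep lst + 60 * ∑ u ∈ Icc 1 n, (lst' u).length := by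
      rw [pot, pot, f1, b0, b4, b5]
      omega
    refine ⟨trivial, by omega, fun h4 => ?_, fun h4 => ?_⟩
    · refine ⟨by omega, r, lst', h2, f2.trans hr, hr1, by omega, by rwa [b0], fun h0 => absurd h0 h4,
        fun _ => ⟨by omega, ?_⟩⟩
      have key : τ'.arr 0 (τ'.reg 4) = 0 ∧
          (UpEdge n (Γ.dat 5) (Γ.dat 6) bad (τ'.reg 1) (τ'.reg 4) ∨
            UpEdge n (Γ.dat 5) (Γ.dat 6) bad (τ'.reg 4) (τ'.reg 1)) ∧
          1 ≤ τ'.reg 4 ∧ τ'.reg 4 ≤ n := by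
        rw [b0, f1]
        rcases d2 h4 with h5 | ⟨h5, h6⟩
        · rw [h5] at h4 ⊢
          have h6 := u1 h4
          have h7 := hq.upEdge_anc h6.2
          exact ⟨h6.1, Or.inr h6.2, h7.1, by omega⟩
        · rw [ea] at h5
          rw [e1] at h6
          have h7 := hq.upEdge_anc h6
          exact ⟨h5, Or.inl h6, by omega, h7.2.2.2⟩
      refine ⟨key.2.2.1, key.2.2.2, key.1, Or.inr ⟨key.2.1, by rw [f1]; exact hcn.2.2,
        ((h2.vis _ key.2.2.1 key.2.2.2).1 key.1).1⟩, by omega⟩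
    · obtain ⟨d3, d4⟩ := d1 h4
      have hback := h2.exhausted hq (by rw [f1]; exact hc) d4 (by rw [b0, f1]; exact u2 d3)
      refine ⟨⟨by omega, trivial⟩, by omega, r, lst', ⟨h2.size, h2.bad_eq, h2.top_eq, ?_, h2.vis,
        h2.visited, h2.limits, h2.lists, h2.nodes, h2.sound, h2.recorded⟩, f2.trans hr, hr1, by omega,
        by simpa [b0] using hrv, fun _ => ?_, fun h0 => absurd h4 h0⟩
      · simpa using hback
      · have g1 : pot Γ n m F bad top (τ'.setr 1 (τ'.arr 6 (τ'.reg 1))) dep lst' + F =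
            pot Γ n m F bad top τ' dep lst' := by
          have := h2.trav.depth (τ'.reg 1) (by rwa [f1])
          rw [pot, pot, this, Mach.setr_arr, Mach.setr_reg, if_pos rfl]
          ring
        omega

/-- The traversal of the whole surviving graph consumes at most the initial potential. -/
theorem traverse_spec (hq : Query Γ n m len N adj bad vis₀ top)
    (hF : ∀ w, 1 ≤ w → w ≤ n → (70 * (Nat.log 2 n + 1) + 350) *
      ancCard n (Γ.dat 4) (fun x => top x = x) w + 60 * badUpTo (Γ.dat 5) (Γ.dat 6) bad w w + 400 ≤ F)
    {σ : Mach} {dfn dep : ℕ → ℕ} {c : ℕ} {lst : ℕ → List ℕ}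
    (h : Visiting Γ n N bad vis₀ top σ dfn dep c lst) (hr : σ.reg 2 = 1)
    {k k₀ : ℕ} {Q : Mach → ℕ → Prop}
    (hk : pot Γ n m F bad top σ dep lst + 100 * n + 20 + k₀ ≤ k)
    (hQ : ∀ τ l dfn dep c lst, Fr traverse σ τ → Visiting Γ n N bad vis₀ top τ dfn dep c lst →
      τ.reg 1 = 0 → (∀ x, 1 ≤ x → x ≤ n → τ.arr 0 x ≠ 0) → k₀ ≤ l → Q τ l) :
    WP Γ traverse Q σ k := by
  refine WP_conseq (Q := fun τ l => ∃ dfn dep c lst, Visiting Γ n N bad vis₀ top τ dfn dep c lst ∧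
      τ.reg 1 = 0 ∧ (∀ x, 1 ≤ x → x ≤ n → τ.arr 0 x ≠ 0) ∧ k₀ ≤ l) ?_
    fun τ l hF ⟨dfn, dep, c, lst, h1, h2, h3, h4⟩ => hQ τ l dfn dep c lst hF h1 h2 h3 h4
  have hB := hq.bound
  refine WP_loop (fun τ l => ∃ dfn dep c lst r, Visiting Γ n N bad vis₀ top τ dfn dep c lst ∧
      τ.reg 2 = r ∧ 1 ≤ r ∧ r ≤ n + 1 ∧ (∀ x, 1 ≤ x → x < r → τ.arr 0 x ≠ 0) ∧
      pot Γ n m F bad top τ dep lst + 100 * (n + 1 - r) + 20 + k₀ ≤ l) ?_ ?_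
  · exact ⟨dfn, dep, c, lst, 1, h, hr, le_rfl, by omega, fun x h1 h2 => by omega, by omega⟩
  · rintro τ l - ⟨dfn, dep, c, lst, r, h, hr, hr1, hrn, hrv, hl⟩
    have hcn : τ.reg 1 ≤ n := by
      rcases h.trav.at_cur with h1 | h1
      · omega
      · exact (h.visited _ h1).2.1
    simp only [E.ok, E.ev, E.cost, hr, h.size]
    refine ⟨⟨trivial, ⟨⟨trivial, by omega, by omega⟩, trivial⟩, by omega⟩, by omega, fun hc => ?_,
      fun hc => ⟨dfn, dep, c, lst, h, by omega, fun x h1 h2 => hrv x h1 (by omega), by omega⟩⟩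
    change WP Γ nextCmd _ _ _
    refine nextCmd_spec (k₀ := 20 + k₀) hq hF h hr hr1 (fun h0 => by omega) hrv (by omega) ?_
    intro τ' l' r' lst' _ h' hr' hr1' hrn' hrv' g1 g2
    by_cases h4 : τ'.reg 4 = 0
    · have g1 := g1 h4
      refine ⟨trivial, by simp only [E.cost]; omega, fun h0 => absurd h4 h0, fun _ => ?_⟩
      refine ⟨by simp only [E.cost]; omega, dfn, dep, c, lst', r', h', hr', hr1', by omega, hrv', ?_⟩
      simp only [E.cost]; omega
    · obtain ⟨g2, g3, g4, g5, g6, g7⟩ := g2 h4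
      refine ⟨trivial, by simp only [E.cost]; omega, fun _ => ?_, fun h0 => absurd h0 h4⟩
      refine enterCmd_spec (F := F) (m := m) (k₀ := 100 * (n + 1 - r') + 20 + k₀) hq h' g3 g4 rfl g5 g6
        (by simp only [E.cost]; omega) ?_
      intro τ2 l2 dfn2 dep2 c2 lst2 hF2 h2 hv2 hl2
      exact ⟨dfn2, dep2, c2, lst2, r', h2, (hF2.r 2 rfl).trans hr', hr1', by omega,
        fun x k1 k2 k3 => hrv' x k1 k2 (hv2 x k3), by omega⟩

end

/-! ### Answering a query -/

section
open E Cmd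

/-- Output the parent array, in terms of the original vertices. -/
def outLoop : Cmd := .set 4 (c 0) ;; forUp 4 (v 0) (.out (v 4) (d 2 (a 6 (d 1 (add (v 4) (c 1))))))

/-- The query: mark the failures, compute the segments, traverse the surviving graph starting with
no current vertex and the first candidate for a root, and output the result. -/
def queryCmd : Cmd :=
  markVerts ;; markEdges ;; segLoop ;; .set 1 (c 0) ;; .set 2 (c 1) ;; .set 3 (c 0) ;; traverse ;; outLoop

end

section
variable {n m ke : ℕ} {adj : ℕ → ℕ → Prop} {off up bad lo hi : ℕ → ℕ}

/-- The array `bad` marks the positions of the failed edges, which join `lo j` and `hi j` for `j <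
ke`. -/
def Marks (ke : ℕ) (off up lo hi bad : ℕ → ℕ) : Prop :=
  ∀ t, bad t ≠ 0 ↔ ∃ j < ke, off (hi j) ≤ t ∧ t < off (hi j + 1) ∧ up t = lo j

theorem UpLists.block_unique (hU : UpLists n m adj off up) {w w' t : ℕ} (hw : w ≤ n) (hw' : w' ≤ n)
    (h1 : off w ≤ t) (h2 : t < off (w + 1)) (h1' : off w' ≤ t) (h2' : t < off (w' + 1)) : w = w' := by
  rcases lt_trichotomy w w' with h | h | h
  · have := hU.off_mono (v := w + 1) (w := w') h (by omega); omega
  · exact h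
  · have := hU.off_mono (v := w' + 1) (w := w) h (by omega); omega

theorem Marks.iff (hb : Marks ke off up lo hi bad) (hU : UpLists n m adj off up)
    (hhi : ∀ j < ke, hi j ≤ n) {w t : ℕ} (hw : w ≤ n) (h1 : off w ≤ t) (h2 : t < off (w + 1)) :
    bad t ≠ 0 ↔ ∃ j < ke, hi j = w ∧ lo j = up t := by
  rw [hb]
  constructor
  · rintro ⟨j, hj, g1, g2, g3⟩
    exact ⟨j, hj, hU.block_unique (hhi j hj) hw g1 g2 h1 h2, g3.symm⟩
  · rintro ⟨j, hj, rfl, g⟩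
    exact ⟨j, hj, h1, h2, g.symm⟩

theorem Marks.upEdge_iff (hb : Marks ke off up lo hi bad) (hU : UpLists n m adj off up)
    (hhi : ∀ j < ke, hi j ≤ n) {u w : ℕ} :
    UpEdge n off up bad u w ↔ w ≤ n ∧ adj u w ∧ ¬ ∃ j < ke, hi j = w ∧ lo j = u := by
  constructor
  · rintro ⟨hw, t, h1, h2, rfl, h4⟩
    refine ⟨hw, hU.mem w hw t h1 h2, fun h => ?_⟩
    exact (hb.iff hU hhi hw h1 h2).2 h h4
  · rintro ⟨hw, h1, h2⟩
    obtain ⟨t, h3, h4, rfl⟩ := hU.surj u w hw h1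
    refine ⟨hw, t, h3, h4, rfl, ?_⟩
    by_contra hne
    exact h2 ((hb.iff hU hhi hw h3 h4).1 hne)

theorem Marks.card_block (hb : Marks ke off up lo hi bad) (hU : UpLists n m adj off up)
    (hhi : ∀ j < ke, hi j ≤ n) {w : ℕ} (hw : w ≤ n) :
    ((Ico (off w) (off (w + 1))).filter fun t => bad t ≠ 0).card ≤
      ((range ke).filter fun j => hi j = w).card := by
  have key : ∀ t ∈ (Ico (off w) (off (w + 1))).filter fun t => bad t ≠ 0,
      ∃ j, j < ke ∧ hi j = w ∧ lo j = up t := by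
    intro t ht
    simp only [mem_filter, mem_Ico] at ht
    obtain ⟨j, h1, h2, h3⟩ := (hb.iff hU hhi hw ht.1.1 ht.1.2).1 ht.2
    exact ⟨j, h1, h2, h3⟩
  choose! f hf using key
  refine card_le_card_of_injOn f (fun t ht => ?_) fun t ht t' ht' htt => ?_
  · have := hf t ht
    simp only [coe_filter, Set.mem_ofPred_eq, mem_range]
    exact ⟨this.1, this.2.1⟩
  · have h1 := (hf t ht).2.2
    have h2 := (hf t' ht').2.2
    rw [htt, h2] at h1
    simp only [coe_filter, Set.mem_ofPred_eq, mem_Ico] at ht ht'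
    rcases lt_trichotomy t t' with h | h | h
    · have := hU.incr w hw t t' ht.1.1 h ht'.1.2; omega
    · exact h
    · have := hU.incr w hw t' t ht'.1.1 h ht.1.2; omega

theorem Marks.card_le (hb : Marks ke off up lo hi bad) (hU : UpLists n m adj off up)
    (hhi : ∀ j < ke, hi j ≤ n) : ((range m).filter fun t => bad t ≠ 0).card ≤ ke := by
  have h1 := hU.card_filter_Ico (fun t => bad t ≠ 0) (a := 0) (b := n + 1) (by omega) le_rfl
  rw [hU.zero, hU.last, ← range_eq_Ico] at h1
  rw [h1]
  calc ∑ w ∈ Ico 0 (n + 1), _ ≤ ∑ w ∈ range (n + 1), ((range ke).filter fun j => hi j = w).card := by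
        rw [range_eq_Ico]
        exact sum_le_sum fun w hw => hb.card_block hU hhi (by simp at hw; omega)
    _ = ke := by
        rw [← card_eq_sum_card_fiberwise (fun j hj => by
          have := hhi j (by simpa using hj); simp; omega), card_range]

theorem sum_card_up_le (P : ℕ → Prop) [DecidablePred P] :
    ∑ x ∈ Icc 1 n, ((range m).filter fun t => P t ∧ up t = x).card ≤ ((range m).filter P).card := by
  rw [← card_biUnion]
  · apply card_le_card
    intro t
    simp only [mem_biUnion, mem_filter]
    rintro ⟨x, -, h1, h2, -⟩
    exact ⟨h1, h2⟩
  · intro x _ y _ hxy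
    rw [Function.onFun, disjoint_left]
    intro t h3 h4
    simp only [mem_filter] at h3 h4
    exact hxy (h3.2.2.symm.trans h4.2.2)

end

section
variable {Γ : Env} {n m F kk : ℕ} {bad top vis loq hiq : ℕ → ℕ}

theorem ancCard_le {sz : ℕ → ℕ} {P : ℕ → Prop} {w : ℕ} : ancCard n sz P w ≤ n := by
  calc ancCard n sz P w ≤ (Icc 1 n).card := by
        rw [ancCard]
        exact card_le_card fun x hx => by simp only [mem_filter] at hx; exact hx.1
    _ = n := by simp

/-- A vertex is counted, up to the logarithmic factor, once for each of the at most `s` segments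
that start at one of its ancestors. -/
theorem segPot_le (hT : HTree n (Γ.dat 3) (Γ.dat 4)) (hL : Limits n vis top loq hiq)
    {s : ℕ} (hs : ∀ w ≤ n, ancCard n (Γ.dat 4) (fun x => top x = x) w ≤ s) :
    segPot Γ n top loq hiq ≤ (Nat.log 2 n + 1) * ((n + 1) * s) := by
  calc segPot Γ n top loq hiq
      ≤ ∑ q ∈ (Icc 1 n).filter (fun q => top q = q), Γ.dat 4 q * (Nat.log 2 n + 1) := by
        refine sum_le_sum fun q hq => Nat.mul_le_mul_left _ ?_
        simp only [mem_filter, mem_Icc] at hq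
        refine size_le_log ?_
        rcases Nat.lt_or_ge (hiq q) (loq q) with h | h
        · omega
        · have h1 := hL.own q hq.1.1 hq.1.2 hq.2 (hiq q) h le_rfl
          have h2 := hL.own q hq.1.1 hq.1.2 hq.2 (loq q) le_rfl h
          omega
    _ = (Nat.log 2 n + 1) * ∑ w ∈ range (n + 1), ancCard n (Γ.dat 4) (fun x => top x = x) w := by
        rw [← sum_mul, hT.sum_ancCard, mul_comm]
    _ ≤ _ := by
        refine Nat.mul_le_mul_left _ ?_
        calc _ ≤ ∑ w ∈ range (n + 1), s :=
              sum_le_sum fun w hw => hs w (by simp at hw; omega)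
          _ = _ := by simp

/-- The potential at the beginning. -/
theorem pot_init (hT : HTree n (Γ.dat 3) (Γ.dat 4)) {τ : Mach} {ke : ℕ}
    (hb : ((range m).filter fun t => bad t ≠ 0).card ≤ ke) :
    pot Γ n m F bad top τ (fun _ => 0) (fun _ => []) ≤ n * (2 * F + 100) +
      70 * (Nat.log 2 n + 1) * ((n + 1) * (Nat.log 2 n + 2)) + 60 * ke +
      1200 * segPot Γ n top (τ.arr 4) (τ.arr 5) := by
  have h1 : ∑ x ∈ (Icc 1 n).filter (fun x => τ.arr 0 x = 0), weight Γ n m F bad x ≤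
      ∑ x ∈ Icc 1 n, weight Γ n m F bad x := sum_le_sum_of_subset (filter_subset _ _)
  have h2 : ∑ x ∈ Icc 1 n, weight Γ n m F bad x = n * (2 * F + 100) +
      70 * (Nat.log 2 n + 1) * ∑ x ∈ Icc 1 n, lightSize n (Γ.dat 3) (Γ.dat 4) x +
      60 * ∑ x ∈ Icc 1 n, ((range m).filter fun t => bad t ≠ 0 ∧ Γ.dat 6 t = x).card := by
    simp only [weight, sum_add_distrib, sum_const, smul_eq_mul, Nat.card_Icc, mul_sum]
    rw [show n + 1 - 1 = n by omega]
    ring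
  have h3 := Nat.mul_le_mul_left (70 * (Nat.log 2 n + 1)) hT.sum_lightSize
  have h4 := sum_card_up_le (n := n) (m := m) (up := Γ.dat 6) (fun t => bad t ≠ 0)
  rw [pot]
  simp only [List.length_nil, sum_const_zero]
  omega

/-- The number of steps for a query, with an explicit constant. Here `L` stands for the logarithm,
`kk` for the number `k'`, `F` for the credits for a search, `S` for `segPot`, `P` for `pot`, and
`T` for the bound in the theorem. -/
theorem query_time {L ke kv F P S T : ℕ} (hL : 1 ≤ L) (hkv : kv ≤ n) (hke : ke ≤ n * kk)
    (hF : F = (70 * L + 350) * (L + 1 + 3 * kk) + 60 * kk + 400)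
    (hS : S ≤ L * ((n + 1) * (L + 1 + 3 * kk)))
    (hP : P ≤ n * (2 * F + 100) + 70 * L * ((n + 1) * (L + 1)) + 60 * ke + 1200 * S)
    (hT : T = (n + 1) * (kk + L) * L) :
    100 * (kv + 1) + 500 * L * ke + 100 + 200 * (n + 1) + P + 200 * (n + 1) + 200 ≤ 15000 * T := by
  have hn : n ≤ n + 1 := by omega
  have a0 : (n + 1) ≤ T := by
    rw [hT]
    calc n + 1 = (n + 1) * 1 * 1 := by ring
      _ ≤ _ := Nat.mul_le_mul (Nat.mul_le_mul le_rfl (by omega)) hL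
  have a1 : L * ke ≤ T := by
    rw [hT]
    calc L * ke ≤ L * (n * kk) := Nat.mul_le_mul_left _ hke
      _ = n * kk * L := by ring
      _ ≤ _ := Nat.mul_le_mul_right _ (Nat.mul_le_mul hn (by omega))
  have a2 : ke ≤ L * ke := Nat.le_mul_of_pos_left _ hL
  have a3 : L * ((n + 1) * (L + 1 + 3 * kk)) ≤ 3 * T := by
    rw [hT]
    calc L * ((n + 1) * (L + 1 + 3 * kk)) ≤ L * ((n + 1) * (3 * (kk + L))) :=
          Nat.mul_le_mul_left _ (Nat.mul_le_mul_left _ (by omega))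
      _ = _ := by ring
  have a4 : n * F ≤ 1720 * T := by
    have : F ≤ 1720 * ((kk + L) * L) := by
      have b1 : kk + L ≤ (kk + L) * L := Nat.le_mul_of_pos_right _ hL
      have b2 : (70 * L + 350) * (L + 1 + 3 * kk) ≤ (420 * L) * (3 * (kk + L)) :=
        Nat.mul_le_mul (by omega) (by omega)
      have b3 : (420 * L) * (3 * (kk + L)) = 1260 * ((kk + L) * L) := by ring
      omega
    rw [hT]
    calc n * F ≤ (n + 1) * (1720 * ((kk + L) * L)) := Nat.mul_le_mul hn this
      _ = _ := by ring
  have a5 : L * ((n + 1) * (L + 1)) ≤ L * ((n + 1) * (L + 1 + 3 * kk)) :=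
    Nat.mul_le_mul_left _ (Nat.mul_le_mul_left _ (by omega))
  have a6 : n * (2 * F + 100) = 2 * (n * F) + 100 * n := by ring
  have a7 : 70 * L * ((n + 1) * (L + 1)) = 70 * (L * ((n + 1) * (L + 1))) := by ring
  have a8 : 500 * L * ke = 500 * (L * ke) := by ring
  rw [a6, a7] at hP
  rw [a8]
  omega

end

section
variable {Γ : Env} {n m kv ke kk : ℕ} {par fv fa fb lo hi : ℕ → ℕ} {adj : ℕ → ℕ → Prop}

/-- What a query computes: the output is given by a complete depth first traversal of the surviving
graph, in terms of labels. -/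
theorem queryCmd_spec (hD : Data n m par adj Γ.dat)
    (hadj : ∀ u w, adj u w → 1 ≤ u ∧ u < w ∧ w < u + Γ.dat 4 u)
    (hpa : ∀ x, 1 ≤ x → x ≤ n → Γ.dat 3 x ≠ 0 → adj (Γ.dat 3 x) x)
    (hin : FaultInput Γ kv ke fv fa fb) (hfv : ∀ i < kv, fv i ≤ n)
    (hf : ∀ j < ke, fa j ≤ n ∧ fb j ≤ n)
    (hlo : ∀ j < ke, lo j = min (Γ.dat 1 (fa j)) (Γ.dat 1 (fb j)))
    (hhi : ∀ j < ke, hi j = max (Γ.dat 1 (fa j)) (Γ.dat 1 (fb j)))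
    (hfadj : ∀ j < ke, adj (lo j) (hi j)) (hkv : kv ≤ n)
    (hkF : ∀ w ≤ n, ancCard n (Γ.dat 4) (fun x => ∃ i < kv, Γ.dat 1 (fv i) = x) w ≤ kk)
    (hkC : ∀ w ≤ n, ancCard n (Γ.dat 4) (fun x => ∃ j < ke, hi j = x ∧ Γ.dat 3 x = lo j) w ≤ kk)
    (hkE : ∀ w ≤ n, ((range ke).filter fun j => hi j = w).card ≤ kk)
    (hB : (n + 2) ^ 3 + 40 * n + 40 * m + kv + 2 * ke + 3000 ≤ Γ.B) (hb : Γ.b = n)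
    (hup : ∀ i a, Γ.get i a + 1 < Γ.B)
    {σ : Mach} {k : ℕ} {Q : Mach → ℕ → Prop} (hz : ∀ j a, σ.arr j a = 0)
    (hk : 15000 * ((n + 1) * (kk + (Nat.log 2 n + 1)) * (Nat.log 2 n + 1)) ≤ k)
    (hQ : ∀ τ l H dfn ps dep c, Traversal H dfn ps dep 0 c →
      (∀ u w, H u w ↔ (adj u w ∧ (¬ ∃ j < ke, hi j = w ∧ lo j = u) ∨
        adj w u ∧ (¬ ∃ j < ke, hi j = u ∧ lo j = w)) ∧ (u ≤ n ∧ w ≤ n) ∧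
        (¬ ∃ i < kv, Γ.dat 1 (fv i) = u) ∧ (¬ ∃ i < kv, Γ.dat 1 (fv i) = w)) →
      (∀ x, dfn x ≠ 0 ↔ 1 ≤ x ∧ x ≤ n ∧ ¬ ∃ i < kv, Γ.dat 1 (fv i) = x) →
      (∀ v < n, τ.out v = Γ.dat 2 (ps (Γ.dat 1 (v + 1)))) → Q τ l) :
    WP Γ queryCmd Q σ k := by
  have hU := hD.ups
  have hT := hD.labels.tree
  obtain ⟨len, hlen, hS⟩ := hD.snaps
  have hhn : ∀ j < ke, hi j ≤ n := by
    intro j hj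
    have h1 := hD.labels.pre_le _ (hf j hj).1
    have h2 := hD.labels.pre_le _ (hf j hj).2
    rw [hhi j hj]; omega
  -- each failed edge has one of `n` vertices as its lower endpoint
  have hke : ke ≤ n * kk := by
    have h1 : (range ke).card = ∑ w ∈ Icc 1 n, ((range ke).filter fun j => hi j = w).card :=
      card_eq_sum_card_fiberwise fun j hj => by
        have hj : j < ke := by simpa using hj
        have h1 := hhn j hj
        have h2 := hadj _ _ (hfadj j hj)
        simp; omega
    rw [card_range] at h1
    rw [h1]
    calc _ ≤ ∑ w ∈ Icc 1 n, kk := sum_le_sum fun w hw => hkE w (by simp at hw; omega)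
      _ = _ := by simp
  obtain ⟨L, hL⟩ : ∃ L, Nat.log 2 n + 1 = L := ⟨_, rfl⟩
  obtain ⟨T, hT'⟩ : ∃ T, (n + 1) * (kk + L) * L = T := ⟨_, rfl⟩
  rw [hL, hT'] at hk
  have htime := fun F P S h1 h2 h3 => query_time (n := n) (kk := kk) (L := L) (ke := ke) (kv := kv) (F := F) (P := P)
    (S := S) (T := T) (by omega) hkv hke h1 h2 h3 hT'.symm
  have htime0 := htime _ 0 0 rfl (Nat.zero_le _) (Nat.zero_le _)
  simp only [queryCmd, WP]
  refine markVerts_spec (k₀ := k - 100 * (kv + 1)) hin hD.size (by omega) hfv (hz 0) (by omega) ?_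
  intro τ1 l1 F1 r0 hV hl1
  have s1 := F1.a 1 rfl
  have s2 := F1.a 2 rfl
  refine markEdges_spec (k₀ := k - 100 * (kv + 1) - (500 * L * ke + 100)) hin hU
    (fun u w h => (hadj u w h).2.1) (by omega) hf hlo hhi hhn hfadj (by rw [s1]; exact hz 1)
    (by rw [s2]; exact hz 2) (by rw [hL]; omega) ?_
  intro τ2 l2 F2 hbad hcut hl2
  have hbad : Marks ke (Γ.dat 5) (Γ.dat 6) lo hi (τ2.arr 1) := hbad
  obtain ⟨bad, hbd⟩ : ∃ bad, τ2.arr 1 = bad := ⟨_, rfl⟩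
  obtain ⟨vis₀, hvs⟩ : ∃ vis₀, τ2.arr 0 = vis₀ := ⟨_, rfl⟩
  rw [← F2.a 0 rfl, hvs] at hV
  rw [hbd] at hbad
  have hup' := fun u w => hbad.upEdge_iff hU hhn (u := u) (w := w)
  refine segLoop_spec (k₀ := k - 100 * (kv + 1) - (500 * L * ke + 100) - 200 * (n + 1)) (vis := vis₀)
    (H := LiveAdj n (Γ.dat 5) (Γ.dat 6) bad vis₀) (by omega) ((hV 0).2 (Or.inl rfl)) ?_
    ((F2.r 0 rfl).trans r0) hvs rfl (by omega) ?_
  · intro x hx2 hxn hpx hvx hvx1 hcx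
    have h1 : Γ.dat 3 x = x - 1 := by omega
    have h2 := hpa x (by omega) hxn (by omega)
    rw [h1] at h2
    refine ⟨Or.inl ((hup' _ _).2 ⟨hxn, h2, ?_⟩), hvx1, hvx⟩
    rintro ⟨j, hj, rfl, h3⟩
    exact (hcut (hi j)).2 ⟨j, hj, rfl, by omega⟩ hcx
  intro τ3 l3 F3 hseg hlim hstart hl3
  obtain ⟨top, htp⟩ : ∃ top, τ3.arr 3 = top := ⟨_, rfl⟩
  rw [htp] at hseg hlim hstart
  have hsegs : ∀ w ≤ n, ancCard n (Γ.dat 4) (fun x => top x = x) w ≤ L + 1 + 3 * kk := by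
    intro w hw
    have := hT.segs_le (F := fun x => vis₀ x ≠ 0) (C := fun x => τ2.arr 2 x ≠ 0) (kk := kk) hstart hw
      ((ancCard_mono fun x h1 _ _ _ h2 => ((hV x).1 h2).resolve_left (by omega)).trans (hkF w hw))
      ((ancCard_mono fun x _ _ _ _ h2 => (hcut x).1 h2).trans (hkC w hw))
    omega
  -- a crude bound on the number of list nodes, for the size of words
  have hN := segPot_le (s := n) hT hlim fun w _ => ancCard_le
  have hN' : segPot Γ n top (τ3.arr 4) (τ3.arr 5) ≤ (n + 2) ^ 3 := by
    refine hN.trans ?_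
    calc (Nat.log 2 n + 1) * ((n + 1) * n) ≤ (n + 2) * ((n + 2) * (n + 2)) :=
          Nat.mul_le_mul (by have := Nat.log_le_self 2 n; omega)
            (Nat.mul_le_mul (by omega) (by omega))
      _ = _ := by ring
  have hS1 := segPot_le hT hlim hsegs
  have hblk : ∀ w ≤ n, badUpTo (Γ.dat 5) (Γ.dat 6) bad w w ≤ kk := fun w hw =>
    (card_le_card (monotone_filter_right _ fun t _ h => h.1)).trans
      ((hbad.card_block hU hhn hw).trans (hkE w hw))
  -- the time for one search, apart from the list entries removed
  obtain ⟨F, hFe⟩ : ∃ F, F = (70 * L + 350) * (L + 1 + 3 * kk) + 60 * kk + 400 := ⟨_, rfl⟩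
  have hF : ∀ w, 1 ≤ w → w ≤ n → (70 * (Nat.log 2 n + 1) + 350) *
      ancCard n (Γ.dat 4) (fun x => top x = x) w + 60 * badUpTo (Γ.dat 5) (Γ.dat 6) bad w w + 400 ≤ F := by
    intro w _ hw
    rw [hL, hFe]
    have h1 := Nat.mul_le_mul_left (70 * L + 350) (hsegs w hw)
    have h2 := hblk w hw
    omega
  have hpot := fun τ => pot_init (Γ := Γ) (F := F) (top := top) hT (τ := τ) (hbad.card_le hU hhn)
  have hq : Query Γ n m len (segPot Γ n top (τ3.arr 4) (τ3.arr 5)) adj bad vis₀ top :=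
    ⟨hT, hU, hS, hadj, hseg, fun t => hup _ _, by omega⟩
  simp only [E.ev, E.ok, E.cost]
  refine ⟨by omega, by omega, by omega, by omega, by omega, by omega, ?_⟩
  obtain ⟨τ4, h4⟩ : ∃ τ4, ((τ3.setr 1 0).setr 2 1).setr 3 0 = τ4 := ⟨_, rfl⟩
  rw [h4]
  have a : ∀ j, τ4.arr j = τ3.arr j := by subst h4; intro j; rfl
  have r1 : τ4.reg 1 = 0 := by subst h4; rfl
  have r2 : τ4.reg 2 = 1 := by subst h4; rfl
  have r3 : τ4.reg 3 = 0 := by subst h4; rfl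
  have r0' : τ4.reg 0 = n := by
    subst h4; exact (F3.r 0 rfl).trans ((F2.r 0 rfl).trans r0)
  have z : ∀ j, 6 ≤ j → τ4.arr j = fun _ => 0 := by
    intro j hj
    rw [a j, F3.a j, F2.a j, F1.a j]
    · exact funext fun i => hz j i
    · simp [markVerts, Cmd.moda, forUp]; omega
    · simp [markEdges, Cmd.moda, forUp, searchCmd, searchLoop]; omega
    · simp [segLoop, Cmd.moda, forUp]; omega
  have b0 : τ4.arr 0 = vis₀ := (a 0).trans ((F3.a 0 rfl).trans hvs)
  have hvis : Visiting Γ n (segPot Γ n top (τ3.arr 4) (τ3.arr 5)) bad vis₀ top τ4 (fun _ => 0)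
      (fun _ => 0) 0 (fun _ => []) := by
    refine ⟨r0', (a 1).trans ((F3.a 1 rfl).trans hbd), (a 3).trans htp, ?_, ?_, by simp, ?_, ?_, ?_,
      by simp, by simp⟩
    · rw [r1, z 6 (by omega)]; exact Traversal.init _
    · intro x _ _; rw [b0]; simp
    · rw [b0, a 4, a 5]; exact hlim
    · intro u
      rw [z 7 (by omega)]
      rfl
    · rw [r3, a 4, a 5]; omega
  have hp := hpot τ4
  rw [a 4, a 5, show Nat.log 2 n + 2 = L + 1 by omega, hL] at hp
  rw [hL] at hS1
  have hP := htime F _ _ hFe hS1 hp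
  refine traverse_spec (F := F) (m := m) (k₀ := 100 * (n + 1)) hq hF hvis r2 (by omega) ?_
  intro τ5 l5 dfn dep c lst F5 h5 hc5 hv5 hl5
  have hfin : ∀ x, dfn x ≠ 0 ↔ 1 ≤ x ∧ x ≤ n ∧ ¬ ∃ i < kv, Γ.dat 1 (fv i) = x := by
    intro x
    constructor
    · intro hx
      have h1 := h5.visited x hx
      refine ⟨h1.1, h1.2.1, fun h => ?_⟩
      exact (hV x).2 (Or.inr h) h1.2.2
    · rintro ⟨h1, h2, h3⟩ hx
      refine hv5 x h1 h2 ((h5.vis x h1 h2).2 ⟨?_, hx⟩)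
      by_contra hne
      exact ((hV x).1 hne).elim (by omega) h3
  have hH : ∀ u w, LiveAdj n (Γ.dat 5) (Γ.dat 6) bad vis₀ u w ↔
      (adj u w ∧ (¬ ∃ j < ke, hi j = w ∧ lo j = u) ∨
        adj w u ∧ (¬ ∃ j < ke, hi j = u ∧ lo j = w)) ∧ (u ≤ n ∧ w ≤ n) ∧
        (¬ ∃ i < kv, Γ.dat 1 (fv i) = u) ∧ (¬ ∃ i < kv, Γ.dat 1 (fv i) = w) := by
    intro u w
    have e : ∀ x, x ≠ 0 → (vis₀ x = 0 ↔ ¬ ∃ i < kv, Γ.dat 1 (fv i) = x) := by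
      intro x hx
      rw [← not_iff_not, not_not]
      exact (hV x).trans (or_iff_right hx)
    have e0 : ∀ u w, adj u w → 1 ≤ u ∧ u < w := fun u w h => ⟨(hadj u w h).1, (hadj u w h).2.1⟩
    rw [LiveAdj, hup', hup']
    constructor
    · rintro ⟨⟨h1, h2, h3⟩ | ⟨h1, h2, h3⟩, h4, h5⟩
      · have := e0 _ _ h2
        exact ⟨Or.inl ⟨h2, h3⟩, by omega, (e u (by omega)).1 h4, (e w (by omega)).1 h5⟩
      · have := e0 _ _ h2
        exact ⟨Or.inr ⟨h2, h3⟩, by omega, (e u (by omega)).1 h4, (e w (by omega)).1 h5⟩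
    · rintro ⟨⟨h2, h3⟩ | ⟨h2, h3⟩, h1, h4, h5⟩
      · have := e0 _ _ h2
        exact ⟨Or.inl ⟨h1.2, h2, h3⟩, (e u (by omega)).2 h4, (e w (by omega)).2 h5⟩
      · have := e0 _ _ h2
        exact ⟨Or.inr ⟨h1.1, h2, h3⟩, (e u (by omega)).2 h4, (e w (by omega)).2 h5⟩
  have htr := h5.trav
  rw [hc5] at htr
  refine WP_mono (Q := fun τ _ => ∀ v < n, τ.out v = Γ.dat 2 (τ5.arr 6 (Γ.dat 1 (v + 1)))) ?_
    fun τ l hout => hQ τ l _ dfn (τ5.arr 6) dep c htr hH hfin hout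
  simp only [outLoop, WP, E.ok, E.ev, E.cost]
  refine ⟨by omega, by omega, ?_⟩
  refine WP_for 0 n (fun i τ => ∀ v < i, τ.out v = Γ.dat 2 (τ5.arr 6 (Γ.dat 1 (v + 1)))) (fun _ => 50) 0
    (by simp) (by omega) (by omega) (by omega) (fun v hv => by omega) ?_ ?_ ?_ ?_
  · simp only [E.cost, sum_const, Nat.card_Ico, smul_eq_mul]; omega
  · intro τ hF
    have := hF.r 0 rfl
    simp [E.ok, E.ev] at this ⊢
    rw [this, h5.size]
  · intro v τ l h1 h2 hF hr hi hl
    have e6 := hF.a 6 rfl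
    simp only [Mach.setr_arr] at e6
    simp only [WP, E.ok, E.ev, E.cost, hr, e6]
    refine ⟨by simp; omega, by omega, hr, ?_, by omega⟩
    intro v' hv'
    simp only [Mach.setr_out, Mach.puto_out, Function.update_apply]
    split_ifs with hvv
    · rw [hvv]
    · exact hi v' (by omega)
  · exact fun τ l _ _ h _ => h

end

/-! ### Vertices and labels -/

section
variable {n : ℕ} {par pre org pa sz : ℕ → ℕ}

theorem Labels.pre_inj (h : Labels n par pre org pa sz) {a b : ℕ} (ha : a ≤ n) (hb : b ≤ n)
    (e : pre a = pre b) : a = b := by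
  rw [← h.org_pre a ha, e, h.org_pre b hb]

theorem Labels.pre_surj (h : Labels n par pre org pa sz) {x : ℕ} (hx : x ≤ n) :
    ∃ a ≤ n, pre a = x := by
  have h1 : (range (n + 1)).image pre = range (n + 1) := by
    refine eq_of_subset_of_card_le (fun y => ?_) ?_
    · simp only [mem_image, mem_range]
      rintro ⟨a, ha, rfl⟩
      have := h.pre_le a (by omega)
      omega
    · rw [card_image_of_injOn]
      intro a ha b hb e
      simp only [coe_range, Set.mem_Iio] at ha hb
      exact h.pre_inj (by omega) (by omega) e
  have h2 : x ∈ (range (n + 1)).image pre := by rw [h1]; simp; omega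
  obtain ⟨a, ha, e⟩ := mem_image.1 h2
  exact ⟨a, by simp at ha; omega, e⟩

theorem Labels.pre_pos (h : Labels n par pre org pa sz) {a : ℕ} (h1 : 1 ≤ a) (ha : a ≤ n) :
    1 ≤ pre a := by
  by_contra hn
  have := h.pre_inj ha (Nat.zero_le n) (by rw [h.pre_zero]; omega)
  omega

theorem Labels.exists_fin (h : Labels n par pre org pa sz) {x : ℕ} (h1 : 1 ≤ x) (hx : x ≤ n) :
    ∃ v : Fin n, pre (v + 1) = x := by
  obtain ⟨a, ha, rfl⟩ := h.pre_surj hx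
  have : a ≠ 0 := by rintro rfl; rw [h.pre_zero] at h1; omega
  exact ⟨⟨a - 1, by omega⟩, by rw [show a - 1 + 1 = a by omega]⟩

end

/-- The parent of a node: the vertex `v` is the node `v + 1`, and the roots are the children of the
virtual node `0`. -/
def nodePar {n : ℕ} (T : Fin n → Option (Fin n)) (a : ℕ) : ℕ :=
  if h : a - 1 < n then encodeParent (T ⟨a - 1, h⟩) else 0

/-- The first endpoint of the `j`-th edge, as a node. -/
def edgeFst {n : ℕ} (l : List (Fin n × Fin n)) (j : ℕ) : ℕ := l[j]?.elim 0 fun p => p.1 + 1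

/-- The second endpoint of the `j`-th edge, as a node. -/
def edgeSnd {n : ℕ} (l : List (Fin n × Fin n)) (j : ℕ) : ℕ := l[j]?.elim 0 fun p => p.2 + 1

section
variable {n : ℕ} {T : Fin n → Option (Fin n)} {pre org pa sz : ℕ → ℕ}

theorem nodePar_succ (T : Fin n → Option (Fin n)) (v : Fin n) :
    nodePar T (v + 1) = encodeParent (T v) := by
  simp [nodePar]

theorem encodeParent_le (o : Option (Fin n)) : encodeParent o ≤ n := by
  cases o with
  | none => simp [encodeParent]
  | some u => simp only [encodeParent]; omega

theorem nodePar_le (T : Fin n → Option (Fin n)) (a : ℕ) : nodePar T a ≤ n := by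
  rw [nodePar]
  split_ifs
  · exact encodeParent_le _
  · omega

theorem edgeFst_eq {l : List (Fin n × Fin n)} {j : ℕ} (hj : j < l.length) :
    edgeFst l j = l[j].1 + 1 := by
  simp [edgeFst, hj]

theorem edgeSnd_eq {l : List (Fin n × Fin n)} {j : ℕ} (hj : j < l.length) :
    edgeSnd l j = l[j].2 + 1 := by
  simp [edgeSnd, hj]

theorem Labels.pa_some (h : Labels n (nodePar T) pre org pa sz) {u v : Fin n} (e : T v = some u) :
    pa (pre (v + 1)) = pre (u + 1) := by
  rw [h.par_eq _ (by omega) (by omega), nodePar_succ, e, encodeParent]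

theorem Labels.pa_none (h : Labels n (nodePar T) pre org pa sz) {v : Fin n} (e : T v = none) :
    pa (pre (v + 1)) = 0 := by
  rw [h.par_eq _ (by omega) (by omega), nodePar_succ, e, encodeParent, h.pre_zero]

/-- The ancestors of a vertex are those whose intervals of labels contain its label. -/
theorem Labels.isAncestor_iff (h : Labels n (nodePar T) pre org pa sz) {u v : Fin n} :
    IsAncestor T u v ↔ pre (u + 1) ≤ pre (v + 1) ∧ pre (v + 1) < pre (u + 1) + sz (pre (u + 1)) := by
  have hT := h.tree
  have hle := fun v : Fin n => h.pre_le (v + 1) (by omega)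
  constructor
  · intro ha
    induction ha with
    | refl => have := hT.pos _ (hle u); omega
    | @tail b c _ hbc ih =>
      have h1 := hT.par _ (h.pre_pos (a := c + 1) (by omega) (by omega)) (hle c)
      rw [h.pa_some hbc] at h1
      have h2 := hT.nest (hle u) ih.1 ih.2
      have h3 := hT.pos _ (hle c)
      omega
  · induction hx : pre (v + 1) using Nat.strong_induction_on generalizing v with
    | _ x ih =>
      rintro ⟨h1, h2⟩
      rcases Nat.lt_or_eq_of_le h1 with h3 | h3
      · have h4 := hT.inner _ x (hle u) h3 h2
        have h5 := h.pre_pos (a := u + 1) (by omega) (by omega)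
        cases e : T v with
        | none => have := h.pa_none e; rw [hx] at this; omega
        | some p =>
          have h6 := h.pa_some e
          have h7 := hT.par _ (h.pre_pos (a := v + 1) (by omega) (by omega)) (hle v)
          rw [hx] at h6 h7
          exact Relation.ReflTransGen.tail (ih _ (by omega) (v := p) rfl ⟨by omega, by omega⟩) e
      · have := h.pre_inj (a := u + 1) (b := v + 1) (by omega) (by omega) (by omega)
        have : u = v := by ext; omega
        rw [this]
        exact Relation.ReflTransGen.refl

/-- In a depth first search forest, the endpoints of each edge are related. -/
theorem IsDFSForest.related {G : SimpleGraph (Fin n)} (hT : IsDFSForest (⊤ : G.Subgraph) T)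
    {u v : Fin n} (huv : G.Adj u v) : IsAncestor T u v ∨ IsAncestor T v u := by
  obtain ⟨-, dfn, hinj, hd⟩ := hT
  have key : ∀ u v : Fin n, G.Adj u v → dfn u < dfn v → IsAncestor T u v := by
    intro u v huv _
    have : ∀ d, ∀ y, dfn y = d → dfn u ≤ d → d ≤ dfn v → IsAncestor T u y := by
      intro d
      induction d using Nat.strong_induction_on with
      | _ d ih =>
        rintro y rfl h1 h2
        rcases Nat.lt_or_eq_of_le h1 with h3 | h3
        · obtain ⟨p, hp, h4⟩ := (hd y trivial).2 u v huv h3 h2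
          have h5 := ((hd y trivial).1 p hp).2
          exact Relation.ReflTransGen.tail (ih _ h5 p rfl h4 (by omega)) hp
        · rw [hinj (Set.mem_univ u) (Set.mem_univ y) h3]
          exact Relation.ReflTransGen.refl
    exact this _ v rfl (by omega) le_rfl
  rcases lt_trichotomy (dfn u) (dfn v) with h | h | h
  · exact Or.inl (key u v huv h)
  · exact absurd (hinj (Set.mem_univ u) (Set.mem_univ v) h) huv.ne
  · exact Or.inr (key v u huv.symm h)

/-- The numbers of a depth first search serve as ranks: they increase from parent to child. -/
theorem IsDFSForest.rank {G : SimpleGraph (Fin n)} (hT : IsDFSForest (⊤ : G.Subgraph) T) :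
    ∃ rk : ℕ → ℕ, ∀ a, 1 ≤ a → a ≤ n → rk (nodePar T a) < rk a := by
  obtain ⟨-, dfn, -, hd⟩ := hT
  refine ⟨fun a => if h : a - 1 < n ∧ a ≠ 0 then dfn ⟨a - 1, h.1⟩ + 1 else 0, fun a h1 h2 => ?_⟩
  obtain ⟨v, rfl⟩ : ∃ v : Fin n, a = v + 1 := ⟨⟨a - 1, by omega⟩, by simp; omega⟩
  rw [nodePar_succ]
  cases e : T v with
  | none => simp [encodeParent]
  | some u =>
    have := ((hd v trivial).1 u e).2
    simpa [encodeParent] using this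

/-- Each vertex has a leaf below it. -/
theorem Labels.exists_leaf (h : Labels n (nodePar T) pre org pa sz) (v : Fin n) :
    ∃ l, IsLeaf T l ∧ IsAncestor T v l := by
  induction hx : n - pre (v + 1) using Nat.strong_induction_on generalizing v with
  | _ x ih =>
    by_cases hl : IsLeaf T v
    · exact ⟨v, hl, Relation.ReflTransGen.refl⟩
    · simp only [IsLeaf, not_forall, not_not] at hl
      obtain ⟨w, hw⟩ := hl
      have h1 := h.pa_some hw
      have h2 := h.pre_le (w + 1) (by omega)
      have h3 := h.tree.par _ (h.pre_pos (a := w + 1) (by omega) (by omega)) h2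
      obtain ⟨l, h4, h5⟩ := ih (n - pre (w + 1)) (by omega) w rfl
      exact ⟨l, h4, Relation.ReflTransGen.head hw h5⟩

end

/-! ### Encoded inputs -/

section
variable {n : ℕ}

theorem encodePairs_getD (l : List (Fin n × Fin n)) {j : ℕ} (hj : j < l.length) :
    (encodePairs l).getD (2 * j) 0 = l[j].1 ∧ (encodePairs l).getD (2 * j + 1) 0 = l[j].2 := by
  induction l generalizing j with
  | nil => simp at hj
  | cons p l ih =>
    cases j with
    | zero => simp [encodePairs]
    | succ j =>
      have := ih (j := j) (by simpa using hj)
      simpa [encodePairs, Nat.mul_succ] using this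

theorem encodePairs_lt {l : List (Fin n × Fin n)} {x : ℕ} (hx : x ∈ encodePairs l) : x < n := by
  simp only [encodePairs, List.mem_flatMap, List.mem_cons, List.not_mem_nil, or_false] at hx
  obtain ⟨p, -, rfl | rfl⟩ := hx <;> omega

theorem getD_lt {l : List ℕ} {N : ℕ} (h0 : 0 < N) (h : ∀ x ∈ l, x < N) (i : ℕ) : l.getD i 0 < N := by
  by_cases hi : i < l.length
  · rw [List.getD_eq_getElem _ _ hi]; exact h _ (List.getElem_mem hi)
  · rw [List.getD_eq_default _ _ (by omega)]; exact h0

theorem encodeGraph_getD_par (edges : List (Fin n × Fin n)) (T : Fin n → Option (Fin n)) {a : ℕ}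
    (h1 : 1 ≤ a) (ha : a ≤ n) : (encodeGraph edges T).getD (a + 1) 0 = nodePar T a := by
  obtain ⟨v, rfl⟩ : ∃ v : Fin n, a = v + 1 := ⟨⟨a - 1, by omega⟩, by simp; omega⟩
  rw [nodePar_succ, encodeGraph, List.getD_append _ _ _ _ (by simp),
    List.getD_append_right _ _ _ _ (by simp)]
  simp

theorem encodeGraph_getD_edge (edges : List (Fin n × Fin n)) (T : Fin n → Option (Fin n)) (i : ℕ) :
    (encodeGraph edges T).getD (n + 2 + i) 0 = (encodePairs edges).getD i 0 := by
  rw [encodeGraph, List.getD_append_right _ _ _ _ (by simp)]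
  congr 1
  simp

theorem encodeGraph_lt {edges : List (Fin n × Fin n)} {T : Fin n → Option (Fin n)} {N : ℕ}
    (hn : n < N) (hm : edges.length < N) (i : ℕ) : (encodeGraph edges T).getD i 0 < N := by
  refine getD_lt (by omega) (fun x hx => ?_) i
  simp only [encodeGraph, List.mem_append, List.mem_cons, List.not_mem_nil, or_false,
    List.mem_ofFn] at hx
  rcases hx with ((rfl | rfl) | ⟨v, rfl⟩) | hx
  · exact hn
  · exact hm
  · have := encodeParent_le (T v); omega
  · have := encodePairs_lt hx; omega

theorem encodeFaults_getD_vert (vs : List (Fin n)) (es : List (Fin n × Fin n)) {i : ℕ}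
    (hi : i < vs.length) : (encodeFaults vs es).getD (i + 2) 0 = vs[i] := by
  rw [encodeFaults, List.getD_append _ _ _ _ (by simp; omega),
    List.getD_append_right _ _ _ _ (by simp)]
  simp [hi]

theorem encodeFaults_getD_edge (vs : List (Fin n)) (es : List (Fin n × Fin n)) (i : ℕ) :
    (encodeFaults vs es).getD (vs.length + 2 + i) 0 = (encodePairs es).getD i 0 := by
  rw [encodeFaults, List.getD_append_right _ _ _ _ (by simp)]
  congr 1
  simp

theorem encodeFaults_lt {vs : List (Fin n)} {es : List (Fin n × Fin n)} {N : ℕ}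
    (hn : n < N) (hv : vs.length < N) (he : es.length < N) (i : ℕ) :
    (encodeFaults vs es).getD i 0 < N := by
  refine getD_lt (by omega) (fun x hx => ?_) i
  simp only [encodeFaults, List.mem_append, List.mem_cons, List.not_mem_nil, or_false,
    List.mem_map] at hx
  rcases hx with ((rfl | rfl) | ⟨v, -, rfl⟩) | hx
  · exact hv
  · exact he
  · omega
  · have := encodePairs_lt hx; omega

theorem parentInput_encodeGraph {Γ : Env} {edges : List (Fin n × Fin n)}
    {T : Fin n → Option (Fin n)} (hg : ∀ a, Γ.get 0 a = (encodeGraph edges T).getD a 0) :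
    ParentInput Γ n (nodePar T) :=
  ⟨by rw [hg]; rfl, fun a h1 ha => by rw [hg, encodeGraph_getD_par _ _ h1 ha]⟩

theorem edgeInput_encodeGraph {Γ : Env} {edges : List (Fin n × Fin n)}
    {T : Fin n → Option (Fin n)} (hg : ∀ a, Γ.get 0 a = (encodeGraph edges T).getD a 0) :
    EdgeInput Γ n edges.length (edgeFst edges) (edgeSnd edges) := by
  refine ⟨by rw [hg]; rfl, fun j hj => ?_⟩
  have := encodePairs_getD edges hj
  rw [hg, hg, encodeGraph_getD_edge, add_assoc, encodeGraph_getD_edge, this.1, this.2,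
    edgeFst_eq hj, edgeSnd_eq hj]
  exact ⟨rfl, rfl⟩

theorem faultInput_encodeFaults {Γ : Env} {vs : List (Fin n)} {es : List (Fin n × Fin n)}
    (hg : ∀ a, Γ.get 1 a = (encodeFaults vs es).getD a 0) :
    FaultInput Γ vs.length es.length (fun i => vs[i]?.elim 0 fun v => v + 1) (edgeFst es)
      (edgeSnd es) where
  verts := by rw [hg]; rfl
  edges := by rw [hg]; rfl
  vert i hi := by rw [hg, encodeFaults_getD_vert _ _ hi]; simp [hi]
  fst j hj := by rw [hg, encodeFaults_getD_edge, (encodePairs_getD es hj).1, edgeFst_eq hj]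
  snd j hj := by
    rw [hg, add_assoc, encodeFaults_getD_edge, (encodePairs_getD es hj).2, edgeSnd_eq hj]

end

/-! ### The data structure as a function of the graph -/

/-- The pairs of labels that correspond to members of `S`, smaller label first. -/
def labelRel {n : ℕ} (S : Set (Sym2 (Fin n))) (pre : ℕ → ℕ) (u w : ℕ) : Prop :=
  ∃ a b : Fin n, s(a, b) ∈ S ∧ pre (a + 1) = u ∧ pre (b + 1) = w ∧ u < w

section
variable {n : ℕ} {par pre org pa sz : ℕ → ℕ} {S : Set (Sym2 (Fin n))}

theorem labelRel_congr {pre' : ℕ → ℕ} (h : ∀ a ≤ n, pre' a = pre a) :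
    labelRel S pre' = labelRel S pre := by
  funext u w
  have h' := fun a : Fin n => h (a + 1) (by omega)
  simp only [labelRel, h']

theorem Labels.labelRel_pre (h : Labels n par pre org pa sz) {a b : Fin n} :
    labelRel S pre (pre (a + 1)) (pre (b + 1)) ↔ s(a, b) ∈ S ∧ pre (a + 1) < pre (b + 1) := by
  constructor
  · rintro ⟨c, d, h1, h2, h3, h4⟩
    have e1 := h.pre_inj (by omega) (by omega) h2
    have e2 := h.pre_inj (by omega) (by omega) h3
    rw [show a = c by ext; omega, show b = d by ext; omega]
    exact ⟨h1, by omega⟩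
  · exact fun ⟨h1, h2⟩ => ⟨a, b, h1, rfl, rfl, h2⟩

/-- The pairs of labels of the listed edges are those related by `labelRel`. -/
theorem Labels.listed_iff (h : Labels n par pre org pa sz) {l : List (Fin n × Fin n)}
    (hl : ListsEdges l S) (hS : ∀ a, s(a, a) ∉ S) (u w : ℕ) :
    (∃ j < l.length, min (pre (edgeFst l j)) (pre (edgeSnd l j)) = u ∧
      max (pre (edgeFst l j)) (pre (edgeSnd l j)) = w) ↔ labelRel S pre u w := by
  constructor
  · rintro ⟨j, hj, rfl, rfl⟩
    have hm : s(l[j].1, l[j].2) ∈ S := (hl.2 _).1 (List.mem_map.2 ⟨l[j], List.getElem_mem hj, rfl⟩)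
    rw [edgeFst_eq hj, edgeSnd_eq hj]
    rcases lt_trichotomy (pre (l[j].1 + 1)) (pre (l[j].2 + 1)) with hlt | he | hlt
    · exact ⟨l[j].1, l[j].2, hm, by omega, by omega, by omega⟩
    · have := h.pre_inj (by omega) (by omega) he
      have e : l[j].1 = l[j].2 := by ext; omega
      rw [e] at hm
      exact absurd hm (hS _)
    · exact ⟨l[j].2, l[j].1, by rw [Sym2.eq_swap]; exact hm, by omega, by omega, by omega⟩
  · rintro ⟨a, b, h1, rfl, rfl, h4⟩
    obtain ⟨p, hp, e⟩ := List.mem_map.1 ((hl.2 _).2 h1)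
    obtain ⟨j, hj, rfl⟩ := List.mem_iff_getElem.1 hp
    refine ⟨j, hj, ?_⟩
    rw [edgeFst_eq hj, edgeSnd_eq hj]
    rcases Sym2.eq_iff.1 e with ⟨e1, e2⟩ | ⟨e1, e2⟩ <;> rw [e1, e2] <;> omega

theorem ListsEdges.inj {l : List (Fin n × Fin n)} (hl : ListsEdges l S) {i j : ℕ}
    (hi : i < l.length) (hj : j < l.length) (e : s(l[i].1, l[i].2) = s(l[j].1, l[j].2)) : i = j := by
  have := hl.1.getElem_inj_iff (i := i) (j := j) (hi := by simpa) (hj := by simpa)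
  simpa [e] using this

theorem ListsEdges.length_le {l : List (Fin n × Fin n)} (hl : ListsEdges l S) :
    l.length ≤ n * n := by
  simpa using hl.1.of_map.length_le_card

theorem ListsEdges.length_eq {l : List (Fin n × Fin n)} (hl : ListsEdges l S) :
    l.length = S.ncard := by
  classical
  have : S = (l.map fun p => s(p.1, p.2)).toFinset := by ext a; simp [← hl.2 a]
  rw [this, Set.ncard_coe_finset, List.toFinset_card_of_nodup hl.1, List.length_map]

end

/-- Only cells with index at most `2 * m + 2 * n + 4` matter, so that the data structure can be cut
off. -/
theorem Data.congr {n m : ℕ} {par : ℕ → ℕ} {adj : ℕ → ℕ → Prop} {D D' : ℕ → ℕ → ℕ}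
    (h : Data n m par adj D) (hp : ∀ a, 1 ≤ a → a ≤ n → par a ≤ n)
    (hD : ∀ j < 9, ∀ i < 2 * m + 2 * n + 5, D' j i = D j i) : Data n m par adj D' := by
  obtain ⟨h0, hL, hU, len, hlen, hS⟩ := h
  have hT := hL.tree
  have d1 := hD 1 (by omega)
  have d2 := hD 2 (by omega)
  have d3 := hD 3 (by omega)
  have d4 := hD 4 (by omega)
  have d5 := hD 5 (by omega)
  have d6 := hD 6 (by omega)
  have d7 := hD 7 (by omega)
  have d8 := hD 8 (by omega)
  have hoff : ∀ w ≤ n + 1, D 5 w ≤ m := by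
    intro w hw
    rw [← hU.last]
    exact Nat.le_induction (P := fun k _ => k ≤ n + 1 → D 5 w ≤ D 5 k) (fun _ => le_rfl)
      (fun k hk ih hk' => (ih (by omega)).trans (hU.mono k (by omega))) (n + 1) hw le_rfl
  refine ⟨by rw [hD 0 (by omega) 0 (by omega), h0], ?_, ?_, len, hlen, ?_⟩
  · constructor
    · constructor
      · rw [d4 0 (by omega)]; exact hT.sz_zero
      · intro x hx; rw [d4 x (by omega)]; exact hT.pos x hx
      · intro x h1 hx
        have := hT.par x h1 hx
        rw [d3 x (by omega), d4 x (by omega), d4 _ (by omega)]; exact this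
      · intro p x hp h1 h2
        rw [d4 p (by omega)] at h2
        have := hT.le_end hp
        rw [d3 x (by omega)]; exact hT.inner p x hp h1 h2
      · intro x h1 hx h2
        have := hT.par x h1 hx
        rw [d3 x (by omega)] at h2
        rw [d3 x (by omega), d4 x (by omega), d4 _ (by omega)]; exact hT.light x h1 hx h2
    · intro a ha; rw [d1 a (by omega)]; exact hL.pre_le a ha
    · intro a ha
      have := hL.pre_le a ha
      rw [d1 a (by omega), d2 _ (by omega)]; exact hL.org_pre a ha
    · rw [d1 0 (by omega)]; exact hL.pre_zero
    · intro a h1 ha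
      have := hL.pre_le a ha
      have := hp a h1 ha
      rw [d1 a (by omega), d1 _ (by omega), d3 _ (by omega)]; exact hL.par_eq a h1 ha
  · constructor
    · rw [d5 0 (by omega)]; exact hU.zero
    · intro w hw; rw [d5 w (by omega), d5 _ (by omega)]; exact hU.mono w hw
    · rw [d5 _ (by omega)]; exact hU.last
    · intro w hw t h1 h2
      rw [d5 w (by omega)] at h1
      rw [d5 _ (by omega)] at h2
      have := hoff (w + 1) (by omega)
      rw [d6 t (by omega)]; exact hU.mem w hw t h1 h2
    · intro w hw t t' h1 h2 h3
      rw [d5 w (by omega)] at h1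
      rw [d5 _ (by omega)] at h3
      have := hoff (w + 1) (by omega)
      rw [d6 t (by omega), d6 t' (by omega)]; exact hU.incr w hw t t' h1 h2 h3
    · intro u w hw hA
      obtain ⟨t, h1, h2, h3⟩ := hU.surj u w hw hA
      have := hoff (w + 1) (by omega)
      exact ⟨t, by rw [d5 w (by omega)]; exact h1, by rw [d5 _ (by omega)]; exact h2,
        by rw [d6 t (by omega)]; exact h3⟩
  · have hrank : ∀ w ≤ n, ∀ x, rank (D' 5) (D' 6) w x = rank (D 5) (D 6) w x := by
      intro w hw x
      have := hoff (w + 1) (by omega)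
      rw [rank, rank, d5 w (by omega), d5 _ (by omega)]
      congr 1
      refine filter_congr fun t ht => ?_
      rw [d6 t (by rw [mem_Ico] at ht; omega)]
    have hsnap : ∀ x < n + 1, ∀ w, x ≤ w → w < x + D 4 x →
        snap (D' 7) (D' 8) x w = snap (D 7) (D 8) x w := by
      intro x hx w h1 h2
      have := hS.adr_le x hx
      rw [snap, snap, d7 x (by omega), d8 _ (by omega), d8 _ (by omega)]
    constructor
    · intro x hx; rw [d7 x (by omega), d4 x (by omega)]; exact hS.adr_le x hx
    · intro x hx w h1 h2
      rw [d4 x (by omega)] at h2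
      have := hS.adr_le x hx
      rw [d7 x (by omega), d8 _ (by omega), d8 _ (by omega)]; exact hS.mono x hx w h1 h2
    · intro x hx w h1 h2
      rw [d4 x (by omega)] at h2
      have := hT.le_end (x := x) (by omega)
      rw [hsnap x hx w h1 h2, hrank w (by omega)]; exact hS.le x hx w h1 h2
    · intro x hx
      have := hT.le_end (x := x) (by omega)
      rw [d4 x (by omega)]
      refine le_trans (le_of_eq (sum_congr rfl fun w hw => ?_)) (hS.sum x hx)
      rw [mem_Ico] at hw
      rw [hsnap x hx w hw.1 hw.2, hrank w (by omega)]

/-! ### The two programs -/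

/-- The data structure consists of all 32 arrays, interleaved and cut off after `2 * m + 2 * n + 5`
cells each. -/
def preprocess : Program :=
  .seq prepCmd.comp (.set 0 (.op .times (.const 32) (.op .plus (.op .plus (.reg 2) (.reg 2))
    (.op .plus (.input 0 (.const 1)) (.op .plus (.input 0 (.const 1)) (.const 5))))))

/-- The first `n` memory cells are kept for the output, thus `n` is the base address. -/
def query : Program := .seq (.set 1 (.input 0 (.const 0))) queryCmd.comp

section
variable {n : ℕ} {G : SimpleGraph (Fin n)} {T : Fin n → Option (Fin n)}

theorem not_mem_edgeSet_diag (G : SimpleGraph (Fin n)) (a : Fin n) : s(a, a) ∉ G.edgeSet := by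
  simp

/-- Edges join a label to a label in its interval. -/
theorem Labels.edge_nested (hT : IsDFSForest (⊤ : G.Subgraph) T) {pre org pa sz : ℕ → ℕ}
    (h : Labels n (nodePar T) pre org pa sz) {u w : ℕ} (hr : labelRel G.edgeSet pre u w) :
    1 ≤ u ∧ u < w ∧ w < u + sz u ∧ w ≤ n := by
  obtain ⟨a, b, h1, rfl, rfl, h4⟩ := hr
  refine ⟨h.pre_pos (by omega) (by omega), h4, ?_, h.pre_le _ (by omega)⟩
  rcases hT.related (G.mem_edgeSet.1 h1) with h5 | h5
  · exact (h.isAncestor_iff.1 h5).2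
  · have := (h.isAncestor_iff.1 h5).1
    omega

/-- Time and space of the preprocessing, and the properties of the data structure. All words are
below `(n + 2) ^ 14`, which leaves room for the addresses in the interleaved arrays. -/
theorem preprocess_run (hT : IsDFSForest (⊤ : G.Subgraph) T) {edges : List (Fin n × Fin n)}
    (hl : ListsEdges edges G.edgeSet) {W : ℕ} (hW : 64 * (n + 2) ^ 14 + 64 ≤ W) :
    ∃ s t, Exec W [encodeGraph edges T] preprocess State.init s t ∧
      t ≤ 3100 * (n + edges.length + 1) ∧
      s.data.length = 32 * (2 * edges.length + 2 * n + 5) ∧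
      (∀ a, s.data.getD a 0 < (n + 2) ^ 14) ∧ s.data.getD 0 0 = n ∧
      Data n edges.length (nodePar T)
        (labelRel G.edgeSet fun a => s.data.getD (a * 32 + 1) 0)
        fun j i => s.data.getD (i * 32 + j) 0 := by
  have hm := hl.length_le
  set m := edges.length with hmdef
  set B := (n + 2) ^ 14 with hBdef
  have hB : 4096 * (n + 2) ^ 2 ≤ B := by
    have h2 : 2 ^ 12 ≤ (n + 2) ^ 12 := Nat.pow_le_pow_left (by omega) 12
    calc 4096 * (n + 2) ^ 2 ≤ (n + 2) ^ 12 * (n + 2) ^ 2 := Nat.mul_le_mul_right _ h2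
      _ = B := by rw [hBdef]; ring
  have hB' : 40 * n + 40 * m + 1000 ≤ B := by
    have : (n + 2) ^ 2 = n * n + 4 * n + 4 := by ring
    omega
  obtain ⟨rk, hrk⟩ := hT.rank
  set Γ : Env := ⟨W, B, 0, [encodeGraph edges T]⟩ with hΓ
  have hg : ∀ a, Γ.get 0 a = (encodeGraph edges T).getD a 0 := fun a => rfl
  have hfit : Γ.Fits := by
    refine ⟨hW, Nat.zero_le _, by simp only [hΓ]; omega, fun i a => ?_⟩
    rcases i with _ | i
    · exact encodeGraph_lt (by simp only [hΓ]; omega) (by simp only [hΓ]; omega) a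
    · simp [Env.get, hΓ]
      omega
  have hlt : ∀ j < m, edgeFst edges j ≤ n ∧ edgeSnd edges j ≤ n := by
    intro j hj
    rw [edgeFst_eq hj, edgeSnd_eq hj]
    omega
  have hwp : WP Γ prepCmd (fun τ _ => τ.reg 0 = n ∧
      Data n m (nodePar T) (labelRel G.edgeSet (τ.arr 1)) τ.arr) ⟨fun _ => 0, fun _ _ => 0, fun _ => 0⟩
      (3000 * (n + m + 1)) := by
    refine prepCmd_spec (k₀ := 0) (parentInput_encodeGraph hg) (edgeInput_encodeGraph hg)
      (by simp only [hΓ]; omega) (fun a _ _ => nodePar_le T a) hrk hlt ?_ ?_ (fun _ _ => rfl) le_rfl ?_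
    · intro i hi j hj h
      rw [edgeFst_eq hi, edgeFst_eq hj, edgeSnd_eq hi, edgeSnd_eq hj] at h
      refine hl.inj hi hj (Sym2.eq_iff.2 ?_)
      simpa only [Fin.ext_iff, Nat.add_right_cancel_iff] using h
    · intro pre org pa sz hL j hj
      have := (hL.listed_iff hl (not_mem_edgeSet_diag G) _ _).1 ⟨j, hj, rfl, rfl⟩
      have := hL.edge_nested hT this
      exact ⟨this.2.1, this.2.2.1⟩
    · intro τ l h0 hD _
      refine ⟨h0, ?_⟩
      convert hD using 1
      funext u w
      exact propext (hD.labels.listed_iff hl (not_mem_edgeSet_diag G) u w).symm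
  obtain ⟨s, σ, t, hex, hrep, ht, h0, hD⟩ := WP_sound hfit _ _ _ _ hwp State.init
    ⟨rfl, fun _ => rfl, fun _ => by simp only [hΓ]; omega, fun _ _ _ _ => rfl,
      fun _ _ => by simp only [hΓ]; omega, fun _ _ => rfl⟩
  -- the arrays are interleaved from cell `0` on, as the base address is `0`
  have hmem : ∀ j < 32, ∀ i < B, s.mem (i * 32 + j) = σ.arr j i := fun j hj i hi =>
    hrep.arr j hj i hi
  have hr : s.reg 2 = n := (hrep.reg 0).trans h0
  have hin : (encodeGraph edges T).getD 1 0 = m := rfl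
  have hval : Exp.val W [encodeGraph edges T] s (.op .times (.const 32)
      (.op .plus (.op .plus (.reg 2) (.reg 2)) (.op .plus (.input 0 (.const 1))
        (.op .plus (.input 0 (.const 1)) (.const 5))))) = 32 * (2 * m + 2 * n + 5) := by
    have e1 : 1 % W = 1 := Nat.mod_eq_of_lt (by omega)
    simp only [Exp.val, Op.apply, hr, e1, List.getD_cons_zero, hin]
    rw [Nat.mod_eq_of_lt (a := 32) (by omega), Nat.mod_eq_of_lt (a := n) (by omega),
      Nat.mod_eq_of_lt (a := m) (by omega), Nat.mod_eq_of_lt (a := 5) (by omega),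
      Nat.mod_eq_of_lt (a := n + n) (by omega), Nat.mod_eq_of_lt (a := m + 5) (by omega),
      Nat.mod_eq_of_lt (a := m + (m + 5)) (by omega),
      Nat.mod_eq_of_lt (a := n + n + (m + (m + 5))) (by omega), Nat.mod_eq_of_lt (by omega)]
    omega
  have hex2 := Exec.set (W := W) (inp := [encodeGraph edges T]) 0 (.op .times (.const 32)
      (.op .plus (.op .plus (.reg 2) (.reg 2)) (.op .plus (.input 0 (.const 1))
        (.op .plus (.input 0 (.const 1)) (.const 5))))) s
  rw [hval] at hex2
  refine ⟨_, _, Exec.seq hex hex2, ?_, ?_, ?_⟩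
  · simp only [Exp.cost]
    omega
  · simp [State.data]
  · have hdat : ∀ a, (State.data ⟨Function.update s.reg 0 (32 * (2 * m + 2 * n + 5)), s.mem⟩).getD a 0
        = if a < 32 * (2 * m + 2 * n + 5) then s.mem a else 0 := by
      intro a
      by_cases ha : a < 32 * (2 * m + 2 * n + 5)
      · simp [State.data, ha]
      · simp [State.data, ha]
    have hD' : Data n m (nodePar T) (labelRel G.edgeSet (σ.arr 1)) fun j i =>
        (State.data ⟨Function.update s.reg 0 (32 * (2 * m + 2 * n + 5)), s.mem⟩).getD (i * 32 + j) 0 := by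
      refine hD.congr (fun a _ _ => nodePar_le T a) fun j hj i hi => ?_
      rw [hdat, if_pos (by omega), hmem j (by omega) i (by omega)]
    refine ⟨fun a => ?_, hD'.size, ?_⟩
    · rw [hdat]
      split_ifs with ha
      · have := hmem (a % 32) (by omega) (a / 32) (by omega)
        rw [show a / 32 * 32 + a % 32 = a by omega] at this
        rw [this]
        exact hrep.arr_lt _ _
      · omega
    · rw [labelRel_congr (pre := σ.arr 1)]
      · exact hD'
      · intro a ha
        rw [hdat, if_pos (by omega), hmem 1 (by omega) a (by omega)]

end

/-! ### Failures on root-leaf paths -/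

section
variable {n : ℕ} {G : SimpleGraph (Fin n)} {T : Fin n → Option (Fin n)} {pre org pa sz : ℕ → ℕ}
variable {FV : Finset (Fin n)} {FE : Finset (Sym2 (Fin n))}

theorem maxFaults_le (T : Fin n → Option (Fin n)) (FV : Finset (Fin n))
    (FE : Finset (Sym2 (Fin n))) : maxFaults T FV FE ≤ FV.card + FE.card :=
  Finset.sup_le fun l _ => by
    rw [faultsOnPath]
    refine Nat.add_le_add (card_le_card fun x hx => ?_) (card_le_card fun e he => ?_)
    · simp only [mem_filter] at hx
      exact hx.1
    · simp only [mem_filter] at he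
      exact he.1

/-- The failures above a vertex also lie on the path to a leaf below it. -/
theorem Labels.faults_above (h : Labels n (nodePar T) pre org pa sz) (v : Fin n)
    [DecidablePred fun x => IsAncestor T x v]
    [DecidablePred fun e : Sym2 (Fin n) => ∀ x ∈ e, IsAncestor T x v] :
    (FV.filter fun x => IsAncestor T x v).card +
      (FE.filter fun e => ∀ x ∈ e, IsAncestor T x v).card ≤ maxFaults T FV FE := by
  obtain ⟨l, hl, hv⟩ := h.exists_leaf v
  have h1 : faultsOnPath T FV FE l ≤ maxFaults T FV FE :=
    le_sup (f := faultsOnPath T FV FE) (by simpa using hl)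
  refine le_trans (Nat.add_le_add (card_le_card ?_) (card_le_card ?_)) h1
  · intro x hx
    simp only [mem_filter] at hx ⊢
    exact ⟨hx.1, hx.2.trans hv⟩
  · intro e he
    simp only [mem_filter] at he ⊢
    exact ⟨he.1, fun x hx => (he.2 x hx).trans hv⟩

/-- At most `maxFaults` failed vertices are ancestors of a given vertex. -/
theorem Labels.ancCard_verts (h : Labels n (nodePar T) pre org pa sz) (P : ℕ → Prop)
    (hP : ∀ x, P x → ∃ v ∈ FV, pre (v + 1) = x) {w : ℕ} (hw : w ≤ n) :
    ancCard n sz P w ≤ maxFaults T FV FE := by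
  classical
  rcases Nat.eq_zero_or_pos w with rfl | h0
  · rw [ancCard_zero]; exact Nat.zero_le _
  obtain ⟨v, rfl⟩ := h.exists_fin h0 hw
  refine le_trans ?_ (le_trans (Nat.le_add_right _ _) (h.faults_above (FV := FV) (FE := FE) v))
  refine le_trans (card_le_card fun x hx => ?_) (card_image_le (f := fun a : Fin n => pre (a + 1)))
  obtain ⟨-, hx, h1⟩ := mem_filter.1 hx
  obtain ⟨a, ha, rfl⟩ := hP x hx
  exact mem_image.2 ⟨a, mem_filter.2 ⟨ha, h.isAncestor_iff.2 h1⟩, rfl⟩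

/-- A failed edge is on the path to each vertex below its lower endpoint. -/
theorem Labels.edge_above (hT : IsDFSForest (⊤ : G.Subgraph) T)
    (h : Labels n (nodePar T) pre org pa sz) (hE : (FE : Set (Sym2 (Fin n))) ⊆ G.edgeSet)
    {u x : ℕ} {v : Fin n} (hr : labelRel (FE : Set (Sym2 (Fin n))) pre u x)
    (h1 : x ≤ pre (v + 1)) (h2 : pre (v + 1) < x + sz x) :
    ∃ a b : Fin n, s(a, b) ∈ FE ∧ pre (a + 1) = u ∧ pre (b + 1) = x ∧ u < x ∧
      ∀ y ∈ s(a, b), IsAncestor T y v := by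
  obtain ⟨a, b, h3, rfl, rfl, h4⟩ := hr
  have h5 := h.edge_nested hT ⟨a, b, hE h3, rfl, rfl, h4⟩
  have h6 := h.tree.nest (by omega) h5.2.1.le h5.2.2.1
  refine ⟨a, b, h3, rfl, rfl, h4, fun y hy => ?_⟩
  rcases Sym2.mem_iff.1 hy with rfl | rfl
  · exact h.isAncestor_iff.2 ⟨by omega, by omega⟩
  · exact h.isAncestor_iff.2 ⟨h1, h2⟩

/-- At most `maxFaults` ancestors of a given vertex are lower endpoints of failed edges. -/
theorem Labels.ancCard_edges (hT : IsDFSForest (⊤ : G.Subgraph) T)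
    (h : Labels n (nodePar T) pre org pa sz) (hE : (FE : Set (Sym2 (Fin n))) ⊆ G.edgeSet)
    (P : ℕ → Prop) (hP : ∀ x, P x → ∃ u, labelRel (FE : Set (Sym2 (Fin n))) pre u x) {w : ℕ}
    (hw : w ≤ n) : ancCard n sz P w ≤ maxFaults T FV FE := by
  classical
  rcases Nat.eq_zero_or_pos w with rfl | h0
  · rw [ancCard_zero]; exact Nat.zero_le _
  obtain ⟨v, rfl⟩ := h.exists_fin h0 hw
  refine le_trans ?_ (le_trans (Nat.le_add_left _ _) (h.faults_above (FV := FV) (FE := FE) v))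
  refine le_trans (card_le_card fun x hx => ?_) (card_image_le (f := Sym2.lift
    ⟨fun a b : Fin n => max (pre (a + 1)) (pre (b + 1)), fun a b => max_comm _ _⟩))
  obtain ⟨-, hx, h1, h2⟩ := mem_filter.1 hx
  obtain ⟨u, hu⟩ := hP x hx
  obtain ⟨a, b, h3, rfl, rfl, h4, h5⟩ := h.edge_above hT hE hu h1 h2
  exact mem_image.2 ⟨s(a, b), mem_filter.2 ⟨h3, h5⟩, max_eq_right h4.le⟩

/-- At most `maxFaults` failed edges have a given lower endpoint. -/
theorem Labels.card_edges_at (hT : IsDFSForest (⊤ : G.Subgraph) T)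
    (h : Labels n (nodePar T) pre org pa sz) (hE : (FE : Set (Sym2 (Fin n))) ⊆ G.edgeSet)
    {es : List (Fin n × Fin n)} (hes : ListsEdges es (FE : Set (Sym2 (Fin n)))) {w : ℕ}
    (hw : w ≤ n) :
    ((range es.length).filter fun j => max (pre (edgeFst es j)) (pre (edgeSnd es j)) = w).card ≤
      maxFaults T FV FE := by
  classical
  have hd : ∀ a, s(a, a) ∉ (FE : Set (Sym2 (Fin n))) := fun a ha => not_mem_edgeSet_diag G a (hE ha)
  rcases Nat.eq_zero_or_pos w with rfl | h0
  · rw [filter_eq_empty_iff.2]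
    · simp
    · intro j hj e
      have := h.edge_nested hT (w := 0) (u := 0) ((h.listed_iff hes hd 0 0).1
        ⟨j, mem_range.1 hj, by omega, e⟩ |>.imp fun a h => h.imp fun b h => ⟨hE h.1, h.2⟩)
      omega
  obtain ⟨v, rfl⟩ := h.exists_fin h0 hw
  refine le_trans ?_ (le_trans (Nat.le_add_left _ _) (h.faults_above (FV := FV) (FE := FE) v))
  refine le_trans (card_le_card fun j hj => ?_)
    (card_image_le (f := fun e => (es.map fun p => s(p.1, p.2)).idxOf e))
  obtain ⟨h1, h2⟩ := mem_filter.1 hj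
  rw [mem_range] at h1
  have hr := (h.listed_iff hes hd _ _).1 ⟨j, h1, rfl, h2⟩
  have hs := h.tree.pos _ (h.pre_le (v + 1) (by omega))
  obtain ⟨a, b, h3, h4, h5, h6, h7⟩ := h.edge_above hT hE (v := v) hr le_rfl (by omega)
  have he : s(es[j].1, es[j].2) = s(a, b) := by
    rw [edgeFst_eq h1, edgeSnd_eq h1] at h2 h4
    rcases le_total (pre (es[j].1 + 1)) (pre (es[j].2 + 1)) with hle | hle
    · have e1 := h.pre_inj (a := a + 1) (b := es[j].1 + 1) (by omega) (by omega) (by omega)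
      have e2 := h.pre_inj (a := b + 1) (b := es[j].2 + 1) (by omega) (by omega) (by omega)
      exact Sym2.eq_iff.2 (Or.inl ⟨by ext; omega, by ext; omega⟩)
    · have e1 := h.pre_inj (a := a + 1) (b := es[j].2 + 1) (by omega) (by omega) (by omega)
      have e2 := h.pre_inj (a := b + 1) (b := es[j].1 + 1) (by omega) (by omega) (by omega)
      exact Sym2.eq_iff.2 (Or.inr ⟨by ext; omega, by ext; omega⟩)
  refine mem_image.2 ⟨s(a, b), mem_filter.2 ⟨h3, h7⟩, ?_⟩
  have := hes.1.idxOf_getElem j (by simpa using h1)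
  simpa [he] using this

end

/-! ### The resulting forest -/

/-- The inverse of `encodeParent`. -/
def decodeParent (n x : ℕ) : Option (Fin n) :=
  if h : 0 < x ∧ x ≤ n then some ⟨x - 1, by omega⟩ else none

section
variable {n : ℕ} {G : SimpleGraph (Fin n)} {par pre org pa sz : ℕ → ℕ}
variable {FV : Finset (Fin n)} {FE : Finset (Sym2 (Fin n))}

theorem encodeParent_decodeParent {x : ℕ} (hx : x ≤ n) : encodeParent (decodeParent n x) = x := by
  rw [decodeParent]
  split_ifs with h
  · simp only [encodeParent]; omega
  · simp only [encodeParent]; omega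

theorem surviving_adj {a b : Fin n} : (surviving G FV FE).Adj a b ↔
    G.Adj a b ∧ s(a, b) ∉ FE ∧ a ∉ FV ∧ b ∉ FV := by
  simp [surviving]
  tauto

theorem mem_surviving_verts {a : Fin n} : a ∈ (surviving G FV FE).verts ↔ a ∉ FV := by
  simp [surviving]

/-- A complete traversal in terms of labels gives a depth first search forest. -/
theorem Traversal.isDFSForest (h : Labels n par pre org pa sz) {H : ℕ → ℕ → Prop}
    {dfn ps dep : ℕ → ℕ} {c : ℕ} (hR : Traversal H dfn ps dep 0 c)
    (hH : ∀ a b : Fin n, H (pre (a + 1)) (pre (b + 1)) ↔ (surviving G FV FE).Adj a b)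
    (hd : ∀ x, dfn x ≠ 0 ↔ 1 ≤ x ∧ x ≤ n ∧ ¬ ∃ v ∈ FV, pre (v + 1) = x) :
    IsDFSForest (surviving G FV FE) (fun v => decodeParent n (org (ps (pre (v + 1))))) ∧
      ∀ v : Fin n, org (ps (pre (v + 1))) ≤ n := by
  have org_zero : org 0 = 0 := by simpa [h.pre_zero] using h.org_pre 0 (Nat.zero_le n)
  have inj : ∀ a b : Fin n, pre (a + 1) = pre (b + 1) → a = b := fun a b e => by
    have := h.pre_inj (a := a + 1) (b := b + 1) (by omega) (by omega) e
    ext; omega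
  have hdv : ∀ v : Fin n, dfn (pre (v + 1)) ≠ 0 ↔ v ∈ (surviving G FV FE).verts := by
    intro v
    rw [hd, mem_surviving_verts]
    constructor
    · exact fun h1 hv => h1.2.2 ⟨v, hv, rfl⟩
    · refine fun hv => ⟨h.pre_pos (by omega) (by omega), h.pre_le _ (by omega), ?_⟩
      rintro ⟨u, hu, e⟩
      exact hv (inj u v e ▸ hu)
  have hps : ∀ v : Fin n, ps (pre (v + 1)) = 0 ∨ ∃ u : Fin n, ps (pre (v + 1)) = pre (u + 1) := by
    intro v
    by_cases h0 : ps (pre (v + 1)) = 0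
    · exact Or.inl h0
    · have h1 : dfn (pre (v + 1)) ≠ 0 := fun e => h0 (hR.none _ e)
      have h2 := (hd _).1 (hR.par _ h1 h0).2.1
      obtain ⟨u, hu⟩ := h.exists_fin h2.1 h2.2.1
      exact Or.inr ⟨u, hu.symm⟩
  have dec : ∀ u : Fin n, decodeParent n (org (pre (u + 1))) = some u := by
    intro u
    rw [h.org_pre _ (by omega), decodeParent, dif_pos ⟨by omega, by omega⟩]
    rfl
  have dec0 : decodeParent n (org 0) = Option.none := by
    rw [org_zero, decodeParent, dif_neg (by omega)]
  refine ⟨⟨fun v hv => ?_, fun v => dfn (pre (v + 1)), fun a ha b _ e => ?_, fun v hv => ⟨?_, ?_⟩⟩, ?_⟩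
  · have : dfn (pre (v + 1)) = 0 := by
      by_contra h1
      exact hv ((hdv v).1 h1)
    simp only [hR.none _ this, dec0]
  · exact inj a b (hR.inj _ _ ((hdv a).2 ha) e)
  · intro u hu
    rcases hps v with h1 | ⟨b, h1⟩
    · simp [h1, dec0] at hu
    · simp only [h1, dec, Option.some.injEq] at hu
      subst hu
      have h2 := h.pre_pos (a := b + 1) (by omega) (by omega)
      have h3 := hR.par _ ((hdv v).2 hv) (by omega)
      rw [h1] at h3
      exact ⟨(hH _ _).1 h3.1, h3.2.2⟩
  · intro w x hwx h1 h2
    have hw : dfn (pre (w + 1)) ≠ 0 := (hdv w).2 ((surviving G FV FE).edge_vert hwx)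
    obtain ⟨h3, h4⟩ := hR.dfs _ _ _ ((hdv v).2 hv) ((hH _ _).2 hwx) hw h1 (Or.inr h2)
    rcases hps v with h5 | ⟨b, h5⟩
    · exact absurd h5 h3
    · exact ⟨b, by simp only [h5, dec], by rw [h5] at h4; exact h4⟩
  · intro v
    rcases hps v with h1 | ⟨u, h1⟩
    · rw [h1, org_zero]; exact Nat.zero_le _
    · rw [h1, h.org_pre _ (by omega)]; omega

end

/-! ### Correctness of the queries -/

section
variable {n : ℕ} {G : SimpleGraph (Fin n)} {T : Fin n → Option (Fin n)}
variable {FV : Finset (Fin n)} {FE : Finset (Sym2 (Fin n))}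

/-- Time and correctness of queries. The words used are below `(n + 2) ^ 15`: the data structure has
words below `(n + 2) ^ 14`, and the number of list nodes is at most `(n + 2) ^ 3`. -/
theorem query_run (hT : IsDFSForest (⊤ : G.Subgraph) T) {W m : ℕ} {data : List ℕ}
    (hW : 64 * (n + 2) ^ 15 + 64 ≤ W) (hm : m ≤ n * n) (hlt : ∀ a, data.getD a 0 < (n + 2) ^ 14)
    (h0 : data.getD 0 0 = n)
    (hD : Data n m (nodePar T) (labelRel G.edgeSet fun a => data.getD (a * 32 + 1) 0)
      fun j i => data.getD (i * 32 + j) 0)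
    (hE : (FE : Set (Sym2 (Fin n))) ⊆ G.edgeSet) {vs : List (Fin n)} {es : List (Fin n × Fin n)}
    (hvs : Lists vs (FV : Set (Fin n))) (hes : ListsEdges es (FE : Set (Sym2 (Fin n)))) :
    ∃ (s' : State) (t' : ℕ) (T' : Fin n → Option (Fin n)),
      Exec W [data, encodeFaults vs es] query State.init s' t' ∧
      t' ≤ 15003 * ((n + 1) * (maxFaults T FV FE + (Nat.log 2 n + 1)) * (Nat.log 2 n + 1)) ∧
      s'.Outputs T' ∧ IsDFSForest (surviving G FV FE) T' := by
  have hke := hes.length_le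
  have hkv : vs.length ≤ n := by simpa using hvs.1.length_le_card
  set kv := vs.length with hkvdef
  set ke := es.length with hkedef
  set B := (n + 2) ^ 15 with hBdef
  have hB : 4096 * (n + 2) ^ 3 ≤ B := by
    have h2 : 2 ^ 12 ≤ (n + 2) ^ 12 := Nat.pow_le_pow_left (by omega) 12
    calc 4096 * (n + 2) ^ 3 ≤ (n + 2) ^ 12 * (n + 2) ^ 3 := Nat.mul_le_mul_right _ h2
      _ = B := by rw [hBdef]; ring
  have hB' : (n + 2) ^ 3 + 40 * n + 40 * m + kv + 2 * ke + 3000 ≤ B := by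
    have e1 : (n + 2) ^ 3 = n * n * n + 6 * (n * n) + 12 * n + 8 := by ring
    omega
  have hB2 : 2 * (n + 2) ^ 14 ≤ B := by
    calc 2 * (n + 2) ^ 14 ≤ (n + 2) * (n + 2) ^ 14 := Nat.mul_le_mul_right _ (by omega)
      _ = B := by rw [hBdef]; ring
  have hpos : 2 ≤ (n + 2) ^ 14 :=
    le_trans (by norm_num : 2 ≤ 2 ^ 14) (Nat.pow_le_pow_left (by omega) 14)
  clear_value B
  set Γ : Env := ⟨W, B, n, [data, encodeFaults vs es]⟩ with hΓ
  set pre : ℕ → ℕ := fun a => data.getD (a * 32 + 1) 0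
  have hup : ∀ i a, Γ.get i a + 1 < Γ.B := by
    intro i a
    rcases i with _ | _ | i
    · exact lt_of_lt_of_le (Nat.add_lt_add_right (hlt a) 1) (by simp only [hΓ]; omega)
    · have : (encodeFaults vs es).getD a 0 < B - 1 :=
        encodeFaults_lt (by omega) (by omega) (by omega) a
      exact Nat.add_lt_of_lt_sub this
    · simp [Env.get, hΓ]
      omega
  have hfit : Γ.Fits := ⟨hW, by simp only [hΓ]; omega, by simp only [hΓ]; omega,
    fun i a => (Nat.lt_succ_self _).trans (hup i a)⟩
  have hL : Labels n (nodePar T) pre (fun i => data.getD (i * 32 + 2) 0)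
      (fun i => data.getD (i * 32 + 3) 0) fun i => data.getD (i * 32 + 4) 0 := hD.labels
  have hd : ∀ a, s(a, a) ∉ (FE : Set (Sym2 (Fin n))) := fun a ha => not_mem_edgeSet_diag G a (hE ha)
  have hfail : ∀ x, (∃ i < kv, pre (vs[i]?.elim 0 fun v => v + 1) = x) ↔ ∃ v ∈ FV, pre (v + 1) = x := by
    intro x
    constructor
    · rintro ⟨i, hi, rfl⟩
      exact ⟨vs[i], (hvs.2 _).1 (List.getElem_mem hi), by rw [List.getElem?_eq_getElem hi]; rfl⟩
    · rintro ⟨v, hv, rfl⟩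
      obtain ⟨i, hi, rfl⟩ := List.mem_iff_getElem.1 ((hvs.2 v).2 hv)
      exact ⟨i, hi, by rw [List.getElem?_eq_getElem hi]; rfl⟩
  have hbad : ∀ u w, (∃ j < ke, max (pre (edgeFst es j)) (pre (edgeSnd es j)) = w ∧
      min (pre (edgeFst es j)) (pre (edgeSnd es j)) = u) ↔
      labelRel (FE : Set (Sym2 (Fin n))) pre u w := by
    intro u w
    rw [← hL.listed_iff hes hd]
    simp only [and_comm, hkedef]
  have hwp : WP Γ queryCmd (fun τ _ => ∃ T' : Fin n → Option (Fin n),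
      (∀ v : Fin n, τ.out v = encodeParent (T' v)) ∧ IsDFSForest (surviving G FV FE) T')
      ⟨fun _ => 0, fun _ _ => 0, fun _ => 0⟩
      (15000 * ((n + 1) * (maxFaults T FV FE + (Nat.log 2 n + 1)) * (Nat.log 2 n + 1))) := by
    refine queryCmd_spec (kv := kv) (ke := ke) (kk := maxFaults T FV FE) (m := m) (par := nodePar T)
      (adj := labelRel G.edgeSet pre)
      (lo := fun j => min (pre (edgeFst es j)) (pre (edgeSnd es j)))
      (hi := fun j => max (pre (edgeFst es j)) (pre (edgeSnd es j))) hD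
      (fun u w h => ?_) (fun x h1 hx hp => ?_) (faultInput_encodeFaults fun _ => rfl)
      (fun i hi => ?_) (fun j hj => ?_) (fun j _ => rfl) (fun j _ => rfl) (fun j hj => ?_) hkv
      (fun w hw => ?_) (fun w hw => ?_) (fun w hw => ?_) hB' rfl hup (fun _ _ => rfl) le_rfl ?_
    · have := hL.edge_nested hT h
      exact ⟨this.1, this.2.1, this.2.2.1⟩
    · obtain ⟨v, rfl⟩ := hL.exists_fin h1 hx
      cases e : T v with
      | none => exact absurd (hL.pa_none e) hp
      -- the tree edges belong to the graph
      | some u =>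
        have h2 := hL.pa_some e
        have h3 := hL.tree.par _ h1 hx
        obtain ⟨-, dfn, -, hdfs⟩ := hT
        have h4 := ((hdfs v trivial).1 u e).1
        refine ⟨u, v, by simpa using h4, h2.symm, rfl, h3.1⟩
    · simp [show i < vs.length from hi]
    · rw [edgeFst_eq hj, edgeSnd_eq hj]
      omega
    · obtain ⟨a, b, h1, h2⟩ := (hbad _ _).1 ⟨j, hj, rfl, rfl⟩
      exact ⟨a, b, hE h1, h2⟩
    · exact hL.ancCard_verts _ (fun x hx => (hfail x).1 hx) hw
    · exact hL.ancCard_edges hT hE _ (fun x ⟨j, hj, h1, _⟩ => ⟨_, (hbad _ x).1 ⟨j, hj, h1, rfl⟩⟩) hw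
    · exact hL.card_edges_at hT hE hes hw
    · intro τ l H dfn ps dep c hR hH hdfn hout
      have hmain := hR.isDFSForest (G := G) (FV := FV) (FE := FE) hL ?_ ?_
      · refine ⟨_, fun v => ?_, hmain.1⟩
        rw [encodeParent_decodeParent (hmain.2 v)]
        exact hout v v.2
      · intro a b
        have ha := hL.pre_le (a + 1) (by omega)
        have hb := hL.pre_le (b + 1) (by omega)
        have hfv : ∀ a : Fin n, (∃ v ∈ FV, pre (v + 1) = pre (a + 1)) ↔ a ∈ FV := by
          refine fun a => ⟨fun ⟨v, hv, e⟩ => ?_, fun h => ⟨a, h, rfl⟩⟩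
          have := hL.pre_inj (a := v + 1) (b := a + 1) (by omega) (by omega) e
          rwa [show a = v by ext; omega]
        have hne : s(a, b) ∈ G.edgeSet → pre (a + 1) ≠ pre (b + 1) := by
          intro h e
          have := hL.pre_inj (a := a + 1) (b := b + 1) (by omega) (by omega) e
          rw [show a = b by ext; omega] at h
          exact not_mem_edgeSet_diag G b h
        have l1 := fun S => hL.labelRel_pre (S := S) (a := a) (b := b)
        have l2 := fun S => hL.labelRel_pre (S := S) (a := b) (b := a)
        have f1 := (hfail (pre (a + 1))).trans (hfv a)
        have f2 := (hfail (pre (b + 1))).trans (hfv b)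
        refine (hH (pre (a + 1)) (pre (b + 1))).trans ?_
        refine (and_congr (or_congr (and_congr (l1 _) (not_congr ((hbad _ _).trans (l1 _))))
          (and_congr (l2 _) (not_congr ((hbad _ _).trans (l2 _))))) (and_congr Iff.rfl
          (and_congr (not_congr f1) (not_congr f2)))).trans ?_
        rw [surviving_adj, ← SimpleGraph.mem_edgeSet, Sym2.eq_swap (a := b), mem_coe]
        by_cases hE : s(a, b) ∈ G.edgeSet
        · rcases lt_or_gt_of_ne (hne hE) with h | h <;> simp [hE, h, h.not_gt, ha, hb]
        · simp [hE]
      · intro x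
        rw [hdfn, ← hfail]
        rfl
  have hex1 := Exec.set (W := W) (inp := [data, encodeFaults vs es]) 1 (.input 0 (.const 0)) State.init
  have hval : Exp.val W [data, encodeFaults vs es] State.init (.input 0 (.const 0)) = n := by
    simp only [Exp.val, Nat.zero_mod, List.getD_cons_zero, h0]
    exact Nat.mod_eq_of_lt (by omega)
  rw [hval] at hex1
  obtain ⟨s, σ, t, hex, hrep, ht, T', hT1, hT2⟩ := WP_sound hfit _ _ _ _ hwp
    ⟨Function.update State.init.reg 1 n, State.init.mem⟩
    ⟨by simp [hΓ], fun x => by simp [State.init], fun _ => by simp only [hΓ]; omega,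
      fun _ _ _ _ => rfl, fun _ _ => by simp only [hΓ]; omega, fun _ _ => rfl⟩
  refine ⟨s, _, T', Exec.seq hex1 hex, ?_, fun v => ?_, hT2⟩
  · have : 1 ≤ (n + 1) * (maxFaults T FV FE + (Nat.log 2 n + 1)) * (Nat.log 2 n + 1) :=
      Nat.mul_pos (Nat.mul_pos (by omega) (by omega)) (by omega)
    simp only [Exp.cost]
    omega
  · rw [← hT1 v]
    exact hrep.out v v.2

end

end FaultDFS

open FaultDFS in
theorem mainTheorem1 :
    ∃ (preprocess query : Program) (C c : ℕ),
      ∀ (n : ℕ) (G : SimpleGraph (Fin n)) (T : Fin n → Option (Fin n)),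
        IsDFSForest (⊤ : G.Subgraph) T →
      ∀ edges : List (Fin n × Fin n), ListsEdges edges G.edgeSet →
      ∀ W : ℕ, (n + 2) ^ c ≤ W →
        ∃ (s : State) (t : ℕ),
          Exec W [encodeGraph edges T] preprocess State.init s t ∧
          t ≤ C * (G.edgeSet.ncard + n + 1) ∧
          s.data.length ≤ C * (G.edgeSet.ncard + n + 1) ∧
          ∀ (FV : Finset (Fin n)) (FE : Finset (Sym2 (Fin n))),
            (FE : Set (Sym2 (Fin n))) ⊆ G.edgeSet →
            maxFaults T FV FE ≤ FV.card + FE.card ∧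
            ∀ (vs : List (Fin n)) (es : List (Fin n × Fin n)),
              Lists vs (FV : Set (Fin n)) → ListsEdges es (FE : Set (Sym2 (Fin n))) →
              ∃ (s' : State) (t' : ℕ) (T' : Fin n → Option (Fin n)),
                Exec W [s.data, encodeFaults vs es] query State.init s' t' ∧
                t' ≤ C * ((n + 1) * (maxFaults T FV FE + (Nat.log 2 n + 1)) *
                  (Nat.log 2 n + 1)) ∧
                s'.Outputs T' ∧
                IsDFSForest (surviving G FV FE) T' := by
  refine ⟨preprocess, query, 15003, 22, fun n G T hT edges hl W hW => ?_⟩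
  have hW2 : 64 * (n + 2) ^ 15 + 64 ≤ W := by
    have h1 : 2 ^ 7 ≤ (n + 2) ^ 7 := Nat.pow_le_pow_left (by omega) 7
    have h2 : 2 ^ 15 ≤ (n + 2) ^ 15 := Nat.pow_le_pow_left (by omega) 15
    have h3 : 2 ^ 7 * (n + 2) ^ 15 ≤ (n + 2) ^ 22 := by
      calc 2 ^ 7 * (n + 2) ^ 15 ≤ (n + 2) ^ 7 * (n + 2) ^ 15 := Nat.mul_le_mul_right _ h1
        _ = (n + 2) ^ 22 := by ring
    omega
  have hW1 : 64 * (n + 2) ^ 14 + 64 ≤ W := by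
    have : (n + 2) ^ 14 ≤ (n + 2) ^ 15 := Nat.pow_le_pow_right (by omega) (by omega)
    omega
  obtain ⟨s, t, hex, ht, hlen, hlt, h0, hD⟩ := preprocess_run hT hl hW1
  have hm := hl.length_eq
  refine ⟨s, t, hex, by omega, by omega, fun FV FE hE => ⟨maxFaults_le T FV FE, ?_⟩⟩
  intro vs es hvs hes
  exact query_run hT hW2 hl.length_le hlt h0 hD hE hvs hes
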